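/- Let $R_0>0$ and let $v:\mathbb R^3\to[0,\infty)$ be bounded, measurable and radial, with $v>0$ in $\{|x|<R_0\}$ and $v=0$ in $\{|x|>R_0\}$. For $\mu>0$ let $f_0^\mu$ be the positive radial solution of $(-\mu\Delta+v)f_0^\mu=0$ in $\mathbb R^3$, $f_0^\mu(x)\to1$ as $|x|\to\infty$; let $\mathfrak a_0^\mu=\frac1{4\pi\mu}\int v f_0^\mu\,dx$ be the scattering length, $\mathfrak a_0=\mathfrak a_0^1$, $\mathfrak c_0=R_0$ the capacity, and $\eta(\mu)=\mathfrak c_0-\mathfrak a_0^\mu$. For $N\in\mathbb N$, $\varepsilon>0$ and $\lambda=\lambda(N)>0$ put $L=N\varepsilon^6$ and $\mu=1/\lambda$ (this is the case $\beta=\kappa=1$). Let $f_L^\mu$ be the positive radial ground state of the Neumann problem $(-\mu\Delta+v)f=Ef$ in $\{|x|<L\}$, $f=1$ and $\partial_rf=0$ on $\{|x|=L\}$, extended by $1$ to $\{|x|\ge L\}$, and let $K(x)=\lambda(N\varepsilon^2)^3(vf_L^\mu)(N\varepsilon^2x)$. Let $\phi\in C([0,T_0];H^4(\mathbb R^3))$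 solve the modified Gross--Pitaevskii equation $$i\varepsilon\,\partial_t\phi=-\tfrac{\varepsilon^2}{2}\Delta\phi+(K*|\phi|^2)\phi ,\qquad \phi(0)=\phi^{\rm in},$$ and put $\rho^\varepsilon=|\phi|^2$, $J^\varepsilon=\operatorname{Im}(\varepsilon\nabla\phi\,\overline\phi)$. For a constant $c$ let $(\rho,u)\in C([0,T_0];H^5(\mathbb R^3)\times H^4(\mathbb R^3;\mathbb R^3))$, $T_0>0$, solve the compressible Euler equation $$\partial_t\rho+\nabla\cdot(\rho u)=0,\qquad \partial_tu+(u\cdot\nabla)u+c\,\nabla\rho=0 ,$$ and let $$\mathcal M(0)=\tfrac12\int|(i\varepsilon\nabla+u)\phi|^2dx+\tfrac12\int(K*\rho^\varepsilon)\rho^\varepsilon dx+\tfrac c2\int(\rho^2-2\rho\rho^\varepsilon)\,dx\quad\text{at }t=0 .$$ Assume that the initial data are bounded uniformly in $N$ and $\varepsilon$: $\|\langle\varepsilon\nabla\rangle^4\phi^{\rm in}\|_{L^2}^2\le C_0$ and $\tfrac12\|\varepsilon\nabla\phi^{\rm in}\|_{L^2}^2+\tfrac12\int(K*|\phi^{\rm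 in}|^2)|\phi^{\rm in}|^2dx\le C_0$. (i) (GP) If $\lambda=1$ and $c=4\pi\mathfrak a_0$, then there are $C,\delta>0$, independent of $N$, $\varepsilon$ and $\phi$ (they depend on $v$, $T_0$, $(\rho,u)$ and $C_0$), such that whenever $\frac1N+\varepsilon<\delta$ and $L>R_0$, for every $t\in[0,T_0]$ each of $$\|\rho^\varepsilon-\rho\|_{L^2}^2,\qquad \|J^\varepsilon-\rho u\|_{L^1}^2,\qquad \big\||i\varepsilon\nabla\phi|^2-\rho|u|^2\big\|_{L^1}^2$$ is at most $C\big(\mathcal M(0)+\varepsilon^2+\frac1L\big)$. (ii) (HC) If $\lambda=(\ln N)^\alpha$ with a fixed $\alpha\in(0,1)$ and $c=4\pi\mathfrak c_0$, then there are $C,A,\delta>0$, independent of $N$, $\varepsilon$ and $\phi$ (they depend on $v$, $\alpha$, $T_0$, $(\rho,u)$ and $C_0$), such that whenever $\frac1N+\varepsilon<\delta$ and $L>R_0$, for every $t\in[0,T_0]$ each of the same three quantities is at most $C\big(\mathcal M(0)+\varepsilon^2+\frac{\lambda}{L}+A\,\eta(\tfrac1\lambda)\big)$. Moreover $\eta(\mu)\to0$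 as $\mu\to0^+$. -/

import Mathlib

open MeasureTheory Filter Topology Set
open scoped ContDiff Gradient Convolution

namespace SemiclassicalGP

noncomputable section

/-- Physical space `ℝ³`. -/
abbrev E3 : Type := EuclideanSpace ℝ (Fin 3)

/-- A function on `ℝ³` that depends on `|x|` only. -/
def IsRadial (f : E3 → ℝ) : Prop := ∀ x y : E3, ‖x‖ = ‖y‖ → f x = f y

/-! ### Weak derivatives and Sobolev spaces on `ℝ³` -/

section Sobolev

variable {F : Type} [NormedAddCommGroup F] [NormedSpace ℝ F]

/-- `g` is the weak partial derivative `∂ⱼ f`. -/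
def HasWeakPartial (j : Fin 3) (f g : E3 → F) : Prop :=
  ∀ ψ : E3 → ℝ, ContDiff ℝ ∞ ψ → HasCompactSupport ψ →
    ∫ x, (fderiv ℝ ψ x (EuclideanSpace.single j 1)) • f x = -∫ x, ψ x • g x

open Classical in
/-- The weak partial derivative `∂ⱼ f` of a function that has one in `L²` (it is then unique almost
everywhere); `0` if there is none. -/
def weakPartial (j : Fin 3) (f : E3 → F) : E3 → F :=
  if h : ∃ g : E3 → F, MemLp g 2 volume ∧ HasWeakPartial j f g then h.choose else 0

/-- Iterated weak derivatives `∂_{j₁} ⋯ ∂_{jₘ} f`. -/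
def weakDeriv : List (Fin 3) → (E3 → F) → E3 → F
  | [], f => f
  | j :: l, f => weakPartial j (weakDeriv l f)

/-- `f ∈ H^k(ℝ³)`: the function and its weak derivatives up to order `k` are square integrable. -/
def MemH : ℕ → (E3 → F) → Prop
  | 0, f => MemLp f 2 volume
  | k + 1, f => MemLp f 2 volume ∧ ∀ j : Fin 3, ∃ g : E3 → F, HasWeakPartial j f g ∧ MemH k g

/-- `‖⟨ε∇⟩^k f‖²_{L²} = ∑_{m ≤ k} (k choose m) ε^{2m} ‖∇^m f‖²_{L²}`, where `⟨ξ⟩² = 1 + |ξ|²` and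
`‖∇^m f‖² = ∑_{j₁, …, jₘ} ‖∂_{j₁} ⋯ ∂_{jₘ} f‖²`; meant for `f ∈ H^k`. For `ε = 1` this is the square
of the `H^k` norm. -/
def weightedNormSq (ε : ℝ) (k : ℕ) (f : E3 → F) : ℝ :=
  ∑ m ∈ Finset.range (k + 1), (k.choose m : ℝ) * ε ^ (2 * m) *
    ∑ α : Fin m → Fin 3, ∫ x, ‖weakDeriv (List.ofFn α) f x‖ ^ 2

/-- `f ∈ C([0,T]; H^k(ℝ³))`. -/
def ContinuousInH (k : ℕ) (T : ℝ) (f : ℝ → E3 → F) : Prop :=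
  (∀ t ∈ Icc 0 T, MemH k (f t)) ∧
  ∀ t ∈ Icc 0 T,
    Tendsto (fun s => weightedNormSq 1 k (fun x => f s x - f t x)) (𝓝[Icc 0 T] t) (𝓝 0)

/-- The function `f : [0,T] → L²(ℝ³)` has the time derivative `g` at `t` (one-sided at the two end
points): its difference quotients converge to `g` in `L²`. -/
def HasTimeDeriv (T : ℝ) (f : ℝ → E3 → F) (t : ℝ) (g : E3 → F) : Prop :=
  MemLp g 2 volume ∧
  Tendsto (fun s => eLpNorm (fun x => (s - t)⁻¹ • (f s x - f t x) - g x) 2 volume)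
    (𝓝[Icc 0 T \ {t}] t) (𝓝 0)

/-- `g ∈ L^p(ℝ³)` and `‖g‖²_{L^p} ≤ B`. -/
def NormSqLe (p : ENNReal) (g : E3 → F) (B : ℝ) : Prop :=
  MemLp g p volume ∧ (eLpNorm g p volume).toReal ^ 2 ≤ B

end Sobolev

/-! ### The two-body problem -/

/-- The class of interaction potentials: bounded, nonnegative, radial, strictly positive in the open
ball of radius `R₀` and supported in the closed ball. -/
structure IsPotential (R₀ : ℝ) (v : E3 → ℝ) : Prop where
  measurable : Measurable v
  radial : IsRadial v
  nonneg : ∀ x, 0 ≤ v x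
  bounded : ∃ M : ℝ, ∀ x, v x ≤ M
  pos : ∀ x, ‖x‖ < R₀ → 0 < v x
  support : ∀ x, R₀ < ‖x‖ → v x = 0

/-- `(-μΔ + v) f = E f` in the open set `Ω`, in the weak sense, for `f` of class `C¹`. -/
def IsWeakSolution (v : E3 → ℝ) (μ E : ℝ) (Ω : Set E3) (f : E3 → ℝ) : Prop :=
  ∀ ψ : E3 → ℝ, ContDiff ℝ ∞ ψ → HasCompactSupport ψ → tsupport ψ ⊆ Ω →
    ∫ x, (μ * inner ℝ (∇ f x) (∇ ψ x) + v x * f x * ψ x) = E * ∫ x, f x * ψ x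

/-- `f` is the positive radial solution `f₀^μ` of the zero-energy scattering problem
`(-μΔ + v) f = 0` in `ℝ³`, `f(x) → 1` as `|x| → ∞`. -/
structure IsZeroEnergySolution (v : E3 → ℝ) (μ : ℝ) (f : E3 → ℝ) : Prop where
  contDiff : ContDiff ℝ 1 f
  radial : IsRadial f
  pos : ∀ x, 0 < f x
  limit : Tendsto f (cocompact E3) (𝓝 1)
  equation : IsWeakSolution v μ 0 univ f

/-- The scattering length `𝔞₀^μ = (4πμ)⁻¹ ∫ v f₀^μ`. -/
def scatteringLength (v : E3 → ℝ) (μ : ℝ) (f₀ : E3 → ℝ) : ℝ :=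
  (4 * Real.pi * μ)⁻¹ * ∫ x, v x * f₀ x

/-- `f` is the positive ground state `f_L^μ` of the Neumann problem `(-μΔ + v) f = E f` for
`|x| < L`, `f = 1` and `∂ᵣ f = 0` for `|x| = L`, extended by `1` to `|x| ≥ L`. As `f` is `C¹` on `ℝ³`
and is `1` outside the ball, both boundary conditions hold. -/
structure IsNeumannGroundState (v : E3 → ℝ) (μ L : ℝ) (f : E3 → ℝ) : Prop where
  contDiff : ContDiff ℝ 1 f
  radial : IsRadial f
  pos : ∀ x, 0 < f x
  exterior : ∀ x, L ≤ ‖x‖ → f x = 1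
  equation : ∃ E : ℝ, IsWeakSolution v μ E (Metric.ball 0 L) f

/-- The length `L = N ε² ℓ` with `ℓ = ε⁴`. -/
def boxLength (N : ℕ) (ε : ℝ) : ℝ := (N : ℝ) * ε ^ 2 * ε ^ 4

/-- The effective potential `K(x) = λ (Nε²)³ (v f)(Nε² x)`. -/
def effectivePotential (v f : E3 → ℝ) (lam : ℝ) (N : ℕ) (ε : ℝ) (x : E3) : ℝ :=
  lam * ((N : ℝ) * ε ^ 2) ^ 3 * v (((N : ℝ) * ε ^ 2) • x) * f (((N : ℝ) * ε ^ 2) • x)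

/-! ### The modified Gross–Pitaevskii equation and its local densities -/

/-- The mass density `ρ^ε = |φ|²`. -/
def massDensity (φ : E3 → ℂ) (x : E3) : ℝ := ‖φ x‖ ^ 2

/-- The momentum density `J^ε`, `J^ε_j = Im (ε ∂ⱼφ conj φ)`. -/
def momentumDensity (ε : ℝ) (φ : E3 → ℂ) (x : E3) : E3 :=
  WithLp.toLp 2 fun j => ((ε : ℂ) * weakPartial j φ x * starRingEnd ℂ (φ x)).im

/-- The kinetic energy density `|iε∇φ|²`. -/
def kineticDensity (ε : ℝ) (φ : E3 → ℂ) (x : E3) : ℝ :=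
  ∑ j : Fin 3, ‖Complex.I * (ε : ℂ) * weakPartial j φ x‖ ^ 2

/-- The mean-field potential `K * |φ|²`. -/
def meanField (K : E3 → ℝ) (φ : E3 → ℂ) : E3 → ℝ :=
  K ⋆[ContinuousLinearMap.lsmul ℝ ℝ, volume] massDensity φ

/-- `φ ∈ C([0,T]; H⁴)` solves `iε ∂ₜφ = -(ε²/2) Δφ + (K * |φ|²) φ` on `[0,T]`. -/
structure IsModifiedGPSolution (ε : ℝ) (K : E3 → ℝ) (T : ℝ) (φ : ℝ → E3 → ℂ) : Prop where
  regularity : ContinuousInH 4 T φ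
  equation : ∀ t ∈ Icc 0 T, HasTimeDeriv T φ t fun x =>
    (Complex.I * (ε : ℂ))⁻¹ *
      (-((ε : ℂ) ^ 2 / 2) * ∑ j : Fin 3, weakPartial j (weakPartial j (φ t)) x +
        (meanField K (φ t) x : ℂ) * φ t x)

/-- The energy `½ ∫ |ε∇φ|² + ½ ∫ (K * |φ|²) |φ|²`. -/
def energy (ε : ℝ) (K : E3 → ℝ) (φ : E3 → ℂ) : ℝ :=
  1 / 2 * (∫ x, kineticDensity ε φ x) + 1 / 2 * ∫ x, meanField K φ x * massDensity φ x

/-- The modulated energy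
`½ ∫ |(iε∇ + u) φ|² + ½ ∫ (K * ρ^ε) ρ^ε + c ½ ∫ (ρ² - 2 ρ ρ^ε)` with `ρ^ε = |φ|²`. -/
def modulatedEnergy (ε c : ℝ) (K : E3 → ℝ) (φ : E3 → ℂ) (ρ : E3 → ℝ) (u : E3 → E3) : ℝ :=
  1 / 2 * (∫ x, ∑ j : Fin 3,
      ‖Complex.I * (ε : ℂ) * weakPartial j φ x + ((u x j : ℝ) : ℂ) * φ x‖ ^ 2) +
    1 / 2 * (∫ x, meanField K φ x * massDensity φ x) +
    c * (1 / 2 * ∫ x, (ρ x ^ 2 - 2 * ρ x * massDensity φ x))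

/-! ### The compressible Euler equation -/

/-- `(ρ, u) ∈ C([0,T]; H⁵ × H⁴)` solves
`∂ₜρ + ∇·(ρu) = 0`, `∂ₜu + (u·∇)u + c ∇ρ = 0` on `[0,T]`. -/
structure IsEulerSolution (c T : ℝ) (ρ : ℝ → E3 → ℝ) (u : ℝ → E3 → E3) : Prop where
  regularity_density : ContinuousInH 5 T ρ
  regularity_velocity : ∀ j : Fin 3, ContinuousInH 4 T fun t x => u t x j
  continuity : ∀ t ∈ Icc 0 T, HasTimeDeriv T ρ t fun x =>
    -∑ j : Fin 3, weakPartial j (fun y => ρ t y * u t y j) x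
  momentum : ∀ t ∈ Icc 0 T, ∀ j : Fin 3, HasTimeDeriv T (fun s x => u s x j) t fun x =>
    -(∑ k : Fin 3, u t x k * weakPartial k (fun y => u t y j) x + c * weakPartial j (ρ t) x)

/-- The three estimates on `[0,T]` with right-hand side `B`: for every `t ∈ [0,T]`, the squares of
`‖ρ^ε - ρ‖_{L²}`, `‖J^ε - ρu‖_{L¹}` and `‖|iε∇φ|² - ρ|u|²‖_{L¹}` are at most `B`. -/
def DensityEstimates (ε T : ℝ) (φ : ℝ → E3 → ℂ) (ρ : ℝ → E3 → ℝ) (u : ℝ → E3 → E3) (B : ℝ) :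
    Prop :=
  ∀ t ∈ Icc 0 T,
    NormSqLe 2 (fun x => massDensity (φ t) x - ρ t x) B ∧
    NormSqLe 1 (fun x => momentumDensity ε (φ t) x - ρ t x • u t x) B ∧
    NormSqLe 1 (fun x => kineticDensity ε (φ t) x - ρ t x * ‖u t x‖ ^ 2) B

end

end SemiclassicalGP

open SemiclassicalGP

open MeasureTheory Filter Topology Set
open scoped ContDiff Gradient Convolution

namespace SemiclassicalGP

noncomputable section

set_option linter.unusedSectionVars false

/-! The proof is a modulated energy argument. Write D = (iε∇ + u)φ and let Z = ½‖D‖² + (c/2)‖ρ^ε -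
ρ‖² be the nonnegative `defect`. Exactly, M = Z + ½(∫(K*ρ^ε)ρ^ε - c‖ρ^ε‖²)
(`modulatedEnergy_eq_defect`), and Cauchy–Schwarz bounds the three quantities of the theorem by Z
(`density_estimates_of_defect`). It remains to see that the interaction is local up to a small
error, that ∫K is close to c, and that M grows at a rate governed by Z.

Locality. The range of K is r = R₀/(Nε²) = R₀ε⁴/L. Shifting ρ^ε by |z| ≤ r, weighted with ρ^ε, costs
at most a multiple of r ‖∇φ‖ ‖φ‖₆³. Conservation of mass and energy together with the Sobolev
inequality bounds ε‖∇φ‖ and ε‖φ‖₆, so the cost is r O(ε⁻⁴) = O(1/L) (`exists_cubic_bound`): the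
powers of ε cancel exactly. At positive times no quantitative bound on higher derivatives of φ is
needed.

Strength of K. A Wronskian identity between the Neumann ground state and the zero-energy solution
gives 4π𝔞 ≤ ∫K ≤ 4π𝔞 + O(λ/L), the upper bound when λ/L is below a threshold (`neumann_bounds`,
`integral_effectivePotential_bounds`). In the hard-core limit a scattering length bounded away from
R₀ would keep ∫ v f₀ bounded below, although it equals 4πμ𝔞 → 0 (`tendsto_scatteringLength`).

Growth. The increments of M are written as pairings linear in the increments of φ, u and ρ, because
the time derivatives exist in L² only (`hasDerivWithinAt_modulatedEnergy`). After integration by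
parts (`nullIntegral_modulatedRate_sub_flux`), M' is the integral of -∇u : D⊗D, a term of order ε²,
the force term -(K*ρ^ε) div(uρ^ε), and Euler terms. Averaging the force over z and -z
(`integral_transport_symm`) turns it into -½(∫K)∫ div u (ρ^ε)² up to O(1/L). With ∫K replaced by c,
the Euler terms complete the square to -(c/2)∫ div u (ρ^ε - ρ)². Hence M' ≤ C Z + C q, where q = ε²
+ λ/L + A(c - 4π𝔞), and Grönwall applies (`integral_modulatedFlux_le`, `le_exp_mul_of_deriv_le`).

Two points close the argument in `exists_uniform_estimate`. M(0) may be negative, but initially the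
loss of locality is of second order in r, and the second-order bound on the data yields M(0) + q ≥
q/2 (`neg_le_modulatedEnergy_initial`), so the claimed right-hand side absorbs every multiple of q.
If λ/L is not small, that right-hand side is bounded below, whereas Z is bounded outright
(`defect_le_const`). -/

section Toolkit

/-! ### Calculus of weak partial derivatives -/

variable {F : Type} [NormedAddCommGroup F] [NormedSpace ℝ F]

/-- The `j`-th coordinate vector of `ℝ³`. -/
abbrev ej (j : Fin 3) : E3 := EuclideanSpace.single j 1

theorem memLp_locallyIntegrable {f : E3 → F} (hf : MemLp f 2 volume) :
    LocallyIntegrable f volume := hf.locallyIntegrable (by norm_num)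

theorem HasWeakPartial.congr {j : Fin 3} {f g f' g' : E3 → F} (h : HasWeakPartial j f g)
    (hf : f =ᵐ[volume] f') (hg : g =ᵐ[volume] g') : HasWeakPartial j f' g' := by
  intro ψ h1 h2
  have e1 : ∫ x, (fderiv ℝ ψ x (EuclideanSpace.single j 1)) • f' x
      = ∫ x, (fderiv ℝ ψ x (EuclideanSpace.single j 1)) • f x :=
    integral_congr_ae (hf.mono fun x hx => by simp only [hx])
  have e2 : ∫ x, ψ x • g' x = ∫ x, ψ x • g x :=
    integral_congr_ae (hg.mono fun x hx => by simp only [hx])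
  rw [e1, e2, h ψ h1 h2]

theorem integrable_test_smul {ψ : E3 → ℝ} (h1 : Continuous ψ) (h2 : HasCompactSupport ψ)
    {f : E3 → F} (hf : LocallyIntegrable f volume) : Integrable (fun x => ψ x • f x) volume :=
  hf.integrable_smul_left_of_hasCompactSupport h1 h2

theorem continuous_fderiv_apply {ψ : E3 → F} (h1 : ContDiff ℝ 1 ψ) (w : E3) :
    Continuous fun x => fderiv ℝ ψ x w :=
  (h1.continuous_fderiv (by norm_num)).clm_apply continuous_const

theorem hasCompactSupport_fderiv_apply {ψ : E3 → F} (h2 : HasCompactSupport ψ) (w : E3) :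
    HasCompactSupport fun x => fderiv ℝ ψ x w :=
  h2.fderiv_apply (𝕜 := ℝ) w

theorem HasWeakPartial.unique [CompleteSpace F] {j : Fin 3} {f g g' : E3 → F}
    (h : HasWeakPartial j f g) (h' : HasWeakPartial j f g')
    (hg : LocallyIntegrable g volume) (hg' : LocallyIntegrable g' volume) :
    g =ᵐ[volume] g' := by
  have := ae_eq_zero_of_integral_contDiff_smul_eq_zero (μ := (volume : Measure E3))
    (f := fun x => g x - g' x) (hg.sub hg') ?_
  · filter_upwards [this] with x hx using sub_eq_zero.1 hx
  · intro ψ h1 h2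
    simp only [smul_sub]
    rw [integral_sub (integrable_test_smul h1.continuous h2 hg)
      (integrable_test_smul h1.continuous h2 hg'), sub_eq_zero]
    have a := h ψ h1 h2
    have b := h' ψ h1 h2
    rw [a] at b
    exact neg_injective b

theorem HasWeakPartial.sub {j : Fin 3} {f g f' g' : E3 → F}
    (h : HasWeakPartial j f g) (h' : HasWeakPartial j f' g')
    (hf : LocallyIntegrable f volume) (hf' : LocallyIntegrable f' volume)
    (hg : LocallyIntegrable g volume) (hg' : LocallyIntegrable g' volume) :
    HasWeakPartial j (fun x => f x - f' x) (fun x => g x - g' x) := by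
  intro ψ h1 h2
  have hc := continuous_fderiv_apply (h1.of_le (by norm_cast)) (ej j)
  have hs := hasCompactSupport_fderiv_apply h2 (ej j)
  simp only [smul_sub]
  rw [integral_sub (integrable_test_smul hc hs hf) (integrable_test_smul hc hs hf'),
    integral_sub (integrable_test_smul h1.continuous h2 hg)
      (integrable_test_smul h1.continuous h2 hg'), h ψ h1 h2, h' ψ h1 h2]
  abel

theorem HasWeakPartial.clm_comp {G : Type} [NormedAddCommGroup G] [NormedSpace ℝ G]
    [CompleteSpace F] [CompleteSpace G]
    {j : Fin 3} {f g : E3 → F} (h : HasWeakPartial j f g)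
    (hf : LocallyIntegrable f volume) (hg : LocallyIntegrable g volume) (A : F →L[ℝ] G) :
    HasWeakPartial j (fun x => A (f x)) (fun x => A (g x)) := by
  intro ψ h1 h2
  have hc := continuous_fderiv_apply (h1.of_le (by norm_cast)) (ej j)
  have hs := hasCompactSupport_fderiv_apply h2 (ej j)
  simp only [← map_smul]
  rw [A.integral_comp_comm (integrable_test_smul hc hs hf),
    A.integral_comp_comm (integrable_test_smul h1.continuous h2 hg), h ψ h1 h2, map_neg]

theorem measurePreserving_sub_right' (z : E3) :
    MeasurePreserving (fun x : E3 => x - z) volume volume := measurePreserving_sub_right volume z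

theorem HasWeakPartial.translate {j : Fin 3} {f g : E3 → F} (h : HasWeakPartial j f g) (z : E3) :
    HasWeakPartial j (fun x => f (x - z)) (fun x => g (x - z)) := by
  intro ψ h1 h2
  have e1 := integral_sub_right_eq_self (μ := (volume : Measure E3))
    (fun x => (fderiv ℝ ψ (x + z) (ej j)) • f x) z
  have e2 := integral_sub_right_eq_self (μ := (volume : Measure E3))
    (fun x => (ψ (x + z)) • g x) z
  simp only [sub_add_cancel] at e1 e2
  rw [e1, e2]
  have := h (fun x => ψ (x + z)) (h1.comp (contDiff_id.add contDiff_const))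
    (h2.comp_homeomorph (Homeomorph.addRight z))
  simpa only [fderiv_comp_add_right] using this

/-- Moving both derivatives onto the test function reduces the claim to the symmetry of the second
derivative of a smooth function. -/
theorem HasWeakPartial.comm [CompleteSpace F] {i j : Fin 3} {f gi gj gij gji : E3 → F}
    (hi : HasWeakPartial i f gi) (hj : HasWeakPartial j f gj)
    (hij : HasWeakPartial j gi gij) (hji : HasWeakPartial i gj gji)
    (h1 : LocallyIntegrable gij volume) (h2 : LocallyIntegrable gji volume) :
    gij =ᵐ[volume] gji := by
  have := ae_eq_zero_of_integral_contDiff_smul_eq_zero (μ := (volume : Measure E3))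
    (f := fun x => gij x - gji x) (h1.sub h2) ?_
  · filter_upwards [this] with x hx using sub_eq_zero.1 hx
  · intro ψ c1 c2
    simp only [smul_sub]
    rw [integral_sub (integrable_test_smul c1.continuous c2 h1)
      (integrable_test_smul c1.continuous c2 h2), sub_eq_zero]
    have key : ∀ w : E3, ContDiff ℝ ∞ (fun x => fderiv ℝ ψ x w) := fun w =>
      (c1.fderiv_right (m := ∞) (by norm_cast)).clm_apply contDiff_const
    have a1 := hij ψ c1 c2
    have a2 := hi _ (key (ej j)) (hasCompactSupport_fderiv_apply c2 (ej j))
    have b1 := hji ψ c1 c2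
    have b2 := hj _ (key (ej i)) (hasCompactSupport_fderiv_apply c2 (ej i))
    have sw : ∀ x, fderiv ℝ (fun y => fderiv ℝ ψ y (ej j)) x (ej i)
        = fderiv ℝ (fun y => fderiv ℝ ψ y (ej i)) x (ej j) := by
      intro x
      have hd : DifferentiableAt ℝ (fderiv ℝ ψ) x :=
        (c1.fderiv_right (m := ∞) (by norm_cast)).differentiable (by norm_num) x
      rw [fderiv_clm_apply hd (by fun_prop), fderiv_clm_apply hd (by fun_prop)]
      have hs : IsSymmSndFDerivAt ℝ ψ x :=
        (c1.contDiffAt).isSymmSndFDerivAt (by simp; norm_cast)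
      simpa using hs (ej i) (ej j)
    simp only [sw] at a2
    have : ∫ x, (fderiv ℝ ψ x) (ej j) • gi x = ∫ x, (fderiv ℝ ψ x) (ej i) • gj x := by
      have := a2.symm.trans b2
      exact neg_injective this
    rw [a1, b1] at this
    exact neg_injective this

/-! ### Mollification -/

/-- A sequence of bump functions that concentrates at the origin. -/
def bump (n : ℕ) : ContDiffBump (0 : E3) where
  rIn := 1 / (2 * (n + 1))
  rOut := 1 / (n + 1)
  rIn_pos := by positivity
  rIn_lt_rOut := by
    apply one_div_lt_one_div_of_lt <;> linarith [(Nat.cast_nonneg n : (0 : ℝ) ≤ n)]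

/-- The mollification of a function at scale `1 / (n + 1)`. -/
def mollify (n : ℕ) (f : E3 → F) : E3 → F :=
  (bump n).normed volume ⋆[ContinuousLinearMap.lsmul ℝ ℝ, volume] f

theorem bump_rOut_tendsto : Tendsto (fun n => (bump n).rOut) atTop (𝓝 0) :=
  tendsto_one_div_add_atTop_nhds_zero_nat

theorem mollify_ae_tendsto [CompleteSpace F] {f : E3 → F} (hf : LocallyIntegrable f volume) :
    ∀ᵐ x, Tendsto (fun n => mollify n f x) atTop (𝓝 (f x)) := by
  -- Convergence at Lebesgue points needs bumps of bounded eccentricity; the ratio of the outer to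
  -- the inner radius is always 2.
  refine ContDiffBump.ae_convolution_tendsto_right_of_locallyIntegrable (K := 2)
    bump_rOut_tendsto (Eventually.of_forall fun n => ?_) hf
  simp only [bump]
  field_simp
  rfl

theorem mollify_contDiff [CompleteSpace F] (n : ℕ) {f : E3 → F} (hf : LocallyIntegrable f volume) :
    ContDiff ℝ ∞ (mollify n f) :=
  (bump n).hasCompactSupport_normed.contDiff_convolution_left _
    ((bump n).contDiff_normed) hf

theorem mollify_congr (n : ℕ) {f g : E3 → F} (h : f =ᵐ[volume] g) : mollify n f = mollify n g := by
  ext x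
  simp only [mollify, convolution_eq_swap]
  exact integral_congr_ae (h.mono fun y hy => by simp only [hy])

/-- The derivative falls on the bump, and `t ↦ p (x - t)` is an admissible test function for `f`.
The sign produced by the reflection cancels the sign in the definition of the weak derivative. -/
theorem mollify_fderiv [CompleteSpace F] (n : ℕ) {j : Fin 3} {f g : E3 → F}
    (hf : LocallyIntegrable f volume) (h : HasWeakPartial j f g) (x : E3) :
    fderiv ℝ (mollify n f) x (ej j) = mollify n g x := by
  set p := (bump n).normed (volume : Measure E3) with hp
  have hpc : ContDiff ℝ ∞ p := (bump n).contDiff_normed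
  have hps : HasCompactSupport p := (bump n).hasCompactSupport_normed
  have h1 := hps.hasFDerivAt_convolution_left (μ := volume)
    (ContinuousLinearMap.lsmul ℝ ℝ : ℝ →L[ℝ] F →L[ℝ] F) (hpc.of_le (by norm_cast)) hf x
  have h2 : fderiv ℝ (mollify n f) x = _ := h1.fderiv
  rw [h2]
  have hex : ConvolutionExistsAt (fderiv ℝ p) f x
      ((ContinuousLinearMap.lsmul ℝ ℝ : ℝ →L[ℝ] F →L[ℝ] F).precompL E3) volume :=
    (hps.fderiv (𝕜 := ℝ)).convolutionExists_left _ (hpc.continuous_fderiv (by norm_num)) hf x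
  have h3 : ((fderiv ℝ p ⋆[(ContinuousLinearMap.lsmul ℝ ℝ : ℝ →L[ℝ] F →L[ℝ] F).precompL E3,
      volume] f) x) (ej j) = ∫ t, (fderiv ℝ p (x - t) (ej j)) • f t := by
    rw [convolution_eq_swap, ContinuousLinearMap.integral_apply]
    · rfl
    · exact hex.integrable_swap
  rw [h3]
  have h4 := h (fun t => p (x - t)) (hpc.comp (contDiff_const.sub contDiff_id))
    (hps.comp_homeomorph (Homeomorph.subLeft x))
  have h5 : ∀ t, fderiv ℝ (fun t => p (x - t)) t (ej j) = - fderiv ℝ p (x - t) (ej j) := by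
    intro t
    have hd : HasFDerivAt p (fderiv ℝ p (x - t)) (x - t) :=
      (hpc.differentiable (by norm_num) _).hasFDerivAt
    have := hd.comp t ((hasFDerivAt_id t).const_sub x)
    rw [show (fun t => p (x - t)) = p ∘ fun t => x - t from rfl]
    erw [this.fderiv]
    simp
  simp only [h5, neg_smul, integral_neg, neg_inj] at h4
  rw [h4, mollify, convolution_eq_swap]
  rfl

theorem mollify_norm_le [CompleteSpace F] (n : ℕ) {f : E3 → F} {C : ℝ} 
    (h : ∀ᵐ x, ‖f x‖ ≤ C) (x : E3) : ‖mollify n f x‖ ≤ C := by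
  set p := (bump n).normed (volume : Measure E3) with hp
  have hp0 : ∀ y, 0 ≤ p y := (bump n).nonneg_normed
  have hpi : Integrable p volume :=
    ((bump n).continuous_normed).integrable_of_hasCompactSupport (bump n).hasCompactSupport_normed
  rw [mollify, convolution_eq_swap]
  calc _ ≤ ∫ t, C * p (x - t) := by
        refine norm_integral_le_of_norm_le ((hpi.comp_sub_left x).const_mul C) ?_
        filter_upwards [h] with t ht
        simp only [ContinuousLinearMap.lsmul_apply, norm_smul, Real.norm_eq_abs]
        rw [abs_of_nonneg (hp0 _), mul_comm]
        exact mul_le_mul_of_nonneg_right ht (hp0 _)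
    _ = C := by
        rw [integral_const_mul, integral_sub_left_eq_self p volume x]
        rw [(bump n).integral_normed, mul_one]

/-- Translations act continuously on `L²`. -/
theorem tendsto_translate {f : E3 → F} (hf : MemLp f 2 volume) :
    Tendsto (fun z : E3 => eLpNorm (fun x => f (x - z) - f x) 2 volume) (𝓝 0) (𝓝 0) := by
  -- Translations form a continuous family of measure-preserving maps, and composition with such a
  -- family is continuous in `L²`.
  let g : E3 → C(E3, E3) := fun z => ⟨fun x => x - z, by fun_prop⟩
  have hg : Continuous g := ContinuousMap.continuous_of_continuous_uncurry _ (by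
    simp only [g, Function.uncurry_def, ContinuousMap.coe_mk]; fun_prop)
  have hgm : ∀ z, MeasurePreserving (g z) (volume : Measure E3) volume := fun z =>
    measurePreserving_sub_right' z
  have h := (continuous_const (y := hf.toLp f)).compMeasurePreservingLp hg hgm (by norm_num)
  have h0 := h.tendsto 0
  rw [Lp.tendsto_Lp_iff_tendsto_eLpNorm'] at h0
  refine h0.congr fun z => ?_
  refine eLpNorm_congr_ae ?_
  have e1 := Lp.coeFn_compMeasurePreserving (hf.toLp f) (hgm z)
  have e0 := Lp.coeFn_compMeasurePreserving (hf.toLp f) (hgm 0)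
  have e2 := (hgm z).quasiMeasurePreserving.ae_eq_comp hf.coeFn_toLp
  have e3 := (hgm 0).quasiMeasurePreserving.ae_eq_comp hf.coeFn_toLp
  filter_upwards [e0, e1, e2, e3] with x a0 a1 a2 a3
  simp only [Pi.sub_apply]
  rw [a0, a1, a2, a3]
  simp [g]

theorem mollify_sub_eq [CompleteSpace F] (n : ℕ) {f : E3 → F} (hf : LocallyIntegrable f volume)
    (x : E3) : mollify n f x - f x
      = ∫ y, (bump n).normed volume y • (f (x - y) - f x) := by
  set p := (bump n).normed (volume : Measure E3) with hp
  have hpi : Integrable p volume :=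
    ((bump n).continuous_normed).integrable_of_hasCompactSupport (bump n).hasCompactSupport_normed
  have hex : ConvolutionExistsAt p f x (ContinuousLinearMap.lsmul ℝ ℝ) volume :=
    (bump n).hasCompactSupport_normed.convolutionExists_left _ (bump n).continuous_normed hf x
  simp only [smul_sub]
  rw [integral_sub (by exact hex) (hpi.smul_const _), integral_smul_const,
    (bump n).integral_normed, one_smul]
  rfl

/-- Mollification moves a function in `L²` by at most as much as small translations do. -/
theorem mollify_sub_le [CompleteSpace F] {f : E3 → F} (hf : MemLp f 2 volume) (n : ℕ)
    {η : ENNReal} (hball : ∀ y ∈ Metric.ball (0 : E3) (bump n).rOut,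
      eLpNorm (fun x => f (x - y) - f x) 2 volume ≤ η) :
    eLpNorm (fun x => mollify n f x - f x) 2 volume ≤ η := by
  -- A strongly measurable representative makes `(x, y) ↦ f (x - y) - f x` jointly measurable, as
  -- Tonelli requires.
  wlog hm : StronglyMeasurable f generalizing f
  · have h := this (hf.ae_eq hf.1.ae_eq_mk) (fun y hy => ?_) hf.1.stronglyMeasurable_mk
    · refine le_trans (le_of_eq (eLpNorm_congr_ae ?_)) h
      filter_upwards [hf.1.ae_eq_mk] with x hx
      rw [mollify_congr n hf.1.ae_eq_mk, ← hx]
    · refine le_trans (le_of_eq (eLpNorm_congr_ae ?_)) (hball y hy)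
      have := (measurePreserving_sub_right' y).quasiMeasurePreserving.ae_eq_comp hf.1.ae_eq_mk
      filter_upwards [hf.1.ae_eq_mk, this] with x hx hx'
      simp only [Function.comp_apply] at hx'
      rw [← hx, ← hx']
  have hloc := memLp_locallyIntegrable hf
  set p := (bump n).normed (volume : Measure E3) with hp
  have hp0 : ∀ y, 0 ≤ p y := (bump n).nonneg_normed
  have hpc : Continuous p := (bump n).continuous_normed
  have hpi : Integrable p volume :=
    hpc.integrable_of_hasCompactSupport (bump n).hasCompactSupport_normed
  -- The bump is a probability density. The inclusion of `L²` in `L¹` for this probability measure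
  -- is the Jensen inequality that bounds the squared error at `x` by an average over `y`; Tonelli
  -- then leaves only translation errors.
  let w : E3 → ENNReal := fun y => ENNReal.ofReal (p y)
  have hw : Measurable w := hpc.measurable.ennreal_ofReal
  have hw1 : ∫⁻ y, w y = 1 := by
    rw [← ofReal_integral_eq_lintegral_ofReal hpi (Eventually.of_forall hp0),
      (bump n).integral_normed, ENNReal.ofReal_one]
  have hprob : IsProbabilityMeasure (volume.withDensity w) := ⟨by
    rw [withDensity_apply _ MeasurableSet.univ, Measure.restrict_univ, hw1]⟩
  have hmp : StronglyMeasurable (fun q : E3 × E3 => f (q.1 - q.2) - f q.1) :=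
    (hm.comp_measurable (measurable_fst.sub measurable_snd)).sub (hm.comp_measurable measurable_fst)
  have hme : Measurable (fun q : E3 × E3 => w q.2 * ‖f (q.1 - q.2) - f q.1‖ₑ ^ 2) :=
    (hw.comp measurable_snd).mul (hmp.enorm.pow_const 2)
  have hpt : ∀ x, ‖mollify n f x - f x‖ₑ ^ 2 ≤ ∫⁻ y, w y * ‖f (x - y) - f x‖ₑ ^ 2 := by
    intro x
    have hmx : StronglyMeasurable (fun y => f (x - y) - f x) :=
      hmp.comp_measurable (measurable_prodMk_left (x := x))
    have h1 : ‖mollify n f x - f x‖ₑ ≤ eLpNorm (fun y => f (x - y) - f x) 1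
        (volume.withDensity w) := by
      rw [mollify_sub_eq n hloc, eLpNorm_one_eq_lintegral_enorm,
        lintegral_withDensity_eq_lintegral_mul _ hw hmx.enorm]
      refine (enorm_integral_le_lintegral_enorm _).trans (lintegral_mono fun y => ?_)
      simp only [Pi.mul_apply, enorm_smul, w]
      rw [Real.enorm_of_nonneg (hp0 y)]
    have h2 : eLpNorm (fun y => f (x - y) - f x) 1 (volume.withDensity w)
        ≤ eLpNorm (fun y => f (x - y) - f x) 2 (volume.withDensity w) :=
      eLpNorm_le_eLpNorm_of_exponent_le (by norm_num) hmx.aestronglyMeasurable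
    calc _ ≤ (eLpNorm (fun y => f (x - y) - f x) 2 (volume.withDensity w)) ^ 2 := by
          gcongr; exact h1.trans h2
      _ = ∫⁻ y, ‖f (x - y) - f x‖ₑ ^ 2 ∂(volume.withDensity w) := by
          have := eLpNorm_nnreal_pow_eq_lintegral (μ := volume.withDensity w)
            (f := fun y => f (x - y) - f x) (p := 2) (by norm_num)
          simpa using this
      _ = _ := by
          rw [lintegral_withDensity_eq_lintegral_mul _ hw (hmx.enorm.pow_const 2)]
          rfl
  have hsq : (eLpNorm (fun x => mollify n f x - f x) 2 volume) ^ 2 ≤ η ^ 2 := by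
    have e := eLpNorm_nnreal_pow_eq_lintegral (μ := (volume : Measure E3))
      (f := fun x => mollify n f x - f x) (p := 2) (by norm_num)
    have e' : (eLpNorm (fun x => mollify n f x - f x) 2 volume) ^ 2
        = ∫⁻ x, ‖mollify n f x - f x‖ₑ ^ 2 := by simpa using e
    rw [e']
    calc _ ≤ ∫⁻ x, ∫⁻ y, w y * ‖f (x - y) - f x‖ₑ ^ 2 := lintegral_mono hpt
      _ = ∫⁻ y, ∫⁻ x, w y * ‖f (x - y) - f x‖ₑ ^ 2 :=
          lintegral_lintegral_swap hme.aemeasurable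
      _ ≤ ∫⁻ y, w y * η ^ 2 := by
          refine lintegral_mono fun y => ?_
          have hmy : StronglyMeasurable (fun x => f (x - y) - f x) :=
            hmp.comp_measurable (measurable_prodMk_right (y := y))
          rw [lintegral_const_mul _ (hmy.enorm.pow_const 2)]
          by_cases hy : y ∈ Metric.ball (0 : E3) (bump n).rOut
          · gcongr
            have e := eLpNorm_nnreal_pow_eq_lintegral (μ := (volume : Measure E3))
              (f := fun x => f (x - y) - f x) (p := 2) (by norm_num)
            have e' : (eLpNorm (fun x => f (x - y) - f x) 2 volume) ^ 2
              = ∫⁻ x, ‖f (x - y) - f x‖ₑ ^ 2 := by simpa using e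
            rw [← e']
            gcongr
            exact hball y hy
          · have : p y = 0 := by
              by_contra hne
              have hy' : y ∈ Function.support p := hne
              rw [hp, (bump n).support_normed_eq] at hy'
              exact hy hy'
            simp [w, this]
      _ = η ^ 2 := by rw [lintegral_mul_const _ hw, hw1, one_mul]
  exact (ENNReal.pow_le_pow_left_iff (by norm_num)).1 hsq

/-- Mollifications converge in `L²`. -/
theorem mollify_tendsto [CompleteSpace F] {f : E3 → F} (hf : MemLp f 2 volume) :
    Tendsto (fun n => eLpNorm (fun x => mollify n f x - f x) 2 volume) atTop (𝓝 0) := by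
  rw [ENNReal.tendsto_nhds_zero]
  intro η hη
  have h0 := ENNReal.tendsto_nhds_zero.1 (tendsto_translate hf) η hη
  obtain ⟨r, hr, hball⟩ := Metric.eventually_nhds_iff_ball.1 h0
  filter_upwards [bump_rOut_tendsto.eventually (gt_mem_nhds hr)] with n hn
  exact mollify_sub_le hf n fun y hy => hball y (Metric.ball_subset_ball hn.le hy)

theorem MemLp.translate {f : E3 → F} {p : ENNReal} (hf : MemLp f p volume) (z : E3) :
    MemLp (fun x => f (x - z)) p volume :=
  hf.comp_measurePreserving (measurePreserving_sub_right' z)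

theorem eLpNorm_translate {f : E3 → F} {p : ENNReal} (hf : AEStronglyMeasurable f volume) (z : E3) :
    eLpNorm (fun x => f (x - z)) p volume = eLpNorm f p volume :=
  eLpNorm_comp_measurePreserving hf (measurePreserving_sub_right' z)

theorem mollify_memLp [CompleteSpace F] {f : E3 → F} (hf : MemLp f 2 volume) (n : ℕ) :
    MemLp (mollify n f) 2 volume := by
  have hc := (mollify_contDiff n (memLp_locallyIntegrable hf)).continuous
  have h : MemLp (fun x => mollify n f x - f x) 2 volume := by
    refine ⟨hc.aestronglyMeasurable.sub hf.1, lt_of_le_of_lt (mollify_sub_le hf n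
      (η := eLpNorm f 2 volume + eLpNorm f 2 volume) fun y _ => ?_)
      (ENNReal.add_lt_top.2 ⟨hf.2, hf.2⟩)⟩
    refine (eLpNorm_sub_le (MemLp.translate hf y).1 hf.1 (by norm_num)).trans ?_
    rw [eLpNorm_translate hf.1]
  have e : mollify n f = (fun x => mollify n f x - f x) + f := by ext x; simp
  rw [e]
  exact h.add hf

end Toolkit

/-! ### The `L²` norm, integration by parts and the product rule -/

section L2

variable {F G H : Type} [NormedAddCommGroup F] [NormedSpace ℝ F] [CompleteSpace F]
  [NormedAddCommGroup G] [NormedSpace ℝ G] [CompleteSpace G]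
  [NormedAddCommGroup H] [NormedSpace ℝ H] [CompleteSpace H]

/-- The `L²` norm as a real number. -/
def l2 (f : E3 → F) : ℝ := (eLpNorm f 2 volume).toReal

theorem l2_nonneg (f : E3 → F) : 0 ≤ l2 f := ENNReal.toReal_nonneg

theorem l2_congr {f g : E3 → F} (h : f =ᵐ[volume] g) : l2 f = l2 g := by
  rw [l2, l2, eLpNorm_congr_ae h]

theorem l2_sq {f : E3 → F} (hf : MemLp f 2 volume) : l2 f ^ 2 = ∫ x, ‖f x‖ ^ 2 := by
  have h := hf.eLpNorm_eq_integral_rpow_norm (by norm_num) (by norm_num)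
  have h0 : 0 ≤ ∫ x, ‖f x‖ ^ 2 := integral_nonneg fun x => by positivity
  rw [l2, h]
  simp only [ENNReal.toReal_ofNat, Real.rpow_two]
  rw [ENNReal.toReal_ofReal (by positivity), ← Real.rpow_natCast, ← Real.rpow_mul h0]
  norm_num

theorem l2_add_le {f g : E3 → F} (hf : MemLp f 2 volume) (hg : MemLp g 2 volume) :
    l2 (fun x => f x + g x) ≤ l2 f + l2 g := by
  rw [l2, l2, l2, ← ENNReal.toReal_add hf.2.ne hg.2.ne]
  exact ENNReal.toReal_mono (ENNReal.add_ne_top.2 ⟨hf.2.ne, hg.2.ne⟩)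
    (eLpNorm_add_le hf.1 hg.1 (by norm_num))

theorem l2_sub_le {f g : E3 → F} (hf : MemLp f 2 volume) (hg : MemLp g 2 volume) :
    l2 (fun x => f x - g x) ≤ l2 f + l2 g := by
  rw [l2, l2, l2, ← ENNReal.toReal_add hf.2.ne hg.2.ne]
  exact ENNReal.toReal_mono (ENNReal.add_ne_top.2 ⟨hf.2.ne, hg.2.ne⟩)
    (eLpNorm_sub_le hf.1 hg.1 (by norm_num))

theorem l2_le_mul {f : E3 → F} {g : E3 → G} {C : ℝ} (hC : 0 ≤ C) (hg : MemLp g 2 volume)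
    (h : ∀ᵐ x, ‖f x‖ ≤ C * ‖g x‖) : l2 f ≤ C * l2 g := by
  have := eLpNorm_le_mul_eLpNorm_of_ae_le_mul h 2
  rw [l2, l2]
  calc _ ≤ (ENNReal.ofReal C * eLpNorm g 2 volume).toReal :=
        ENNReal.toReal_mono (ENNReal.mul_ne_top (by simp) hg.2.ne) this
    _ = _ := by rw [ENNReal.toReal_mul, ENNReal.toReal_ofReal hC]

theorem memLp_two_of_le {f : E3 → F} {g : E3 → G} {C : ℝ} (hf : AEStronglyMeasurable f volume)
    (hg : MemLp g 2 volume) (h : ∀ᵐ x, ‖f x‖ ≤ C * ‖g x‖) : MemLp f 2 volume :=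
  hg.of_le_mul hf h

theorem integrable_bilin {f : E3 → F} {g : E3 → G} (B : F →L[ℝ] G →L[ℝ] H)
    (hf : MemLp f 2 volume) (hg : MemLp g 2 volume) :
    Integrable (fun x => B (f x) (g x)) volume :=
  memLp_one_iff_integrable.1 (B.memLp_of_bilin 1 hf hg)

/-- Convergence in `L²` of both factors implies convergence of the integral of a product. -/
theorem tendsto_integral_bilin {ι : Type*} {l : Filter ι} {f : ι → E3 → F} {g : ι → E3 → G}
    {f₀ : E3 → F} {g₀ : E3 → G} (B : F →L[ℝ] G →L[ℝ] H)
    (hf : ∀ n, MemLp (f n) 2 volume) (hg : ∀ n, MemLp (g n) 2 volume)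
    (hf₀ : MemLp f₀ 2 volume) (hg₀ : MemLp g₀ 2 volume)
    (h1 : Tendsto (fun n => eLpNorm (fun x => f n x - f₀ x) 2 volume) l (𝓝 0))
    (h2 : Tendsto (fun n => eLpNorm (fun x => g n x - g₀ x) 2 volume) l (𝓝 0)) :
    Tendsto (fun n => ∫ x, B (f n x) (g n x)) l (𝓝 (∫ x, B (f₀ x) (g₀ x))) := by
  have t1 : Tendsto (fun n => (hf n).toLp (f n)) l (𝓝 (hf₀.toLp f₀)) :=
    (Lp.tendsto_Lp_iff_tendsto_eLpNorm'' f hf f₀ hf₀).2 h1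
  have t2 : Tendsto (fun n => (hg n).toLp (g n)) l (𝓝 (hg₀.toLp g₀)) :=
    (Lp.tendsto_Lp_iff_tendsto_eLpNorm'' g hg g₀ hg₀).2 h2
  have key : ∀ (a : E3 → F) (b : E3 → G) (ha : MemLp a 2 volume) (hb : MemLp b 2 volume),
      B.lpPairing volume 2 2 (ha.toLp a) (hb.toLp b) = ∫ x, B (a x) (b x) := by
    intro a b ha hb
    rw [ContinuousLinearMap.lpPairing_eq_integral]
    refine integral_congr_ae ?_
    filter_upwards [ha.coeFn_toLp, hb.coeFn_toLp] with x e1 e2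
    rw [e1, e2]
  have hc : Continuous fun q : Lp F 2 (volume : Measure E3) × Lp G 2 (volume : Measure E3) =>
      B.lpPairing volume 2 2 q.1 q.2 := by fun_prop
  have := (hc.tendsto (hf₀.toLp f₀, hg₀.toLp g₀)).comp (t1.prodMk_nhds t2)
  simpa only [Function.comp_def, key] using this

theorem norm_integral_bilin_le {f : E3 → F} {g : E3 → G} (B : F →L[ℝ] G →L[ℝ] H)
    (hf : MemLp f 2 volume) (hg : MemLp g 2 volume) :
    ∫ x, ‖B (f x) (g x)‖ ≤ ‖B‖ * (l2 f * l2 g) := by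
  have h := eLpNorm_le_eLpNorm_mul_eLpNorm_of_nnnorm (p := 2) (q := 2) (r := 1) hf.1 hg.1
    (fun a b => B a b) ‖B‖₊ (Eventually.of_forall fun x => by
      exact_mod_cast B.le_opNorm₂ (f x) (g x))
  have hi := integrable_bilin B hf hg
  rw [eLpNorm_one_eq_lintegral_enorm] at h
  rw [integral_norm_eq_lintegral_enorm hi.1]
  refine (ENNReal.toReal_mono (ENNReal.mul_ne_top (ENNReal.mul_ne_top (by simp) hf.2.ne)
    hg.2.ne) h).trans (le_of_eq ?_)
  simp only [ENNReal.toReal_mul, l2]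
  rw [mul_assoc]
  rfl

/-! ### Functions with a weak partial derivative in `L²` -/

/-- `f ∈ L²` has the weak partial derivative `∂ⱼ f = g ∈ L²`. -/
structure HasL2Partial (j : Fin 3) (f g : E3 → F) : Prop where
  mem : MemLp f 2 volume
  mem' : MemLp g 2 volume
  weak : HasWeakPartial j f g

theorem HasL2Partial.congr {j : Fin 3} {f g f' g' : E3 → F} (h : HasL2Partial j f g)
    (hf : f =ᵐ[volume] f') (hg : g =ᵐ[volume] g') : HasL2Partial j f' g' :=
  ⟨h.mem.ae_eq hf, h.mem'.ae_eq hg, h.weak.congr hf hg⟩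

theorem HasL2Partial.sub {j : Fin 3} {f g f' g' : E3 → F} (h : HasL2Partial j f g)
    (h' : HasL2Partial j f' g') :
    HasL2Partial j (fun x => f x - f' x) (fun x => g x - g' x) :=
  ⟨h.mem.sub h'.mem, h.mem'.sub h'.mem', h.weak.sub h'.weak
    (memLp_locallyIntegrable h.mem) (memLp_locallyIntegrable h'.mem)
    (memLp_locallyIntegrable h.mem') (memLp_locallyIntegrable h'.mem')⟩

theorem HasL2Partial.clm_comp {j : Fin 3} {f g : E3 → F} (h : HasL2Partial j f g)
    (A : F →L[ℝ] G) : HasL2Partial j (fun x => A (f x)) (fun x => A (g x)) :=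
  ⟨A.comp_memLp' h.mem, A.comp_memLp' h.mem', h.weak.clm_comp
    (memLp_locallyIntegrable h.mem) (memLp_locallyIntegrable h.mem') A⟩

theorem HasL2Partial.translate {j : Fin 3} {f g : E3 → F} (h : HasL2Partial j f g) (z : E3) :
    HasL2Partial j (fun x => f (x - z)) (fun x => g (x - z)) :=
  ⟨MemLp.translate h.mem z, MemLp.translate h.mem' z, h.weak.translate z⟩

/-- Integration by parts. -/
theorem HasL2Partial.integral_bilin {j : Fin 3} {f f' : E3 → F} {g g' : E3 → G}
    (h : HasL2Partial j f f') (h' : HasL2Partial j g g') (B : F →L[ℝ] G →L[ℝ] H) :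
    ∫ x, B (f x) (g' x) = -∫ x, B (f' x) (g x) := by
  -- The identity holds for the smooth mollifications, where all products are integrable, and both
  -- sides are continuous for `L²` convergence of the factors.
  have t1 := tendsto_integral_bilin B (mollify_memLp h.mem) (mollify_memLp h'.mem')
    h.mem h'.mem' (mollify_tendsto h.mem) (mollify_tendsto h'.mem')
  have t2 := tendsto_integral_bilin B (mollify_memLp h.mem') (mollify_memLp h'.mem)
    h.mem' h'.mem (mollify_tendsto h.mem') (mollify_tendsto h'.mem)
  refine tendsto_nhds_unique t1 (t2.neg.congr fun n => ?_)
  have c1 := memLp_locallyIntegrable h.mem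
  have c2 := memLp_locallyIntegrable h'.mem
  have := integral_bilinear_fderiv_right_eq_neg_left_of_integrable (μ := (volume : Measure E3))
    (f := mollify n f) (g := mollify n g) (v := ej j) (B := B)
    (by simp only [mollify_fderiv n c1 h.weak]
        exact integrable_bilin B (mollify_memLp h.mem' n) (mollify_memLp h'.mem n))
    (by simp only [mollify_fderiv n c2 h'.weak]
        exact integrable_bilin B (mollify_memLp h.mem n) (mollify_memLp h'.mem' n))
    (integrable_bilin B (mollify_memLp h.mem n) (mollify_memLp h'.mem n))
    (fun x _ => (mollify_contDiff n c1).differentiable (by norm_num) x)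
    (fun x _ => (mollify_contDiff n c2).differentiable (by norm_num) x)
  simp only [mollify_fderiv n c1 h.weak, mollify_fderiv n c2 h'.weak] at this
  exact this.symm

theorem bounded_of_compactSupport {ψ : E3 → ℝ} (h1 : Continuous ψ) (h2 : HasCompactSupport ψ) :
    ∃ C, 0 ≤ C ∧ ∀ x, ‖ψ x‖ ≤ C := by
  obtain ⟨C, hC⟩ := h2.exists_bound_of_continuous h1
  exact ⟨C, (norm_nonneg _).trans (hC 0), hC⟩

theorem memLp_smul_of_bound {ψ : E3 → ℝ} {C : ℝ} (h1 : AEStronglyMeasurable ψ volume)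
    (h2 : ∀ᵐ x, ‖ψ x‖ ≤ C) {f : E3 → F} (hf : MemLp f 2 volume) :
    MemLp (fun x => ψ x • f x) 2 volume :=
  memLp_two_of_le (h1.smul hf.1) hf (h2.mono fun x hx => by
    rw [norm_smul]; exact mul_le_mul_of_nonneg_right hx (norm_nonneg _))

/-- The product of a test function and a function in `L²` with a weak derivative in `L²`. -/
theorem HasL2Partial.test_smul {j : Fin 3} {f g : E3 → F} (h : HasL2Partial j f g) {ψ : E3 → ℝ}
    (h1 : ContDiff ℝ ∞ ψ) (h2 : HasCompactSupport ψ) :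
    HasL2Partial j (fun x => ψ x • f x) (fun x => fderiv ℝ ψ x (ej j) • f x + ψ x • g x) := by
  have hc := continuous_fderiv_apply (h1.of_le (by norm_cast)) (ej j)
  have hs := hasCompactSupport_fderiv_apply h2 (ej j)
  obtain ⟨C, -, hC⟩ := bounded_of_compactSupport h1.continuous h2
  obtain ⟨D, -, hD⟩ := bounded_of_compactSupport hc hs
  have lf := memLp_locallyIntegrable h.mem
  have lg := memLp_locallyIntegrable h.mem'
  have m1 := memLp_smul_of_bound hc.aestronglyMeasurable (Eventually.of_forall hD) h.mem
  have m2 := memLp_smul_of_bound h1.continuous.aestronglyMeasurable (Eventually.of_forall hC) h.mem'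
  have m0 := memLp_smul_of_bound h1.continuous.aestronglyMeasurable (Eventually.of_forall hC) h.mem
  refine ⟨m0, m1.add m2, ?_⟩
  intro χ k1 k2
  have kc := continuous_fderiv_apply (k1.of_le (by norm_cast)) (ej j)
  have ks := hasCompactSupport_fderiv_apply k2 (ej j)
  have key := h.weak (fun x => χ x * ψ x) (k1.mul h1) (k2.mul_right)
  have hd : ∀ x, fderiv ℝ (fun x => χ x * ψ x) x (ej j)
      = χ x * fderiv ℝ ψ x (ej j) + fderiv ℝ χ x (ej j) * ψ x := by
    intro x
    rw [fderiv_fun_mul (k1.differentiable (by norm_num) x) (h1.differentiable (by norm_num) x)]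
    simp [mul_comm]
  simp only [hd, add_smul, mul_smul] at key
  simp only [smul_add]
  have i1 : Integrable (fun x => χ x • fderiv ℝ ψ x (ej j) • f x) volume :=
    integrable_test_smul k1.continuous k2 (memLp_locallyIntegrable m1)
  have i2 : Integrable (fun x => fderiv ℝ χ x (ej j) • ψ x • f x) volume :=
    integrable_test_smul kc ks (memLp_locallyIntegrable m0)
  have i3 : Integrable (fun x => χ x • ψ x • g x) volume :=
    integrable_test_smul k1.continuous k2 (memLp_locallyIntegrable m2)
  rw [integral_add i1 i2] at key
  rw [integral_add i1 i3, neg_add, ← key]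
  abel

/-- The product rule. -/
theorem HasL2Partial.bilin_weak {j : Fin 3} {f f' : E3 → F} {g g' : E3 → G}
    (h : HasL2Partial j f f') (h' : HasL2Partial j g g') (B : F →L[ℝ] G →L[ℝ] H) :
    HasWeakPartial j (fun x => B (f x) (g x)) (fun x => B (f' x) (g x) + B (f x) (g' x)) := by
  intro ψ h1 h2
  have hc := continuous_fderiv_apply (h1.of_le (by norm_cast)) (ej j)
  have hs := hasCompactSupport_fderiv_apply h2 (ej j)
  -- Integrating `ψ f` by parts against `g` is already the product rule tested against `ψ`.
  have key := (h.test_smul h1 h2).integral_bilin h' B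
  have i0 := integrable_test_smul hc hs (integrable_bilin B h.mem h'.mem).locallyIntegrable
  have i1 := integrable_test_smul h1.continuous h2
    (integrable_bilin B h.mem' h'.mem).locallyIntegrable
  have i2 := integrable_test_smul h1.continuous h2
    (integrable_bilin B h.mem h'.mem').locallyIntegrable
  simp only [map_add, map_smul, add_apply, smul_apply]
    at key
  rw [integral_add i0 i1] at key
  simp only [smul_add]
  rw [integral_add i1 i2, key]
  abel

/-- Bounded functions with a weak derivative in `L²` form an algebra. -/
theorem HasL2Partial.bilin {j : Fin 3} {f f' : E3 → F} {g g' : E3 → G}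
    (h : HasL2Partial j f f') (h' : HasL2Partial j g g') (B : F →L[ℝ] G →L[ℝ] H) {C D : ℝ}
    (hf : ∀ᵐ x, ‖f x‖ ≤ C) (hg : ∀ᵐ x, ‖g x‖ ≤ D) :
    HasL2Partial j (fun x => B (f x) (g x)) (fun x => B (f' x) (g x) + B (f x) (g' x)) := by
  have k1 : ∀ {p : E3 → F} {q : E3 → G}, MemLp p 2 volume → MemLp q 2 volume →
      (∀ᵐ x, ‖p x‖ ≤ C) → MemLp (fun x => B (p x) (q x)) 2 volume := by
    intro p q hp hq hb
    refine memLp_two_of_le (C := ‖B‖ * C) (B.aestronglyMeasurable_comp₂ hp.1 hq.1) hq ?_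
    filter_upwards [hb] with x hx
    exact (B.le_opNorm₂ _ _).trans (by gcongr)
  have k2 : ∀ {p : E3 → F} {q : E3 → G}, MemLp p 2 volume → MemLp q 2 volume →
      (∀ᵐ x, ‖q x‖ ≤ D) → MemLp (fun x => B (p x) (q x)) 2 volume := by
    intro p q hp hq hb
    refine memLp_two_of_le (C := ‖B‖ * D) (B.aestronglyMeasurable_comp₂ hp.1 hq.1) hp ?_
    filter_upwards [hb] with x hx
    refine (B.le_opNorm₂ _ _).trans ?_
    rw [mul_right_comm]
    gcongr
  exact ⟨k1 h.mem h'.mem hf, (k2 h.mem' h'.mem hg).add (k1 h.mem h'.mem' hf), h.bilin_weak h' B⟩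

end L2

/-! ### Sobolev embeddings and Lipschitz bounds for translations -/

section Embedding

variable {F : Type} [NormedAddCommGroup F] [NormedSpace ℝ F] [CompleteSpace F]

theorem sum_coord_smul_ej (z : E3) : z = ∑ j : Fin 3, z j • ej j := by
  ext i
  fin_cases i <;> simp [Fin.sum_univ_three]

theorem abs_coord_le_norm (z : E3) (j : Fin 3) : |z j| ≤ ‖z‖ := by
  simpa using PiLp.norm_apply_le z j

theorem norm_clm_apply_le (A : E3 →L[ℝ] F) (z : E3) : ‖A z‖ ≤ ‖z‖ * ∑ j, ‖A (ej j)‖ := by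
  conv_lhs => rw [sum_coord_smul_ej z]
  rw [map_sum, Finset.mul_sum]
  refine (norm_sum_le _ _).trans (Finset.sum_le_sum fun j _ => ?_)
  rw [map_smul, norm_smul, Real.norm_eq_abs]
  gcongr
  exact abs_coord_le_norm z j

theorem norm_clm_le (A : E3 →L[ℝ] F) : ‖A‖ ≤ ∑ j, ‖A (ej j)‖ :=
  A.opNorm_le_bound (by positivity) fun z => by rw [mul_comm]; exact norm_clm_apply_le A z

theorem l2_sub_tendsto {ι : Type*} {l : Filter ι} {f : ι → E3 → F}
    (h : Tendsto (fun n => eLpNorm (f n) 2 volume) l (𝓝 0)) :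
    Tendsto (fun n => l2 (f n)) l (𝓝 0) := by
  have := (ENNReal.tendsto_toReal ENNReal.zero_ne_top).comp h
  rwa [ENNReal.toReal_zero] at this

/-- The `L²` error of mollification. -/
def mollifyError (n : ℕ) (f : E3 → F) : ℝ := l2 fun x => mollify n f x - f x

theorem mollifyError_tendsto {f : E3 → F} (hf : MemLp f 2 volume) :
    Tendsto (fun n => mollifyError n f) atTop (𝓝 0) := l2_sub_tendsto (mollify_tendsto hf)

theorem l2_mollify_le {f : E3 → F} (hf : MemLp f 2 volume) (n : ℕ) :
    l2 (mollify n f) ≤ l2 f + mollifyError n f := by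
  have h := l2_add_le hf ((mollify_memLp hf n).sub hf)
  simp only [Pi.sub_apply, add_sub_cancel] at h
  exact h

/-! ### Cutoff functions -/

/-- A fixed bump function on `ℝ³`. -/
def cutBump : ContDiffBump (0 : E3) := ⟨1, 2, one_pos, one_lt_two⟩

/-- Cutoff functions at scale `n + 1`. -/
def cutoff (n : ℕ) (x : E3) : ℝ := cutBump (((n : ℝ) + 1)⁻¹ • x)

theorem cutoff_contDiff (n : ℕ) : ContDiff ℝ ∞ (cutoff n) :=
  cutBump.contDiff.comp (contDiff_const_smul _)

theorem cutoff_hasCompactSupport (n : ℕ) : HasCompactSupport (cutoff n) :=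
  cutBump.hasCompactSupport.comp_homeomorph
    (Homeomorph.smulOfNeZero (((n : ℝ) + 1)⁻¹) (by positivity))

theorem cutoff_norm_le (n : ℕ) (x : E3) : ‖cutoff n x‖ ≤ 1 := by
  rw [cutoff, Real.norm_eq_abs, abs_of_nonneg cutBump.nonneg]
  exact cutBump.le_one

theorem cutoff_eq_one {n : ℕ} {x : E3} (h : ‖x‖ ≤ n + 1) : cutoff n x = 1 := by
  refine cutBump.one_of_mem_closedBall ?_
  rw [mem_closedBall_zero_iff, norm_smul, norm_inv, Real.norm_of_nonneg (by positivity)]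
  show _ ≤ (1 : ℝ)
  rw [inv_mul_le_one₀ (by positivity)]
  exact h

theorem fderiv_scale {ψ : E3 → ℝ} (h : ContDiff ℝ 1 ψ) (s : ℝ) (x w : E3) :
    fderiv ℝ (fun y => ψ (s • y)) x w = s * fderiv ℝ ψ (s • x) w := by
  have h1 : HasFDerivAt (fun y : E3 => s • y) (s • ContinuousLinearMap.id ℝ E3) x :=
    (hasFDerivAt_id x).const_smul s
  have h2 := ((h.differentiable (by norm_num) (s • x)).hasFDerivAt).comp x h1
  rw [show (fun y => ψ (s • y)) = ψ ∘ fun y => s • y from rfl, h2.fderiv]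
  simp

/-- The cutoffs are dilations of one bump by a factor at most 1, which can only shrink derivatives.
The bounds of the fixed bump therefore serve for every `n`. -/
theorem exists_cutoff_bound : ∃ D : ℝ, 0 ≤ D ∧
    (∀ n j x, ‖fderiv ℝ (cutoff n) x (ej j)‖ ≤ D) ∧
    ∀ n j x, ‖fderiv ℝ (fun y => fderiv ℝ (cutoff n) y (ej j)) x (ej j)‖ ≤ D := by
  have hc : ContDiff ℝ ∞ (cutBump : E3 → ℝ) := cutBump.contDiff
  have hs : HasCompactSupport (cutBump : E3 → ℝ) := cutBump.hasCompactSupport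
  have key : ∀ w : E3, ContDiff ℝ ∞ (fun x => fderiv ℝ cutBump x w) := fun w =>
    (hc.fderiv_right (m := ∞) (by norm_cast)).clm_apply contDiff_const
  have b1 : ∀ j, ∃ C, 0 ≤ C ∧ ∀ x, ‖fderiv ℝ cutBump x (ej j)‖ ≤ C := fun j =>
    bounded_of_compactSupport (key _).continuous (hasCompactSupport_fderiv_apply hs _)
  have b2 : ∀ j, ∃ C, 0 ≤ C ∧ ∀ x,
      ‖fderiv ℝ (fun y => fderiv ℝ cutBump y (ej j)) x (ej j)‖ ≤ C := fun j =>
    bounded_of_compactSupport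
      (continuous_fderiv_apply ((key (ej j)).of_le (by norm_cast)) _)
      (hasCompactSupport_fderiv_apply (hasCompactSupport_fderiv_apply hs _) _)
  choose C1 p1 q1 using b1
  choose C2 p2 q2 using b2
  have hinv : ∀ n : ℕ, |((n : ℝ) + 1)⁻¹| ≤ 1 := fun n => by
    rw [abs_of_nonneg (by positivity)]
    exact inv_le_one_of_one_le₀ (by linarith [(Nat.cast_nonneg n : (0 : ℝ) ≤ n)])
  have e1 : ∀ (n : ℕ) (j : Fin 3) x, fderiv ℝ (cutoff n) x (ej j)
      = ((n : ℝ) + 1)⁻¹ * fderiv ℝ cutBump (((n : ℝ) + 1)⁻¹ • x) (ej j) := fun n j x =>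
    fderiv_scale (hc.of_le (by norm_cast)) _ x _
  refine ⟨∑ j, (C1 j + C2 j), Finset.sum_nonneg fun j _ => add_nonneg (p1 j) (p2 j), ?_, ?_⟩
  · intro n j x
    have hle : C1 j ≤ ∑ j, (C1 j + C2 j) := (le_add_of_nonneg_right (p2 j)).trans
      (Finset.single_le_sum (f := fun j => C1 j + C2 j) (fun j _ => add_nonneg (p1 j) (p2 j))
        (Finset.mem_univ j))
    rw [e1, norm_mul, Real.norm_eq_abs]
    calc _ ≤ 1 * C1 j := mul_le_mul (hinv n) (q1 j _) (norm_nonneg _) zero_le_one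
      _ ≤ _ := by rw [one_mul]; exact hle
  · intro n j x
    have hle : C2 j ≤ ∑ j, (C1 j + C2 j) := (le_add_of_nonneg_left (p1 j)).trans
      (Finset.single_le_sum (f := fun j => C1 j + C2 j) (fun j _ => add_nonneg (p1 j) (p2 j))
        (Finset.mem_univ j))
    simp only [e1]
    have hd : DifferentiableAt ℝ (fun y : E3 =>
        fderiv ℝ cutBump (((n : ℝ) + 1)⁻¹ • y) (ej j)) x :=
      ((key (ej j)).comp (contDiff_const_smul _)).differentiable (by norm_num) x
    rw [fderiv_const_mul hd, smul_apply, smul_eq_mul,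
      fderiv_scale (ψ := fun y => fderiv ℝ cutBump y (ej j)) ((key (ej j)).of_le (by norm_cast)),
      norm_mul, norm_mul, Real.norm_eq_abs]
    calc _ ≤ 1 * (1 * C2 j) := mul_le_mul (hinv n) (mul_le_mul (hinv n) (q2 j _)
            (norm_nonneg _) zero_le_one) (by positivity) zero_le_one
      _ ≤ _ := by rw [one_mul, one_mul]; exact hle

/-! ### The embedding of `H²` into `L^∞` -/

-- Each derivative contributes a factor `2πi ξⱼ`, and two of them give the minus sign that makes the
-- multiplier of `1 - Δ` positive. Its inverse is the weight used in the sup bound that follows.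
open SchwartzMap FourierTransform LineDeriv in
theorem schwartz_fourier_helmholtz (h : 𝓢(E3, ℂ)) (ξ : E3) :
    𝓕 (h - ∑ j : Fin 3, ∂_{ej j} (∂_{ej j} h)) ξ
      = ((1 + (2 * Real.pi) ^ 2 * ‖ξ‖ ^ 2 : ℝ) : ℂ) * 𝓕 h ξ := by
  have h2 : ∀ j : Fin 3, 𝓕 (∂_{ej j} (∂_{ej j} h)) ξ
      = -((2 * Real.pi) ^ 2 * (ξ j) ^ 2 : ℝ) * 𝓕 h ξ := by
    intro j
    have t : (fun x : E3 => inner ℝ x (ej j)).HasTemperateGrowth :=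
      ((innerSL ℝ).flip (ej j)).hasTemperateGrowth
    rw [fourier_lineDerivOp_eq, fourier_lineDerivOp_eq]
    simp only [smul_apply, smulLeftCLM_apply_apply t]
    have hin : inner ℝ ξ (ej j) = ξ j := by simp [EuclideanSpace.inner_single_right]
    rw [hin]
    simp only [smul_eq_mul, Complex.real_smul]
    push_cast
    have := Complex.I_sq
    linear_combination (4 * Real.pi ^ 2 * (ξ j : ℂ) ^ 2 * 𝓕 h ξ) * this
  have e : 𝓕 (h - ∑ j : Fin 3, ∂_{ej j} (∂_{ej j} h))
      = 𝓕 h - ∑ j : Fin 3, 𝓕 (∂_{ej j} (∂_{ej j} h)) := by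
    have := map_sub (FourierTransform.fourierCLM ℂ 𝓢(E3, ℂ)) h (∑ j : Fin 3, ∂_{ej j} (∂_{ej j} h))
    rw [map_sum] at this
    exact this
  rw [e]
  simp only [sub_apply, sum_apply, h2]
  rw [EuclideanSpace.norm_sq_eq]
  simp only [Fin.sum_univ_three, Real.norm_eq_abs, sq_abs]
  push_cast
  ring

-- Fourier inversion bounds `|h|` by the `L¹` norm of its transform. Dividing the transform of `h -
-- Δh` by the multiplier and using Cauchy–Schwarz and Plancherel leaves the `L²` norm of the inverse
-- multiplier, which is finite in dimension three.
open SchwartzMap FourierTransform LineDeriv in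
theorem exists_schwartz_sup_bound : ∃ C : ℝ, 0 ≤ C ∧ ∀ (h : 𝓢(E3, ℂ)) (x : E3),
    ‖h x‖ ≤ C * l2 (fun y => h y - ∑ j : Fin 3, ∂_{ej j} (∂_{ej j} h) y) := by
  let w : E3 → ℝ := fun ξ => (1 + (2 * Real.pi) ^ 2 * ‖ξ‖ ^ 2)⁻¹
  have hwp : ∀ ξ : E3, 0 < 1 + (2 * Real.pi) ^ 2 * ‖ξ‖ ^ 2 := fun ξ => by positivity
  have hwc : Continuous w := Continuous.inv₀ (by fun_prop) fun ξ => (hwp ξ).ne'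
  have hw : MemLp w 2 volume := by
    rw [memLp_two_iff_integrable_sq hwc.aestronglyMeasurable]
    -- The squared weight decays like `|ξ|⁻⁴`, and 4 exceeds the dimension 3.
    have hi := integrable_rpow_neg_one_add_norm_sq (E := E3) (μ := volume) (r := 4)
      (by simp; norm_num)
    refine hi.mono' (hwc.pow 2).aestronglyMeasurable (Eventually.of_forall fun ξ => ?_)
    rw [Real.norm_of_nonneg (by positivity)]
    have e : ((1 : ℝ) + ‖ξ‖ ^ 2) ^ (-(4 : ℝ) / 2) = ((1 + ‖ξ‖ ^ 2)⁻¹) ^ 2 := by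
      rw [show (-(4 : ℝ) / 2) = ((-2 : ℤ) : ℝ) by norm_num, Real.rpow_intCast, zpow_neg, inv_pow]
      norm_cast
    rw [e]
    have hpi : 1 ≤ (2 * Real.pi) ^ 2 := by nlinarith [Real.pi_gt_three]
    have : ‖ξ‖ ^ 2 ≤ (2 * Real.pi) ^ 2 * ‖ξ‖ ^ 2 := by nlinarith [sq_nonneg ‖ξ‖]
    simp only [w]
    gcongr
  refine ⟨l2 w, l2_nonneg _, fun h x => ?_⟩
  set g : 𝓢(E3, ℂ) := h - ∑ j : Fin 3, ∂_{ej j} (∂_{ej j} h) with hg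
  have hge : (fun y => h y - ∑ j : Fin 3, ∂_{ej j} (∂_{ej j} h) y) = g := by
    ext y
    simp [hg]
  have hgL : MemLp (𝓕 g : 𝓢(E3, ℂ)) 2 volume := (𝓕 g).memLp 2 volume
  have hpl : l2 (𝓕 g : 𝓢(E3, ℂ)) = l2 g := by
    have a := l2_sq hgL
    have b := l2_sq (g.memLp 2 volume)
    rw [integral_norm_sq_fourier, ← b] at a
    exact (sq_eq_sq₀ (l2_nonneg _) (l2_nonneg _)).1 a
  have hinv : h x = 𝓕⁻ (𝓕 h) x := by rw [FourierTransform.fourierInv_fourier_eq]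
  have h1 : ‖h x‖ ≤ ∫ ξ, ‖(𝓕 h : 𝓢(E3, ℂ)) ξ‖ := by
    rw [hinv, SchwartzMap.fourierInv_coe, Real.fourierInv_eq]
    refine (norm_integral_le_integral_norm _).trans (le_of_eq ?_)
    congr 1
    ext ξ
    simp [Circle.norm_smul]
  have h2 : ∀ ξ, ‖(𝓕 h : 𝓢(E3, ℂ)) ξ‖
      = ‖ContinuousLinearMap.lsmul ℝ ℝ (w ξ) ((𝓕 g : 𝓢(E3, ℂ)) ξ)‖ := by
    intro ξ
    rw [hg, schwartz_fourier_helmholtz, ContinuousLinearMap.lsmul_apply, norm_smul, norm_mul,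
      Complex.norm_real, ← mul_assoc, ← norm_mul]
    simp only [w]
    rw [inv_mul_cancel₀ (hwp ξ).ne', norm_one, one_mul]
  simp only [h2] at h1
  have h3 := norm_integral_bilin_le (ContinuousLinearMap.lsmul ℝ ℝ : ℝ →L[ℝ] ℂ →L[ℝ] ℂ) hw hgL
  rw [hge, ← hpl]
  refine h1.trans (h3.trans ?_)
  have hle := ContinuousLinearMap.opNorm_lsmul_le (𝕜 := ℝ) (R := ℝ) (E := ℂ)
  calc _ ≤ 1 * (l2 w * l2 (𝓕 g : 𝓢(E3, ℂ))) :=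
        mul_le_mul_of_nonneg_right hle (mul_nonneg (l2_nonneg _) (l2_nonneg _))
    _ = _ := one_mul _

open SchwartzMap LineDeriv in
/-- Compactly supported functions in `H²` are bounded. -/
theorem exists_sup_bound_of_compactSupport : ∃ C : ℝ, 0 ≤ C ∧
    ∀ (f : E3 → ℂ) (g g2 : Fin 3 → E3 → ℂ), HasCompactSupport f →
      (∀ j, HasL2Partial j f (g j)) → (∀ j, HasL2Partial j (g j) (g2 j)) →
      ∀ᵐ x, ‖f x‖ ≤ C * (l2 f + ∑ j, l2 (g2 j)) := by
  obtain ⟨C, hC, hb⟩ := exists_schwartz_sup_bound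
  refine ⟨C, hC, fun f g g2 hs h1 h2 => ?_⟩
  have hf := (h1 0).mem
  have hl := memLp_locallyIntegrable hf
  -- Mollifying a compactly supported function gives a Schwartz function, so the Fourier bound
  -- applies; the mollification errors vanish in the limit.
  have key : ∀ n x, ‖mollify n f x‖
      ≤ C * (l2 f + mollifyError n f + ∑ j, (l2 (g2 j) + mollifyError n (g2 j))) := by
    intro n x
    have hsn : HasCompactSupport (mollify n f) :=
      (bump n).hasCompactSupport_normed.convolution _ hs
    have hcn := mollify_contDiff n hl
    set h : 𝓢(E3, ℂ) := hsn.toSchwartzMap hcn with hh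
    have hd : ∀ j y, ∂_{ej j} (∂_{ej j} h) y = mollify n (g2 j) y := by
      intro j y
      have e : ∀ w, ∂_{ej j} h w = mollify n (g j) w := fun w => by
        rw [lineDerivOp_apply_eq_fderiv]
        exact mollify_fderiv n hl (h1 j).weak w
      have e' : ((∂_{ej j} h : 𝓢(E3, ℂ)) : E3 → ℂ) = mollify n (g j) := funext e
      rw [lineDerivOp_apply_eq_fderiv, e']
      exact mollify_fderiv n (memLp_locallyIntegrable (h1 j).mem') (h2 j).weak y
    have := hb h x
    simp only [hd] at this
    refine this.trans (mul_le_mul_of_nonneg_left ?_ hC)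
    have m2 : ∀ j ∈ Finset.univ, MemLp (fun y => mollify n (g2 j) y) 2 volume :=
      fun j _ => mollify_memLp (h2 j).mem' n
    have m3 : MemLp (fun y => ∑ j, mollify n (g2 j) y) 2 volume := memLp_finsetSum _ m2
    refine (l2_sub_le (mollify_memLp hf n) m3).trans (add_le_add (l2_mollify_le hf n) ?_)
    simp only [Fin.sum_univ_three]
    have a0 := l2_mollify_le (h2 0).mem' n
    have a1 := l2_mollify_le (h2 1).mem' n
    have a2 := l2_mollify_le (h2 2).mem' n
    have b1 := l2_add_le (m2 0 (Finset.mem_univ _)) (m2 1 (Finset.mem_univ _))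
    have b2 := l2_add_le ((m2 0 (Finset.mem_univ _)).add (m2 1 (Finset.mem_univ _)))
      (m2 2 (Finset.mem_univ _))
    have b3 : l2 ((fun y => mollify n (g2 0) y) + fun y => mollify n (g2 1) y)
        = l2 (fun y => mollify n (g2 0) y + mollify n (g2 1) y) := rfl
    simp only [Pi.add_apply] at b2
    rw [b3] at b2
    linarith
  filter_upwards [mollify_ae_tendsto hl] with x hx
  refine le_of_tendsto_of_tendsto' hx.norm ?_ (fun n => key n x)
  have t1 := mollifyError_tendsto hf
  have t2 : Tendsto (fun n => ∑ j, (l2 (g2 j) + mollifyError n (g2 j))) atTop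
      (𝓝 (∑ j, (l2 (g2 j) + 0))) :=
    tendsto_finsetSum _ fun j _ => (mollifyError_tendsto (h2 j).mem').const_add _
  simpa using ((t1.const_add (l2 f)).add t2).const_mul C

theorem HasL2Partial.add {j : Fin 3} {f g f' g' : E3 → F} (h : HasL2Partial j f g)
    (h' : HasL2Partial j f' g') :
    HasL2Partial j (fun x => f x + f' x) (fun x => g x + g' x) := by
  have hn := h'.clm_comp (-ContinuousLinearMap.id ℝ F)
  have := h.sub hn
  simpa using this

/-- The Sobolev embedding `H² ⊂ L^∞`. -/
theorem exists_sup_bound_complex : ∃ C : ℝ, 0 ≤ C ∧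
    ∀ (f : E3 → ℂ) (g g2 : Fin 3 → E3 → ℂ),
      (∀ j, HasL2Partial j f (g j)) → (∀ j, HasL2Partial j (g j) (g2 j)) →
      ∀ᵐ x, ‖f x‖ ≤ C * (l2 f + ∑ j, (l2 (g j) + l2 (g2 j))) := by
  obtain ⟨C, hC, hb⟩ := exists_sup_bound_of_compactSupport
  obtain ⟨D, hD, hD1, hD2⟩ := exists_cutoff_bound
  -- `3 * D` pays for the second derivatives of the cutoff in three directions, `2 * D` for the
  -- cross terms, and the two units for `f` and its second derivatives.
  refine ⟨C * (1 + 3 * D + 2 * D + 1), by positivity, fun f g g2 h1 h2 => ?_⟩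
  have hf := (h1 0).mem
  -- A bound that is uniform in `n` suffices, because at a given `x` the cutoff equals 1 once `n`
  -- exceeds `‖x‖`.
  have hn : ∀ n : ℕ, ∀ᵐ x, ‖cutoff n x • f x‖ ≤
      C * (1 + 3 * D + 2 * D + 1) * (l2 f + ∑ j, (l2 (g j) + l2 (g2 j))) := by
    intro n
    have hc := cutoff_contDiff n
    have hs := cutoff_hasCompactSupport n
    have hc' : ∀ j, ContDiff ℝ ∞ (fun x => fderiv ℝ (cutoff n) x (ej j)) := fun j =>
      (hc.fderiv_right (m := ∞) (by norm_cast)).clm_apply contDiff_const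
    have hs' : ∀ j, HasCompactSupport (fun x => fderiv ℝ (cutoff n) x (ej j)) := fun j =>
      hasCompactSupport_fderiv_apply hs _
    have k1 := fun j => (h1 j).test_smul hc hs
    have k2 := fun j => ((h1 j).test_smul (hc' j) (hs' j)).add ((h2 j).test_smul hc hs)
    have := hb _ _ _ (hs.smul_right (f' := f)) k1 k2
    filter_upwards [this] with x hx
    refine hx.trans ?_
    rw [mul_assoc]
    refine mul_le_mul_of_nonneg_left ?_ hC
    have e0 : l2 (fun x => cutoff n x • f x) ≤ 1 * l2 f := l2_le_mul zero_le_one hf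
      (Eventually.of_forall fun x => by
        rw [norm_smul]; exact mul_le_mul_of_nonneg_right (cutoff_norm_le n x) (norm_nonneg _))
    have e1 : ∀ j, l2 (fun x => fderiv ℝ (fun y => fderiv ℝ (cutoff n) y (ej j)) x (ej j) • f x +
        fderiv ℝ (cutoff n) x (ej j) • g j x +
        (fderiv ℝ (cutoff n) x (ej j) • g j x + cutoff n x • g2 j x))
        ≤ D * l2 f + D * l2 (g j) + (D * l2 (g j) + 1 * l2 (g2 j)) := by
      intro j
      have m1 := memLp_smul_of_bound (continuous_fderiv_apply ((hc' j).of_le (by norm_cast))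
        (ej j)).aestronglyMeasurable (Eventually.of_forall (hD2 n j)) hf
      have m2 := memLp_smul_of_bound (hc' j).continuous.aestronglyMeasurable
        (Eventually.of_forall (hD1 n j)) (h1 j).mem'
      have m3 := memLp_smul_of_bound hc.continuous.aestronglyMeasurable
        (Eventually.of_forall (cutoff_norm_le n)) (h2 j).mem'
      refine (l2_add_le (m1.add m2) (m2.add m3)).trans (add_le_add ?_ ?_)
      · refine (l2_add_le m1 m2).trans (add_le_add ?_ ?_)
        · exact l2_le_mul hD hf (Eventually.of_forall fun x => by
            rw [norm_smul]; exact mul_le_mul_of_nonneg_right (hD2 n j x) (norm_nonneg _))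
        · exact l2_le_mul hD (h1 j).mem' (Eventually.of_forall fun x => by
            rw [norm_smul]; exact mul_le_mul_of_nonneg_right (hD1 n j x) (norm_nonneg _))
      · refine (l2_add_le m2 m3).trans (add_le_add ?_ ?_)
        · exact l2_le_mul hD (h1 j).mem' (Eventually.of_forall fun x => by
            rw [norm_smul]; exact mul_le_mul_of_nonneg_right (hD1 n j x) (norm_nonneg _))
        · exact l2_le_mul zero_le_one (h2 j).mem' (Eventually.of_forall fun x => by
            rw [norm_smul]; exact mul_le_mul_of_nonneg_right (cutoff_norm_le n x) (norm_nonneg _))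
    refine (add_le_add e0 (Finset.sum_le_sum fun j _ => e1 j)).trans ?_
    simp only [Fin.sum_univ_three]
    have p0 := l2_nonneg f
    have p1 := fun j => l2_nonneg (g j)
    have p2 := fun j => l2_nonneg (g2 j)
    have q2 := fun j => mul_nonneg hD (p2 j)
    have q1 := fun j => mul_nonneg hD (p1 j)
    have q0 := mul_nonneg hD p0
    nlinarith [p1 0, p1 1, p1 2, p2 0, p2 1, p2 2, q1 0, q1 1, q1 2, q2 0, q2 1, q2 2]
  filter_upwards [ae_all_iff.2 hn] with x hx
  obtain ⟨n, hxn⟩ := exists_nat_ge ‖x‖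
  have := hx n
  rwa [cutoff_eq_one (by linarith), one_smul] at this

theorem l2_ofReal {f : E3 → ℝ} : l2 (fun x => (f x : ℂ)) = l2 f := by
  rw [l2, l2]
  congr 1
  exact eLpNorm_congr_norm_ae (Eventually.of_forall fun x => by simp)

theorem exists_sup_bound_real : ∃ C : ℝ, 0 ≤ C ∧
    ∀ (f : E3 → ℝ) (g g2 : Fin 3 → E3 → ℝ),
      (∀ j, HasL2Partial j f (g j)) → (∀ j, HasL2Partial j (g j) (g2 j)) →
      ∀ᵐ x, ‖f x‖ ≤ C * (l2 f + ∑ j, (l2 (g j) + l2 (g2 j))) := by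
  obtain ⟨C, hC, hb⟩ := exists_sup_bound_complex
  refine ⟨C, hC, fun f g g2 h1 h2 => ?_⟩
  have := hb _ _ _ (fun j => (h1 j).clm_comp Complex.ofRealCLM)
    (fun j => (h2 j).clm_comp Complex.ofRealCLM)
  simpa [l2_ofReal] using this

/-! ### The Sobolev inequality -/

/-- The Gagliardo–Nirenberg–Sobolev inequality is applied to cutoffs times mollifications, which are
smooth with compact support, and Fatou's lemma passes to the limit. The gradient of the cutoff is
only bounded uniformly, which is why the `L²` norm of `f` stays on the right. -/
theorem exists_sobolev : ∃ C : ℝ, 0 ≤ C ∧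
    ∀ (f : E3 → ℂ) (g : Fin 3 → E3 → ℂ), (∀ j, HasL2Partial j f (g j)) →
      MemLp f 6 volume ∧ (eLpNorm f 6 volume).toReal ≤ C * (l2 f + ∑ j, l2 (g j)) := by
  obtain ⟨D, hD, hD1, -⟩ := exists_cutoff_bound
  obtain ⟨S, hS⟩ : ∃ S : NNReal,
    S = SNormLESNormFDerivOfEqConst ℂ (volume : Measure E3) ((2 : NNReal) : ℝ) := ⟨_, rfl⟩
  refine ⟨S * (3 * D + 1), by positivity, fun f g h1 => ?_⟩
  have hf := (h1 0).mem
  have hl := memLp_locallyIntegrable hf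
  have hcut : ∀ n, ContDiff ℝ ∞ (fun x => cutoff n x • mollify n f x) := fun n =>
    (cutoff_contDiff n).smul (mollify_contDiff n hl)
  have hfd : ∀ n x (j : Fin 3), fderiv ℝ (fun x => cutoff n x • mollify n f x) x (ej j)
      = cutoff n x • mollify n (g j) x + fderiv ℝ (cutoff n) x (ej j) • mollify n f x := by
    intro n x j
    rw [fderiv_fun_smul ((cutoff_contDiff n).differentiable (by norm_num) x)
      ((mollify_contDiff n hl).differentiable (by norm_num) x)]
    simp [mollify_fderiv n hl (h1 j).weak]
  let R : ℕ → ℝ := fun n => S * (3 * D * (l2 f + mollifyError n f)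
    + ∑ j, (l2 (g j) + mollifyError n (g j)))
  have key : ∀ n, eLpNorm (fun x => cutoff n x • mollify n f x) 6 volume ≤ ENNReal.ofReal (R n) := by
    intro n
    have h6 := eLpNorm_le_eLpNorm_fderiv_of_eq (F := ℂ) (volume : Measure E3)
      (u := fun x => cutoff n x • mollify n f x) ((hcut n).of_le (by norm_cast))
      ((cutoff_hasCompactSupport n).smul_right) (p := 2) (p' := 6) (by norm_num)
      (by simp) (by simp; norm_num)
    rw [← hS] at h6
    refine h6.trans ?_
    set W : E3 → ℝ := fun x => 3 * D * ‖mollify n f x‖ + ∑ j, ‖mollify n (g j) x‖ with hW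
    have mj : ∀ j, MemLp (fun x => ‖mollify n (g j) x‖) 2 volume := fun j =>
      (mollify_memLp (h1 j).mem' n).norm
    have m0 : MemLp (fun x => 3 * D * ‖mollify n f x‖) 2 volume :=
      (mollify_memLp hf n).norm.const_mul _
    have ms : MemLp (fun x => ∑ j, ‖mollify n (g j) x‖) 2 volume :=
      memLp_finsetSum _ fun j _ => mj j
    have mW : MemLp W 2 volume := m0.add ms
    have b1 : eLpNorm (fderiv ℝ fun x => cutoff n x • mollify n f x) 2 volume
        ≤ eLpNorm W 2 volume := by
      refine eLpNorm_mono_real fun x => ?_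
      refine (norm_clm_le _).trans ?_
      simp only [hfd, hW, Fin.sum_univ_three]
      have c : ∀ j, ‖cutoff n x • mollify n (g j) x + fderiv ℝ (cutoff n) x (ej j) • mollify n f x‖
          ≤ ‖mollify n (g j) x‖ + D * ‖mollify n f x‖ := by
        intro j
        refine (norm_add_le _ _).trans (add_le_add ?_ ?_)
        · rw [norm_smul]
          exact mul_le_of_le_one_left (norm_nonneg _) (cutoff_norm_le n x)
        · rw [norm_smul]
          exact mul_le_mul_of_nonneg_right (hD1 n j x) (norm_nonneg _)
      linarith [c 0, c 1, c 2]
    have b2 : l2 W ≤ 3 * D * (l2 f + mollifyError n f)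
        + ∑ j, (l2 (g j) + mollifyError n (g j)) := by
      refine (l2_add_le m0 ms).trans (add_le_add ?_ ?_)
      · refine (l2_le_mul (C := 3 * D) (g := mollify n f) (by positivity) (mollify_memLp hf n)
          (Eventually.of_forall fun x => by simp [abs_of_nonneg hD])).trans ?_
        exact mul_le_mul_of_nonneg_left (l2_mollify_le hf n) (by positivity)
      · have nn : ∀ j, l2 (fun x => ‖mollify n (g j) x‖) ≤ l2 (g j) + mollifyError n (g j) := by
          intro j
          refine le_trans (le_of_eq ?_) (l2_mollify_le (h1 j).mem' n)
          rw [l2, l2, eLpNorm_norm]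
        simp only [Fin.sum_univ_three]
        have b1 := l2_add_le (mj 0) (mj 1)
        have b2 := l2_add_le ((mj 0).add (mj 1)) (mj 2)
        simp only [Pi.add_apply] at b2
        have b3 : l2 ((fun x => ‖mollify n (g 0) x‖) + fun x => ‖mollify n (g 1) x‖)
          = l2 (fun x => ‖mollify n (g 0) x‖ + ‖mollify n (g 1) x‖) := rfl
        rw [b3] at b2
        linarith [nn 0, nn 1, nn 2]
    have b3 : eLpNorm W 2 volume = ENNReal.ofReal (l2 W) := (ENNReal.ofReal_toReal mW.2.ne).symm
    calc _ ≤ (S : ENNReal) * ENNReal.ofReal (l2 W) := by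
          rw [← b3]
          exact mul_le_mul_right b1 _
      _ = ENNReal.ofReal (S * l2 W) := by
          rw [ENNReal.ofReal_mul S.coe_nonneg, ENNReal.ofReal_coe_nnreal]
      _ ≤ _ := ENNReal.ofReal_le_ofReal (mul_le_mul_of_nonneg_left b2 S.coe_nonneg)
  have hR : Tendsto R atTop (𝓝 (S * (3 * D * l2 f + ∑ j, l2 (g j)))) := by
    have t1 := ((mollifyError_tendsto hf).const_add (l2 f)).const_mul (3 * D)
    have t2 : Tendsto (fun n => ∑ j, (l2 (g j) + mollifyError n (g j))) atTop
        (𝓝 (∑ j, (l2 (g j) + 0))) :=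
      tendsto_finsetSum _ fun j _ => (mollifyError_tendsto (h1 j).mem').const_add _
    simpa using (t1.add t2).const_mul (S : ℝ)
  have hlim : ∀ᵐ x, Tendsto (fun n => cutoff n x • mollify n f x) atTop (𝓝 (f x)) := by
    filter_upwards [mollify_ae_tendsto hl] with x hx
    refine hx.congr' ?_
    obtain ⟨n, hxn⟩ := exists_nat_ge ‖x‖
    filter_upwards [eventually_ge_atTop n] with m hm
    rw [cutoff_eq_one, one_smul]
    have : (n : ℝ) ≤ m := by exact_mod_cast hm
    linarith
  have hle := (Lp.eLpNorm_lim_le_liminf_eLpNorm (p := 6)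
    (fun n => (hcut n).continuous.aestronglyMeasurable) f hlim)
  have hle2 : eLpNorm f 6 volume ≤ ENNReal.ofReal (S * (3 * D * l2 f + ∑ j, l2 (g j))) := by
    have t : Tendsto (fun n => ENNReal.ofReal (R n)) atTop
        (𝓝 (ENNReal.ofReal (S * (3 * D * l2 f + ∑ j, l2 (g j))))) := ENNReal.tendsto_ofReal hR
    have hlim2 : liminf (fun n => eLpNorm (fun x => cutoff n x • mollify n f x) 6 volume) atTop
        ≤ liminf (fun n => ENNReal.ofReal (R n)) atTop :=
      liminf_le_liminf (Eventually.of_forall key)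
    rw [t.liminf_eq] at hlim2
    exact hle.trans hlim2
  refine ⟨⟨hf.1, hle2.trans_lt ENNReal.ofReal_lt_top⟩, ?_⟩
  have p0 := l2_nonneg f
  have p1 : 0 ≤ ∑ j, l2 (g j) := Finset.sum_nonneg fun j _ => l2_nonneg _
  have p2 : 0 ≤ S * (3 * D * l2 f + ∑ j, l2 (g j)) :=
    mul_nonneg S.coe_nonneg (add_nonneg (mul_nonneg (mul_nonneg zero_le_three hD) p0) p1)
  refine (ENNReal.toReal_le_of_le_ofReal p2 hle2).trans ?_
  rw [mul_assoc (S : ℝ)]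
  refine mul_le_mul_of_nonneg_left ?_ S.coe_nonneg
  nlinarith [mul_nonneg hD p0, mul_nonneg hD p1]

/-! ### Translations -/

theorem l2_translate {f : E3 → F} (hf : MemLp f 2 volume) (z : E3) :
    l2 (fun x => f (x - z)) = l2 f := by
  rw [l2, l2, eLpNorm_translate hf.1]

theorem eLpNorm_two_sq (f : E3 → F) : (eLpNorm f 2 volume) ^ 2 = ∫⁻ x, ‖f x‖ₑ ^ 2 := by
  have e := eLpNorm_nnreal_pow_eq_lintegral (μ := (volume : Measure E3)) (f := f) (p := 2)
    (by norm_num)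
  simpa using e

/-- The fundamental theorem of calculus along the segment from `x` to `x - z`, then Jensen on `[0,
1]`, Tonelli and translation invariance. -/
theorem eLpNorm_translate_sub_le_of_contDiff {f : E3 → F} (hf : ContDiff ℝ 1 f) (z : E3) :
    eLpNorm (fun x => f (x - z) - f x) 2 volume ≤ eLpNorm (fun x => fderiv ℝ f x z) 2 volume := by
  have hc : Continuous fun x => fderiv ℝ f x z := continuous_fderiv_apply hf z
  have hpt : ∀ x, ‖f (x - z) - f x‖ₑ ^ 2 ≤ ∫⁻ s in Ioc (0 : ℝ) 1, ‖fderiv ℝ f (x - s • z) z‖ₑ ^ 2 := by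
    intro x
    have hprob : IsProbabilityMeasure ((volume : Measure ℝ).restrict (Ioc 0 1)) := ⟨by simp⟩
    have hcs : Continuous fun s : ℝ => fderiv ℝ f (x - s • z) z := hc.comp (by fun_prop)
    have hd : ∀ s ∈ uIcc (0 : ℝ) 1, HasDerivAt (fun s : ℝ => f (x - s • z))
        (-(fderiv ℝ f (x - s • z) z)) s := by
      intro s _
      have h1 : HasDerivAt (fun s : ℝ => x - s • z) (-z) s := by
        have := ((hasDerivAt_id s).smul_const z).const_sub x
        simpa using this
      have h2 := ((hf.differentiable (by norm_num) (x - s • z)).hasFDerivAt).comp_hasDerivAt s h1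
      rw [map_neg] at h2
      exact h2
    have h1 := intervalIntegral.integral_eq_sub_of_hasDerivAt hd (hcs.neg.intervalIntegrable _ _)
    simp only [one_smul, zero_smul, sub_zero] at h1
    rw [← h1, intervalIntegral.integral_of_le zero_le_one]
    have h2 : ‖∫ s in Ioc (0 : ℝ) 1, -(fderiv ℝ f (x - s • z) z)‖ₑ
        ≤ eLpNorm (fun s : ℝ => fderiv ℝ f (x - s • z) z) 1 (volume.restrict (Ioc 0 1)) := by
      rw [eLpNorm_one_eq_lintegral_enorm]
      refine (enorm_integral_le_lintegral_enorm _).trans (le_of_eq ?_)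
      simp
    have h3 := h2.trans (eLpNorm_le_eLpNorm_of_exponent_le (q := 2) (by norm_num)
      hcs.aestronglyMeasurable)
    have e := eLpNorm_nnreal_pow_eq_lintegral (μ := (volume : Measure ℝ).restrict (Ioc 0 1))
      (f := fun s : ℝ => fderiv ℝ f (x - s • z) z) (p := 2) (by norm_num)
    have e' : (eLpNorm (fun s : ℝ => fderiv ℝ f (x - s • z) z) 2 (volume.restrict (Ioc 0 1))) ^ 2
        = ∫⁻ s in Ioc (0 : ℝ) 1, ‖fderiv ℝ f (x - s • z) z‖ₑ ^ 2 := by simpa using e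
    rw [← e']
    gcongr
  refine (ENNReal.pow_le_pow_left_iff (n := 2) (by norm_num)).1 ?_
  rw [eLpNorm_two_sq, eLpNorm_two_sq]
  have hm : Measurable fun q : E3 × ℝ => ‖fderiv ℝ f (q.1 - q.2 • z) z‖ₑ ^ 2 :=
    ((hc.comp (by fun_prop : Continuous fun q : E3 × ℝ => q.1 - q.2 • z)).enorm.measurable).pow_const 2
  calc _ ≤ ∫⁻ x, ∫⁻ s in Ioc (0 : ℝ) 1, ‖fderiv ℝ f (x - s • z) z‖ₑ ^ 2 := lintegral_mono hpt
    _ = ∫⁻ s in Ioc (0 : ℝ) 1, ∫⁻ x, ‖fderiv ℝ f (x - s • z) z‖ₑ ^ 2 :=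
        lintegral_lintegral_swap hm.aemeasurable
    _ = ∫⁻ s in Ioc (0 : ℝ) 1, ∫⁻ x, ‖fderiv ℝ f x z‖ₑ ^ 2 := by
        congr 1
        ext s
        exact lintegral_sub_right_eq_self (fun x => ‖fderiv ℝ f x z‖ₑ ^ 2) (s • z)
    _ = _ := by simp

/-- Translations are Lipschitz on `H¹`. -/
theorem l2_translate_sub_le {f : E3 → F} {g : Fin 3 → E3 → F} (h : ∀ j, HasL2Partial j f (g j))
    (z : E3) : l2 (fun x => f (x - z) - f x) ≤ ‖z‖ * ∑ j, l2 (g j) := by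
  have hf := (h 0).mem
  have hl := memLp_locallyIntegrable hf
  -- The smooth bound for the mollification, plus the mollification error twice: once for `f` and
  -- once for its translate.
  have key : ∀ n, l2 (fun x => f (x - z) - f x)
      ≤ 2 * mollifyError n f + ‖z‖ * ∑ j, (l2 (g j) + mollifyError n (g j)) := by
    intro n
    set p := mollify n f with hp
    have hpm : MemLp p 2 volume := mollify_memLp hf n
    have mj : ∀ j, MemLp (fun x => ‖mollify n (g j) x‖) 2 volume := fun j =>
      (mollify_memLp (h j).mem' n).norm
    have ms : MemLp (fun x => ∑ j, ‖mollify n (g j) x‖) 2 volume :=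
      memLp_finsetSum _ fun j _ => mj j
    have s1 : l2 (fun x => p (x - z) - p x) ≤ ‖z‖ * ∑ j, (l2 (g j) + mollifyError n (g j)) := by
      have c1 := (mollify_contDiff n hl).of_le (m := 1) (by norm_cast)
      have mz : MemLp (fun x => fderiv ℝ p x z) 2 volume := by
        refine memLp_two_of_le (C := ‖z‖) (continuous_fderiv_apply c1 z).aestronglyMeasurable ms
          (Eventually.of_forall fun x => ?_)
        refine (norm_clm_apply_le _ z).trans (le_of_eq ?_)
        rw [Real.norm_of_nonneg (by positivity)]
        simp only [hp, mollify_fderiv n hl (h _).weak]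
      have a := ENNReal.toReal_mono mz.2.ne (eLpNorm_translate_sub_le_of_contDiff c1 z)
      refine a.trans ?_
      have b : l2 (fun x => fderiv ℝ p x z) ≤ ‖z‖ * l2 (fun x => ∑ j, ‖mollify n (g j) x‖) := by
        refine l2_le_mul (norm_nonneg _) ms (Eventually.of_forall fun x => ?_)
        refine (norm_clm_apply_le _ z).trans (le_of_eq ?_)
        rw [Real.norm_of_nonneg (by positivity)]
        simp only [hp, mollify_fderiv n hl (h _).weak]
      refine b.trans (mul_le_mul_of_nonneg_left ?_ (norm_nonneg _))
      have nn : ∀ j, l2 (fun x => ‖mollify n (g j) x‖) ≤ l2 (g j) + mollifyError n (g j) := by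
        intro j
        refine le_trans (le_of_eq ?_) (l2_mollify_le (h j).mem' n)
        rw [l2, l2, eLpNorm_norm]
      simp only [Fin.sum_univ_three]
      have b1 := l2_add_le (mj 0) (mj 1)
      have b2 := l2_add_le ((mj 0).add (mj 1)) (mj 2)
      simp only [Pi.add_apply] at b2
      have b3 : l2 ((fun x => ‖mollify n (g 0) x‖) + fun x => ‖mollify n (g 1) x‖)
        = l2 (fun x => ‖mollify n (g 0) x‖ + ‖mollify n (g 1) x‖) := rfl
      rw [b3] at b2
      linarith [nn 0, nn 1, nn 2]
    have md : MemLp (fun x => p x - f x) 2 volume := hpm.sub hf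
    have mt : MemLp (fun x => p (x - z) - p x) 2 volume := (MemLp.translate hpm z).sub hpm
    have s2 : l2 (fun x => f (x - z) - f x) ≤ l2 (fun x => (p (x - z) - p x) + (p x - f x))
        + l2 (fun x => p (x - z) - f (x - z)) := by
      refine le_trans (le_of_eq (congrArg l2 ?_)) (l2_sub_le (mt.add md) (MemLp.translate md z))
      ext x
      simp
    have s3 : l2 (fun x => p (x - z) - f (x - z)) = mollifyError n f := l2_translate md z
    have s4 := l2_add_le mt md
    have s5 : l2 (fun x => p x - f x) = mollifyError n f := rfl
    linarith
  have t1 := (mollifyError_tendsto hf).const_mul 2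
  have t2 : Tendsto (fun n => ∑ j, (l2 (g j) + mollifyError n (g j))) atTop
      (𝓝 (∑ j, (l2 (g j) + 0))) :=
    tendsto_finsetSum _ fun j _ => (mollifyError_tendsto (h j).mem').const_add _
  have t := t1.add (t2.const_mul ‖z‖)
  simp only [mul_zero, add_zero, zero_add] at t
  exact ge_of_tendsto' t key

/-- Functions with bounded weak derivatives are Lipschitz. -/
theorem ae_translate_sub_le {f : E3 → F} {g : Fin 3 → E3 → F} (h : ∀ j, HasL2Partial j f (g j))
    {M : ℝ} (hM : ∀ j, ∀ᵐ x, ‖g j x‖ ≤ M) (z : E3) :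
    ∀ᵐ x, ‖f (x - z) - f x‖ ≤ 3 * M * ‖z‖ := by
  have hl := memLp_locallyIntegrable (h 0).mem
  have hlip : ∀ n x, ‖mollify n f (x - z) - mollify n f x‖ ≤ 3 * M * ‖z‖ := by
    intro n x
    have := Convex.norm_image_sub_le_of_norm_fderiv_le (𝕜 := ℝ) (f := mollify n f) (s := univ)
      (C := 3 * M) (x := x) (y := x - z)
      (fun y _ => (mollify_contDiff n hl).differentiable (by norm_num) y)
      (fun y _ => by
        refine (norm_clm_le _).trans ?_
        simp only [mollify_fderiv n hl (h _).weak, Fin.sum_univ_three]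
        linarith [mollify_norm_le n (hM 0) y, mollify_norm_le n (hM 1) y,
          mollify_norm_le n (hM 2) y]) convex_univ (mem_univ _) (mem_univ _)
    simpa using this
  have a1 := mollify_ae_tendsto hl
  have a2 := (measurePreserving_sub_right' z).quasiMeasurePreserving.ae a1
  filter_upwards [a1, a2] with x h1 h2
  exact le_of_tendsto' (h2.sub h1).norm (fun n => hlip n x)

end Embedding

/-! ### The spaces `H^k` and curves in `L²` and `L^∞` -/

section SobolevSpaces

variable {F : Type} [NormedAddCommGroup F] [NormedSpace ℝ F] [CompleteSpace F]

theorem weakPartial_spec {j : Fin 3} {f g : E3 → F} (h : HasL2Partial j f g) :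
    HasL2Partial j f (weakPartial j f) := by
  have hex : ∃ g : E3 → F, MemLp g 2 volume ∧ HasWeakPartial j f g := ⟨g, h.mem', h.weak⟩
  rw [weakPartial, dif_pos hex]
  exact ⟨h.mem, hex.choose_spec.1, hex.choose_spec.2⟩

theorem HasL2Partial.unique {j : Fin 3} {f g g' : E3 → F} (h : HasL2Partial j f g)
    (h' : HasL2Partial j f g') : g =ᵐ[volume] g' :=
  h.weak.unique h'.weak (memLp_locallyIntegrable h.mem') (memLp_locallyIntegrable h'.mem')

/-- Uniqueness makes the choice inside `weakPartial` irrelevant: any explicit `L²` weak derivative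
may be substituted almost everywhere. -/
theorem HasL2Partial.weakPartial_ae {j : Fin 3} {f g : E3 → F} (h : HasL2Partial j f g) :
    weakPartial j f =ᵐ[volume] g := (weakPartial_spec h).unique h

theorem MemH.memLp {k : ℕ} {f : E3 → F} (h : MemH k f) : MemLp f 2 volume := by
  cases k with
  | zero => exact h
  | succ k => exact h.1

theorem MemH.hasL2Partial {k : ℕ} {f : E3 → F} (h : MemH (k + 1) f) (j : Fin 3) :
    HasL2Partial j f (weakPartial j f) := by
  obtain ⟨g, h1, h2⟩ := h.2 j
  exact weakPartial_spec ⟨h.1, h2.memLp, h1⟩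

theorem MemH.congr {k : ℕ} {f g : E3 → F} (h : MemH k f) (e : f =ᵐ[volume] g) : MemH k g := by
  cases k with
  | zero => exact MemLp.ae_eq e h
  | succ k =>
    refine ⟨h.1.ae_eq e, fun j => ?_⟩
    obtain ⟨w, h1, h2⟩ := h.2 j
    exact ⟨w, h1.congr e (ae_eq_refl _), h2⟩

theorem memH_weakPartial {k : ℕ} {f : E3 → F} (h : MemH (k + 1) f) (j : Fin 3) :
    MemH k (weakPartial j f) := by
  obtain ⟨g, h1, h2⟩ := h.2 j
  have h3 : HasL2Partial j f g := ⟨h.1, h2.memLp, h1⟩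
  exact h2.congr h3.weakPartial_ae.symm

theorem MemH.of_succ {k : ℕ} {f : E3 → F} (h : MemH (k + 1) f) : MemH k f := by
  induction k generalizing f with
  | zero => exact h.1
  | succ k ih =>
    refine ⟨h.1, fun j => ?_⟩
    obtain ⟨g, h1, h2⟩ := h.2 j
    exact ⟨g, h1, ih h2⟩

theorem MemH.mono {k m : ℕ} (hkm : m ≤ k) {f : E3 → F} (h : MemH k f) : MemH m f := by
  induction k, hkm using Nat.le_induction with
  | base => exact h
  | succ n _ ih => exact ih h.of_succ

theorem MemH.sub {k : ℕ} {f g : E3 → F} (hf : MemH k f) (hg : MemH k g) :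
    MemH k (fun x => f x - g x) := by
  induction k generalizing f g with
  | zero => exact MemLp.sub hf hg
  | succ k ih =>
    refine ⟨hf.1.sub hg.1, fun j => ?_⟩
    obtain ⟨a, h1, h2⟩ := hf.2 j
    obtain ⟨b, h3, h4⟩ := hg.2 j
    exact ⟨fun x => a x - b x, (HasL2Partial.sub ⟨hf.1, h2.memLp, h1⟩ ⟨hg.1, h4.memLp, h3⟩).weak,
      ih h2 h4⟩

theorem memH_weakDeriv (l : List (Fin 3)) {m : ℕ} {f : E3 → F} (h : MemH (m + l.length) f) :
    MemH m (weakDeriv l f) := by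
  induction l generalizing m with
  | nil => exact h
  | cons j l ih =>
    have h' : MemH ((m + 1) + l.length) f := by
      rw [List.length_cons] at h
      exact h.mono (by omega)
    exact memH_weakPartial (ih h') j

theorem memH_weakDeriv_sub (l : List (Fin 3)) {f g : E3 → F} (hf : MemH l.length f)
    (hg : MemH l.length g) :
    weakDeriv l (fun x => f x - g x) =ᵐ[volume] fun x => weakDeriv l f x - weakDeriv l g x := by
  induction l with
  | nil => exact ae_eq_refl _
  | cons j l ih =>
    rw [List.length_cons] at hf hg
    have e := ih hf.of_succ hg.of_succ
    have h1 : MemH 1 (weakDeriv l f) := memH_weakDeriv l (hf.mono (by omega))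
    have h2 : MemH 1 (weakDeriv l g) := memH_weakDeriv l (hg.mono (by omega))
    have h3 := (h1.hasL2Partial j).sub (h2.hasL2Partial j)
    exact (h3.congr e.symm (ae_eq_refl _)).weakPartial_ae

/-- All summands of the weighted norm are nonnegative and every binomial coefficient that occurs is
at least 1, so one multi-index can be singled out. -/
theorem weightedNormSq_ge {ε : ℝ} (hε : 0 ≤ ε) {k : ℕ} {f : E3 → F} (hf : MemH k f)
    (l : List (Fin 3)) (hl : l.length ≤ k) :
    ε ^ (2 * l.length) * l2 (weakDeriv l f) ^ 2 ≤ weightedNormSq ε k f := by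
  have hm : MemLp (weakDeriv l f) 2 volume := by
    have : MemH 0 (weakDeriv l f) := memH_weakDeriv l (hf.mono (by omega))
    exact this
  rw [l2_sq hm, weightedNormSq]
  have hnn : ∀ m (α : Fin m → Fin 3), 0 ≤ ∫ x, ‖weakDeriv (List.ofFn α) f x‖ ^ 2 := fun m α =>
    integral_nonneg fun x => by positivity
  have hterm : ∀ m ∈ Finset.range (k + 1), 0 ≤ (k.choose m : ℝ) * ε ^ (2 * m) *
      ∑ α : Fin m → Fin 3, ∫ x, ‖weakDeriv (List.ofFn α) f x‖ ^ 2 := fun m _ =>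
    mul_nonneg (by positivity) (Finset.sum_nonneg fun α _ => hnn m α)
  refine le_trans ?_ (Finset.single_le_sum hterm (Finset.mem_range.2 (Nat.lt_succ_of_le hl)))
  have h1 : (1 : ℝ) ≤ (k.choose l.length : ℝ) := by exact_mod_cast Nat.choose_pos hl
  have h2 : ∫ x, ‖weakDeriv l f x‖ ^ 2
      ≤ ∑ α : Fin l.length → Fin 3, ∫ x, ‖weakDeriv (List.ofFn α) f x‖ ^ 2 := by
    have := Finset.single_le_sum
      (f := fun α : Fin l.length → Fin 3 => ∫ x, ‖weakDeriv (List.ofFn α) f x‖ ^ 2)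
      (fun α _ => hnn _ α) (Finset.mem_univ l.get)
    simpa [List.ofFn_get] using this
  have h3 : 0 ≤ ∫ x, ‖weakDeriv l f x‖ ^ 2 := integral_nonneg fun x => by positivity
  have h4 : 0 ≤ ε ^ (2 * l.length) := by positivity
  calc _ ≤ ε ^ (2 * l.length) * ∑ α : Fin l.length → Fin 3,
        ∫ x, ‖weakDeriv (List.ofFn α) f x‖ ^ 2 := mul_le_mul_of_nonneg_left h2 h4
    _ ≤ _ := by
      refine mul_le_mul_of_nonneg_right ?_ (h3.trans h2)
      exact le_mul_of_one_le_left h4 h1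

/-! ### Curves in `L²` and in `L^∞` -/

/-- A continuous curve `[0,T] → L²`. -/
structure L2Cont (T : ℝ) (f : ℝ → E3 → F) : Prop where
  mem : ∀ t ∈ Icc 0 T, MemLp (f t) 2 volume
  tendsto : ∀ t ∈ Icc 0 T, Tendsto (fun s => l2 (fun x => f s x - f t x)) (𝓝[Icc 0 T] t) (𝓝 0)

/-- Weak derivatives are linear up to null sets, and the squared `H^k` norm of the difference
dominates each of its derivatives. -/
theorem ContinuousInH.l2Cont {k : ℕ} {T : ℝ} {f : ℝ → E3 → F} (h : ContinuousInH k T f)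
    (l : List (Fin 3)) (hl : l.length ≤ k) : L2Cont T (fun t => weakDeriv l (f t)) where
  mem t ht := by
    have : MemH 0 (weakDeriv l (f t)) := memH_weakDeriv l ((h.1 t ht).mono (by omega))
    exact this
  tendsto t ht := by
    have key : ∀ᶠ s in 𝓝[Icc 0 T] t,
        l2 (fun x => weakDeriv l (f s) x - weakDeriv l (f t) x)
          ≤ √(weightedNormSq 1 k (fun x => f s x - f t x)) := by
      filter_upwards [self_mem_nhdsWithin] with s hs
      have e := memH_weakDeriv_sub l ((h.1 s hs).mono hl) ((h.1 t ht).mono hl)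
      rw [← l2_congr e]
      refine Real.le_sqrt_of_sq_le ?_
      have := weightedNormSq_ge zero_le_one ((h.1 s hs).sub (h.1 t ht)) l hl
      simpa using this
    have t0 := (Real.continuous_sqrt.tendsto 0).comp (h.2 t ht)
    rw [Real.sqrt_zero] at t0
    exact squeeze_zero' (Eventually.of_forall fun s => l2_nonneg _) key t0

theorem abs_l2_sub_l2_le {f g : E3 → F} (hf : MemLp f 2 volume) (hg : MemLp g 2 volume) :
    |l2 f - l2 g| ≤ l2 (fun x => f x - g x) := by
  have h1 := l2_add_le (hf.sub hg) hg
  have h2 := l2_sub_le hf (hf.sub hg)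
  simp only [Pi.sub_apply, sub_add_cancel, sub_sub_cancel] at h1 h2
  rw [abs_le]
  constructor
  · have : l2 (fun x => g x) ≤ l2 f + l2 (f - g) := h2
    have e : l2 (f - g) = l2 (fun x => f x - g x) := rfl
    have e' : l2 (fun x => g x) = l2 g := rfl
    linarith
  · have e : l2 (f - g) = l2 (fun x => f x - g x) := rfl
    have e' : l2 (fun x => f x) = l2 f := rfl
    linarith

theorem L2Cont.bounded {T : ℝ} {f : ℝ → E3 → F} (h : L2Cont T f) :
    ∃ C, 0 ≤ C ∧ ∀ t ∈ Icc 0 T, l2 (f t) ≤ C := by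
  have hc : ContinuousOn (fun t => l2 (f t)) (Icc 0 T) := by
    intro t ht
    rw [ContinuousWithinAt, tendsto_iff_norm_sub_tendsto_zero]
    refine squeeze_zero' (Eventually.of_forall fun s => norm_nonneg _) ?_ (h.tendsto t ht)
    filter_upwards [self_mem_nhdsWithin] with s hs
    exact abs_l2_sub_l2_le (h.mem s hs) (h.mem t ht)
  obtain ⟨C, hC⟩ := isCompact_Icc.exists_bound_of_continuousOn hc
  refine ⟨max C 0, le_max_right _ _, fun t ht => ?_⟩
  exact (le_abs_self _).trans ((hC t ht).trans (le_max_left _ _))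

/-- A bounded curve `[0,T] → L^∞` that is continuous. -/
structure SupCont (T : ℝ) (f : ℝ → E3 → F) : Prop where
  bounded : ∃ M, 0 ≤ M ∧ ∀ t ∈ Icc 0 T, ∀ᵐ x, ‖f t x‖ ≤ M
  tendsto : ∀ t ∈ Icc 0 T, ∃ b : ℝ → ℝ, Tendsto b (𝓝[Icc 0 T] t) (𝓝 0) ∧
    ∀ s ∈ Icc 0 T, ∀ᵐ x, ‖f s x - f t x‖ ≤ b s

variable (F) in
/-- The Sobolev embedding `H² ⊂ L^∞` holds for functions with values in `F`. -/
def HasSupBound : Prop := ∃ C : ℝ, 0 ≤ C ∧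
    ∀ (f : E3 → F) (g g2 : Fin 3 → E3 → F),
      (∀ j, HasL2Partial j f (g j)) → (∀ j, HasL2Partial j (g j) (g2 j)) →
      ∀ᵐ x, ‖f x‖ ≤ C * (l2 f + ∑ j, (l2 (g j) + l2 (g2 j)))

/-- The embedding into `L^∞` costs two further derivatives. Applied to `f t` it gives the uniform
bound, applied to `f s - f t` it gives continuity. -/
theorem ContinuousInH.supCont (hF : HasSupBound F) {k : ℕ} {T : ℝ} {f : ℝ → E3 → F}
    (h : ContinuousInH k T f) (l : List (Fin 3)) (hl : l.length + 2 ≤ k) :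
    SupCont T (fun t => weakDeriv l (f t)) := by
  obtain ⟨C, hC, hb⟩ := hF
  have c0 := h.l2Cont l (by omega)
  have c1 := fun j => h.l2Cont (j :: l) (by simp; omega)
  have c2 := fun j => h.l2Cont (j :: j :: l) (by simp; omega)
  have m2 : ∀ t ∈ Icc 0 T, MemH 2 (weakDeriv l (f t)) := fun t ht =>
    memH_weakDeriv l ((h.1 t ht).mono (by omega))
  have p1 : ∀ t ∈ Icc 0 T, ∀ j, HasL2Partial j (weakDeriv l (f t))
      (weakDeriv (j :: l) (f t)) := fun t ht j => (m2 t ht).hasL2Partial j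
  have p2 : ∀ t ∈ Icc 0 T, ∀ j, HasL2Partial j (weakDeriv (j :: l) (f t))
      (weakDeriv (j :: j :: l) (f t)) := fun t ht j =>
    (memH_weakPartial (m2 t ht) j).hasL2Partial j
  refine ⟨?_, fun t ht => ?_⟩
  · obtain ⟨C0, n0, b0⟩ := c0.bounded
    choose C1 n1 b1 using fun j => (c1 j).bounded
    choose C2 n2 b2 using fun j => (c2 j).bounded
    refine ⟨C * (C0 + ∑ j, (C1 j + C2 j)), mul_nonneg hC (add_nonneg n0
      (Finset.sum_nonneg fun j _ => add_nonneg (n1 j) (n2 j))), fun t ht => ?_⟩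
    filter_upwards [hb _ _ _ (p1 t ht) (p2 t ht)] with x hx
    refine hx.trans (mul_le_mul_of_nonneg_left (add_le_add (b0 t ht)
      (Finset.sum_le_sum fun j _ => add_le_add (b1 j t ht) (b2 j t ht))) hC)
  · refine ⟨fun s => C * (l2 (fun x => weakDeriv l (f s) x -
        weakDeriv l (f t) x) +
      ∑ j, (l2 (fun x => weakDeriv (j :: l) (f s) x -
        weakDeriv (j :: l) (f t) x) +
        l2 (fun x => weakDeriv (j :: j :: l) (f s) x -
        weakDeriv (j :: j :: l) (f t) x))), ?_, fun s hs => ?_⟩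
    · have t3 : Tendsto (fun s => ∑ j, (l2 (fun x => weakDeriv (j :: l) (f s) x -
        weakDeriv (j :: l) (f t) x) +
        l2 (fun x => weakDeriv (j :: j :: l) (f s) x -
        weakDeriv (j :: j :: l) (f t) x))) (𝓝[Icc 0 T] t)
          (𝓝 (∑ j : Fin 3, ((0 : ℝ) + 0))) :=
        tendsto_finsetSum _ fun j _ => ((c1 j).tendsto t ht).add ((c2 j).tendsto t ht)
      simpa using (((c0.tendsto t ht).add t3).const_mul C)
    · exact hb _ _ _ (fun j => (p1 s hs j).sub (p1 t ht j)) (fun j => (p2 s hs j).sub (p2 t ht j))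

/-- Difference quotients of curves on `[0, T]` lie in `L²` only for times inside the interval, so
membership is required only eventually. The proof estimates `B(f,g) - B(f₀,g₀)` as `B(f-f₀,g) +
B(f₀,g-g₀)`. -/
theorem tendsto_integral_bilin_of_eventually {G H : Type} [NormedAddCommGroup G] [NormedSpace ℝ G]
    [CompleteSpace G] [NormedAddCommGroup H] [NormedSpace ℝ H] [CompleteSpace H]
    {ι : Type*} {l : Filter ι} {f : ι → E3 → F} {g : ι → E3 → G}
    {f₀ : E3 → F} {g₀ : E3 → G} (B : F →L[ℝ] G →L[ℝ] H)
    (hf : ∀ᶠ n in l, MemLp (f n) 2 volume) (hg : ∀ᶠ n in l, MemLp (g n) 2 volume)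
    (hf₀ : MemLp f₀ 2 volume) (hg₀ : MemLp g₀ 2 volume)
    (h1 : Tendsto (fun n => l2 (fun x => f n x - f₀ x)) l (𝓝 0))
    (h2 : Tendsto (fun n => l2 (fun x => g n x - g₀ x)) l (𝓝 0)) :
    Tendsto (fun n => ∫ x, B (f n x) (g n x)) l (𝓝 (∫ x, B (f₀ x) (g₀ x))) := by
  rw [tendsto_iff_norm_sub_tendsto_zero]
  have key : ∀ᶠ n in l, ‖(∫ x, B (f n x) (g n x)) - ∫ x, B (f₀ x) (g₀ x)‖
      ≤ ‖B‖ * (l2 (fun x => f n x - f₀ x) * (l2 g₀ + l2 (fun x => g n x - g₀ x)))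
        + ‖B‖ * (l2 f₀ * l2 (fun x => g n x - g₀ x)) := by
    filter_upwards [hf, hg] with n a b
    have e : (∫ x, B (f n x) (g n x)) - ∫ x, B (f₀ x) (g₀ x)
        = (∫ x, B (f n x - f₀ x) (g n x)) + ∫ x, B (f₀ x) (g n x - g₀ x) := by
      rw [← integral_sub (integrable_bilin B a b) (integrable_bilin B hf₀ hg₀),
        ← integral_add (f := fun x => B (f n x - f₀ x) (g n x))
          (g := fun x => B (f₀ x) (g n x - g₀ x))
          (integrable_bilin B (a.sub hf₀) b) (integrable_bilin B hf₀ (b.sub hg₀))]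
      congr 1
      ext x
      simp
    rw [e]
    refine (norm_add_le _ _).trans (add_le_add ?_ ?_)
    · refine (norm_integral_le_integral_norm _).trans
        ((norm_integral_bilin_le B (a.sub hf₀) b).trans ?_)
      refine mul_le_mul_of_nonneg_left (mul_le_mul_of_nonneg_left ?_ (l2_nonneg _)) (norm_nonneg B)
      have := abs_l2_sub_l2_le b hg₀
      linarith [le_abs_self (l2 (g n) - l2 g₀)]
    · exact (norm_integral_le_integral_norm _).trans (norm_integral_bilin_le B hf₀ (b.sub hg₀))
  refine squeeze_zero' (Eventually.of_forall fun n => norm_nonneg _) key ?_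
  have := ((h1.mul (h2.const_add (l2 g₀))).const_mul ‖B‖).add ((h2.const_mul (l2 f₀)).const_mul ‖B‖)
  simpa using this

/-- Pairing the difference quotients of a differentiable curve with a continuous curve. -/
theorem HasTimeDeriv.tendsto_pairing {G H : Type} [NormedAddCommGroup G] [NormedSpace ℝ G]
    [CompleteSpace G] [NormedAddCommGroup H] [NormedSpace ℝ H] [CompleteSpace H]
    {T t : ℝ} {f : ℝ → E3 → F} {g : E3 → F} (h : HasTimeDeriv T f t g)
    (hm : ∀ s ∈ Icc 0 T, MemLp (f s) 2 volume) (ht : t ∈ Icc 0 T)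
    (B : G →L[ℝ] F →L[ℝ] H) {w : ℝ → E3 → G} {w₀ : E3 → G}
    (hw : ∀ s ∈ Icc 0 T, MemLp (w s) 2 volume) (hw₀ : MemLp w₀ 2 volume)
    (hwt : Tendsto (fun s => l2 (fun x => w s x - w₀ x)) (𝓝[Icc 0 T] t) (𝓝 0)) :
    Tendsto (fun s => (s - t)⁻¹ • ∫ x, B (w s x) (f s x - f t x)) (𝓝[Icc 0 T \ {t}] t)
      (𝓝 (∫ x, B (w₀ x) (g x))) := by
  have hsub : 𝓝[Icc 0 T \ {t}] t ≤ 𝓝[Icc 0 T] t := nhdsWithin_mono _ sdiff_subset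
  have hin : ∀ᶠ s in 𝓝[Icc 0 T \ {t}] t, s ∈ Icc 0 T :=
    hsub self_mem_nhdsWithin
  have hq : ∀ᶠ s in 𝓝[Icc 0 T \ {t}] t,
      MemLp (fun x => (s - t)⁻¹ • (f s x - f t x)) 2 volume := by
    filter_upwards [hin] with s hs using ((hm s hs).sub (hm t ht)).const_smul _
  have := tendsto_integral_bilin_of_eventually B (f := w)
    (g := fun s x => (s - t)⁻¹ • (f s x - f t x)) (hin.mono fun s hs => hw s hs) hq hw₀ h.1
    (hwt.mono_left hsub) (l2_sub_tendsto h.2)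
  refine this.congr fun s => ?_
  simp only [map_smul]
  rw [integral_smul]

end SobolevSpaces

theorem hasSupBound_complex : HasSupBound ℂ := exists_sup_bound_complex

theorem hasSupBound_real : HasSupBound ℝ := exists_sup_bound_real

/-! ### Radial functions and their profiles -/

/-- The profile of a radial function. -/
def profile (f : E3 → ℝ) (r : ℝ) : ℝ := f (r • ej 0)

theorem norm_smul_ej (r : ℝ) : ‖r • ej 0‖ = |r| := by simp [norm_smul]

theorem IsRadial.eq_profile {f : E3 → ℝ} (h : IsRadial f) (x : E3) : f x = profile f ‖x‖ :=
  h _ _ (by rw [norm_smul_ej, abs_norm])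

theorem profile_contDiff {f : E3 → ℝ} {n : WithTop ℕ∞} (h : ContDiff ℝ n f) :
    ContDiff ℝ n (profile f) :=
  h.comp (contDiff_id.smul contDiff_const)

theorem integral_radial (g : ℝ → ℝ) :
    ∫ x : E3, g ‖x‖ = 4 * Real.pi * ∫ r in Ioi (0 : ℝ), r ^ 2 * g r := by
  rw [integral_fun_norm_addHaar (volume : Measure E3) g]
  have : (volume : Measure E3).real (Metric.ball 0 1) = Real.pi * 4 / 3 := by
    rw [Measure.real, EuclideanSpace.volume_ball_fin_three]
    simp
    positivity
  rw [this]
  simp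
  ring

/-- Integration by parts with one absolutely continuous factor. -/
theorem integral_mul_eq_sub_of_contDiff {h χ : ℝ → ℝ} {R : ℝ}
    (hh : IntervalIntegrable h volume 0 R) (hχ : ContDiff ℝ 1 χ) :
    ∫ s in (0)..R, h s * χ s
      = (∫ s in (0)..R, h s) * χ R - ∫ s in (0)..R, (∫ y in (0)..s, h y) * deriv χ s := by
  have a1 : AbsolutelyContinuousOnInterval (fun s => ∫ y in (0)..s, h y) 0 R :=
    hh.absolutelyContinuousOnInterval_intervalIntegral (by simp)
  have a2 : AbsolutelyContinuousOnInterval χ 0 R :=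
    hχ.contDiffOn.absolutelyContinuousOnInterval
  have key := a1.integral_mul_deriv_eq_deriv_mul a2
  rw [key]
  simp only [intervalIntegral.integral_same, zero_mul, sub_zero]
  have : ∫ s in (0)..R, deriv (fun s => ∫ y in (0)..s, h y) s * χ s = ∫ s in (0)..R, h s * χ s := by
    refine intervalIntegral.integral_congr_ae ?_
    filter_upwards [hh.ae_hasDerivAt_integral] with x hx hx'
    rw [(hx (uIoc_subset_uIcc hx') 0 (by simp)).deriv]
  rw [this]
  ring

/-- Away from the origin the norm is smooth, and its gradient `x/|x|` is read off from the
derivative of `|x|²`; the chain rule does the rest. -/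
theorem gradient_radial {f : E3 → ℝ} (hf : ContDiff ℝ 1 f) (hr : IsRadial f) {x : E3} (hx : x ≠ 0) :
    ∇ f x = (deriv (profile f) ‖x‖ * ‖x‖⁻¹) • x := by
  have e : f = fun y => profile f ‖y‖ := funext hr.eq_profile
  have h1 : HasDerivAt (profile f) (deriv (profile f) ‖x‖) ‖x‖ :=
    ((profile_contDiff hf).differentiable (by norm_num) _).hasDerivAt
  have h2 : HasFDerivAt (fun y : E3 => ‖y‖) (fderiv ℝ (fun y : E3 => ‖y‖) x) x :=
    (contDiffAt_norm ℝ hx (n := 1)).differentiableAt (by norm_num) |>.hasFDerivAt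
  have h3 := h1.comp_hasFDerivAt x h2
  have h4 : fderiv ℝ f x = deriv (profile f) ‖x‖ • fderiv ℝ (fun y : E3 => ‖y‖) x := by
    conv_lhs => rw [e]
    exact h3.fderiv
  have h5 : fderiv ℝ (fun y : E3 => ‖y‖) x = ‖x‖⁻¹ • innerSL ℝ x := by
    have hs : HasStrictFDerivAt (fun y : E3 => ‖y‖ ^ 2) (2 • innerSL ℝ x) x :=
      hasStrictFDerivAt_norm_sq x
    have hp : HasFDerivAt (fun y : E3 => ‖y‖ ^ 2)
        ((2 * ‖x‖) • fderiv ℝ (fun y : E3 => ‖y‖) x) x := by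
      have := h2.pow 2
      simpa using this
    have := hs.hasFDerivAt.unique hp
    have hne : ‖x‖ ≠ 0 := norm_ne_zero_iff.2 hx
    ext y
    have hy := congrArg (fun A : E3 →L[ℝ] ℝ => A y) this
    simp only [smul_apply, nsmul_eq_mul, smul_eq_mul] at hy ⊢
    have hy' : 2 * (innerSL ℝ x) y = 2 * ‖x‖ * (fderiv ℝ (fun y : E3 => ‖y‖) x) y := by
      simpa using hy
    field_simp
    linarith
  refine ext_inner_right ℝ fun y => ?_
  rw [gradient, InnerProductSpace.toDual_symm_apply, h4, h5]
  simp [inner_smul_left]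
  ring

theorem profile_measurable {v : E3 → ℝ} (hv : Measurable v) : Measurable (profile v) :=
  hv.comp (by fun_prop)

/-- The test function `∫_R^{|x|} g` built from a function `g` supported in `(0, R)`. -/
theorem radialTest {g : ℝ → ℝ} {R : ℝ} (hg : ContDiff ℝ ∞ g)
    (hgs : HasCompactSupport g) (hgR : tsupport g ⊆ Ioo 0 R) :
    ContDiff ℝ ∞ (fun x : E3 => ∫ s in R..‖x‖, g s) ∧
    HasCompactSupport (fun x : E3 => ∫ s in R..‖x‖, g s) ∧
    tsupport (fun x : E3 => ∫ s in R..‖x‖, g s) ⊆ Metric.ball 0 R ∧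
    IsRadial (fun x : E3 => ∫ s in R..‖x‖, g s) ∧
    (∀ r, HasDerivAt (fun r => ∫ s in R..r, g s) (g r) r) ∧
    ∃ a > 0, ∀ r < a, g r = 0 := by
  have hder : ∀ r, HasDerivAt (fun r => ∫ s in R..r, g s) (g r) r := fun r =>
    intervalIntegral.integral_hasDerivAt_right (hg.continuous.intervalIntegrable _ _)
      hg.continuous.stronglyMeasurable.stronglyMeasurableAtFilter hg.continuous.continuousAt
  -- Compactness of the support inside `(0, R)` provides a margin at both ends: the primitive is
  -- constant near 0, hence smooth across the origin as a function of `|x|`, and it vanishes beyond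
  -- `b < R`.
  obtain ⟨a, ha, b, hb, hab⟩ : ∃ a > 0, ∃ b < R, ∀ r, g r ≠ 0 → a ≤ r ∧ r ≤ b := by
    by_cases hne : (tsupport g).Nonempty
    · obtain ⟨a, ha, ha'⟩ := hgs.isCompact.exists_isLeast hne
      obtain ⟨b, hb, hb'⟩ := hgs.isCompact.exists_isGreatest hne
      exact ⟨a, (hgR ha).1, b, (hgR hb).2, fun r hr =>
        ⟨ha' (subset_tsupport g hr), hb' (subset_tsupport g hr)⟩⟩
    · refine ⟨1, one_pos, R - 1, by linarith, fun r hr => absurd ⟨r, subset_tsupport g hr⟩ hne⟩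
  have hsm : ContDiff ℝ ∞ (fun r => ∫ s in R..r, g s) := by
    rw [contDiff_infty_iff_deriv]
    refine ⟨fun r => (hder r).differentiableAt, ?_⟩
    rw [show deriv (fun r => ∫ s in R..r, g s) = g from funext fun r => (hder r).deriv]
    exact hg
  have hzero : ∀ r, b < r → ∫ s in R..r, g s = 0 := by
    intro r hr
    refine (intervalIntegral.integral_congr (g := fun _ => 0) fun s hs => ?_).trans (by simp)
    by_contra h
    have := (hab s h).2
    have h2 := hs.1
    have : min R r ≤ b := h2.trans this
    rcases min_le_iff.1 this with h' | h' <;> linarith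
  have hconst : ∀ r, r < a → ∫ s in R..r, g s = ∫ s in R..a, g s := by
    intro r hr
    have h1 := intervalIntegral.integral_add_adjacent_intervals
      (hg.continuous.intervalIntegrable (μ := volume) R r) (hg.continuous.intervalIntegrable r a)
    have h2 : ∫ s in r..a, g s = 0 := by
      rw [intervalIntegral.integral_of_le hr.le, integral_Ioc_eq_integral_Ioo]
      refine (setIntegral_congr_fun measurableSet_Ioo (g := fun _ => 0) fun s hs => ?_).trans
        (by simp)
      by_contra h
      exact absurd (hab s h).1 (not_le.2 hs.2)
    rw [← h1, h2, add_zero]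
  have hsupp : tsupport (fun x : E3 => ∫ s in R..‖x‖, g s) ⊆ Metric.closedBall 0 b := by
    refine closure_minimal (fun x hx => ?_) Metric.isClosed_closedBall
    rw [mem_closedBall_zero_iff]
    by_contra h
    exact hx (hzero _ (not_le.1 h))
  refine ⟨?_, ?_, ?_, ?_, hder, a, ha, fun r hr => ?_⟩
  · rw [contDiff_iff_contDiffAt]
    intro x
    by_cases hx : ‖x‖ < a
    · have : (fun x : E3 => ∫ s in R..‖x‖, g s) =ᶠ[𝓝 x] fun _ => ∫ s in R..a, g s := by
        filter_upwards [continuous_norm.continuousAt.eventually (gt_mem_nhds hx)] with y hy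
        exact hconst _ hy
      exact contDiffAt_const.congr_of_eventuallyEq this
    · have hx0 : x ≠ 0 := by
        rintro rfl
        rw [norm_zero] at hx
        exact hx ha
      exact hsm.contDiffAt.comp x (contDiffAt_norm ℝ hx0)
  · exact HasCompactSupport.of_support_subset_isCompact (isCompact_closedBall 0 b)
      ((subset_tsupport _).trans hsupp)
  · exact hsupp.trans (Metric.closedBall_subset_ball hb)
  · intro x y hxy
    simp only [hxy]
  · by_contra h
    exact absurd (hab r h).1 (not_le.2 hr)

theorem intervalIntegrable_profile_mul {v : E3 → ℝ} (hvm : Measurable v) {M : ℝ}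
    (hvM : ∀ x, |v x| ≤ M) (E : ℝ) {F : ℝ → ℝ} (hF : Continuous F) (a b : ℝ) :
    IntervalIntegrable (fun s => s ^ 2 * ((profile v s - E) * F s)) volume a b := by
  have key : ∀ a b : ℝ, IntegrableOn (fun s => s ^ 2 * ((profile v s - E) * F s)) (Ioc a b)
      volume := by
    intro a b
    have h1 : IntegrableOn (fun s => s ^ 2 * F s) (Ioc a b) volume :=
      (((continuous_id.pow 2).mul hF).integrableOn_Icc (a := a) (b := b)).mono_set Ioc_subset_Icc_self
    have h2 := Integrable.bdd_mul (c := M + |E|) (f := fun s => profile v s - E) h1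
      (((profile_measurable hvm).sub_const E).aestronglyMeasurable) (Eventually.of_forall fun s => by
        refine (norm_sub_le _ _).trans (add_le_add (hvM _) le_rfl))
    refine h2.congr (Eventually.of_forall fun s => ?_)
    show _ = _
    ring
  exact ⟨key a b, key b a⟩

/-- The radial equation in divergence form. -/
theorem radial_flux {v : E3 → ℝ} (hvm : Measurable v) (hvr : IsRadial v) {M : ℝ}
    (hvM : ∀ x, |v x| ≤ M) {μ E R : ℝ} {f : E3 → ℝ} (hf : ContDiff ℝ 1 f)
    (hfr : IsRadial f) (hR : 0 < R) (heq : IsWeakSolution v μ E (Metric.ball 0 R) f)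
    {r : ℝ} (hr : r ∈ Ioo 0 R) :
    μ * (r ^ 2 * deriv (profile f) r)
      = ∫ s in (0)..r, s ^ 2 * ((profile v s - E) * profile f s) := by
  set F := profile f with hF
  set V := profile v with hV
  have hFc : ContDiff ℝ 1 F := profile_contDiff hf
  have hF' : Continuous (deriv F) := hFc.continuous_deriv (by norm_num)
  have hVm : Measurable V := profile_measurable hvm
  have hInt : ∀ a b : ℝ, IntervalIntegrable (fun s => s ^ 2 * ((V s - E) * F s)) volume a b :=
    fun a b => intervalIntegrable_profile_mul hvm hvM E hFc.continuous a b
  set H : ℝ → ℝ := fun r => ∫ s in (0)..r, s ^ 2 * ((V s - E) * F s) with hH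
  have hHc : Continuous H := intervalIntegral.continuous_primitive (fun a b => hInt a b) 0
  have hcont : Continuous fun r => μ * (r ^ 2 * deriv F r) - H r := by fun_prop
  -- The difference of the two sides is continuous in `r`, so it suffices that it vanishes as a
  -- distribution on `(0, R)`. An arbitrary one-dimensional test function `g` is the radial
  -- derivative of the spatial test function `∫_R^{|x|} g`.
  have key : ∀ᵐ r : ℝ, r ∈ Ioo 0 R → μ * (r ^ 2 * deriv F r) - H r = 0 := by
    refine isOpen_Ioo.ae_eq_zero_of_integral_contDiff_smul_eq_zero
      (hcont.locallyIntegrable.locallyIntegrableOn _) ?_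
    intro g hg hgs hgR
    obtain ⟨c1, c2, c3, c4, c5, a, ha, hga⟩ := radialTest hg hgs hgR
    set χ : ℝ → ℝ := fun r => ∫ s in R..r, g s with hχ
    have hχc : ContDiff ℝ 1 χ := by
      rw [contDiff_one_iff_deriv]
      refine ⟨fun r => (c5 r).differentiableAt, ?_⟩
      rw [show deriv χ = g from funext fun r => (c5 r).deriv]
      exact hg.continuous
    have hg0 : ∀ r, R ≤ r → g r = 0 := by
      intro r hr
      by_contra h
      exact absurd (hgR (subset_tsupport g h)).2 (not_lt.2 hr)
    have hχ0 : ∀ r, R ≤ r → χ r = 0 := by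
      intro r hr
      refine (intervalIntegral.integral_congr (g := fun _ => 0) fun s hs => ?_).trans (by simp)
      rw [uIcc_of_le hr] at hs
      exact hg0 s hs.1
    have w := heq _ c1 c2 c3
    have hprof : ∀ r, 0 ≤ r → profile (fun x : E3 => ∫ s in R..‖x‖, g s) r = χ r := by
      intro r hr
      simp only [profile, norm_smul_ej, abs_of_nonneg hr, hχ]
    have hder : ∀ x : E3, x ≠ 0 →
        deriv (profile (fun x : E3 => ∫ s in R..‖x‖, g s)) ‖x‖ = g ‖x‖ := by
      intro x hx
      have hpos : 0 < ‖x‖ := norm_pos_iff.2 hx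
      have : profile (fun x : E3 => ∫ s in R..‖x‖, g s) =ᶠ[𝓝 ‖x‖] χ := by
        filter_upwards [lt_mem_nhds hpos] with r hr using hprof r hr.le
      rw [this.deriv_eq, (c5 _).deriv]
    have e1 : ∀ᵐ x : E3, μ * inner ℝ (∇ f x) (∇ (fun x : E3 => ∫ s in R..‖x‖, g s) x)
        + v x * f x * (∫ s in R..‖x‖, g s)
        = μ * (deriv F ‖x‖ * g ‖x‖) + V ‖x‖ * F ‖x‖ * χ ‖x‖ := by
      have : ∀ᵐ x : E3, x ≠ 0 := by
        rw [ae_iff]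
        simp
      filter_upwards [this] with x hx
      rw [gradient_radial hf hfr hx, gradient_radial (c1.of_le (by norm_cast)) c4 hx, hder x hx,
        hvr.eq_profile x, hfr.eq_profile x]
      rw [inner_smul_left, inner_smul_right, real_inner_self_eq_norm_sq]
      have hne : ‖x‖ ≠ 0 := norm_ne_zero_iff.2 hx
      simp only [conj_trivial]
      field_simp
      simp only [hF, hV, hχ]
      ring
    have e2 : ∀ x : E3, f x * (∫ s in R..‖x‖, g s) = F ‖x‖ * χ ‖x‖ := by
      intro x
      rw [hfr.eq_profile x]
    rw [integral_congr_ae e1] at w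
    simp only [e2] at w
    rw [integral_radial (fun r => μ * (deriv F r * g r) + V r * F r * χ r),
      integral_radial (fun r => F r * χ r)] at w
    have restrict : ∀ q : ℝ → ℝ, (∀ r, R ≤ r → q r = 0) →
        ∫ r in Ioi (0 : ℝ), q r = ∫ r in (0)..R, q r := by
      intro q hq
      rw [intervalIntegral.integral_of_le hR.le]
      refine (setIntegral_eq_of_subset_of_forall_sdiff_eq_zero measurableSet_Ioi
        (Ioc_subset_Ioi_self) fun x hx => ?_)
      have : ¬ (x ≤ R) := fun h => hx.2 ⟨hx.1, h⟩
      exact hq x (not_le.1 this).le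
    rw [restrict _ (fun r hr => by rw [hg0 r hr, hχ0 r hr]; ring),
      restrict _ (fun r hr => by rw [hχ0 r hr]; ring)] at w
    have i1 : IntervalIntegrable (fun r => r ^ 2 * (μ * (deriv F r * g r))) volume 0 R :=
      (((continuous_id.pow 2).mul (continuous_const.mul (hF'.mul hg.continuous)))).intervalIntegrable
        _ _
    have i2 : IntervalIntegrable (fun r => r ^ 2 * ((V r - E) * F r) * χ r) volume 0 R :=
      (hInt 0 R).mul_continuousOn hχc.continuous.continuousOn
    have i3 : IntervalIntegrable (fun r => r ^ 2 * (F r * χ r)) volume 0 R :=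
      ((continuous_id.pow 2).mul (hFc.continuous.mul hχc.continuous)).intervalIntegrable _ _
    have w2 : (∫ r in (0)..R, r ^ 2 * (μ * (deriv F r * g r)))
        + ∫ r in (0)..R, r ^ 2 * ((V r - E) * F r) * χ r = 0 := by
      have s1 : ∫ r in (0)..R, r ^ 2 * (μ * (deriv F r * g r) + V r * F r * χ r)
          = (∫ r in (0)..R, r ^ 2 * (μ * (deriv F r * g r)))
            + (∫ r in (0)..R, r ^ 2 * ((V r - E) * F r) * χ r)
            + E * ∫ r in (0)..R, r ^ 2 * (F r * χ r) := by
        rw [← intervalIntegral.integral_add i1 i2, ← intervalIntegral.integral_const_mul,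
          ← intervalIntegral.integral_add (i1.add i2) (i3.const_mul E)]
        congr 1
        ext r
        ring
      rw [s1] at w
      have hpi : (4 * Real.pi) ≠ 0 := by positivity
      have : 4 * Real.pi * ((∫ r in (0)..R, r ^ 2 * (μ * (deriv F r * g r)))
            + (∫ r in (0)..R, r ^ 2 * ((V r - E) * F r) * χ r)) = 0 := by linarith
      exact (mul_eq_zero.1 this).resolve_left hpi
    -- Integration by parts moves the derivative to `χ`, whose derivative is `g`. No boundary term
    -- survives, since `χ` vanishes at `R` and the primitive vanishes at 0.
    rw [integral_mul_eq_sub_of_contDiff (hInt 0 R) hχc, hχ0 R le_rfl, mul_zero, zero_sub] at w2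
    have hdχ : deriv χ = g := funext fun r => (c5 r).deriv
    have i4 : IntervalIntegrable (fun r => H r * g r) volume 0 R :=
      (hHc.mul hg.continuous).intervalIntegrable _ _
    rw [hdχ, ← sub_eq_add_neg] at w2
    change _ - (∫ r in (0)..R, H r * g r) = 0 at w2
    rw [← intervalIntegral.integral_sub i1 i4] at w2
    have e3 : ∫ r : ℝ, g r • (μ * (r ^ 2 * deriv F r) - H r)
        = ∫ r in (0)..R, (r ^ 2 * (μ * (deriv F r * g r)) - H r * g r) := by
      rw [intervalIntegral.integral_of_le hR.le]
      rw [← setIntegral_univ, setIntegral_eq_of_subset_of_forall_sdiff_eq_zero MeasurableSet.univ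
        (subset_univ (Ioc 0 R))]
      · congr 1
        ext r
        simp only [smul_eq_mul]
        ring
      · intro x hx
        have : g x = 0 := by
          by_contra h
          have := hgR (subset_tsupport g h)
          exact hx.2 ⟨this.1, this.2.le⟩
        simp [this]
    rw [e3]
    exact w2
  have hall := Measure.eqOn_open_of_ae_eq (μ := (volume : Measure ℝ)) (U := Ioo 0 R)
    (f := fun r => μ * (r ^ 2 * deriv F r) - H r) (g := fun _ => 0)
    ((ae_restrict_iff' measurableSet_Ioo).2 key) isOpen_Ioo hcont.continuousOn continuousOn_const
  have := hall hr
  simp only at this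
  linarith

/-! ### The zero-energy scattering problem -/

theorem IsPotential.exists_bound {R₀ : ℝ} {v : E3 → ℝ} (hv : IsPotential R₀ v) :
    ∃ M : ℝ, 1 ≤ M ∧ ∀ x, |v x| ≤ M := by
  obtain ⟨M, hM⟩ := hv.bounded
  exact ⟨max M 1, le_max_right _ _, fun x => by
    rw [abs_of_nonneg (hv.nonneg x)]; exact (hM x).trans (le_max_left _ _)⟩

theorem IsPotential.profile_nonneg {R₀ : ℝ} {v : E3 → ℝ} (hv : IsPotential R₀ v) (r : ℝ) :
    0 ≤ profile v r := hv.nonneg _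

theorem IsPotential.profile_eq_zero {R₀ : ℝ} {v : E3 → ℝ} (hv : IsPotential R₀ v) {r : ℝ}
    (hr0 : 0 < R₀) (hr : R₀ < r) : profile v r = 0 :=
  hv.support _ (by rw [norm_smul_ej, abs_of_pos (hr0.trans hr)]; exact hr)

theorem IsPotential.profile_pos {R₀ : ℝ} {v : E3 → ℝ} (hv : IsPotential R₀ v) {r : ℝ}
    (hr0 : 0 ≤ r) (hr : r < R₀) : 0 < profile v r :=
  hv.pos _ (by rw [norm_smul_ej, abs_of_nonneg hr0]; exact hr)

section

variable {R₀ : ℝ} {v : E3 → ℝ}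

theorem IsPotential.intervalIntegrable (hv : IsPotential R₀ v) (E : ℝ) {F : ℝ → ℝ}
    (hF : Continuous F) (a b : ℝ) :
    IntervalIntegrable (fun s => s ^ 2 * ((profile v s - E) * F s)) volume a b := by
  obtain ⟨M, -, hM⟩ := hv.exists_bound
  exact intervalIntegrable_profile_mul hv.measurable hM E hF a b

theorem IsPotential.intervalIntegrable' (hv : IsPotential R₀ v) {F : ℝ → ℝ}
    (hF : Continuous F) (a b : ℝ) :
    IntervalIntegrable (fun s => s ^ 2 * (profile v s * F s)) volume a b := by
  simpa using hv.intervalIntegrable 0 hF a b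

theorem IsPotential.integral_eq_of_le (hv : IsPotential R₀ v) (hR : 0 < R₀) {F : ℝ → ℝ}
    (hF : Continuous F) {r : ℝ} (hr : R₀ ≤ r) :
    ∫ s in (0)..r, s ^ 2 * (profile v s * F s) = ∫ s in (0)..R₀, s ^ 2 * (profile v s * F s) := by
  rw [← intervalIntegral.integral_add_adjacent_intervals (hv.intervalIntegrable' hF 0 R₀)
    (hv.intervalIntegrable' hF R₀ r)]
  have : ∫ s in R₀..r, s ^ 2 * (profile v s * F s) = 0 := by
    rw [intervalIntegral.integral_of_le hr]
    refine (setIntegral_congr_fun measurableSet_Ioc (g := fun _ => 0) fun s hs => ?_).trans (by simp)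
    simp [hv.profile_eq_zero hR hs.1]
  rw [this, add_zero]

theorem IsPotential.integral_mul_radial (hv : IsPotential R₀ v) (hR : 0 < R₀) {f : E3 → ℝ}
    (hfr : IsRadial f) :
    ∫ x, v x * f x = 4 * Real.pi * ∫ s in (0)..R₀, s ^ 2 * (profile v s * profile f s) := by
  have e : ∀ x, v x * f x = (fun r => profile v r * profile f r) ‖x‖ := fun x => by
    rw [hv.radial.eq_profile x, hfr.eq_profile x]
  simp only [e]
  rw [integral_radial (fun r => profile v r * profile f r), intervalIntegral.integral_of_le hR.le]
  congr 1
  refine setIntegral_eq_of_subset_of_forall_sdiff_eq_zero measurableSet_Ioi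
    Ioc_subset_Ioi_self fun x hx => ?_
  have : ¬ (x ≤ R₀) := fun h => hx.2 ⟨hx.1, h⟩
  rw [hv.profile_eq_zero hR (not_le.1 this)]
  ring

variable {μ : ℝ} {f : E3 → ℝ}

theorem IsZeroEnergySolution.flux (hf : IsZeroEnergySolution v μ f) (hv : IsPotential R₀ v)
    {r : ℝ} (hr : 0 < r) :
    μ * (r ^ 2 * deriv (profile f) r) = ∫ s in (0)..r, s ^ 2 * (profile v s * profile f s) := by
  obtain ⟨M, -, hM⟩ := hv.exists_bound
  -- The equation holds in the whole space; the ball of radius `r + 1` only serves to contain the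
  -- sphere of radius `r`.
  have h := radial_flux (R := r + 1) (E := 0) hv.measurable hv.radial hM hf.contDiff hf.radial
    (by linarith) (fun ψ h1 h2 _ => hf.equation ψ h1 h2 (subset_univ _)) ⟨hr, by linarith⟩
  simpa using h

theorem IsZeroEnergySolution.scatteringLength_eq (hf : IsZeroEnergySolution v μ f)
    (hv : IsPotential R₀ v) (hR : 0 < R₀) (hμ : 0 < μ) :
    μ * scatteringLength v μ f = ∫ s in (0)..R₀, s ^ 2 * (profile v s * profile f s) := by
  rw [scatteringLength, hv.integral_mul_radial hR hf.radial]
  have := Real.pi_pos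
  field_simp

theorem IsZeroEnergySolution.profile_pos (hf : IsZeroEnergySolution v μ f) (r : ℝ) :
    0 < profile f r := hf.pos _

theorem IsZeroEnergySolution.profile_continuous (hf : IsZeroEnergySolution v μ f) :
    Continuous (profile f) := (profile_contDiff hf.contDiff).continuous

theorem IsZeroEnergySolution.hasDerivAt (hf : IsZeroEnergySolution v μ f) (r : ℝ) :
    HasDerivAt (profile f) (deriv (profile f) r) r :=
  ((profile_contDiff hf.contDiff).differentiable (by norm_num) r).hasDerivAt

theorem IsZeroEnergySolution.deriv_nonneg (hf : IsZeroEnergySolution v μ f)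
    (hv : IsPotential R₀ v) (hμ : 0 < μ) {r : ℝ} (hr : 0 < r) : 0 ≤ deriv (profile f) r := by
  have h := hf.flux hv hr
  have h2 : 0 ≤ ∫ s in (0)..r, s ^ 2 * (profile v s * profile f s) :=
    intervalIntegral.integral_nonneg hr.le fun s _ =>
      mul_nonneg (sq_nonneg _) (mul_nonneg (hv.profile_nonneg s) (hf.profile_pos s).le)
  rw [← h] at h2
  exact (mul_nonneg_iff_of_pos_left (by positivity : 0 < r ^ 2)).1
    ((mul_nonneg_iff_of_pos_left hμ).1 h2)

/-- The flux `r² f₀'` is the integral of a nonnegative density over `(0, r)`, up to the factor `μ`.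
It increases until `R₀`, where it has collected the whole scattering length. -/
theorem IsZeroEnergySolution.sq_mul_deriv_le (hf : IsZeroEnergySolution v μ f)
    (hv : IsPotential R₀ v) (hR : 0 < R₀) (hμ : 0 < μ) {r : ℝ} (hr : 0 < r) :
    r ^ 2 * deriv (profile f) r ≤ scatteringLength v μ f := by
  refine le_of_mul_le_mul_left ?_ hμ
  rw [hf.flux hv hr, hf.scatteringLength_eq hv hR hμ]
  rcases le_total r R₀ with h | h
  · refine intervalIntegral.integral_mono_interval le_rfl hr.le h
      (Eventually.of_forall fun s => ?_) (hv.intervalIntegrable' hf.profile_continuous _ _)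
    exact mul_nonneg (sq_nonneg _) (mul_nonneg (hv.profile_nonneg s) (hf.profile_pos s).le)
  · exact (hv.integral_eq_of_le hR hf.profile_continuous h).le

theorem IsZeroEnergySolution.sq_mul_deriv_eq (hf : IsZeroEnergySolution v μ f)
    (hv : IsPotential R₀ v) (hR : 0 < R₀) (hμ : 0 < μ) {r : ℝ} (hr : R₀ ≤ r) :
    r ^ 2 * deriv (profile f) r = scatteringLength v μ f := by
  refine mul_left_cancel₀ hμ.ne' ?_
  rw [hf.flux hv (hR.trans_le hr), hf.scatteringLength_eq hv hR hμ]
  exact hv.integral_eq_of_le hR hf.profile_continuous hr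

theorem IsZeroEnergySolution.profile_tendsto (hf : IsZeroEnergySolution v μ f) :
    Tendsto (profile f) atTop (𝓝 1) := by
  refine hf.limit.comp ?_
  rw [← Metric.cobounded_eq_cocompact, ← tendsto_norm_atTop_iff_cobounded]
  simp only [norm_smul_ej]
  exact tendsto_abs_atTop_atTop

theorem IsZeroEnergySolution.hasDerivAt_add (hf : IsZeroEnergySolution v μ f) (a : ℝ) {r : ℝ}
    (hr : 0 < r) :
    HasDerivAt (fun r => profile f r + a / r) (deriv (profile f) r - a / r ^ 2) r := by
  have := (hf.hasDerivAt r).add ((hasDerivAt_inv hr.ne').const_mul a)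
  simp only [div_eq_mul_inv]
  refine this.congr_deriv ?_
  ring

theorem IsZeroEnergySolution.tendsto_add (hf : IsZeroEnergySolution v μ f) (a : ℝ) :
    Tendsto (fun r => profile f r + a / r) atTop (𝓝 1) := by
  simpa using hf.profile_tendsto.add (tendsto_const_nhds.div_atTop tendsto_id : Tendsto
    (fun r : ℝ => a / r) atTop (𝓝 0))

/-- By the flux bound `f₀ + a/r` is nonincreasing; as it tends to 1 at infinity, it is never below
1. -/
theorem IsZeroEnergySolution.one_sub_profile_le (hf : IsZeroEnergySolution v μ f)
    (hv : IsPotential R₀ v) (hR : 0 < R₀) (hμ : 0 < μ) {r : ℝ} (hr : 0 < r) :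
    1 - profile f r ≤ scatteringLength v μ f / r := by
  set a := scatteringLength v μ f with ha
  have hanti : AntitoneOn (fun r => profile f r + a / r) (Ioi 0) := by
    refine antitoneOn_of_deriv_nonpos (convex_Ioi 0)
      (fun x hx => (hf.hasDerivAt_add a hx).continuousAt.continuousWithinAt) ?_ ?_
    · rw [interior_Ioi]
      exact fun x hx => (hf.hasDerivAt_add a hx).differentiableAt.differentiableWithinAt
    · rw [interior_Ioi]
      intro x hx
      rw [(hf.hasDerivAt_add a hx).deriv, sub_nonpos, le_div_iff₀ (by positivity [mem_Ioi.1 hx]),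
        mul_comm]
      exact hf.sq_mul_deriv_le hv hR hμ hx
  have := ge_of_tendsto (hf.tendsto_add a) (b := profile f r + a / r) |> fun _ =>
    le_of_tendsto (hf.tendsto_add a) (b := profile f r + a / r) (by
      filter_upwards [eventually_ge_atTop r] with s hs
      exact hanti hr (hr.trans_le hs) hs)
  linarith

/-- Beyond `R₀` the flux is constant, so `f₀ + a/r` is nondecreasing as well, and comparison with
its limit gives the reverse inequality. -/
theorem IsZeroEnergySolution.profile_eq (hf : IsZeroEnergySolution v μ f)
    (hv : IsPotential R₀ v) (hR : 0 < R₀) (hμ : 0 < μ) {r : ℝ} (hr : R₀ ≤ r) :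
    profile f r = 1 - scatteringLength v μ f / r := by
  set a := scatteringLength v μ f with ha
  have hpos : ∀ x ∈ Ici R₀, 0 < x := fun x hx => hR.trans_le hx
  have hmono : MonotoneOn (fun r => profile f r + a / r) (Ici R₀) := by
    refine monotoneOn_of_deriv_nonneg (convex_Ici R₀)
      (fun x hx => (hf.hasDerivAt_add a (hpos x hx)).continuousAt.continuousWithinAt) ?_ ?_
    · intro x hx
      exact (hf.hasDerivAt_add a (hpos x (interior_subset hx))).differentiableAt.differentiableWithinAt
    · intro x hx
      have hx' := interior_subset hx
      have hx0 := hpos x hx'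
      rw [(hf.hasDerivAt_add a hx0).deriv, sub_nonneg, div_le_iff₀ (by positivity), mul_comm]
      exact (hf.sq_mul_deriv_eq hv hR hμ hx').ge
  have h1 : profile f r + a / r ≤ 1 := ge_of_tendsto (hf.tendsto_add a) (by
      filter_upwards [eventually_ge_atTop r] with s hs
      exact hmono hr (le_trans hr hs) hs)
  have h2 := hf.one_sub_profile_le hv hR hμ (hR.trans_le hr)
  rw [← ha] at h2
  linarith

theorem IsZeroEnergySolution.profile_le_one (hf : IsZeroEnergySolution v μ f)
    (hv : IsPotential R₀ v) (hμ : 0 < μ) {r : ℝ} (hr : 0 ≤ r) : profile f r ≤ 1 := by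
  have hmono : MonotoneOn (profile f) (Ici 0) := by
    refine monotoneOn_of_deriv_nonneg (convex_Ici 0) hf.profile_continuous.continuousOn
      (fun x _ => (hf.hasDerivAt x).differentiableAt.differentiableWithinAt) ?_
    rw [interior_Ici]
    exact fun x hx => hf.deriv_nonneg hv hμ hx
  exact ge_of_tendsto hf.profile_tendsto (by
      filter_upwards [eventually_ge_atTop r] with s hs
      exact hmono hr (le_trans hr hs) hs)

theorem IsZeroEnergySolution.scatteringLength_pos (hf : IsZeroEnergySolution v μ f)
    (hv : IsPotential R₀ v) (hR : 0 < R₀) (hμ : 0 < μ) : 0 < scatteringLength v μ f := by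
  refine (mul_pos_iff_of_pos_left hμ).1 ?_
  rw [hf.scatteringLength_eq hv hR hμ]
  refine intervalIntegral.intervalIntegral_pos_of_pos_on
    (hv.intervalIntegrable' hf.profile_continuous _ _) (fun s hs => ?_) hR
  have := hv.profile_pos hs.1.le hs.2
  have h2 := hf.profile_pos s
  have h3 := hs.1
  positivity

/-- This is the positivity of `f₀` on the sphere of radius `R₀`, where `f₀ = 1 - a/R₀`. -/
theorem IsZeroEnergySolution.scatteringLength_lt (hf : IsZeroEnergySolution v μ f)
    (hv : IsPotential R₀ v) (hR : 0 < R₀) (hμ : 0 < μ) : scatteringLength v μ f < R₀ := by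
  have h1 := hf.profile_eq hv hR hμ le_rfl
  have h2 := hf.profile_pos R₀
  rw [h1, sub_pos, div_lt_one hR] at h2
  exact h2

/-- The scattering length tends to the radius of the potential in the hard core limit. -/
theorem tendsto_scatteringLength (hv : IsPotential R₀ v) (hR : 0 < R₀) {f₀ : ℝ → E3 → ℝ}
    (hf₀ : ∀ μ : ℝ, 0 < μ → IsZeroEnergySolution v μ (f₀ μ)) :
    Tendsto (fun μ : ℝ => R₀ - scatteringLength v μ (f₀ μ)) (𝓝[>] 0) (𝓝 0) := by
  rw [Metric.tendsto_nhds]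
  intro e he
  -- The cap at `R₀` keeps the layer `[R₀ - d/8, R₀]` in the outer half of the support.
  set d := min e R₀ with hd
  have hd0 : 0 < d := lt_min he hR
  have hdR : d ≤ R₀ := min_le_right _ _
  set m := ∫ s in (R₀ - d / 8)..R₀, s ^ 2 * (profile v s * 1) with hm
  have hm0 : 0 < m := by
    refine intervalIntegral.intervalIntegral_pos_of_pos_on
      (hv.intervalIntegrable' continuous_const _ _) (fun s hs => ?_) (by linarith)
    have h0 : 0 < s := by linarith [hs.1]
    have := hv.profile_pos h0.le hs.2
    positivity
  have hpos : 0 < d / (2 * R₀) * m / R₀ := by positivity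
  filter_upwards [self_mem_nhdsWithin, nhdsWithin_le_nhds (gt_mem_nhds hpos)] with μ hμ hμm
  have hμ0 : 0 < μ := hμ
  have hf := hf₀ μ hμ0
  set a := scatteringLength v μ (f₀ μ) with ha
  have hlt := hf.scatteringLength_lt hv hR hμ0
  have hap := hf.scatteringLength_pos hv hR hμ0
  rw [Real.dist_eq, sub_zero, abs_of_pos (sub_pos.2 hlt)]
  by_contra hcon
  have hη : d ≤ R₀ - a := (min_le_left _ _).trans (not_lt.1 hcon)
  -- If `a ≤ R₀ - d`, then `f₀(R₀) = 1 - a/R₀ ≥ d/R₀`. In the outer half `f₀' ≤ 4/R₀` by the flux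
  -- bound, so at most half of this value is lost across a layer of width `d/8`.
  have hlow : ∀ s ∈ Icc (R₀ - d / 8) R₀, d / (2 * R₀) ≤ profile (f₀ μ) s := by
    intro s hs
    have hs0 : R₀ / 2 ≤ s := by linarith [hs.1]
    have hs0' : 0 < s := by linarith
    have hR1 := hf.profile_eq hv hR hμ0 le_rfl
    have hbd : ∀ x ∈ Icc s R₀, ‖deriv (profile (f₀ μ)) x‖ ≤ 4 / R₀ := by
      intro x hx
      have hx0 : R₀ / 2 ≤ x := hs0.trans hx.1
      have hx0' : 0 < x := by linarith
      rw [Real.norm_of_nonneg (hf.deriv_nonneg hv hμ0 hx0')]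
      have := hf.sq_mul_deriv_le hv hR hμ0 hx0'
      have hq := hf.deriv_nonneg hv hμ0 hx0'
      rw [le_div_iff₀ hR]
      have h3 : (R₀ / 2) ^ 2 * deriv (profile (f₀ μ)) x ≤ R₀ := by
        calc _ ≤ x ^ 2 * deriv (profile (f₀ μ)) x := by gcongr
          _ ≤ a := this
          _ ≤ R₀ := hlt.le
      have h4 : R₀ * (deriv (profile (f₀ μ)) x * R₀) ≤ R₀ * 4 := by nlinarith
      exact le_of_mul_le_mul_left h4 hR
    have hmv := Convex.norm_image_sub_le_of_norm_deriv_le (𝕜 := ℝ) (f := profile (f₀ μ))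
      (s := Icc s R₀) (C := 4 / R₀) (fun x _ => (hf.hasDerivAt x).differentiableAt) hbd
      (convex_Icc _ _) (left_mem_Icc.2 hs.2) (right_mem_Icc.2 hs.2)
    rw [Real.norm_eq_abs, Real.norm_of_nonneg (by linarith [hs.2])] at hmv
    have h5 := (le_abs_self _).trans hmv
    have h6 : 4 / R₀ * (R₀ - s) ≤ 4 / R₀ * (d / 8) :=
      mul_le_mul_of_nonneg_left (by linarith [hs.1]) (by positivity)
    have h7 : 4 / R₀ * (d / 8) = d / (2 * R₀) := by field_simp; norm_num
    have h8 : d / R₀ ≤ 1 - a / R₀ := by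
      rw [← div_self hR.ne', ← sub_div]
      gcongr
    have h9 : d / R₀ = d / (2 * R₀) + d / (2 * R₀) := by field_simp; norm_num
    linarith
  have hI := hf.scatteringLength_eq hv hR hμ0
  have hcont := hf.profile_continuous
  -- The contradiction: `μ a` would stay above a positive constant that does not depend on `μ`,
  -- whereas `μ a ≤ μ R₀` is as small as desired.
  have h1 : d / (2 * R₀) * m ≤ ∫ s in (0)..R₀, s ^ 2 * (profile v s * profile (f₀ μ) s) := by
    calc d / (2 * R₀) * m
        ≤ ∫ s in (R₀ - d / 8)..R₀, s ^ 2 * (profile v s * profile (f₀ μ) s) := by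
          rw [hm, ← intervalIntegral.integral_const_mul]
          refine intervalIntegral.integral_mono_on (by linarith)
            ((hv.intervalIntegrable' continuous_const _ _).const_mul _)
            (hv.intervalIntegrable' hcont _ _) fun s hs => ?_
          have := mul_le_mul_of_nonneg_left (hlow s hs)
            (mul_nonneg (sq_nonneg s) (hv.profile_nonneg s))
          linarith
      _ ≤ _ := by
          refine intervalIntegral.integral_mono_interval (by linarith) (by linarith) le_rfl
            (Eventually.of_forall fun s => ?_) (hv.intervalIntegrable' hcont _ _)
          exact mul_nonneg (sq_nonneg _) (mul_nonneg (hv.profile_nonneg s) (hf.profile_pos s).le)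
  rw [← hI, ← ha] at h1
  have h2 : μ * a ≤ μ * R₀ := mul_le_mul_of_nonneg_left hlt.le hμ0.le
  have h3 : μ * R₀ < d / (2 * R₀) * m := by rwa [lt_div_iff₀ hR] at hμm
  linarith

/-! ### The Neumann problem -/

variable {L : ℝ}

theorem IsNeumannGroundState.profile_pos (hf : IsNeumannGroundState v μ L f) (r : ℝ) :
    0 < profile f r := hf.pos _

theorem IsNeumannGroundState.profile_eq_one (hf : IsNeumannGroundState v μ L f) (hL : 0 < L)
    {r : ℝ} (hr : L ≤ r) : profile f r = 1 :=
  hf.exterior _ (by rw [norm_smul_ej, abs_of_pos (hL.trans_le hr)]; exact hr)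

/-- The profile is `C¹` and constant to the right of `L`, so its derivative vanishes at `L`. This
Neumann condition is what makes the total flux zero. -/
theorem IsNeumannGroundState.flux (hf : IsNeumannGroundState v μ L f) (hv : IsPotential R₀ v)
    (hL : 0 < L) : ∃ E : ℝ, (∀ r ∈ Icc 0 L, μ * (r ^ 2 * deriv (profile f) r)
        = ∫ s in (0)..r, s ^ 2 * ((profile v s - E) * profile f s)) ∧
      ∫ s in (0)..L, s ^ 2 * ((profile v s - E) * profile f s) = 0 := by
  obtain ⟨M, -, hM⟩ := hv.exists_bound
  obtain ⟨E, hE⟩ := hf.equation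
  have hF := profile_contDiff hf.contDiff
  have hF' : Continuous (deriv (profile f)) := hF.continuous_deriv (by norm_num)
  have h1 : EqOn (fun r => μ * (r ^ 2 * deriv (profile f) r))
      (fun r => ∫ s in (0)..r, s ^ 2 * ((profile v s - E) * profile f s)) (Ioo 0 L) :=
    fun r hr => radial_flux hv.measurable hv.radial hM hf.contDiff hf.radial hL hE hr
  have h2 := h1.closure (by fun_prop) (intervalIntegral.continuous_primitive
    (fun a b => hv.intervalIntegrable E hF.continuous a b) 0)
  rw [closure_Ioo hL.ne] at h2
  refine ⟨E, fun r hr => h2 hr, ?_⟩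
  have hd : deriv (profile f) L = 0 := by
    have hda : HasDerivAt (profile f) (deriv (profile f) L) L :=
      (hF.differentiable (by norm_num) L).hasDerivAt
    have hw : HasDerivWithinAt (profile f) (deriv (profile f) L) (Ici L) L :=
      hda.hasDerivWithinAt
    have hc : HasDerivWithinAt (profile f) 0 (Ici L) L :=
      (hasDerivWithinAt_const L (Ici L) (1 : ℝ)).congr (fun x hx => hf.profile_eq_one hL hx)
        (hf.profile_eq_one hL le_rfl)
    exact (uniqueDiffWithinAt_Ici L).eq_deriv _ hw hc
  have := h2 (right_mem_Icc.2 hL.le)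
  simp only [hd, mul_zero] at this
  exact this.symm

/-- The Neumann problem compared with the zero-energy scattering problem: the two-sided bound on the
integral of the effective potential. -/
theorem neumann_bounds (hv : IsPotential R₀ v) (hR : 0 < R₀) {M : ℝ}
    (hM : ∀ x, |v x| ≤ M) (hμ : 0 < μ) (hL : R₀ < L) {f₀ : E3 → ℝ}
    (hf₀ : IsZeroEnergySolution v μ f₀) (hf : IsNeumannGroundState v μ L f) :
    4 * Real.pi * (μ * scatteringLength v μ f₀) ≤ ∫ x, v x * f x ∧
    (M * R₀ ^ 3 ≤ 3 * (μ * L) → ∫ x, v x * f x ≤ 4 * Real.pi * (μ * scatteringLength v μ f₀)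
      + 4 * Real.pi * (M * R₀ ^ 4) / L) := by
  have hL0 : 0 < L := hR.trans hL
  obtain ⟨E, hflux, hzero⟩ := hf.flux hv hL0
  set a := scatteringLength v μ f₀ with ha
  set F := profile f with hFdef
  set F0 := profile f₀ with hF0def
  set V := profile v with hVdef
  have hFC : ContDiff ℝ 1 F := profile_contDiff hf.contDiff
  have hF0C : ContDiff ℝ 1 F0 := profile_contDiff hf₀.contDiff
  have hFc := hFC.continuous
  have hF0c := hF0C.continuous
  have hF' : Continuous (deriv F) := hFC.continuous_deriv (by norm_num)
  have hF0' : Continuous (deriv F0) := hF0C.continuous_deriv (by norm_num)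
  have hFp : ∀ r, 0 < F r := hf.profile_pos
  have hFL : F L = 1 := hf.profile_eq_one hL0 le_rfl
  have iV : ∀ (G : ℝ → ℝ), Continuous G → ∀ a b,
      IntervalIntegrable (fun s => s ^ 2 * (V s * G s)) volume a b := fun G hG a b =>
    hv.intervalIntegrable' hG a b
  have iE := fun a b => hv.intervalIntegrable E hFc a b
  have iF : IntervalIntegrable (fun s => s ^ 2 * F s) volume 0 L :=
    ((continuous_id.pow 2).mul hFc).intervalIntegrable _ _
  -- Zero total flux expresses the integral of `v f` through the eigenvalue, which is therefore
  -- nonnegative.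
  have hsplit : ∫ s in (0)..L, s ^ 2 * (V s * F s) = E * ∫ s in (0)..L, s ^ 2 * F s := by
    have : ∫ s in (0)..L, s ^ 2 * ((V s - E) * F s)
        = (∫ s in (0)..L, s ^ 2 * (V s * F s)) - E * ∫ s in (0)..L, s ^ 2 * F s := by
      rw [← intervalIntegral.integral_const_mul,
        ← intervalIntegral.integral_sub (iV F hFc 0 L) (iF.const_mul E)]
      congr 1
      ext s
      ring
    rw [hzero] at this
    linarith
  have hFint : 0 < ∫ s in (0)..L, s ^ 2 * F s :=
    intervalIntegral.intervalIntegral_pos_of_pos_on iF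
      (fun s hs => mul_pos (pow_pos hs.1 2) (hFp s)) hL0
  have hE0 : 0 ≤ E := by
    have h1 : 0 ≤ ∫ s in (0)..L, s ^ 2 * (V s * F s) :=
      intervalIntegral.integral_nonneg hL0.le fun s _ =>
        mul_nonneg (sq_nonneg _) (mul_nonneg (hv.profile_nonneg s) (hFp s).le)
    rw [hsplit] at h1
    exact nonneg_of_mul_nonneg_left h1 hFint
  -- the value of the integral
  have hval : ∫ x, v x * f x = 4 * Real.pi * (E * ∫ s in (0)..L, s ^ 2 * F s) := by
    rw [hv.integral_mul_radial hR hf.radial, ← hsplit, ← hv.integral_eq_of_le hR hFc hL.le]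
  -- the Wronskian identity
  have hwr : μ * a = E * ∫ s in (0)..L, s ^ 2 * (F s * F0 s) := by
    have p1 := integral_mul_eq_sub_of_contDiff (iE 0 L) hF0C
    rw [hzero, zero_mul, zero_sub] at p1
    have p2 := integral_mul_eq_sub_of_contDiff (iV F0 hF0c 0 L) hFC
    rw [hv.integral_eq_of_le hR hF0c hL.le, ← hf₀.scatteringLength_eq hv hR hμ, hFL, mul_one] at p2
    have q1 : ∫ s in (0)..L, (∫ y in (0)..s, y ^ 2 * ((V y - E) * F y)) * deriv F0 s
        = ∫ s in (0)..L, μ * (s ^ 2 * deriv F s) * deriv F0 s := by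
      refine intervalIntegral.integral_congr fun s hs => ?_
      rw [uIcc_of_le hL0.le] at hs
      simp only [hflux s hs]
    have q2 : ∫ s in (0)..L, (∫ y in (0)..s, y ^ 2 * (V y * F0 y)) * deriv F s
        = ∫ s in (0)..L, μ * (s ^ 2 * deriv F s) * deriv F0 s := by
      rw [intervalIntegral.integral_of_le hL0.le, intervalIntegral.integral_of_le hL0.le]
      refine setIntegral_congr_fun measurableSet_Ioc fun s hs => ?_
      rw [← hf₀.flux hv hs.1]
      ring
    rw [q1] at p1
    rw [q2] at p2
    have i1 : IntervalIntegrable (fun s => s ^ 2 * ((V s - E) * F s) * F0 s) volume 0 L :=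
      (iE 0 L).mul_continuousOn hF0c.continuousOn
    have i2 : IntervalIntegrable (fun s => s ^ 2 * (V s * F0 s) * F s) volume 0 L :=
      (iV F0 hF0c 0 L).mul_continuousOn hFc.continuousOn
    have : E * ∫ s in (0)..L, s ^ 2 * (F s * F0 s)
        = (∫ s in (0)..L, s ^ 2 * (V s * F0 s) * F s)
          - ∫ s in (0)..L, s ^ 2 * ((V s - E) * F s) * F0 s := by
      rw [← intervalIntegral.integral_sub i2 i1, ← intervalIntegral.integral_const_mul]
      congr 1
      ext s
      ring
    rw [this, p1, p2]
    ring
  have i3 : IntervalIntegrable (fun s => s ^ 2 * (F s * F0 s)) volume 0 L :=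
    ((continuous_id.pow 2).mul (hFc.mul hF0c)).intervalIntegrable _ _
  have i4 : IntervalIntegrable (fun s => s ^ 2 * (F s * (1 - F0 s))) volume 0 L :=
    ((continuous_id.pow 2).mul (hFc.mul (continuous_const.sub hF0c))).intervalIntegrable _ _
  -- Both bounds concern the excess `E ∫ s² F (1 - F₀)`: it is nonnegative because `F₀ ≤ 1`, and
  -- small once `E` and `F` are bounded above.
  have hdiff : ∫ x, v x * f x = 4 * Real.pi * (μ * a)
      + 4 * Real.pi * (E * ∫ s in (0)..L, s ^ 2 * (F s * (1 - F0 s))) := by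
    have : ∫ s in (0)..L, s ^ 2 * F s = (∫ s in (0)..L, s ^ 2 * (F s * F0 s))
        + ∫ s in (0)..L, s ^ 2 * (F s * (1 - F0 s)) := by
      rw [← intervalIntegral.integral_add i3 i4]
      congr 1
      ext s
      ring
    rw [hval, hwr, this]
    ring
  have hrest : 0 ≤ ∫ s in (0)..L, s ^ 2 * (F s * (1 - F0 s)) :=
    intervalIntegral.integral_nonneg hL0.le fun s hs => mul_nonneg (sq_nonneg _)
      (mul_nonneg (hFp s).le (sub_nonneg.2 (hf₀.profile_le_one hv hμ hs.1)))
  have hpi := Real.pi_pos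
  refine ⟨by rw [hdiff]; have := mul_nonneg hE0 hrest; nlinarith, fun hsmall => ?_⟩
  -- the upper bound on the energy
  have hEL : E * L ^ 3 ≤ M * R₀ ^ 3 := by
    -- Testing the equation with `1/F` gives `∫ s² (V - E) = ∫ μ s² F'²/F² ≥ 0`, hence `E L³/3 ≤ ∫
    -- s² V`. No variational characterization of the ground state is needed.
    have hinvC : ContDiff ℝ 1 (fun s => (F s)⁻¹) := hFC.inv fun s => (hFp s).ne'
    have p := integral_mul_eq_sub_of_contDiff (iE 0 L) hinvC
    rw [hzero, zero_mul, zero_sub] at p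
    have hd : ∀ s, deriv (fun s => (F s)⁻¹) s = -deriv F s / F s ^ 2 := fun s =>
      ((hFC.differentiable (by norm_num) s).hasDerivAt.inv (hFp s).ne').deriv
    have hge : 0 ≤ ∫ s in (0)..L, s ^ 2 * ((V s - E) * F s) * (F s)⁻¹ := by
      rw [p, ← intervalIntegral.integral_neg]
      refine intervalIntegral.integral_nonneg hL0.le fun s hs => ?_
      rw [← hflux s hs, hd]
      have : -(μ * (s ^ 2 * deriv F s) * (-deriv F s / F s ^ 2))
          = μ * (s ^ 2 * (deriv F s) ^ 2) / F s ^ 2 := by ring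
      rw [this]
      positivity
    have e1 : ∫ s in (0)..L, s ^ 2 * ((V s - E) * F s) * (F s)⁻¹
        = (∫ s in (0)..L, s ^ 2 * (V s * 1)) - E * ∫ s in (0)..L, s ^ 2 := by
      have i5 : IntervalIntegrable (fun s : ℝ => E * s ^ 2) volume 0 L :=
        (continuous_const.mul (continuous_id.pow 2)).intervalIntegrable _ _
      have i6 : IntervalIntegrable (fun s : ℝ => s ^ 2 * (V s * 1)) volume 0 L :=
        iV _ continuous_const 0 L
      rw [← intervalIntegral.integral_const_mul, ← intervalIntegral.integral_sub i6 i5]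
      congr 1
      ext s
      have := (hFp s).ne'
      field_simp
    have e2 : ∫ s in (0)..L, s ^ 2 * (V s * 1) ≤ M * (R₀ ^ 3 / 3) := by
      have he : ∫ s in (0)..L, s ^ 2 * (V s * 1) = ∫ s in (0)..R₀, s ^ 2 * (V s * 1) :=
        hv.integral_eq_of_le hR continuous_const hL.le
      rw [he]
      calc _ ≤ ∫ s in (0)..R₀, M * s ^ 2 := by
            refine intervalIntegral.integral_mono_on hR.le (iV _ continuous_const 0 R₀)
              ((continuous_const.mul (continuous_id.pow 2)).intervalIntegrable _ _) fun s _ => ?_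
            have h1 : V s ≤ M := (le_abs_self _).trans (hM _)
            have := mul_le_mul_of_nonneg_left h1 (sq_nonneg s)
            linarith
        _ = _ := by rw [intervalIntegral.integral_const_mul, integral_pow]; norm_num
    have e3 : ∫ s in (0)..L, s ^ 2 = L ^ 3 / 3 := by rw [integral_pow]; norm_num
    rw [e1, e3] at hge
    linarith
  -- the upper bound on the ground state
  have hF2 : ∀ s ∈ Icc 0 L, F s ≤ 2 := by
    obtain ⟨r₀, hr₀, hmax⟩ := isCompact_Icc.exists_isMaxOn (nonempty_Icc.2 hL0.le) hFc.continuousOn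
    set m := F r₀ with hm
    have hm0 : 0 < m := hFp r₀
    -- The potential only pushes `F'` upwards, so `μ s² F' ≥ -E m s³/3` with `m` the maximum of `F`.
    -- Comparing the maximum point with `L`, where `F = 1`, gives `m ≤ 1 + m/2` because `E L² ≤ 3μ`.
    have hmono : MonotoneOn (fun r => F r + E * m / (6 * μ) * r ^ 2) (Icc 0 L) := by
      have hder : ∀ r, HasDerivAt (fun r => F r + E * m / (6 * μ) * r ^ 2)
          (deriv F r + E * m / (6 * μ) * (2 * r)) r := fun r => by
        have := ((hFC.differentiable (by norm_num) r).hasDerivAt).add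
          ((hasDerivAt_pow 2 r).const_mul (E * m / (6 * μ)))
        exact this.congr_deriv (by simp)
      refine monotoneOn_of_deriv_nonneg (convex_Icc _ _)
        (fun r _ => (hder r).continuousAt.continuousWithinAt)
        (fun r _ => (hder r).differentiableAt.differentiableWithinAt) fun r hr => ?_
      rw [interior_Icc] at hr
      rw [(hder r).deriv]
      have hfl := hflux r ⟨hr.1.le, hr.2.le⟩
      have hlow : -(E * m * (r ^ 3 / 3)) ≤ ∫ s in (0)..r, s ^ 2 * ((V s - E) * F s) := by
        have e : -(E * m * (r ^ 3 / 3)) = ∫ s in (0)..r, -(E * m) * s ^ 2 := by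
          rw [intervalIntegral.integral_const_mul, integral_pow]; norm_num
        rw [e]
        refine intervalIntegral.integral_mono_on hr.1.le
          ((continuous_const.mul (continuous_id.pow 2)).intervalIntegrable _ _) (iE 0 r)
          fun s hs => ?_
        have h1 : F s ≤ m := hmax ⟨hs.1, hs.2.trans hr.2.le⟩
        have h2 : 0 ≤ V s * F s := mul_nonneg (hv.profile_nonneg s) (hFp s).le
        have h3 : E * F s ≤ E * m := mul_le_mul_of_nonneg_left h1 hE0
        have h4 := mul_nonneg (sq_nonneg s) h2
        have h5 := mul_le_mul_of_nonneg_left h3 (sq_nonneg s)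
        linarith
      rw [← hfl] at hlow
      have hr2 : 0 < r ^ 2 * μ := mul_pos (pow_pos hr.1 2) hμ
      have : 0 ≤ (r ^ 2 * μ) * (deriv F r + E * m / (6 * μ) * (2 * r)) := by
        have e : (r ^ 2 * μ) * (deriv F r + E * m / (6 * μ) * (2 * r))
            = μ * (r ^ 2 * deriv F r) + E * m * (r ^ 3 / 3) := by
          field_simp
          ring
        rw [e]
        linarith
      exact (mul_nonneg_iff_of_pos_left hr2).1 this
    have hle := hmono hr₀ (right_mem_Icc.2 hL0.le) hr₀.2
    simp only [hFL] at hle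
    have hEL2 : E * L ^ 2 ≤ 3 * μ := by
      refine le_of_mul_le_mul_right ?_ hL0
      calc E * L ^ 2 * L = E * L ^ 3 := by ring
        _ ≤ 3 * (μ * L) := hEL.trans hsmall
        _ = _ := by ring
    have h6 : E * m / (6 * μ) * L ^ 2 ≤ m / 2 := by
      have : E * m / (6 * μ) * L ^ 2 = (E * L ^ 2) * (m / (6 * μ)) := by ring
      rw [this]
      calc _ ≤ 3 * μ * (m / (6 * μ)) := by gcongr
        _ = m / 2 := by field_simp; norm_num
    have h7 : 0 ≤ E * m / (6 * μ) * r₀ ^ 2 := by positivity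
    have hm2 : m ≤ 2 := by linarith
    exact fun s hs => (hmax hs).trans hm2
  have ha0 := hf₀.scatteringLength_pos hv hR hμ
  have haR := hf₀.scatteringLength_lt hv hR hμ
  -- From `F ≤ 2` and `1 - F₀ ≤ a/s` the integrand is at most `2 a s`. Together with `E L³ ≤ M R₀³`
  -- this leaves an excess of order `1/L`.
  have hup : ∫ s in (0)..L, s ^ 2 * (F s * (1 - F0 s)) ≤ a * L ^ 2 := by
    calc _ ≤ ∫ s in (0)..L, 2 * a * s := by
          refine intervalIntegral.integral_mono_on_of_le_Ioo hL0.le i4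
            ((continuous_const.mul continuous_id).intervalIntegrable _ _) fun s hs => ?_
          have h1 := hF2 s ⟨hs.1.le, hs.2.le⟩
          have h2 := hf₀.one_sub_profile_le hv hR hμ hs.1
          have h3 := sub_nonneg.2 (hf₀.profile_le_one hv hμ hs.1.le)
          have h4 : F s * (1 - F0 s) ≤ 2 * (a / s) :=
            mul_le_mul h1 h2 h3 zero_le_two
          calc s ^ 2 * (F s * (1 - F0 s)) ≤ s ^ 2 * (2 * (a / s)) :=
                mul_le_mul_of_nonneg_left h4 (sq_nonneg s)
            _ = 2 * a * s := by
                have := hs.1.ne'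
                field_simp
      _ = a * L ^ 2 := by
          rw [intervalIntegral.integral_const_mul, integral_id]
          ring
  rw [hdiff]
  have h1 : E * ∫ s in (0)..L, s ^ 2 * (F s * (1 - F0 s)) ≤ M * R₀ ^ 4 / L := by
    calc _ ≤ E * (a * L ^ 2) := mul_le_mul_of_nonneg_left hup hE0
      _ = a * (E * L ^ 3) / L := by field_simp
      _ ≤ R₀ * (M * R₀ ^ 3) / L := by
          have : 0 ≤ E * L ^ 3 := by positivity
          gcongr
      _ = _ := by ring
  have h2 := mul_le_mul_of_nonneg_left h1 (by positivity : (0 : ℝ) ≤ 4 * Real.pi)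
  have h3 : 4 * Real.pi * (M * R₀ ^ 4) / L = 4 * Real.pi * (M * R₀ ^ 4 / L) := by ring
  rw [h3]
  linarith

end

/-! ### Real inner product on `ℂ` and vanishing integrals of derivatives -/

/-- The real inner product of `ℂ` as a continuous bilinear map. -/
def cdot : ℂ →L[ℝ] ℂ →L[ℝ] ℝ := innerSL ℝ

theorem cdot_apply (z w : ℂ) : cdot z w = z.re * w.re + z.im * w.im := by
  rw [cdot, innerSL_apply_apply, Complex.inner]
  simp
  ring

theorem cdot_self (z : ℂ) : cdot z z = ‖z‖ ^ 2 := by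
  rw [cdot, innerSL_apply_apply, real_inner_self_eq_norm_sq]

theorem abs_cdot_le (z w : ℂ) : |cdot z w| ≤ ‖z‖ * ‖w‖ := abs_real_inner_le_norm z w

theorem norm_cdot_le : ‖cdot‖ ≤ 1 :=
  ContinuousLinearMap.opNorm_le_bound₂ _ zero_le_one fun z w => by
    rw [one_mul]; exact abs_cdot_le z w

theorem cdot_comm (z w : ℂ) : cdot z w = cdot w z := by
  rw [cdot_apply, cdot_apply]
  ring

/-- The function is integrable with vanishing integral. -/
structure NullIntegral (T : E3 → ℝ) : Prop where
  integrable : Integrable T volume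
  zero : ∫ x, T x = 0

namespace NullIntegral

variable {S T : E3 → ℝ}

theorem add (hS : NullIntegral S) (hT : NullIntegral T) : NullIntegral fun x => S x + T x :=
  ⟨hS.1.add hT.1, by rw [integral_add hS.1 hT.1, hS.2, hT.2, add_zero]⟩

theorem const_mul (hT : NullIntegral T) (a : ℝ) : NullIntegral fun x => a * T x :=
  ⟨hT.1.const_mul a, by rw [integral_const_mul, hT.2, mul_zero]⟩

theorem sum {ι : Type*} [Fintype ι] {T : ι → E3 → ℝ} (hT : ∀ i, NullIntegral (T i)) :
    NullIntegral fun x => ∑ i, T i x :=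
  ⟨integrable_finsetSum _ fun i _ => (hT i).1, by
    rw [integral_finsetSum _ fun i _ => (hT i).1]
    exact Finset.sum_eq_zero fun i _ => (hT i).2⟩

theorem congr (hT : NullIntegral T) (h : T =ᵐ[volume] S) : NullIntegral S :=
  ⟨hT.1.congr h, by rw [← integral_congr_ae h, hT.2]⟩

end NullIntegral

section Trilinear

variable {F G : Type} [NormedAddCommGroup F] [NormedSpace ℝ F] [CompleteSpace F]
  [NormedAddCommGroup G] [NormedSpace ℝ G] [CompleteSpace G]

/-- Integration by parts for two factors. -/
theorem HasL2Partial.nullIntegral {j : Fin 3} {f f' : E3 → F} {g g' : E3 → G}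
    (hf : HasL2Partial j f f') (hg : HasL2Partial j g g') (B : F →L[ℝ] G →L[ℝ] ℝ) :
    NullIntegral fun x => B (f' x) (g x) + B (f x) (g' x) :=
  ⟨(integrable_bilin B hf.mem' hg.mem).add (integrable_bilin B hf.mem hg.mem'), by
    rw [integral_add (integrable_bilin B hf.mem' hg.mem) (integrable_bilin B hf.mem hg.mem'),
      hf.integral_bilin hg B]
    ring⟩

/-- The product of a bounded function and a bounded vector-valued function. -/
theorem HasL2Partial.smul {j : Fin 3} {a a' : E3 → ℝ} {f f' : E3 → F}
    (ha : HasL2Partial j a a') (hf : HasL2Partial j f f') {C D : ℝ}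
    (hC : ∀ᵐ x, ‖a x‖ ≤ C) (hD : ∀ᵐ x, ‖f x‖ ≤ D) :
    HasL2Partial j (fun x => a x • f x) (fun x => a' x • f x + a x • f' x) :=
  ha.bilin hf (ContinuousLinearMap.lsmul ℝ ℝ) hC hD

/-- Integration by parts for three factors. -/
theorem HasL2Partial.nullIntegral_smul {j : Fin 3} {a a' : E3 → ℝ} {f f' : E3 → F}
    {g g' : E3 → G} (ha : HasL2Partial j a a') (hf : HasL2Partial j f f')
    (hg : HasL2Partial j g g') {C D : ℝ} (hC : ∀ᵐ x, ‖a x‖ ≤ C) (hD : ∀ᵐ x, ‖f x‖ ≤ D)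
    (B : F →L[ℝ] G →L[ℝ] ℝ) :
    NullIntegral fun x => a' x * B (f x) (g x) + a x * B (f' x) (g x) + a x * B (f x) (g' x) := by
  refine ((ha.smul hf hC hD).nullIntegral hg B).congr (Eventually.of_forall fun x => ?_)
  simp

end Trilinear

/-! ### Algebra of the modulated energy rate -/

/-- The symbol of the operator `iε(u·∇ + ½ div u) + ½|u|² - cρ` applied at a point, where
`d = div u`. -/
def drift (ε c : ℝ) (u : Fin 3 → ℝ) (d r : ℝ) (p1 : Fin 3 → ℂ) (p : ℂ) : ℂ :=
  Complex.I * (ε : ℂ) * (∑ j, (u j : ℂ) * p1 j + ((d / 2 : ℝ) : ℂ) * p)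
    + ((1 / 2 * ∑ j, u j ^ 2 - c * r : ℝ) : ℂ) * p

/-- The time derivative prescribed by the modified Gross–Pitaevskii equation, where `l = Δφ`. -/
def gpVelocity (ε : ℝ) (l : ℂ) (V : ℝ) (p : ℂ) : ℂ :=
  (Complex.I * (ε : ℂ))⁻¹ * (-((ε : ℂ) ^ 2 / 2) * l + (V : ℂ) * p)

theorem I_mul_gpVelocity {ε : ℝ} (hε : ε ≠ 0) (l : ℂ) (V : ℝ) (p : ℂ) :
    Complex.I * (ε : ℂ) * gpVelocity ε l V p = ((-(ε ^ 2 / 2) : ℝ) : ℂ) * l + (V : ℂ) * p := by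
  have : Complex.I * (ε : ℂ) ≠ 0 := mul_ne_zero Complex.I_ne_zero (by exact_mod_cast hε)
  rw [gpVelocity, mul_inv_cancel_left₀ this]
  push_cast
  ring

theorem gpVelocity_re {ε : ℝ} (hε : ε ≠ 0) (l : ℂ) (V : ℝ) (p : ℂ) :
    (gpVelocity ε l V p).re = -(ε / 2) * l.im + V * p.im * ε⁻¹ := by
  have h := congrArg Complex.im (I_mul_gpVelocity hε l V p)
  simp only [Complex.add_im, Complex.mul_im, Complex.mul_re, Complex.I_re, Complex.I_im,
    Complex.ofReal_re, Complex.ofReal_im] at h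
  have he : ε * ε⁻¹ = 1 := mul_inv_cancel₀ hε
  linear_combination ε⁻¹ * h - ((gpVelocity ε l V p).re + ε / 2 * l.im) * he

theorem gpVelocity_im {ε : ℝ} (hε : ε ≠ 0) (l : ℂ) (V : ℝ) (p : ℂ) :
    (gpVelocity ε l V p).im = ε / 2 * l.re - V * p.re * ε⁻¹ := by
  have h := congrArg Complex.re (I_mul_gpVelocity hε l V p)
  simp only [Complex.add_re, Complex.mul_im, Complex.mul_re, Complex.I_re, Complex.I_im,
    Complex.ofReal_re, Complex.ofReal_im] at h
  have he : ε * ε⁻¹ = 1 := mul_inv_cancel₀ hε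
  linear_combination -ε⁻¹ * h + (-(gpVelocity ε l V p).im + ε / 2 * l.re) * he

/-- The integrand of the time derivative of the modulated energy before integration by parts. -/
def modulatedRate (ε c : ℝ) (p : ℂ) (p1 : Fin 3 → ℂ) (l : ℂ) (u : Fin 3 → ℝ)
    (u1 : Fin 3 → Fin 3 → ℝ) (r : ℝ) (r1 : Fin 3 → ℝ) (V : ℝ) : ℝ :=
  2 * cdot (drift ε c u (∑ j, u1 j j) r p1 p) (gpVelocity ε l V p)
    + (∑ j, (-(∑ k, u k * u1 j k + c * r1 j)) * (u j * ‖p‖ ^ 2 + cdot (Complex.I * ε * p1 j) p)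
      - c * (-∑ j, (r1 j * u j + r * u1 j j)) * ‖p‖ ^ 2)
    + c * (r * (-∑ j, (r1 j * u j + r * u1 j j)))

/-- The integrand of the time derivative of the modulated energy after integration by parts. -/
def modulatedFlux (ε c : ℝ) (p : ℂ) (p1 : Fin 3 → ℂ) (u : Fin 3 → ℝ)
    (u1 u3 : Fin 3 → Fin 3 → ℝ) (r : ℝ) (V : ℝ) : ℝ :=
  -(∑ j, ∑ k, u1 j k * cdot (Complex.I * ε * p1 j + (u j : ℂ) * p)
      (Complex.I * ε * p1 k + (u k : ℂ) * p))
    + ε ^ 2 / 4 * ∑ j, ∑ k, u3 j k * ‖p‖ ^ 2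
    - V * ∑ j, (u j * (2 * cdot p (p1 j)) + u1 j j * ‖p‖ ^ 2)
    + c * (∑ j, u1 j j) * (r * ‖p‖ ^ 2) - c / 2 * (∑ j, u1 j j) * r ^ 2

-- The left side lists exact derivatives, in order: `ε² ∂ₖ(uⱼ ∂ⱼφ·∂ₖφ)`, `-(ε²/2) ∂ⱼ(uⱼ |∂ₖφ|²)`,
-- `(ε²/2) ∂ₖ(∂ⱼuⱼ φ·∂ₖφ)`, `-(ε²/4) ∂ₖ(∂ₖ∂ⱼuⱼ |φ|²)`, `(ε/2) ∂ₖ(uⱼ² φ·i∂ₖφ)`, `-εc ∂ₖ(ρ φ·i∂ₖφ)`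
-- and `-(c/2) ∂ₖ(uₖ ρ²)`. Taking values and derivatives at a point as independent variables turns
-- the claim into a polynomial identity in real and imaginary parts, up to symmetry of the second
-- derivatives and `ε ε⁻¹ = 1`. The potential needs no integration by parts here.
set_option maxHeartbeats 4000000 in
theorem modulatedRate_sub_flux {ε : ℝ} (hε : ε ≠ 0) (c : ℝ) (p : ℂ) (p1 : Fin 3 → ℂ)
    (p2 : Fin 3 → Fin 3 → ℂ) (hp2 : ∀ j k, p2 j k = p2 k j) (u : Fin 3 → ℝ)
    (u1 u2 u3 : Fin 3 → Fin 3 → ℝ) (r : ℝ) (r1 : Fin 3 → ℝ) (V : ℝ) :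
    (∑ j, ∑ k, (ε ^ 2 * (u1 j k * cdot (p1 j) (p1 k) + u j * cdot (p2 j k) (p1 k)
          + u j * cdot (p1 j) (p2 k k))
        + (-(ε ^ 2 / 2) * (u1 j j * cdot (p1 k) (p1 k) + u j * cdot (p2 k j) (p1 k)
          + u j * cdot (p1 k) (p2 k j))
        + (ε ^ 2 / 2 * (u2 j k * cdot p (p1 k) + u1 j j * cdot (p1 k) (p1 k)
          + u1 j j * cdot p (p2 k k))
        + (-(ε ^ 2 / 4) * (u3 j k * cdot p p + u2 j k * cdot (p1 k) p + u2 j k * cdot p (p1 k))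
        + ε / 2 * (u1 j k * cdot (u j • p) (Complex.I * p1 k)
          + u j * cdot (u1 j k • p + u j • p1 k) (Complex.I * p1 k)
          + u j * cdot (u j • p) (Complex.I * p2 k k)))))))
      + (∑ k, (-(ε * c) * (r1 k * cdot p (Complex.I * p1 k) + r * cdot (p1 k) (Complex.I * p1 k)
          + r * cdot p (Complex.I * p2 k k))
        + -(c / 2) * (u1 k k * (r * r) + u k * (r1 k * r) + u k * (r * r1 k))))
      = modulatedRate ε c p p1 (∑ j, p2 j j) u u1 r r1 V - modulatedFlux ε c p p1 u u1 u3 r V := by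
  have e01 := hp2 1 0
  have e02 := hp2 2 0
  have e12 := hp2 2 1
  simp only [modulatedRate, modulatedFlux, Fin.sum_univ_three, ← cdot_self, cdot_apply,
    gpVelocity_re hε, gpVelocity_im hε, drift, e01, e02, e12]
  simp only [Complex.add_re, Complex.add_im, Complex.mul_re, Complex.mul_im, Complex.I_re,
    Complex.I_im, Complex.ofReal_re, Complex.ofReal_im, Complex.smul_re, Complex.smul_im,
    smul_eq_mul]
  have he : ε * ε⁻¹ = 1 := mul_inv_cancel₀ hε
  generalize ε⁻¹ = e at *
  linear_combination (2 * V * ((u 0 * (p1 0).re + u 1 * (p1 1).re + u 2 * (p1 2).re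
    + (u1 0 0 + u1 1 1 + u1 2 2) / 2 * p.re) * p.re + (u 0 * (p1 0).im + u 1 * (p1 1).im
    + u 2 * (p1 2).im + (u1 0 0 + u1 1 1 + u1 2 2) / 2 * p.im) * p.im)) * he

theorem MemH.exists_bound {F : Type} [NormedAddCommGroup F] [NormedSpace ℝ F] [CompleteSpace F]
    (hF : HasSupBound F) {k : ℕ} {f : E3 → F} (h : MemH k f) (hk : 2 ≤ k) :
    ∃ C, ∀ᵐ x, ‖f x‖ ≤ C := by
  obtain ⟨C, -, hC⟩ := hF
  have h2 : MemH 2 f := h.mono hk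
  exact ⟨_, hC f _ _ (fun j => h2.hasL2Partial j)
    fun j => (memH_weakPartial h2 j).hasL2Partial j⟩

theorem weakPartial_comm {F : Type} [NormedAddCommGroup F] [NormedSpace ℝ F] [CompleteSpace F]
    {f : E3 → F} (h : MemH 2 f) (j k : Fin 3) :
    weakPartial k (weakPartial j f) =ᵐ[volume] weakPartial j (weakPartial k f) := by
  have hj := h.hasL2Partial j
  have hk := h.hasL2Partial k
  have hjk := (memH_weakPartial h j).hasL2Partial k
  have hkj := (memH_weakPartial h k).hasL2Partial j
  exact hj.weak.comm hk.weak hjk.weak hkj.weak (memLp_locallyIntegrable hjk.mem')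
    (memLp_locallyIntegrable hkj.mem')

/-- The time derivative of the modulated energy after integration by parts. -/
theorem nullIntegral_modulatedRate_sub_flux {ε : ℝ} (hε : ε ≠ 0) (c : ℝ) {p : E3 → ℂ}
    (hp : MemH 4 p) {u : Fin 3 → E3 → ℝ} (hu : ∀ j, MemH 4 (u j)) {r : E3 → ℝ} (hr : MemH 2 r)
    (V : E3 → ℝ) :
    NullIntegral fun x =>
      modulatedRate ε c (p x) (fun j => weakPartial j p x)
          (∑ j, weakPartial j (weakPartial j p) x) (fun j => u j x)
          (fun j k => weakPartial k (u j) x) (r x) (fun j => weakPartial j r x) (V x)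
        - modulatedFlux ε c (p x) (fun j => weakPartial j p x) (fun j => u j x)
          (fun j k => weakPartial k (u j) x)
          (fun j k => weakPartial k (weakPartial k (weakPartial j (u j))) x) (r x) (V x) := by
  have P1 : ∀ j, HasL2Partial j p (weakPartial j p) := fun j => hp.hasL2Partial j
  have P2 : ∀ j k, HasL2Partial k (weakPartial j p) (weakPartial k (weakPartial j p)) :=
    fun j k => (memH_weakPartial hp j).hasL2Partial k
  have I1 : ∀ j k, HasL2Partial k (fun x => Complex.I * weakPartial j p x)
      (fun x => Complex.I * weakPartial k (weakPartial j p) x) :=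
    fun j k => (P2 j k).clm_comp (ContinuousLinearMap.mul ℝ ℂ Complex.I)
  have U1 : ∀ j k, HasL2Partial k (u j) (weakPartial k (u j)) := fun j k => (hu j).hasL2Partial k
  have U2 : ∀ j k, HasL2Partial k (weakPartial j (u j)) (weakPartial k (weakPartial j (u j))) :=
    fun j k => (memH_weakPartial (hu j) j).hasL2Partial k
  have U3 : ∀ j k, HasL2Partial k (weakPartial k (weakPartial j (u j)))
      (weakPartial k (weakPartial k (weakPartial j (u j)))) :=
    fun j k => (memH_weakPartial (memH_weakPartial (hu j) j) k).hasL2Partial k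
  have R1 : ∀ j, HasL2Partial j r (weakPartial j r) := fun j => hr.hasL2Partial j
  obtain ⟨Cp, hCp⟩ := hp.exists_bound hasSupBound_complex (by norm_num)
  obtain ⟨Cr, hCr⟩ := hr.exists_bound hasSupBound_real le_rfl
  have hCp1 := fun j => (memH_weakPartial hp j).exists_bound hasSupBound_complex (by norm_num)
  have hCu := fun j => (hu j).exists_bound hasSupBound_real (by norm_num)
  have hCu1 := fun j => (memH_weakPartial (hu j) j).exists_bound hasSupBound_real (by norm_num)
  have hCu2 := fun j k => (memH_weakPartial (memH_weakPartial (hu j) j) k).exists_bound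
    hasSupBound_real (by norm_num)
  choose Cp1 hCp1 using hCp1
  choose Cu hCu using hCu
  choose Cu1 hCu1 using hCu1
  choose Cu2 hCu2 using hCu2
  have hup : ∀ j, ∀ᵐ x, ‖u j x • p x‖ ≤ Cu j * Cp := fun j => by
    filter_upwards [hCu j, hCp] with x h1 h2
    rw [norm_smul]
    exact mul_le_mul h1 h2 (norm_nonneg _) ((norm_nonneg _).trans h1)
  -- One family for each of the seven exact derivatives in `modulatedRate_sub_flux`. Integrating
  -- three factors by parts needs `L^∞` bounds on two of them; `H⁴` provides these for `∇φ` and for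
  -- two derivatives of `u`.
  have n1 := fun j k => (U1 j k).nullIntegral_smul (P2 j k) (P2 k k) (hCu j) (hCp1 j) cdot
  have n2 := fun j k => (U1 j j).nullIntegral_smul (P2 k j) (P2 k j) (hCu j) (hCp1 k) cdot
  have n3 := fun j k => (U2 j k).nullIntegral_smul (P1 k) (P2 k k) (hCu1 j) hCp cdot
  have n4 := fun j k => (U3 j k).nullIntegral_smul (P1 k) (P1 k) (hCu2 j k) hCp cdot
  have n5 := fun j k => (U1 j k).nullIntegral_smul ((U1 j k).smul (P1 k) (hCu j) hCp) (I1 k k)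
    (hCu j) (hup j) cdot
  have n6 := fun k => (R1 k).nullIntegral_smul (P1 k) (I1 k k) hCr hCp cdot
  have n7 := fun k => (U1 k k).nullIntegral_smul (R1 k) (R1 k) (hCu k) hCr
    (ContinuousLinearMap.mul ℝ ℝ)
  have key := (NullIntegral.sum fun j => NullIntegral.sum fun k =>
    ((n1 j k).const_mul (ε ^ 2)).add (((n2 j k).const_mul (-(ε ^ 2 / 2))).add
      (((n3 j k).const_mul (ε ^ 2 / 2)).add (((n4 j k).const_mul (-(ε ^ 2 / 4))).add
        ((n5 j k).const_mul (ε / 2)))))).add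
    (NullIntegral.sum fun k => ((n6 k).const_mul (-(ε * c))).add ((n7 k).const_mul (-(c / 2))))
  refine key.congr ?_
  have hcomm : ∀ᵐ x, ∀ j k, weakPartial k (weakPartial j p) x = weakPartial j (weakPartial k p) x :=
    ae_all_iff.2 fun j => ae_all_iff.2 fun k => weakPartial_comm (hp.mono (by norm_num)) j k
  filter_upwards [hcomm] with x hx
  exact modulatedRate_sub_flux hε c (p x) (fun j => weakPartial j p x)
    (fun j k => weakPartial k (weakPartial j p) x) hx (fun j => u j x)
    (fun j k => weakPartial k (u j) x) (fun j k => weakPartial k (weakPartial j (u j)) x)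
    (fun j k => weakPartial k (weakPartial k (weakPartial j (u j))) x) (r x)
    (fun j => weakPartial j r x) (V x)

/-! ### Convolution with short-range even kernels -/

theorem integrable_mul_of_memLp {f g : E3 → ℝ} (hf : MemLp f 2 volume) (hg : MemLp g 2 volume) :
    Integrable (fun x => f x * g x) volume :=
  integrable_bilin (ContinuousLinearMap.mul ℝ ℝ) hf hg

theorem integral_abs_mul_le {f g : E3 → ℝ} (hf : MemLp f 2 volume) (hg : MemLp g 2 volume) :
    ∫ x, |f x * g x| ≤ l2 f * l2 g := by
  have h := norm_integral_bilin_le (ContinuousLinearMap.mul ℝ ℝ) hf hg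
  refine h.trans ?_
  have : ‖ContinuousLinearMap.mul ℝ ℝ‖ ≤ 1 := ContinuousLinearMap.opNorm_mul_le ℝ ℝ
  have h0 : 0 ≤ l2 f * l2 g := mul_nonneg (l2_nonneg f) (l2_nonneg g)
  calc _ ≤ 1 * (l2 f * l2 g) := mul_le_mul_of_nonneg_right this h0
    _ = _ := one_mul _

theorem abs_integral_mul_le {f g : E3 → ℝ} (hf : MemLp f 2 volume) (hg : MemLp g 2 volume) :
    |∫ x, f x * g x| ≤ l2 f * l2 g :=
  (abs_integral_le_integral_abs).trans (integral_abs_mul_le hf hg)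

/-- The class of interaction kernels: bounded, nonnegative, even and supported in the closed ball
of radius `r`. -/
structure IsKernel (K : E3 → ℝ) (r : ℝ) : Prop where
  measurable : Measurable K
  nonneg : ∀ z, 0 ≤ K z
  even : ∀ z, K (-z) = K z
  bounded : ∃ B, ∀ z, K z ≤ B
  support : ∀ z, r < ‖z‖ → K z = 0

namespace IsKernel

variable {K : E3 → ℝ} {r : ℝ}

theorem integrable (hK : IsKernel K r) : Integrable K volume := by
  obtain ⟨B, hB⟩ := hK.bounded
  have h : IntegrableOn K (Metric.closedBall 0 r) volume :=
    Measure.integrableOn_of_bounded (M := B) measure_closedBall_lt_top.ne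
      hK.measurable.aestronglyMeasurable (Eventually.of_forall fun z => by
        rw [Real.norm_eq_abs, abs_of_nonneg (hK.nonneg z)]; exact hB z)
  rw [← integrableOn_univ]
  refine h.of_forall_sdiff_eq_zero MeasurableSet.univ fun z hz => hK.support z ?_
  simpa using hz.2

theorem integral_nonneg (hK : IsKernel K r) : 0 ≤ ∫ z, K z :=
  MeasureTheory.integral_nonneg hK.nonneg

theorem conv_apply (K g : E3 → ℝ) (x : E3) :
    (K ⋆[ContinuousLinearMap.lsmul ℝ ℝ, volume] g) x = ∫ z, K z * g (x - z) := rfl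

/-- For fixed `z`, Cauchy–Schwarz and translation invariance bound the inner integral by `K z` times
the two `L²` norms. This justifies the Fubini exchanges below. -/
theorem integrable_prod (hK : IsKernel K r) {f g : E3 → ℝ} (hf : MemLp f 2 volume)
    (hg : MemLp g 2 volume) :
    Integrable (fun q : E3 × E3 => f q.1 * (K q.2 * g (q.1 - q.2)))
      ((volume : Measure E3).prod volume) := by
  have hm : AEStronglyMeasurable (fun q : E3 × E3 => f q.1 * (K q.2 * g (q.1 - q.2)))
      ((volume : Measure E3).prod volume) :=
    hf.1.comp_fst.mul (AEStronglyMeasurable.convolution_integrand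
      (ContinuousLinearMap.lsmul ℝ ℝ) hK.measurable.aestronglyMeasurable hg.1)
  rw [integrable_prod_iff' hm]
  have hz : ∀ z, Integrable (fun x => f x * (K z * g (x - z))) volume := fun z => by
    have := (integrable_mul_of_memLp hf (MemLp.translate hg z)).const_mul (K z)
    refine this.congr (Eventually.of_forall fun x => ?_)
    change K z * (f x * g (x - z)) = f x * (K z * g (x - z))
    ring
  refine ⟨Eventually.of_forall hz, ?_⟩
  refine (hK.integrable.mul_const (l2 f * l2 g)).mono' hm.norm.prod_swap.integral_prod_right'
    (Eventually.of_forall fun z => ?_)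
  rw [Real.norm_of_nonneg (MeasureTheory.integral_nonneg fun x => norm_nonneg _)]
  have e : ∀ x, ‖f x * (K z * g (x - z))‖ = K z * |f x * g (x - z)| := fun x => by
    rw [Real.norm_eq_abs, abs_mul, abs_mul, abs_mul, abs_of_nonneg (hK.nonneg z)]; ring
  simp only [e]
  rw [integral_const_mul]
  refine mul_le_mul_of_nonneg_left ?_ (hK.nonneg z)
  rw [← l2_translate hg z]
  exact integral_abs_mul_le hf (MemLp.translate hg z)

theorem integrable_mul_conv (hK : IsKernel K r) {f g : E3 → ℝ} (hf : MemLp f 2 volume)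
    (hg : MemLp g 2 volume) :
    Integrable (fun x => f x * (K ⋆[ContinuousLinearMap.lsmul ℝ ℝ, volume] g) x) volume := by
  have := (hK.integrable_prod hf hg).integral_prod_left
  simp only [integral_const_mul] at this
  exact this

theorem integrable_mul_corr (hK : IsKernel K r) {f g : E3 → ℝ} (hf : MemLp f 2 volume)
    (hg : MemLp g 2 volume) : Integrable (fun z => K z * ∫ x, f x * g (x - z)) volume := by
  have := (hK.integrable_prod hf hg).integral_prod_right
  refine this.congr (Eventually.of_forall fun z => ?_)
  change ∫ x, f x * (K z * g (x - z)) = K z * ∫ x, f x * g (x - z)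
  rw [← integral_const_mul]
  refine integral_congr_ae (Eventually.of_forall fun x => ?_)
  change f x * (K z * g (x - z)) = K z * (f x * g (x - z))
  ring

/-- The interaction becomes an average over shifts `z` of the correlations of `f` and `g`, so only
shifts within the range of the kernel matter. -/
theorem integral_mul_conv (hK : IsKernel K r) {f g : E3 → ℝ} (hf : MemLp f 2 volume)
    (hg : MemLp g 2 volume) :
    ∫ x, f x * (K ⋆[ContinuousLinearMap.lsmul ℝ ℝ, volume] g) x
      = ∫ z, K z * ∫ x, f x * g (x - z) := by
  have h := integral_integral_swap (f := fun x z => f x * (K z * g (x - z)))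
    (hK.integrable_prod hf hg)
  simp only [integral_const_mul] at h
  simp only [conv_apply]
  rw [h]
  refine integral_congr_ae (Eventually.of_forall fun z => ?_)
  change ∫ x, f x * (K z * g (x - z)) = K z * ∫ x, f x * g (x - z)
  rw [← integral_const_mul]
  refine integral_congr_ae (Eventually.of_forall fun x => ?_)
  change f x * (K z * g (x - z)) = K z * (f x * g (x - z))
  ring

theorem integral_corr_neg (hK : IsKernel K r) (f g : E3 → ℝ) :
    ∫ z, K z * ∫ x, f x * g (x - -z) = ∫ z, K z * ∫ x, f x * g (x - z) := by
  rw [← integral_neg_eq_self (fun z => K z * ∫ x, f x * g (x - z))]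
  simp only [hK.even]

theorem integrable_corr_neg (hK : IsKernel K r) {f g : E3 → ℝ} (hf : MemLp f 2 volume)
    (hg : MemLp g 2 volume) : Integrable (fun z => K z * ∫ x, f x * g (x - -z)) volume := by
  have := (hK.integrable_mul_corr hf hg).comp_neg
  simpa only [hK.even] using this

theorem integral_translate_comm (f g : E3 → ℝ) (z : E3) :
    ∫ x, f x * g (x - -z) = ∫ x, g x * f (x - z) := by
  rw [← integral_sub_right_eq_self (fun x => f x * g (x - -z)) z]
  refine integral_congr_ae (Eventually.of_forall fun x => ?_)
  change f (x - z) * g (x - z - -z) = g x * f (x - z)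
  rw [sub_neg_eq_add, sub_add_cancel, mul_comm]

/-- Convolution with an even kernel is symmetric. -/
theorem integral_mul_conv_comm (hK : IsKernel K r) {f g : E3 → ℝ} (hf : MemLp f 2 volume)
    (hg : MemLp g 2 volume) :
    ∫ x, f x * (K ⋆[ContinuousLinearMap.lsmul ℝ ℝ, volume] g) x
      = ∫ x, g x * (K ⋆[ContinuousLinearMap.lsmul ℝ ℝ, volume] f) x := by
  rw [hK.integral_mul_conv hf hg, hK.integral_mul_conv hg hf, ← hK.integral_corr_neg f g]
  simp only [integral_translate_comm]

theorem integrable_conv_integrand (hK : IsKernel K r) {g : E3 → ℝ} (hg : Integrable g volume)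
    (x : E3) : Integrable (fun z => K z * g (x - z)) volume := by
  obtain ⟨B, hB⟩ := hK.bounded
  refine (hg.comp_sub_left x).bdd_mul (c := B) hK.measurable.aestronglyMeasurable
    (Eventually.of_forall fun z => ?_)
  rw [Real.norm_eq_abs, abs_of_nonneg (hK.nonneg z)]
  exact hB z

theorem abs_conv_le (hK : IsKernel K r) {B : ℝ} (hB : ∀ z, K z ≤ B) {g : E3 → ℝ}
    (hg : Integrable g volume) (x : E3) :
    |(K ⋆[ContinuousLinearMap.lsmul ℝ ℝ, volume] g) x| ≤ B * ∫ y, |g y| := by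
  rw [conv_apply]
  refine (abs_integral_le_integral_abs).trans ?_
  rw [← integral_sub_left_eq_self (fun y => |g y|) volume x, ← integral_const_mul]
  refine integral_mono (hK.integrable_conv_integrand hg x).abs
    ((hg.comp_sub_left x).abs.const_mul B) fun z => ?_
  change |K z * g (x - z)| ≤ B * |g (x - z)|
  rw [abs_mul, abs_of_nonneg (hK.nonneg z)]
  exact mul_le_mul_of_nonneg_right (hB z) (abs_nonneg _)

theorem conv_sub (hK : IsKernel K r) {g h : E3 → ℝ} (hg : Integrable g volume)
    (hh : Integrable h volume) (x : E3) :
    (K ⋆[ContinuousLinearMap.lsmul ℝ ℝ, volume] g) x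
      - (K ⋆[ContinuousLinearMap.lsmul ℝ ℝ, volume] h) x
      = (K ⋆[ContinuousLinearMap.lsmul ℝ ℝ, volume] fun y => g y - h y) x := by
  simp only [conv_apply, mul_sub]
  rw [integral_sub (hK.integrable_conv_integrand hg x) (hK.integrable_conv_integrand hh x)]

theorem aestronglyMeasurable_conv (hK : IsKernel K r) {g : E3 → ℝ} (hg : Integrable g volume) :
    AEStronglyMeasurable (K ⋆[ContinuousLinearMap.lsmul ℝ ℝ, volume] g) volume :=
  (Integrable.integrable_convolution (ContinuousLinearMap.lsmul ℝ ℝ) hK.integrable hg).1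

/-- A function that is almost constant on the support of the kernel. -/
theorem abs_integral_sub_le (hK : IsKernel K r) {h : E3 → ℝ} {a b : ℝ}
    (hi : Integrable (fun z => K z * h z) volume) (hb : ∀ z, ‖z‖ ≤ r → |h z - a| ≤ b) :
    |(∫ z, K z * h z) - (∫ z, K z) * a| ≤ (∫ z, K z) * b := by
  rw [← integral_mul_const, ← integral_mul_const, ← integral_sub hi (hK.integrable.mul_const a)]
  refine (abs_integral_le_integral_abs).trans ?_
  refine integral_mono (hi.sub (hK.integrable.mul_const a)).abs (hK.integrable.mul_const b)
    fun z => ?_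
  change |K z * h z - K z * a| ≤ K z * b
  rw [← mul_sub, abs_mul, abs_of_nonneg (hK.nonneg z)]
  by_cases hz : ‖z‖ ≤ r
  · exact mul_le_mul_of_nonneg_left (hb z hz) (hK.nonneg z)
  · rw [hK.support z (not_le.1 hz), zero_mul, zero_mul]

/-- A lower bound of the interaction energy by the integral of the kernel. -/
theorem le_integral_mul_conv (hK : IsKernel K r) {g : E3 → ℝ} (hg : MemLp g 2 volume) {b : ℝ}
    (hb : ∀ z, ‖z‖ ≤ r → (∫ x, g x * g x) - ∫ x, g x * g (x - z) ≤ b) :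
    (∫ z, K z) * ((∫ x, g x * g x) - b)
      ≤ ∫ x, g x * (K ⋆[ContinuousLinearMap.lsmul ℝ ℝ, volume] g) x := by
  rw [hK.integral_mul_conv hg hg, ← integral_mul_const]
  refine integral_mono (hK.integrable.mul_const _) (hK.integrable_mul_corr hg hg) fun z => ?_
  by_cases hz : ‖z‖ ≤ r
  · exact mul_le_mul_of_nonneg_left (by linarith [hb z hz]) (hK.nonneg z)
  · simp [hK.support z (not_le.1 hz)]

end IsKernel

/-- Symmetrization of the transport of the density against its translates. -/
theorem integral_transport_symm {j : Fin 3} {w w' g g' : E3 → ℝ} (hw : HasL2Partial j w w')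
    (hg : HasL2Partial j g g') {C D : ℝ} (hC : ∀ᵐ x, ‖w x‖ ≤ C) (hD : ∀ᵐ x, ‖g x‖ ≤ D) (z : E3) :
    (∫ x, (w x * g' x + w' x * g x) * g (x - z)) + ∫ x, (w x * g' x + w' x * g x) * g (x - -z)
      = (∫ x, (w x - w (x - z)) * (g' x * g (x - z))) + ∫ x, w' x * (g x * g (x - z)) := by
  have hwg : HasL2Partial j (fun x => w x * g x) (fun x => w x * g' x + w' x * g x) := by
    have := hw.smul hg hC hD
    simpa only [smul_eq_mul, add_comm] using this
  -- The `-z` half is integrated by parts and shifted by `z`, so that it pairs `g'` with `w g` at `x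
  -- - z`. In the sum the derivative falls on one copy of `g` only, and `w` enters through its
  -- increment.
  have e1 := hwg.integral_bilin (hg.translate (-z)) (ContinuousLinearMap.mul ℝ ℝ)
  simp only [ContinuousLinearMap.mul_apply'] at e1
  have e2 : ∫ x, (w x * g x) * g' (x - -z) = ∫ x, g' x * (w (x - z) * g (x - z)) :=
    IsKernel.integral_translate_comm (fun x => w x * g x) g' z
  have e3 : ∫ x, (w x * g' x + w' x * g x) * g (x - -z)
      = -∫ x, g' x * (w (x - z) * g (x - z)) := by rw [← e2, e1, neg_neg]
  have mt : MemLp (fun x => g (x - z)) 2 volume := MemLp.translate hg.mem z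
  have bt : ∀ᵐ x, ‖g (x - z)‖ ≤ D :=
    (measurePreserving_sub_right' z).quasiMeasurePreserving.ae hD
  have i0 := integrable_mul_of_memLp hwg.mem' mt
  have i1 := integrable_mul_of_memLp hg.mem' (MemLp.translate hwg.mem z)
  have i2 : Integrable (fun x => w' x * (g x * g (x - z))) volume :=
    integrable_mul_of_memLp hw.mem' (memLp_smul_of_bound hg.mem.1 hD mt)
  have i3 : Integrable (fun x => w x * g' x * g (x - z)) volume := by
    refine (i0.sub i2).congr (Eventually.of_forall fun x => ?_)
    change (w x * g' x + w' x * g x) * g (x - z) - w' x * (g x * g (x - z)) = _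
    ring
  rw [e3, ← sub_eq_add_neg, ← integral_sub i0 i1]
  have i4 : Integrable (fun x => (w x - w (x - z)) * (g' x * g (x - z))) volume := by
    refine (i3.sub i1).congr (Eventually.of_forall fun x => ?_)
    change w x * g' x * g (x - z) - g' x * (w (x - z) * g (x - z)) = _
    ring
  rw [← integral_add i4 i2]
  refine integral_congr_ae (Eventually.of_forall fun x => ?_)
  ring

/-! ### Variation of the mass density under translations -/

theorem memLp_cube {p : E3 → ℂ} (hp : MemLp p 6 volume) :
    MemLp (fun x => ‖p x‖ ^ 3) 2 volume ∧
      l2 (fun x => ‖p x‖ ^ 3) = (eLpNorm p 6 volume).toReal ^ 3 := by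
  have e : eLpNorm (fun x => ‖p x‖ ^ 3) 2 volume = eLpNorm p 6 volume ^ (3 : ℝ) := by
    have h := eLpNorm_norm_rpow (μ := (volume : Measure E3)) (p := 2) (q := 3) p (by norm_num)
    have e2 : (2 : ENNReal) * ENNReal.ofReal 3 = 6 := by
      rw [ENNReal.ofReal_ofNat]; norm_num
    rw [e2] at h
    rw [← h]
    congr 1
    ext x
    norm_cast
  refine ⟨⟨hp.1.norm.pow 3, ?_⟩, ?_⟩
  · rw [e]
    exact ENNReal.rpow_lt_top_of_nonneg (by norm_num) hp.2.ne
  · rw [l2, e, ← ENNReal.toReal_rpow]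
    norm_cast

theorem massDensity_eq (p : E3 → ℂ) : massDensity p = fun x => cdot (p x) (p x) := by
  ext x
  rw [cdot_self, massDensity]

theorem massDensity_nonneg (p : E3 → ℂ) (x : E3) : 0 ≤ massDensity p x := sq_nonneg _

theorem integrable_massDensity {p : E3 → ℂ} (hp : MemLp p 2 volume) :
    Integrable (massDensity p) volume := by
  rw [massDensity_eq]
  exact integrable_bilin cdot hp hp

section Density

variable {p : E3 → ℂ} {p1 : Fin 3 → E3 → ℂ} {Cp : ℝ}

theorem hasL2Partial_massDensity {j : Fin 3} {p' : E3 → ℂ} (h : HasL2Partial j p p')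
    (hb : ∀ᵐ x, ‖p x‖ ≤ Cp) :
    HasL2Partial j (massDensity p) (fun x => 2 * cdot (p x) (p' x)) := by
  have := h.bilin h cdot hb hb
  rw [massDensity_eq]
  refine this.congr (ae_eq_refl _) (Eventually.of_forall fun x => ?_)
  change cdot (p' x) (p x) + cdot (p x) (p' x) = 2 * cdot (p x) (p' x)
  rw [cdot_comm (p' x)]
  ring

theorem massDensity_bound (hb : ∀ᵐ x, ‖p x‖ ≤ Cp) : ∀ᵐ x, ‖massDensity p x‖ ≤ Cp ^ 2 := by
  filter_upwards [hb] with x hx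
  rw [Real.norm_of_nonneg (massDensity_nonneg p x), massDensity]
  exact pow_le_pow_left₀ (norm_nonneg _) hx 2

theorem memLp_massDensity (hp : MemLp p 2 volume) (hb : ∀ᵐ x, ‖p x‖ ≤ Cp) :
    MemLp (massDensity p) 2 volume := by
  refine memLp_two_of_le (C := Cp) (integrable_massDensity hp).1 hp ?_
  filter_upwards [hb] with x hx
  rw [Real.norm_of_nonneg (massDensity_nonneg p x), massDensity, sq]
  exact mul_le_mul_of_nonneg_right hx (norm_nonneg _)

theorem sq_mul_add_le {a b : ℝ} (ha : 0 ≤ a) (hb : 0 ≤ b) :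
    a ^ 2 * (a + b) ≤ 2 * (a ^ 3 + b ^ 3) := by
  nlinarith [mul_nonneg (add_nonneg ha hb) (sq_nonneg (a - b)), pow_nonneg ha 3, pow_nonneg hb 3]

theorem mul_sq_le {a b : ℝ} (ha : 0 ≤ a) (hb : 0 ≤ b) : a * b ^ 2 ≤ a ^ 3 + b ^ 3 := by
  nlinarith [mul_nonneg (add_nonneg ha hb) (sq_nonneg (a - b)), pow_nonneg ha 3, pow_nonneg hb 3,
    mul_nonneg ha hb, mul_nonneg (mul_nonneg ha ha) hb]

/-- The variation of the density under translation, with the density as weight. -/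
theorem integral_massDensity_translate_le (h1 : ∀ j, HasL2Partial j p (p1 j))
    (hb : ∀ᵐ x, ‖p x‖ ≤ Cp) (h6 : MemLp p 6 volume) (z : E3) :
    Integrable (fun x => massDensity p x * |massDensity p (x - z) - massDensity p x|) volume ∧
    ∫ x, massDensity p x * |massDensity p (x - z) - massDensity p x|
      ≤ 4 * (‖z‖ * ∑ j, l2 (p1 j)) * l2 (fun x => ‖p x‖ ^ 3) := by
  have hp := (h1 0).mem
  have hm := memLp_massDensity hp hb
  obtain ⟨c1, -⟩ := memLp_cube h6
  have ht := MemLp.translate hp z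
  have hd : MemLp (fun x => p (x - z) - p x) 2 volume := ht.sub hp
  have cs : MemLp (fun x => ‖p x‖ ^ 3 + ‖p (x - z)‖ ^ 3) 2 volume := c1.add (MemLp.translate c1 z)
  have i1 : Integrable (fun x => massDensity p x * |massDensity p (x - z) - massDensity p x|)
      volume := integrable_mul_of_memLp hm ((MemLp.translate hm z).sub hm).abs
  have i2 := (integrable_mul_of_memLp hd.norm cs)
  refine ⟨i1, ?_⟩
  -- Factoring the difference of squares isolates one increment of `p`, estimated in `L²`; the three
  -- remaining factors are absorbed into cubes, which the `L⁶` norm controls.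
  have hpt : ∀ x, massDensity p x * |massDensity p (x - z) - massDensity p x|
      ≤ 2 * |‖p (x - z) - p x‖ * (‖p x‖ ^ 3 + ‖p (x - z)‖ ^ 3)| := by
    intro x
    have a0 := norm_nonneg (p x)
    have b0 := norm_nonneg (p (x - z))
    have d0 := norm_nonneg (p (x - z) - p x)
    have e0 : |‖p (x - z) - p x‖ * (‖p x‖ ^ 3 + ‖p (x - z)‖ ^ 3)|
        = ‖p (x - z) - p x‖ * (‖p x‖ ^ 3 + ‖p (x - z)‖ ^ 3) := abs_of_nonneg (by positivity)
    rw [e0]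
    have e : massDensity p (x - z) - massDensity p x
        = (‖p (x - z)‖ - ‖p x‖) * (‖p x‖ + ‖p (x - z)‖) := by
      rw [massDensity, massDensity]; ring
    rw [e, abs_mul, abs_of_nonneg (add_nonneg a0 b0), massDensity]
    have hn := abs_norm_sub_norm_le (p (x - z)) (p x)
    have k1 := sq_mul_add_le a0 b0
    calc ‖p x‖ ^ 2 * (|‖p (x - z)‖ - ‖p x‖| * (‖p x‖ + ‖p (x - z)‖))
        = |‖p (x - z)‖ - ‖p x‖| * (‖p x‖ ^ 2 * (‖p x‖ + ‖p (x - z)‖)) := by ring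
      _ ≤ ‖p (x - z) - p x‖ * (2 * (‖p x‖ ^ 3 + ‖p (x - z)‖ ^ 3)) := by
          refine mul_le_mul hn k1 (by positivity) d0
      _ = _ := by ring
  have k1 := integral_mono i1 (i2.abs.const_mul 2) hpt
  rw [integral_const_mul] at k1
  have k2 := integral_abs_mul_le hd.norm cs
  have k3 : l2 (fun x => ‖p (x - z) - p x‖) = l2 (fun x => p (x - z) - p x) := by
    rw [l2, l2, eLpNorm_norm]
  have k4 := l2_translate_sub_le h1 z
  have k5 := l2_add_le c1 (MemLp.translate c1 z)
  rw [l2_translate c1 z] at k5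
  have q0 : 0 ≤ l2 (fun x => ‖p x‖ ^ 3) := l2_nonneg _
  rw [k3] at k2
  have k6 : l2 (fun x => p (x - z) - p x) * l2 (fun x => ‖p x‖ ^ 3 + ‖p (x - z)‖ ^ 3)
      ≤ (‖z‖ * ∑ j, l2 (p1 j)) * (l2 (fun x => ‖p x‖ ^ 3) + l2 (fun x => ‖p x‖ ^ 3)) :=
    mul_le_mul k4 k5 (l2_nonneg _) ((l2_nonneg _).trans k4)
  linarith

/-- The increment of `w` supplies the small factor `m`. One derivative of `p` is put in `L²`, and
the three undifferentiated factors are dominated by cubes. -/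
theorem abs_integral_lipschitz_transport_le {j : Fin 3} {p' : E3 → ℂ} (h : HasL2Partial j p p')
    (h6 : MemLp p 6 volume) {w : E3 → ℝ} {z : E3} {m : ℝ} (hm : 0 ≤ m)
    (hw : ∀ᵐ x, ‖w (x - z) - w x‖ ≤ m) :
    |∫ x, (w x - w (x - z)) * (2 * cdot (p x) (p' x) * massDensity p (x - z))|
      ≤ 4 * m * l2 p' * l2 (fun x => ‖p x‖ ^ 3) := by
  obtain ⟨c1, -⟩ := memLp_cube h6
  have cs : MemLp (fun x => ‖p x‖ ^ 3 + ‖p (x - z)‖ ^ 3) 2 volume := c1.add (MemLp.translate c1 z)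
  have i2 := integrable_mul_of_memLp h.mem'.norm cs
  have hpt : ∀ᵐ x, ‖(w x - w (x - z)) * (2 * cdot (p x) (p' x) * massDensity p (x - z))‖
      ≤ 2 * m * |‖p' x‖ * (‖p x‖ ^ 3 + ‖p (x - z)‖ ^ 3)| := by
    filter_upwards [hw] with x hx
    have a0 := norm_nonneg (p x)
    have b0 := norm_nonneg (p (x - z))
    have d0 := norm_nonneg (p' x)
    rw [abs_of_nonneg (by positivity), norm_mul, norm_mul, norm_mul, norm_sub_rev,
      Real.norm_of_nonneg (massDensity_nonneg p _), massDensity, Real.norm_ofNat]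
    have k1 := mul_sq_le a0 b0
    have k2 : ‖cdot (p x) (p' x)‖ ≤ ‖p x‖ * ‖p' x‖ := abs_cdot_le _ _
    calc ‖w (x - z) - w x‖ * (2 * ‖cdot (p x) (p' x)‖ * ‖p (x - z)‖ ^ 2)
        ≤ m * (2 * (‖p x‖ * ‖p' x‖) * ‖p (x - z)‖ ^ 2) := by gcongr
      _ = 2 * m * (‖p' x‖ * (‖p x‖ * ‖p (x - z)‖ ^ 2)) := by ring
      _ ≤ _ := by gcongr
  have k1 := norm_integral_le_of_norm_le (i2.abs.const_mul (2 * m)) hpt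
  rw [integral_const_mul] at k1
  have k2 := integral_abs_mul_le h.mem'.norm cs
  have k3 : l2 (fun x => ‖p' x‖) = l2 p' := by rw [l2, l2, eLpNorm_norm]
  have k5 := l2_add_le c1 (MemLp.translate c1 z)
  rw [l2_translate c1 z] at k5
  rw [k3] at k2
  have k6 := mul_le_mul_of_nonneg_left k5 (l2_nonneg p')
  have k7 := mul_le_mul_of_nonneg_left (k2.trans k6) (mul_nonneg zero_le_two hm)
  calc _ ≤ _ := k1
    _ ≤ _ := k7
    _ = _ := by ring

/-- The mean-field force tested with a vector field, compared with the local interaction. -/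
theorem abs_integral_transport_sub_le {K : E3 → ℝ} {r : ℝ} (hK : IsKernel K r) (hr : 0 ≤ r)
    (h1 : ∀ j, HasL2Partial j p (p1 j)) (hb : ∀ᵐ x, ‖p x‖ ≤ Cp) (h6 : MemLp p 6 volume)
    (j : Fin 3) {w : E3 → ℝ} {w1 : Fin 3 → E3 → ℝ} (hw : ∀ k, HasL2Partial k w (w1 k)) {C M : ℝ}
    (hM : 0 ≤ M) (hwC : ∀ᵐ x, ‖w x‖ ≤ C) (hwM : ∀ k, ∀ᵐ x, ‖w1 k x‖ ≤ M) :
    Integrable (fun x => (w x * (2 * cdot (p x) (p1 j x)) + w1 j x * massDensity p x)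
      * meanField K p x) volume ∧
    |2 * (∫ x, (w x * (2 * cdot (p x) (p1 j x)) + w1 j x * massDensity p x) * meanField K p x)
        - (∫ z, K z) * ∫ x, w1 j x * (massDensity p x * massDensity p x)|
      ≤ (∫ z, K z) * (16 * M * r * (∑ k, l2 (p1 k)) * l2 (fun x => ‖p x‖ ^ 3)) := by
  have hg := hasL2Partial_massDensity (h1 j) hb
  have hgb := massDensity_bound hb
  have hm : MemLp (fun x => w x * (2 * cdot (p x) (p1 j x)) + w1 j x * massDensity p x) 2 volume :=
    (memLp_smul_of_bound (hw j).mem.1 hwC hg.mem').add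
      (memLp_smul_of_bound (hw j).mem'.1 (hwM j) hg.mem)
  refine ⟨hK.integrable_mul_conv hm hg.mem, ?_⟩
  set m : E3 → ℝ := fun x => w x * (2 * cdot (p x) (p1 j x)) + w1 j x * massDensity p x with hmdef
  set g := massDensity p with hgdef
  -- Evenness of the kernel permits averaging over `z` and `-z`, the form in which the transport
  -- term can be symmetrized.
  have e1 : 2 * (∫ x, m x * meanField K p x)
      = ∫ z, K z * ((∫ x, m x * g (x - z)) + ∫ x, m x * g (x - -z)) := by
    have a1 := hK.integral_mul_conv hm hg.mem
    have a2 := hK.integral_corr_neg m g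
    have a3 := integral_add (hK.integrable_mul_corr hm hg.mem) (hK.integrable_corr_neg hm hg.mem)
    simp only [← mul_add] at a3
    rw [a3, a2, ← a1, two_mul]
    rfl
  rw [e1]
  have hInt : Integrable (fun z => K z * ((∫ x, m x * g (x - z)) + ∫ x, m x * g (x - -z)))
      volume := by
    simp only [mul_add]
    exact (hK.integrable_mul_corr hm hg.mem).add (hK.integrable_corr_neg hm hg.mem)
  refine hK.abs_integral_sub_le hInt fun z hz => ?_
  rw [integral_transport_symm (hw j) hg hwC hgb z]
  -- Two errors: the increment of `w`, at most `3 * M * ‖z‖`, and the shift of one density. They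
  -- contribute 12 and 4 to the constant 16.
  have s1 := abs_integral_lipschitz_transport_le (h1 j) h6 (m := 3 * M * ‖z‖)
    (by positivity) (ae_translate_sub_le hw hwM z)
  obtain ⟨i1, s2⟩ := integral_massDensity_translate_le h1 hb h6 z
  have mt : MemLp (fun x => g (x - z)) 2 volume := MemLp.translate hg.mem z
  have i2 : Integrable (fun x => w1 j x * (g x * g (x - z))) volume :=
    integrable_mul_of_memLp (hw j).mem' (memLp_smul_of_bound hg.mem.1 hgb mt)
  have i3 : Integrable (fun x => w1 j x * (g x * g x)) volume :=
    integrable_mul_of_memLp (hw j).mem' (memLp_smul_of_bound hg.mem.1 hgb hg.mem)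
  have s3 : |(∫ x, w1 j x * (g x * g (x - z))) - ∫ x, w1 j x * (g x * g x)|
      ≤ M * (4 * (‖z‖ * ∑ k, l2 (p1 k)) * l2 (fun x => ‖p x‖ ^ 3)) := by
    rw [← integral_sub i2 i3]
    have := norm_integral_le_of_norm_le (i1.const_mul M)
      (f := fun x => w1 j x * (g x * g (x - z)) - w1 j x * (g x * g x)) (by
        filter_upwards [hwM j] with x hx
        have : w1 j x * (g x * g (x - z)) - w1 j x * (g x * g x)
          = w1 j x * (g x * (g (x - z) - g x)) := by ring
        rw [this, norm_mul, norm_mul, Real.norm_of_nonneg (massDensity_nonneg p x)]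
        exact mul_le_mul_of_nonneg_right hx
          (mul_nonneg (massDensity_nonneg p x) (norm_nonneg _)))
    rw [integral_const_mul] at this
    exact this.trans (mul_le_mul_of_nonneg_left s2 hM)
  set S := ∑ k, l2 (p1 k) with hS
  set Q := l2 (fun x => ‖p x‖ ^ 3) with hQ
  have hSj : l2 (p1 j) ≤ S :=
    Finset.single_le_sum (f := fun k => l2 (p1 k)) (fun k _ => l2_nonneg _) (Finset.mem_univ j)
  have hQ0 : 0 ≤ Q := l2_nonneg _
  have hS0 : 0 ≤ S := (l2_nonneg _).trans hSj
  have t1 : 4 * (3 * M * ‖z‖) * l2 (p1 j) * Q ≤ 4 * (3 * M * r) * S * Q := by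
    have h0 : 3 * M * ‖z‖ ≤ 3 * M * r := mul_le_mul_of_nonneg_left hz (by linarith)
    have h1 : 0 ≤ 3 * M * r := mul_nonneg (by linarith) hr
    exact mul_le_mul_of_nonneg_right (mul_le_mul (by linarith) hSj (l2_nonneg _) (by linarith)) hQ0
  have t2 : M * (4 * (‖z‖ * S) * Q) ≤ M * (4 * (r * S) * Q) := by
    have h0 : ‖z‖ * S ≤ r * S := mul_le_mul_of_nonneg_right hz hS0
    exact mul_le_mul_of_nonneg_left (mul_le_mul_of_nonneg_right (by linarith) hQ0) hM
  have t3 := abs_add_le (∫ x, (w x - w (x - z)) * (2 * cdot (p x) (p1 j x) * g (x - z)))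
    ((∫ x, w1 j x * (g x * g (x - z))) - ∫ x, w1 j x * (g x * g x))
  rw [← add_sub_assoc] at t3
  refine t3.trans ?_
  linarith

/-- The interaction energy is bounded below by the local interaction. -/
theorem le_interaction {K : E3 → ℝ} {r : ℝ} (hK : IsKernel K r)
    (h1 : ∀ j, HasL2Partial j p (p1 j)) (hb : ∀ᵐ x, ‖p x‖ ≤ Cp) (h6 : MemLp p 6 volume) :
    (∫ z, K z) * (l2 (massDensity p) ^ 2
        - 4 * (r * ∑ j, l2 (p1 j)) * l2 (fun x => ‖p x‖ ^ 3))
      ≤ ∫ x, meanField K p x * massDensity p x := by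
  have hm := memLp_massDensity (h1 0).mem hb
  have e : l2 (massDensity p) ^ 2 = ∫ x, massDensity p x * massDensity p x := by
    rw [l2_sq hm]
    refine integral_congr_ae (Eventually.of_forall fun x => ?_)
    change ‖massDensity p x‖ ^ 2 = massDensity p x * massDensity p x
    rw [Real.norm_eq_abs, sq_abs, sq]
  have := hK.le_integral_mul_conv hm (b := 4 * (r * ∑ j, l2 (p1 j)) * l2 (fun x => ‖p x‖ ^ 3))
    fun z hz => by
      obtain ⟨i1, s1⟩ := integral_massDensity_translate_le h1 hb h6 z
      rw [← integral_sub (integrable_mul_of_memLp hm hm)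
        (integrable_mul_of_memLp hm (MemLp.translate hm z))]
      have k1 : ∫ x, (massDensity p x * massDensity p x - massDensity p x * massDensity p (x - z))
          ≤ ∫ x, massDensity p x * |massDensity p (x - z) - massDensity p x| := by
        refine integral_mono ((integrable_mul_of_memLp hm hm).sub
          (integrable_mul_of_memLp hm (MemLp.translate hm z))) i1 fun x => ?_
        change massDensity p x * massDensity p x - massDensity p x * massDensity p (x - z)
          ≤ massDensity p x * |massDensity p (x - z) - massDensity p x|
        rw [← mul_sub, abs_sub_comm]
        exact mul_le_mul_of_nonneg_left (le_abs_self _) (massDensity_nonneg p x)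
      refine (k1.trans s1).trans ?_
      have hS0 : 0 ≤ ∑ j, l2 (p1 j) := Finset.sum_nonneg fun j _ => l2_nonneg _
      have hQ0 : 0 ≤ l2 (fun x => ‖p x‖ ^ 3) := l2_nonneg _
      have h0 := mul_le_mul_of_nonneg_right hz hS0
      exact mul_le_mul_of_nonneg_right (by linarith) hQ0
  rw [e]
  refine this.trans (le_of_eq (integral_congr_ae (Eventually.of_forall fun x => ?_)))
  exact mul_comm _ _

/-- The lower bound of the interaction energy that is of second order in the radius of the
kernel. -/
theorem le_interaction_sq {K : E3 → ℝ} {r : ℝ} (hK : IsKernel K r)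
    (h1 : ∀ j, HasL2Partial j p (p1 j)) (hb : ∀ᵐ x, ‖p x‖ ≤ Cp) (hCp : 0 ≤ Cp) :
    (∫ z, K z) * (l2 (massDensity p) ^ 2 - 2 * (r * (Cp * ∑ j, l2 (p1 j))) ^ 2)
      ≤ ∫ x, meanField K p x * massDensity p x := by
  have hm := memLp_massDensity (h1 0).mem hb
  have hsq : ∀ f : E3 → ℝ, MemLp f 2 volume → l2 f ^ 2 = ∫ x, f x * f x := fun f hf => by
    rw [l2_sq hf]
    refine integral_congr_ae (Eventually.of_forall fun x => ?_)
    change ‖f x‖ ^ 2 = f x * f x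
    rw [Real.norm_eq_abs, sq_abs, sq]
  set g := massDensity p with hg
  have hgp := fun j => hasL2Partial_massDensity (h1 j) hb
  have hl : ∀ j, l2 (fun x => 2 * cdot (p x) (p1 j x)) ≤ 2 * Cp * l2 (p1 j) := fun j => by
    refine l2_le_mul (by positivity) (h1 j).mem' ?_
    filter_upwards [hb] with x hx
    rw [norm_mul, Real.norm_ofNat, mul_assoc]
    refine mul_le_mul_of_nonneg_left ((abs_cdot_le _ _).trans ?_) zero_le_two
    exact mul_le_mul_of_nonneg_right hx (norm_nonneg _)
  have := hK.le_integral_mul_conv hm (b := 2 * (r * (Cp * ∑ j, l2 (p1 j))) ^ 2) fun z hz => by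
    have mt : MemLp (fun x => g (x - z)) 2 volume := MemLp.translate hm z
    -- The deficit of the autocorrelation is exactly half the squared norm of an increment, hence
    -- quadratic in the shift. The price is a sup bound on `p`, which is controlled quantitatively
    -- only for the initial data.
    have e1 : l2 (fun x => g (x - z) - g x) ^ 2
        = 2 * ((∫ x, g x * g x) - ∫ x, g x * g (x - z)) := by
      have a1 := hsq _ (mt.sub hm)
      have a2 := hsq _ mt
      rw [l2_translate hm z, hsq _ hm] at a2
      have a3 : ∫ x, (g (x - z) - g x) * (g (x - z) - g x)
          = (∫ x, g (x - z) * g (x - z)) - 2 * (∫ x, g x * g (x - z)) + ∫ x, g x * g x := by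
        have i0 : Integrable (fun x => g (x - z) * g (x - z) - 2 * (g x * g (x - z))) volume :=
          (integrable_mul_of_memLp mt mt).sub ((integrable_mul_of_memLp hm mt).const_mul 2)
        rw [← integral_const_mul, ← integral_sub (integrable_mul_of_memLp mt mt)
          ((integrable_mul_of_memLp hm mt).const_mul 2), ← integral_add i0
          (integrable_mul_of_memLp hm hm)]
        refine integral_congr_ae (Eventually.of_forall fun x => ?_)
        ring
      have a4 : l2 (fun x => g (x - z) - g x) ^ 2
        = ∫ x, (g (x - z) - g x) * (g (x - z) - g x) := a1
      rw [a4, a3, ← a2]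
      ring
    have k := l2_translate_sub_le hgp z
    have hS0 : 0 ≤ ∑ j, l2 (p1 j) := Finset.sum_nonneg fun j _ => l2_nonneg _
    have k2 : ‖z‖ * ∑ j, l2 (fun x => 2 * cdot (p x) (p1 j x))
        ≤ r * (2 * Cp * ∑ j, l2 (p1 j)) := by
      refine mul_le_mul hz ?_ (Finset.sum_nonneg fun j _ => l2_nonneg _) ((norm_nonneg z).trans hz)
      rw [Finset.mul_sum]
      exact Finset.sum_le_sum fun j _ => hl j
    have k3 := pow_le_pow_left₀ (l2_nonneg _) (k.trans k2) 2
    rw [e1] at k3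
    linarith [k3, (by ring : (r * (2 * Cp * ∑ j, l2 (p1 j))) ^ 2
      = 4 * (r * (Cp * ∑ j, l2 (p1 j))) ^ 2)]
  rw [hsq _ hm]
  refine this.trans (le_of_eq (integral_congr_ae (Eventually.of_forall fun x => ?_)))
  exact mul_comm _ _

end Density

/-! ### Products and pairings of time-continuous families -/

section TimeContinuity

variable {F G H : Type} [NormedAddCommGroup F] [NormedSpace ℝ F] [CompleteSpace F]
  [NormedAddCommGroup G] [NormedSpace ℝ G] [CompleteSpace G]
  [NormedAddCommGroup H] [NormedSpace ℝ H] [CompleteSpace H] {T : ℝ}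

theorem L2Cont.const {f : E3 → F} (hf : MemLp f 2 volume) : L2Cont T (fun _ => f) :=
  ⟨fun _ _ => hf, fun t _ => by
    have : l2 (fun x => f x - f x) = 0 := by simp [l2]
    simp only [this]
    exact tendsto_const_nhds⟩

theorem L2Cont.add {f g : ℝ → E3 → F} (hf : L2Cont T f) (hg : L2Cont T g) :
    L2Cont T (fun t x => f t x + g t x) :=
  ⟨fun t ht => (hf.mem t ht).add (hg.mem t ht), fun t ht => by
    have h := (hf.tendsto t ht).add (hg.tendsto t ht)
    rw [add_zero] at h
    refine squeeze_zero' (Eventually.of_forall fun s => l2_nonneg _) ?_ h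
    filter_upwards [self_mem_nhdsWithin] with s hs
    have := l2_add_le ((hf.mem s hs).sub (hf.mem t ht)) ((hg.mem s hs).sub (hg.mem t ht))
    refine le_trans (le_of_eq ?_) this
    congr 1
    ext x
    simp only [Pi.sub_apply]
    abel⟩

theorem L2Cont.clm_comp {f : ℝ → E3 → F} (hf : L2Cont T f) (A : F →L[ℝ] G) :
    L2Cont T (fun t x => A (f t x)) :=
  ⟨fun t ht => A.comp_memLp' (hf.mem t ht), fun t ht => by
    have h := (hf.tendsto t ht).const_mul ‖A‖
    rw [mul_zero] at h
    refine squeeze_zero' (Eventually.of_forall fun s => l2_nonneg _) ?_ h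
    filter_upwards [self_mem_nhdsWithin] with s hs
    refine l2_le_mul (norm_nonneg A) ((hf.mem s hs).sub (hf.mem t ht))
      (Eventually.of_forall fun x => ?_)
    rw [← map_sub]
    exact A.le_opNorm _⟩

theorem L2Cont.sum {ι : Type*} (s : Finset ι) {f : ι → ℝ → E3 → F} (hf : ∀ i, L2Cont T (f i)) :
    L2Cont T (fun t x => ∑ i ∈ s, f i t x) := by
  classical
  induction s using Finset.induction_on with
  | empty =>
    simp only [Finset.sum_empty]
    exact L2Cont.const (MemLp.zero' (p := 2))
  | insert a s ha ih =>
    simp only [Finset.sum_insert ha]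
    exact (hf a).add ih

theorem SupCont.bilin {f : ℝ → E3 → F} {g : ℝ → E3 → G} (hf : SupCont T f) (hg : SupCont T g)
    (B : F →L[ℝ] G →L[ℝ] H) : SupCont T (fun t x => B (f t x) (g t x)) := by
  obtain ⟨M, hM, hfM⟩ := hf.bounded
  obtain ⟨M', hM', hgM⟩ := hg.bounded
  have hB : ∀ a b {m n : ℝ}, 0 ≤ m → ‖a‖ ≤ m → ‖b‖ ≤ n → ‖B a b‖ ≤ ‖B‖ * (m * n) :=
    fun a b m n hm ha hb => (B.le_opNorm₂ a b).trans (by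
      rw [mul_assoc]
      exact mul_le_mul_of_nonneg_left (mul_le_mul ha hb (norm_nonneg _) hm) (norm_nonneg B))
  refine ⟨⟨‖B‖ * (M * M'), by positivity, fun t ht => ?_⟩, fun t ht => ?_⟩
  · filter_upwards [hfM t ht, hgM t ht] with x h1 h2 using hB _ _ hM h1 h2
  · obtain ⟨b, hb, hfb⟩ := hf.tendsto t ht
    obtain ⟨b', hb', hgb⟩ := hg.tendsto t ht
    refine ⟨fun s => ‖B‖ * (|b s| * M') + ‖B‖ * (M * b' s), ?_, fun s hs => ?_⟩
    · have := ((hb.abs.mul_const M').const_mul ‖B‖).add ((hb'.const_mul M).const_mul ‖B‖)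
      simpa using this
    · filter_upwards [hfb s hs, hgb s hs, hfM t ht, hgM s hs] with x h1 h2 h3 h4
      have e : B (f s x) (g s x) - B (f t x) (g t x)
          = B (f s x - f t x) (g s x) + B (f t x) (g s x - g t x) := by
        simp only [map_sub, sub_apply]
        abel
      rw [e]
      refine (norm_add_le _ _).trans (add_le_add ?_ ?_)
      · exact hB _ _ (abs_nonneg _) (h1.trans (le_abs_self _)) h4
      · exact hB _ _ hM h3 h2

theorem SupCont.const {f : E3 → F} {C : ℝ} (hf : ∀ᵐ x, ‖f x‖ ≤ C) : SupCont T (fun _ => f) :=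
  ⟨⟨|C|, abs_nonneg C, fun _ _ => hf.mono fun _ h => h.trans (le_abs_self C)⟩, fun _ _ =>
    ⟨fun _ => 0, tendsto_const_nhds, fun _ _ => Eventually.of_forall fun x => by simp⟩⟩

/-- The product of a family that is continuous in `L^∞` and one that is continuous in `L²`. -/
theorem L2Cont.bilin {f : ℝ → E3 → F} {g : ℝ → E3 → G} (hf : SupCont T f)
    (hfm : ∀ t ∈ Icc 0 T, AEStronglyMeasurable (f t) volume) (hg : L2Cont T g)
    (B : F →L[ℝ] G →L[ℝ] H) : L2Cont T (fun t x => B (f t x) (g t x)) := by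
  obtain ⟨M, hM, hfM⟩ := hf.bounded
  obtain ⟨M', hM', hgM⟩ := hg.bounded
  have hB : ∀ a b {m : ℝ}, ‖a‖ ≤ m → ‖B a b‖ ≤ ‖B‖ * m * ‖b‖ := fun a b m ha =>
    (B.le_opNorm₂ a b).trans (mul_le_mul_of_nonneg_right
      (mul_le_mul_of_nonneg_left ha (norm_nonneg B)) (norm_nonneg _))
  refine ⟨fun t ht => ?_, fun t ht => ?_⟩
  · refine memLp_two_of_le (B.aestronglyMeasurable_comp₂ (hfm t ht) (hg.mem t ht).1)
      (hg.mem t ht) (C := ‖B‖ * M) ?_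
    filter_upwards [hfM t ht] with x hx using hB _ _ hx
  · obtain ⟨b, hb, hfb⟩ := hf.tendsto t ht
    have h := ((hb.abs.const_mul ‖B‖).mul_const M').add ((hg.tendsto t ht).const_mul (‖B‖ * M))
    simp only [abs_zero, mul_zero, zero_mul, add_zero] at h
    refine squeeze_zero' (Eventually.of_forall fun s => l2_nonneg _) ?_ h
    filter_upwards [self_mem_nhdsWithin] with s hs
    have md : MemLp (fun x => g s x - g t x) 2 volume := (hg.mem s hs).sub (hg.mem t ht)
    have k1 : ∀ᵐ x, ‖B (f s x - f t x) (g s x)‖ ≤ ‖B‖ * |b s| * ‖g s x‖ := by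
      filter_upwards [hfb s hs] with x hx using hB _ _ (hx.trans (le_abs_self _))
    have k2 : ∀ᵐ x, ‖B (f t x) (g s x - g t x)‖ ≤ ‖B‖ * M * ‖g s x - g t x‖ := by
      filter_upwards [hfM t ht] with x hx using hB _ _ hx
    have m1 : MemLp (fun x => B (f s x - f t x) (g s x)) 2 volume :=
      memLp_two_of_le (B.aestronglyMeasurable_comp₂ ((hfm s hs).sub (hfm t ht)) (hg.mem s hs).1)
        (hg.mem s hs) k1
    have m2 : MemLp (fun x => B (f t x) (g s x - g t x)) 2 volume :=
      memLp_two_of_le (B.aestronglyMeasurable_comp₂ (hfm t ht) md.1) md k2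
    have e : (fun x => B (f s x) (g s x) - B (f t x) (g t x))
        = fun x => B (f s x - f t x) (g s x) + B (f t x) (g s x - g t x) := by
      ext x
      simp only [map_sub, sub_apply]
      abel
    rw [e]
    refine (l2_add_le m1 m2).trans (add_le_add ?_ ?_)
    · refine (l2_le_mul (by positivity) (hg.mem s hs) k1).trans ?_
      exact mul_le_mul_of_nonneg_left (hgM s hs) (by positivity)
    · exact l2_le_mul (by positivity) md k2

/-- Time derivative of a pairing with a continuous family. -/
theorem HasTimeDeriv.tendsto_pairing_cont {f : ℝ → E3 → F} {g : E3 → F} {t : ℝ}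
    (h : HasTimeDeriv T f t g) (hf : L2Cont T f) (ht : t ∈ Icc 0 T) (B : G →L[ℝ] F →L[ℝ] ℝ)
    {w : ℝ → E3 → G} (hw : L2Cont T w) :
    Tendsto (fun s => (s - t)⁻¹ * ∫ x, B (w s x) (f s x - f t x)) (𝓝[Icc 0 T \ {t}] t)
      (𝓝 (∫ x, B (w t x) (g x))) :=
  h.tendsto_pairing hf.mem ht B hw.mem (hw.mem t ht) (hw.tendsto t ht)

end TimeContinuity

theorem ContinuousInH.l2Cont_self {F : Type} [NormedAddCommGroup F] [NormedSpace ℝ F]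
    [CompleteSpace F] {k : ℕ} {T : ℝ} {f : ℝ → E3 → F} (h : ContinuousInH k T f) : L2Cont T f :=
  h.l2Cont [] (Nat.zero_le _)

theorem ContinuousInH.l2Cont_one {F : Type} [NormedAddCommGroup F] [NormedSpace ℝ F]
    [CompleteSpace F] {k : ℕ} {T : ℝ} {f : ℝ → E3 → F} (h : ContinuousInH k T f) (hk : 1 ≤ k)
    (j : Fin 3) : L2Cont T (fun t => weakPartial j (f t)) :=
  h.l2Cont [j] hk

theorem ContinuousInH.l2Cont_two {F : Type} [NormedAddCommGroup F] [NormedSpace ℝ F]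
    [CompleteSpace F] {k : ℕ} {T : ℝ} {f : ℝ → E3 → F} (h : ContinuousInH k T f) (hk : 2 ≤ k)
    (i j : Fin 3) : L2Cont T (fun t => weakPartial i (weakPartial j (f t))) :=
  h.l2Cont [i, j] hk

/-- `|a|² - |b|²` is the real inner product of `a + b` and `a - b`, to which Cauchy–Schwarz applies.
-/
theorem L2Cont.integral_abs_massDensity_sub_le {T : ℝ} {φ : ℝ → E3 → ℂ} (h : L2Cont T φ) {t s : ℝ} (ht : t ∈ Icc 0 T)
    (hs : s ∈ Icc 0 T) :
    ∫ x, |massDensity (φ s) x - massDensity (φ t) x|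
      ≤ (l2 (φ s) + l2 (φ t)) * l2 (fun x => φ s x - φ t x) := by
  have ms := h.mem s hs
  have mt := h.mem t ht
  have m1 : MemLp (fun x => φ s x + φ t x) 2 volume := ms.add mt
  have m2 : MemLp (fun x => φ s x - φ t x) 2 volume := ms.sub mt
  have e : ∀ x, |massDensity (φ s) x - massDensity (φ t) x|
      = ‖cdot (φ s x + φ t x) (φ s x - φ t x)‖ := fun x => by
    rw [massDensity, massDensity, ← cdot_self, ← cdot_self]
    simp only [cdot_apply, Complex.add_re, Complex.add_im, Complex.sub_re, Complex.sub_im,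
      Real.norm_eq_abs]
    congr 1
    ring
  simp only [e]
  refine (norm_integral_bilin_le cdot m1 m2).trans ?_
  have h1 := l2_add_le ms mt
  have h2 := l2_nonneg (fun x => φ s x - φ t x)
  calc ‖cdot‖ * (l2 (fun x => φ s x + φ t x) * l2 (fun x => φ s x - φ t x))
      ≤ 1 * ((l2 (φ s) + l2 (φ t)) * l2 (fun x => φ s x - φ t x)) :=
        mul_le_mul norm_cdot_le (mul_le_mul_of_nonneg_right h1 h2)
          (mul_nonneg (l2_nonneg _) h2) zero_le_one
    _ = _ := one_mul _

/-- The mean field of a family that is continuous in `L²` is continuous in `L^∞`. -/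
theorem IsKernel.supCont_meanField {K : E3 → ℝ} {r T : ℝ} (hK : IsKernel K r) {φ : ℝ → E3 → ℂ}
    (h : L2Cont T φ) : SupCont T (fun t => meanField K (φ t)) := by
  obtain ⟨B, hB⟩ := hK.bounded
  have hB0 : 0 ≤ B := (hK.nonneg 0).trans (hB 0)
  obtain ⟨M, hM, hφ⟩ := h.bounded
  have hi := fun t (ht : t ∈ Icc 0 T) => integrable_massDensity (h.mem t ht)
  refine ⟨⟨B * M ^ 2, by positivity, fun t ht => Eventually.of_forall fun x => ?_⟩, fun t ht => ?_⟩
  · refine (hK.abs_conv_le hB (hi t ht) x).trans (mul_le_mul_of_nonneg_left ?_ hB0)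
    have e : ∫ y, |massDensity (φ t) y| = l2 (φ t) ^ 2 := by
      rw [l2_sq (h.mem t ht)]
      refine integral_congr_ae (Eventually.of_forall fun y => ?_)
      exact abs_of_nonneg (massDensity_nonneg _ y)
    rw [e]
    exact pow_le_pow_left₀ (l2_nonneg _) (hφ t ht) 2
  · refine ⟨fun s => B * (2 * M * l2 (fun x => φ s x - φ t x)), ?_, fun s hs =>
      Eventually.of_forall fun x => ?_⟩
    · simpa using ((h.tendsto t ht).const_mul (2 * M)).const_mul B
    · rw [meanField, meanField, hK.conv_sub (hi s hs) (hi t ht)]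
      refine (hK.abs_conv_le hB ((hi s hs).sub (hi t ht)) x).trans
        (mul_le_mul_of_nonneg_left ?_ hB0)
      refine (h.integral_abs_massDensity_sub_le ht hs).trans (mul_le_mul_of_nonneg_right ?_ (l2_nonneg _))
      linarith [hφ s hs, hφ t ht]

/-- The functionals below have increments that are exact pairings with `φ s - φ t`. Dividing by `s -
t` and passing to the limit in the pairing then replaces a product rule for curves in `L²`. -/
theorem hasDerivWithinAt_of_tendsto {T t a : ℝ} {f D : ℝ → ℝ}
    (hD : ∀ s ∈ Icc 0 T, f s - f t = D s)
    (h : Tendsto (fun s => (s - t)⁻¹ * D s) (𝓝[Icc 0 T \ {t}] t) (𝓝 a)) :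
    HasDerivWithinAt f a (Icc 0 T) t := by
  rw [hasDerivWithinAt_iff_tendsto_slope]
  refine h.congr' ?_
  filter_upwards [self_mem_nhdsWithin] with s hs
  rw [slope_def_field, hD s hs.1, div_eq_inv_mul]

theorem eq_of_hasDerivWithinAt_zero {T : ℝ} (hT : 0 < T) {f : ℝ → ℝ}
    (h : ∀ t ∈ Icc 0 T, HasDerivWithinAt f 0 (Icc 0 T) t) {t : ℝ} (ht : t ∈ Icc 0 T) :
    f t = f 0 :=
  constant_of_derivWithin_zero (fun s hs => (h s hs).differentiableWithinAt)
    (fun s hs => (h s ⟨hs.1, hs.2.le⟩).derivWithin (uniqueDiffOn_Icc hT s ⟨hs.1, hs.2.le⟩)) t ht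

/-! ### Exact increments of mass and energy -/

section Fixed

variable {ε c : ℝ} {K : E3 → ℝ} {r : ℝ}

theorem l2_sq_eq_integral_cdot {p : E3 → ℂ} (hp : MemLp p 2 volume) :
    l2 p ^ 2 = ∫ x, cdot (p x) (p x) := by
  rw [l2_sq hp]
  simp only [cdot_self]

/-- Polarization writes the increment linearly in `p - p'`, as `hasDerivWithinAt_of_tendsto`
requires. -/
theorem l2_sq_sub {p p' : E3 → ℂ} (hp : MemLp p 2 volume) (hp' : MemLp p' 2 volume) :
    l2 p ^ 2 - l2 p' ^ 2 = ∫ x, cdot (p x + p' x) (p x - p' x) := by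
  rw [l2_sq_eq_integral_cdot hp, l2_sq_eq_integral_cdot hp',
    ← integral_sub (integrable_bilin cdot hp hp) (integrable_bilin cdot hp' hp')]
  refine integral_congr_ae (Eventually.of_forall fun x => ?_)
  simp only [cdot_apply, Complex.add_re, Complex.add_im, Complex.sub_re, Complex.sub_im]
  ring

/-- The generator is skew: the potential is real and drops out pointwise, and the Laplacian drops
out after one integration by parts since `∂φ` is orthogonal to `i ∂φ`. -/
theorem integral_cdot_gpVelocity {p : E3 → ℂ} (hε : ε ≠ 0) (hp : MemH 2 p) (V : E3 → ℝ) :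
    ∫ x, cdot (p x) (gpVelocity ε (∑ j, weakPartial j (weakPartial j p) x) (V x) (p x)) = 0 := by
  have n := (NullIntegral.sum fun j => ((memH_weakPartial hp j).hasL2Partial j).nullIntegral
    ((hp.hasL2Partial j).clm_comp (ContinuousLinearMap.mul ℝ ℂ Complex.I)) cdot).const_mul (-(ε / 2))
  rw [← n.zero]
  refine integral_congr_ae (Eventually.of_forall fun x => ?_)
  simp only [cdot_apply, gpVelocity_re hε, gpVelocity_im hε, Fin.sum_univ_three,
    ContinuousLinearMap.mul_apply', Complex.mul_re, Complex.mul_im, Complex.I_re, Complex.I_im,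
    Complex.add_re, Complex.add_im]
  ring

theorem integrable_kineticDensity {p : E3 → ℂ} (hp : MemH 1 p) :
    Integrable (kineticDensity ε p) volume := by
  refine integrable_finsetSum _ fun j _ => ?_
  have h : MemLp (fun x => Complex.I * (ε : ℂ) * weakPartial j p x) 2 volume :=
    (hp.hasL2Partial j).mem'.const_mul _
  exact h.integrable_norm_pow (by norm_num)

theorem integral_kineticDensity {p : E3 → ℂ} (hp : MemH 1 p) :
    ∫ x, kineticDensity ε p x = ε ^ 2 * ∑ j, l2 (weakPartial j p) ^ 2 := by
  have h : ∀ j, MemLp (fun x => Complex.I * (ε : ℂ) * weakPartial j p x) 2 volume := fun j =>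
    (hp.hasL2Partial j).mem'.const_mul _
  simp only [kineticDensity]
  rw [integral_finsetSum _ fun j _ => (h j).integrable_norm_pow (by norm_num), Finset.mul_sum]
  refine Finset.sum_congr rfl fun j _ => ?_
  rw [l2_sq (hp.hasL2Partial j).mem', ← integral_const_mul]
  refine integral_congr_ae (Eventually.of_forall fun x => ?_)
  simp [mul_pow]

theorem meanField_aestronglyMeasurable (hK : IsKernel K r) {p : E3 → ℂ} (hp : MemLp p 2 volume) :
    AEStronglyMeasurable (meanField K p) volume :=
  hK.aestronglyMeasurable_conv (integrable_massDensity hp)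

theorem exists_meanField_bound (hK : IsKernel K r) {p : E3 → ℂ} (hp : MemLp p 2 volume) :
    ∃ C, ∀ x, ‖meanField K p x‖ ≤ C := by
  obtain ⟨B, hB⟩ := hK.bounded
  exact ⟨_, fun x => hK.abs_conv_le hB (integrable_massDensity hp) x⟩

/-- Symmetry of the convolution cancels the mixed terms, so the increment of the quadratic form
factors into the sum of the mean fields times the difference of the densities. -/
theorem interaction_sub (hK : IsKernel K r) {p p' : E3 → ℂ} (hp : MemH 2 p) (hp' : MemH 2 p') :
    (∫ x, meanField K p x * massDensity p x) - ∫ x, meanField K p' x * massDensity p' x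
      = ∫ x, cdot ((meanField K p x + meanField K p' x) • (p x + p' x)) (p x - p' x) := by
  obtain ⟨C, hC⟩ := hp.exists_bound hasSupBound_complex le_rfl
  obtain ⟨C', hC'⟩ := hp'.exists_bound hasSupBound_complex le_rfl
  have m := memLp_massDensity hp.memLp hC
  have m' := memLp_massDensity hp'.memLp hC'
  have e := hK.integral_mul_conv_comm m m'
  have i1 := hK.integrable_mul_conv m m
  have i2 := hK.integrable_mul_conv m' m
  have i3 := hK.integrable_mul_conv m m'
  have i4 := hK.integrable_mul_conv m' m'
  have e1 : ∫ x, meanField K p x * massDensity p x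
      = ∫ x, massDensity p x * (K ⋆[ContinuousLinearMap.lsmul ℝ ℝ, volume] massDensity p) x :=
    integral_congr_ae (Eventually.of_forall fun x => mul_comm _ _)
  have e2 : ∫ x, meanField K p' x * massDensity p' x
      = ∫ x, massDensity p' x * (K ⋆[ContinuousLinearMap.lsmul ℝ ℝ, volume] massDensity p') x :=
    integral_congr_ae (Eventually.of_forall fun x => mul_comm _ _)
  have e3 : ∫ x, cdot ((meanField K p x + meanField K p' x) • (p x + p' x)) (p x - p' x)
      = ((∫ x, massDensity p x * (K ⋆[ContinuousLinearMap.lsmul ℝ ℝ, volume] massDensity p) x)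
        - ∫ x, massDensity p' x * (K ⋆[ContinuousLinearMap.lsmul ℝ ℝ, volume] massDensity p) x)
      + ((∫ x, massDensity p x * (K ⋆[ContinuousLinearMap.lsmul ℝ ℝ, volume] massDensity p') x)
        - ∫ x, massDensity p' x
          * (K ⋆[ContinuousLinearMap.lsmul ℝ ℝ, volume] massDensity p') x) := by
    have a := integral_add (i1.sub i2) (i3.sub i4)
    simp only [Pi.sub_apply] at a
    rw [← integral_sub i1 i2, ← integral_sub i3 i4, ← a]
    refine integral_congr_ae (Eventually.of_forall fun x => ?_)
    have m1 : massDensity p x = cdot (p x) (p x) := congrFun (massDensity_eq p) x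
    have m2 : massDensity p' x = cdot (p' x) (p' x) := congrFun (massDensity_eq p') x
    beta_reduce
    rw [m1, m2]
    simp only [cdot_apply, Complex.add_re, Complex.add_im, Complex.sub_re, Complex.sub_im,
      Complex.smul_re, Complex.smul_im, smul_eq_mul, meanField]
    ring
  rw [e3, e1, e2]
  linarith

/-- The kinetic increment is integrated by parts so that it pairs with `p - p'` itself. Thus only
`φ`, and not its gradient, has to be differentiated in time. -/
theorem energy_sub (hK : IsKernel K r) {p p' : E3 → ℂ} (hp : MemH 2 p) (hp' : MemH 2 p') :
    energy ε K p - energy ε K p'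
      = (-(ε ^ 2 / 2) * ∑ j, ∫ x, cdot (weakPartial j (weakPartial j p) x
          + weakPartial j (weakPartial j p') x) (p x - p' x))
        + 1 / 2 * ∫ x, cdot ((meanField K p x + meanField K p' x) • (p x + p' x)) (p x - p' x) := by
  have h : ∀ j, l2 (weakPartial j p) ^ 2 - l2 (weakPartial j p') ^ 2
      = -∫ x, cdot (weakPartial j (weakPartial j p) x + weakPartial j (weakPartial j p') x)
        (p x - p' x) := fun j => by
    rw [l2_sq_sub (hp.hasL2Partial j).mem' (hp'.hasL2Partial j).mem']
    exact (((memH_weakPartial hp j).hasL2Partial j).add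
      ((memH_weakPartial hp' j).hasL2Partial j)).integral_bilin
      ((hp.hasL2Partial j).sub (hp'.hasL2Partial j)) cdot
  rw [energy, energy, integral_kineticDensity (hp.mono (by norm_num)),
    integral_kineticDensity (hp'.mono (by norm_num)), ← interaction_sub hK hp hp']
  have e : ∑ j, ∫ x, cdot (weakPartial j (weakPartial j p) x + weakPartial j (weakPartial j p') x)
        (p x - p' x) = -(∑ j, l2 (weakPartial j p) ^ 2 - ∑ j, l2 (weakPartial j p') ^ 2) := by
    rw [← Finset.sum_sub_distrib, ← Finset.sum_neg_distrib]
    exact Finset.sum_congr rfl fun j _ => by rw [h j, neg_neg]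
  rw [e]
  ring

end Fixed

/-! ### Conservation of mass and energy -/

section Conservation

variable {ε : ℝ} {K : E3 → ℝ} {r T : ℝ} {φ : ℝ → E3 → ℂ}

theorem IsModifiedGPSolution.timeDeriv (hφ : IsModifiedGPSolution ε K T φ) {t : ℝ}
    (ht : t ∈ Icc 0 T) : HasTimeDeriv T φ t fun x =>
      gpVelocity ε (∑ j, weakPartial j (weakPartial j (φ t)) x) (meanField K (φ t) x) (φ t x) :=
  hφ.equation t ht

theorem IsModifiedGPSolution.l2_eq (hφ : IsModifiedGPSolution ε K T φ) (hε : ε ≠ 0) (hT : 0 < T)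
    {t : ℝ} (ht : t ∈ Icc 0 T) : l2 (φ t) = l2 (φ 0) := by
  have hc := hφ.regularity.l2Cont_self
  have h : l2 (φ t) ^ 2 = l2 (φ 0) ^ 2 := by
    refine eq_of_hasDerivWithinAt_zero hT (f := fun t => l2 (φ t) ^ 2) (fun t ht => ?_) ht
    refine hasDerivWithinAt_of_tendsto (fun s hs => l2_sq_sub (hc.mem s hs) (hc.mem t ht)) ?_
    have := (hφ.timeDeriv ht).tendsto_pairing_cont hc ht cdot (hc.add (L2Cont.const (hc.mem t ht)))
    convert this using 2
    have e := integral_cdot_gpVelocity hε ((hφ.regularity.1 t ht).mono (by norm_num))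
      (meanField K (φ t))
    rw [eq_comm, ← mul_zero (2 : ℝ), ← e, ← integral_const_mul]
    refine integral_congr_ae (Eventually.of_forall fun x => ?_)
    simp only [map_add, add_apply]
    ring
  have h1 := l2_nonneg (φ t)
  have h2 := l2_nonneg (φ 0)
  exact (pow_left_inj₀ h1 h2 two_ne_zero).1 h

/-- The velocity is `(iε)⁻¹` times half the limiting weight of the increment, so the limiting
pairing vanishes pointwise and no further integration by parts is needed. -/
theorem IsModifiedGPSolution.hasDerivWithinAt_energy (hφ : IsModifiedGPSolution ε K T φ)
    (hK : IsKernel K r) (hε : ε ≠ 0) {t : ℝ} (ht : t ∈ Icc 0 T) :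
    HasDerivWithinAt (fun t => energy ε K (φ t)) 0 (Icc 0 T) t := by
  have hc := hφ.regularity.l2Cont_self
  have hH : ∀ t ∈ Icc 0 T, MemH 2 (φ t) := fun t ht => (hφ.regularity.1 t ht).mono (by norm_num)
  refine hasDerivWithinAt_of_tendsto (fun s hs => energy_sub hK (hH s hs) (hH t ht)) ?_
  have hV := hK.supCont_meanField hc
  have hVm : ∀ t ∈ Icc 0 T, AEStronglyMeasurable (meanField K (φ t)) volume := fun t ht =>
    meanField_aestronglyMeasurable hK (hc.mem t ht)
  have c1 := fun j => (hφ.regularity.l2Cont_two (by norm_num) j j).add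
    (L2Cont.const ((hφ.regularity.l2Cont_two (by norm_num) j j).mem t ht) (T := T))
  have cs := hc.add (L2Cont.const (hc.mem t ht) (T := T))
  obtain ⟨C, hC⟩ := exists_meanField_bound hK (hc.mem t ht)
  have c2 := (L2Cont.bilin hV hVm cs (ContinuousLinearMap.lsmul ℝ ℝ)).add
    (L2Cont.bilin (SupCont.const (Eventually.of_forall hC)) (fun _ _ => hVm t ht) cs
      (ContinuousLinearMap.lsmul ℝ ℝ))
  have l1 := fun j => (hφ.timeDeriv ht).tendsto_pairing_cont hc ht cdot (c1 j)
  have l2' := (hφ.timeDeriv ht).tendsto_pairing_cont hc ht cdot c2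
  have l3 := ((tendsto_finsetSum Finset.univ fun j _ => l1 j).const_mul (-(ε ^ 2 / 2))).add
    (l2'.const_mul (1 / 2))
  have hq := (hφ.timeDeriv ht).1
  set q : E3 → ℂ := fun x =>
    gpVelocity ε (∑ j, weakPartial j (weakPartial j (φ t)) x) (meanField K (φ t) x) (φ t x)
    with hqdef
  have e0 : -(ε ^ 2 / 2) * (∑ j, ∫ x, cdot (weakPartial j (weakPartial j (φ t)) x
        + weakPartial j (weakPartial j (φ t)) x) (q x))
      + 1 / 2 * (∫ x, cdot (ContinuousLinearMap.lsmul ℝ ℝ (meanField K (φ t) x) (φ t x + φ t x)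
        + ContinuousLinearMap.lsmul ℝ ℝ (meanField K (φ t) x) (φ t x + φ t x)) (q x)) = 0 := by
    have i1 := fun j => integrable_bilin cdot ((c1 j).mem t ht) hq
    have i2 := integrable_bilin cdot (c2.mem t ht) hq
    rw [← integral_finsetSum _ fun j _ => i1 j, ← integral_const_mul, ← integral_const_mul,
      ← integral_add ((integrable_finsetSum _ fun j _ => i1 j).const_mul _) (i2.const_mul _)]
    rw [← integral_zero E3 ℝ]
    refine integral_congr_ae (Eventually.of_forall fun x => ?_)
    simp only [hqdef, cdot_apply, gpVelocity_re hε, gpVelocity_im hε, Fin.sum_univ_three,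
      ContinuousLinearMap.lsmul_apply, Complex.add_re, Complex.add_im, Complex.smul_re,
      Complex.smul_im, smul_eq_mul]
    have he : ε * ε⁻¹ = 1 := mul_inv_cancel₀ hε
    linear_combination (-(ε * meanField K (φ t) x * ((φ t x).im
      * ((weakPartial 0 (weakPartial 0 (φ t)) x).re + (weakPartial 1 (weakPartial 1 (φ t)) x).re
        + (weakPartial 2 (weakPartial 2 (φ t)) x).re) - (φ t x).re
      * ((weakPartial 0 (weakPartial 0 (φ t)) x).im + (weakPartial 1 (weakPartial 1 (φ t)) x).im
        + (weakPartial 2 (weakPartial 2 (φ t)) x).im)))) * he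
  rw [e0] at l3
  refine l3.congr fun s => ?_
  rw [← Finset.mul_sum]
  have e3 : ∀ x, ContinuousLinearMap.lsmul ℝ ℝ (meanField K (φ s) x) (φ s x + φ t x)
      + ContinuousLinearMap.lsmul ℝ ℝ (meanField K (φ t) x) (φ s x + φ t x)
      = (meanField K (φ s) x + meanField K (φ t) x) • (φ s x + φ t x) := fun x => by
    rw [add_smul]; rfl
  simp only [e3]
  ring

theorem IsModifiedGPSolution.energy_eq (hφ : IsModifiedGPSolution ε K T φ) (hK : IsKernel K r)
    (hε : ε ≠ 0) (hT : 0 < T) {t : ℝ} (ht : t ∈ Icc 0 T) :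
    energy ε K (φ t) = energy ε K (φ 0) :=
  eq_of_hasDerivWithinAt_zero hT (f := fun t => energy ε K (φ t))
    (fun _ ht => hφ.hasDerivWithinAt_energy hK hε ht) ht

end Conservation

/-! ### The first-order operator generated by the Euler fields -/

theorem drift_eq_sum (ε c : ℝ) (u d : Fin 3 → ℝ) (r : ℝ) (p1 : Fin 3 → ℂ) (p : ℂ) :
    drift ε c u (∑ j, d j) r p1 p
      = Complex.I * (ε : ℂ) * (∑ j, (u j • p1 j + (1 / 2 : ℝ) • (d j • p)))
        + (∑ j, (1 / 2 : ℝ) • ((u j * u j) • p) + (-c) • (r • p)) := by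
  simp only [drift, Fin.sum_univ_three, Complex.real_smul]
  push_cast
  ring

theorem L2Cont.drift {T : ℝ} (ε c : ℝ) {u d : Fin 3 → ℝ → E3 → ℝ} {ρ : ℝ → E3 → ℝ}
    {p1 : Fin 3 → ℝ → E3 → ℂ} {p : ℝ → E3 → ℂ} (hu : ∀ j, SupCont T (u j))
    (hum : ∀ j, ∀ t ∈ Icc 0 T, AEStronglyMeasurable (u j t) volume) (hd : ∀ j, SupCont T (d j))
    (hdm : ∀ j, ∀ t ∈ Icc 0 T, AEStronglyMeasurable (d j t) volume) (hρ : SupCont T ρ)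
    (hρm : ∀ t ∈ Icc 0 T, AEStronglyMeasurable (ρ t) volume) (hp1 : ∀ j, L2Cont T (p1 j))
    (hp : L2Cont T p) :
    L2Cont T (fun t x => drift ε c (fun j => u j t x) (∑ j, d j t x) (ρ t x) (fun j => p1 j t x)
      (p t x)) := by
  -- In this form every term is a bounded coefficient, continuous in `L^∞`, times a curve continuous
  -- in `L²`.
  simp only [drift_eq_sum]
  have hs : ∀ (a : ℝ) {f : ℝ → E3 → ℂ}, L2Cont T f → L2Cont T (fun t x => a • f t x) :=
    fun a f hf => hf.clm_comp (a • ContinuousLinearMap.id ℝ ℂ)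
  refine L2Cont.add ?_ (L2Cont.add ?_ ?_)
  · refine (L2Cont.sum Finset.univ fun j => L2Cont.add ?_ (hs _ ?_)).clm_comp
      (ContinuousLinearMap.mul ℝ ℂ (Complex.I * (ε : ℂ)))
    · exact L2Cont.bilin (hu j) (hum j) (hp1 j) (ContinuousLinearMap.lsmul ℝ ℝ)
    · exact L2Cont.bilin (hd j) (hdm j) hp (ContinuousLinearMap.lsmul ℝ ℝ)
  · refine L2Cont.sum Finset.univ fun j => hs _ ?_
    exact L2Cont.bilin ((hu j).bilin (hu j) (ContinuousLinearMap.mul ℝ ℝ))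
      (fun t ht => (hum j t ht).mul (hum j t ht)) hp (ContinuousLinearMap.lsmul ℝ ℝ)
  · exact hs _ (L2Cont.bilin hρ hρm hp (ContinuousLinearMap.lsmul ℝ ℝ))

/-- The first order operator `iε(u·∇ + ½ div u) + ½|u|² - cρ`. -/
def driftField (ε c : ℝ) (u : Fin 3 → E3 → ℝ) (ρ : E3 → ℝ) (p : E3 → ℂ) (x : E3) : ℂ :=
  drift ε c (fun j => u j x) (∑ j, weakPartial j (u j) x) (ρ x) (fun j => weakPartial j p x) (p x)

section Fixed

variable {ε c : ℝ} {u : Fin 3 → E3 → ℝ} {ρ : E3 → ℝ}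

theorem memLp_driftField {p : E3 → ℂ} (hu : ∀ j, MemH 4 (u j)) (hρ : MemH 2 ρ) (hp : MemH 1 p) :
    MemLp (driftField ε c u ρ p) 2 volume := by
  have hCu := fun j => (hu j).exists_bound hasSupBound_real (by norm_num)
  have hCd := fun j => (memH_weakPartial (hu j) j).exists_bound hasSupBound_real (by norm_num)
  obtain ⟨Cρ, hCρ⟩ := hρ.exists_bound hasSupBound_real le_rfl
  choose Cu hCu using hCu
  choose Cd hCd using hCd
  -- Constant curves on the degenerate interval `[0, 0]` reduce the claim to the time-dependent
  -- lemma.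
  have := L2Cont.drift (T := 0) ε c (u := fun j _ => u j) (d := fun j _ => weakPartial j (u j))
    (ρ := fun _ => ρ) (p1 := fun j _ => weakPartial j p) (p := fun _ => p)
    (fun j => SupCont.const (hCu j)) (fun j _ _ => (hu j).memLp.1)
    (fun j => SupCont.const (hCd j)) (fun j _ _ => (memH_weakPartial (hu j) j).memLp.1)
    (SupCont.const hCρ) (fun _ _ => hρ.memLp.1) (fun j => L2Cont.const (hp.hasL2Partial j).mem')
    (L2Cont.const hp.memLp)
  exact this.mem 0 (by simp)

/-- The operator is symmetric. -/
theorem integral_cdot_driftField_comm {f g : E3 → ℂ} (hu : ∀ j, MemH 4 (u j)) (hρ : MemH 2 ρ)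
    (hf : MemH 2 f) (hg : MemH 1 g) :
    ∫ x, cdot (driftField ε c u ρ f x) (g x) = ∫ x, cdot (f x) (driftField ε c u ρ g x) := by
  have hCu := fun j => (hu j).exists_bound hasSupBound_real (by norm_num)
  obtain ⟨Cf, hCf⟩ := hf.exists_bound hasSupBound_complex le_rfl
  choose Cu hCu using hCu
  -- Only the part with `iε` fails to be symmetric pointwise. The term `½ div u` is what makes its
  -- antisymmetric remainder the exact derivative `ε ∂ⱼ(uⱼ (i f)·g)`.
  have n := (NullIntegral.sum fun j => ((hu j).hasL2Partial j).nullIntegral_smul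
    ((hf.hasL2Partial j).clm_comp (ContinuousLinearMap.mul ℝ ℂ Complex.I)) (hg.hasL2Partial j)
    (hCu j) (D := Cf) (by
      filter_upwards [hCf] with x hx
      simpa using hx) cdot).const_mul ε
  have i1 := integrable_bilin cdot (memLp_driftField (ε := ε) (c := c) hu hρ
    (hf.mono (by norm_num))) hg.memLp
  have i2 := integrable_bilin cdot hf.memLp (memLp_driftField (ε := ε) (c := c) hu hρ hg)
  rw [← sub_eq_zero, ← integral_sub i1 i2, ← n.zero]
  refine integral_congr_ae (Eventually.of_forall fun x => ?_)
  simp only [driftField, drift, cdot_apply, Fin.sum_univ_three, ContinuousLinearMap.mul_apply',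
    Complex.mul_re, Complex.mul_im, Complex.I_re, Complex.I_im, Complex.add_re, Complex.add_im,
    Complex.ofReal_re, Complex.ofReal_im]
  ring

theorem memLp_modulated {p : E3 → ℂ} {w : E3 → ℝ} {C : ℝ} (hw : MemLp w 2 volume)
    (hC : ∀ᵐ x, ‖w x‖ ≤ C) (hp : MemH 1 p) (j : Fin 3) :
    MemLp (fun x => Complex.I * (ε : ℂ) * weakPartial j p x + (w x : ℂ) * p x) 2 volume := by
  refine ((hp.hasL2Partial j).mem'.const_mul _).add ?_
  refine (memLp_smul_of_bound hw.1 hC hp.memLp).congr_norm ?_ ?_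
  · exact (Complex.continuous_ofReal.comp_aestronglyMeasurable hw.1).mul hp.memLp.1
  · exact Eventually.of_forall fun x => by simp

/-- The modulated energy in terms of the energy. -/
theorem modulatedEnergy_eq {K : E3 → ℝ} {p : E3 → ℂ} {u : E3 → E3}
    (hu : ∀ j, MemH 4 fun x => u x j) (hρ : MemH 2 ρ) (hp : MemH 2 p) :
    modulatedEnergy ε c K p ρ u = energy ε K p
      + (∫ x, cdot (driftField ε c (fun j x => u x j) ρ p x) (p x)) + c / 2 * ∫ x, ρ x * ρ x := by
  have hCu := fun j => (hu j).exists_bound hasSupBound_real (by norm_num)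
  choose Cu hCu using hCu
  obtain ⟨C, hC⟩ := hp.exists_bound hasSupBound_complex le_rfl
  have hp1 : MemH 1 p := hp.mono (by norm_num)
  have hm := memLp_massDensity hp.memLp hC
  have iD : Integrable (fun x => ∑ j : Fin 3,
      ‖Complex.I * (ε : ℂ) * weakPartial j p x + ((u x j : ℝ) : ℂ) * p x‖ ^ 2) volume :=
    integrable_finsetSum _ fun j _ =>
      (memLp_modulated (hu j).memLp (hCu j) hp1 j).integrable_norm_pow (by norm_num)
  have iK := integrable_kineticDensity (ε := ε) hp1
  have iS := integrable_bilin cdot (memLp_driftField (ε := ε) (c := c) hu hρ hp1) hp.memLp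
  have iρ := integrable_mul_of_memLp hρ.memLp hρ.memLp
  have iρm := integrable_mul_of_memLp hρ.memLp hm
  have iQ : Integrable (fun x => ρ x ^ 2 - 2 * ρ x * massDensity p x) volume := by
    refine (iρ.sub (iρm.const_mul 2)).congr (Eventually.of_forall fun x => ?_)
    change ρ x * ρ x - 2 * (ρ x * massDensity p x) = _
    ring
  rw [modulatedEnergy, energy]
  have key : 1 / 2 * (∫ x, ∑ j : Fin 3,
        ‖Complex.I * (ε : ℂ) * weakPartial j p x + ((u x j : ℝ) : ℂ) * p x‖ ^ 2)
      + c / 2 * (∫ x, (ρ x ^ 2 - 2 * ρ x * massDensity p x))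
      = 1 / 2 * (∫ x, kineticDensity ε p x)
        + (∫ x, cdot (driftField ε c (fun j x => u x j) ρ p x) (p x))
        + c / 2 * ∫ x, ρ x * ρ x := by
    simp only [← integral_const_mul]
    rw [← integral_add (iD.const_mul _) (iQ.const_mul _), ← integral_add (iK.const_mul _) iS]
    have i3 : Integrable (fun x => 1 / 2 * kineticDensity ε p x
      + cdot (driftField ε c (fun j x => u x j) ρ p x) (p x)) volume := (iK.const_mul _).add iS
    rw [← integral_add i3 (iρ.const_mul _)]
    refine integral_congr_ae (Eventually.of_forall fun x => ?_)
    simp only [kineticDensity, massDensity, ← cdot_self, driftField, drift, cdot_apply,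
      Fin.sum_univ_three, Complex.mul_re, Complex.mul_im, Complex.I_re, Complex.I_im,
      Complex.add_re, Complex.add_im, Complex.ofReal_re, Complex.ofReal_im]
    ring
  linarith

end Fixed

theorem memLp_cdot_modulation (ε : ℝ) {p : E3 → ℂ} (hp : MemH 2 p) (j : Fin 3) :
    MemLp (fun x => cdot (Complex.I * (ε : ℂ) * weakPartial j p x) (p x)) 2 volume := by
  obtain ⟨C, hC⟩ := hp.exists_bound hasSupBound_complex le_rfl
  have h : MemLp (fun x => Complex.I * (ε : ℂ) * weakPartial j p x) 2 volume :=
    (hp.hasL2Partial j).mem'.const_mul _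
  refine memLp_two_of_le (C := C) (cdot.aestronglyMeasurable_comp₂ h.1 hp.memLp.1) h ?_
  filter_upwards [hC] with x hx
  rw [mul_comm C]
  exact (abs_cdot_le _ _).trans (mul_le_mul_of_nonneg_left hx (norm_nonneg _))

/-- The increment of the quadratic form of the drift operator. -/
theorem integral_driftField_sub {ε c : ℝ} {u u' : Fin 3 → E3 → ℝ} {ρ ρ' : E3 → ℝ} {p p' : E3 → ℂ}
    (hu : ∀ j, MemH 4 (u j)) (hu' : ∀ j, MemH 4 (u' j)) (hρ : MemH 2 ρ) (hρ' : MemH 2 ρ')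
    (hp : MemH 2 p) (hp' : MemH 2 p') :
    (∫ x, cdot (driftField ε c u ρ p x) (p x)) - ∫ x, cdot (driftField ε c u' ρ' p' x) (p' x)
      = (∫ x, cdot (driftField ε c u ρ p x + driftField ε c u ρ p' x) (p x - p' x))
        + (∑ j, ∫ x, (cdot (Complex.I * (ε : ℂ) * weakPartial j p' x) (p' x)
            + 1 / 2 * (massDensity p' x * (u j x + u' j x))) * (u j x - u' j x))
        + ∫ x, -c * massDensity p' x * (ρ x - ρ' x) := by
  obtain ⟨C', hC'⟩ := hp'.exists_bound hasSupBound_complex le_rfl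
  have hp1 : MemH 1 p := hp.mono (by norm_num)
  have hp1' : MemH 1 p' := hp'.mono (by norm_num)
  have hm := memLp_massDensity hp'.memLp hC'
  have mS := memLp_driftField (ε := ε) (c := c) hu hρ hp1
  have mS' := memLp_driftField (ε := ε) (c := c) hu hρ hp1'
  have mS'' := memLp_driftField (ε := ε) (c := c) hu' hρ' hp1'
  have i1 := integrable_bilin cdot mS hp.memLp
  have i2 := integrable_bilin cdot mS hp'.memLp
  have i3 := integrable_bilin cdot hp.memLp mS'
  have i4 := integrable_bilin cdot mS' hp'.memLp
  have i5 := integrable_bilin cdot mS'' hp'.memLp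
  -- By symmetry, with the coefficients frozen, the form polarizes and pairs the operator applied to
  -- `p + p'` with `p - p'`. What is left is the change of the coefficients at the fixed function
  -- `p'`.
  have e := integral_cdot_driftField_comm (ε := ε) (c := c) hu hρ hp hp1'
  have s1 : ∫ x, cdot (driftField ε c u ρ p x + driftField ε c u ρ p' x) (p x - p' x)
      = ((∫ x, cdot (driftField ε c u ρ p x) (p x)) - ∫ x, cdot (driftField ε c u ρ p x) (p' x))
        + ((∫ x, cdot (p x) (driftField ε c u ρ p' x))
          - ∫ x, cdot (driftField ε c u ρ p' x) (p' x)) := by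
    have a := integral_add (i1.sub i2) (i3.sub i4)
    simp only [Pi.sub_apply] at a
    rw [← integral_sub i1 i2, ← integral_sub i3 i4, ← a]
    refine integral_congr_ae (Eventually.of_forall fun x => ?_)
    simp only [map_add, map_sub, add_apply]
    rw [cdot_comm (p x)]
    ring
  have mW : ∀ j, MemLp (fun x => cdot (Complex.I * (ε : ℂ) * weakPartial j p' x) (p' x)
      + 1 / 2 * (massDensity p' x * (u j x + u' j x))) 2 volume := fun j =>
    (memLp_cdot_modulation ε hp' j).add ((memLp_smul_of_bound hm.1 (massDensity_bound hC')
      ((hu j).memLp.add (hu' j).memLp)).const_mul (1 / 2))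
  have iW : ∀ j, Integrable (fun x => (cdot (Complex.I * (ε : ℂ) * weakPartial j p' x) (p' x)
      + 1 / 2 * (massDensity p' x * (u j x + u' j x))) * (u j x - u' j x)) volume := fun j =>
    integrable_mul_of_memLp (mW j) ((hu j).memLp.sub (hu' j).memLp)
  have iR : Integrable (fun x => -c * massDensity p' x * (ρ x - ρ' x)) volume :=
    integrable_mul_of_memLp (hm.const_mul (-c)) (hρ.memLp.sub hρ'.memLp)
  have s2 : (∑ j, ∫ x, (cdot (Complex.I * (ε : ℂ) * weakPartial j p' x) (p' x)
        + 1 / 2 * (massDensity p' x * (u j x + u' j x))) * (u j x - u' j x))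
      + (∫ x, -c * massDensity p' x * (ρ x - ρ' x))
      = (∫ x, cdot (driftField ε c u ρ p' x) (p' x))
        - ∫ x, cdot (driftField ε c u' ρ' p' x) (p' x) := by
    rw [← integral_finsetSum _ fun j _ => iW j,
      ← integral_add (integrable_finsetSum _ fun j _ => iW j) iR, ← integral_sub i4 i5]
    refine integral_congr_ae (Eventually.of_forall fun x => ?_)
    simp only [massDensity, ← cdot_self, driftField, drift, cdot_apply,
      Fin.sum_univ_three, Complex.mul_re, Complex.mul_im, Complex.I_re, Complex.I_im,
      Complex.add_re, Complex.add_im, Complex.ofReal_re, Complex.ofReal_im]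
    ring
  rw [s1]
  linarith

/-! ### Differentiating the modulated energy in time -/

section Derivative

variable {ε c : ℝ} {K : E3 → ℝ} {r T : ℝ} {φ : ℝ → E3 → ℂ} {ρ : ℝ → E3 → ℝ} {u : ℝ → E3 → E3}

theorem IsEulerSolution.memH_velocity (hE : IsEulerSolution c T ρ u) {t : ℝ} (ht : t ∈ Icc 0 T)
    (j : Fin 3) : MemH 4 fun x => u t x j :=
  (hE.regularity_velocity j).1 t ht

theorem IsEulerSolution.memH_density (hE : IsEulerSolution c T ρ u) {t : ℝ} (ht : t ∈ Icc 0 T) :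
    MemH 2 (ρ t) :=
  (hE.regularity_density.1 t ht).mono (by norm_num)

theorem IsEulerSolution.continuity_ae (hE : IsEulerSolution c T ρ u) {t : ℝ} (ht : t ∈ Icc 0 T) :
    (fun x => -∑ j : Fin 3, weakPartial j (fun y => ρ t y * u t y j) x) =ᵐ[volume]
      fun x => -∑ j : Fin 3, (weakPartial j (ρ t) x * u t x j
        + ρ t x * weakPartial j (fun y => u t y j) x) := by
  obtain ⟨C, hC⟩ := (hE.memH_density ht).exists_bound hasSupBound_real le_rfl
  have h : ∀ᵐ x, ∀ j : Fin 3, weakPartial j (fun y => ρ t y * u t y j) x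
      = weakPartial j (ρ t) x * u t x j + ρ t x * weakPartial j (fun y => u t y j) x := by
    refine ae_all_iff.2 fun j => ?_
    obtain ⟨D, hD⟩ := (hE.memH_velocity ht j).exists_bound hasSupBound_real (by norm_num)
    exact (((hE.memH_density ht).hasL2Partial j).smul ((hE.memH_velocity ht j).hasL2Partial j)
      hC hD).weakPartial_ae
  filter_upwards [h] with x hx
  simp only [hx]

/-- The time derivative of the modulated energy. -/
theorem hasDerivWithinAt_modulatedEnergy (hφ : IsModifiedGPSolution ε K T φ)
    (hE : IsEulerSolution c T ρ u) (hK : IsKernel K r) (hε : ε ≠ 0) {t : ℝ} (ht : t ∈ Icc 0 T) :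
    HasDerivWithinAt (fun t => modulatedEnergy ε c K (φ t) (ρ t) (u t))
      (∫ x, modulatedRate ε c (φ t x) (fun j => weakPartial j (φ t) x)
        (∑ j, weakPartial j (weakPartial j (φ t)) x) (fun j => u t x j)
        (fun j k => weakPartial k (fun y => u t y j) x) (ρ t x) (fun j => weakPartial j (ρ t) x)
        (meanField K (φ t) x)) (Icc 0 T) t ∧
    Integrable (fun x => modulatedRate ε c (φ t x) (fun j => weakPartial j (φ t) x)
        (∑ j, weakPartial j (weakPartial j (φ t)) x) (fun j => u t x j)
        (fun j k => weakPartial k (fun y => u t y j) x) (ρ t x) (fun j => weakPartial j (ρ t) x)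
        (meanField K (φ t) x)) volume := by
  have hc := hφ.regularity.l2Cont_self
  have hH : ∀ t ∈ Icc 0 T, MemH 2 (φ t) := fun t ht => (hφ.regularity.1 t ht).mono (by norm_num)
  obtain ⟨C, hC⟩ := (hH t ht).exists_bound hasSupBound_complex le_rfl
  have hm := memLp_massDensity (hc.mem t ht) hC
  have hum : ∀ j, ∀ t ∈ Icc 0 T, AEStronglyMeasurable (fun x => u t x j) volume := fun j t ht =>
    (hE.memH_velocity ht j).memLp.1
  have hdm : ∀ j, ∀ t ∈ Icc 0 T, AEStronglyMeasurable (weakPartial j fun x => u t x j) volume :=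
    fun j t ht => (memH_weakPartial (hE.memH_velocity ht j) j).memLp.1
  have hρm : ∀ t ∈ Icc 0 T, AEStronglyMeasurable (ρ t) volume := fun t ht =>
    (hE.memH_density ht).memLp.1
  have su : ∀ j, SupCont T fun t x => u t x j := fun j =>
    (hE.regularity_velocity j).supCont hasSupBound_real [] (by simp)
  have sd : ∀ j, SupCont T fun t => weakPartial j fun x => u t x j := fun j =>
    (hE.regularity_velocity j).supCont hasSupBound_real [j] (by simp)
  have sρ : SupCont T ρ := hE.regularity_density.supCont hasSupBound_real [] (by simp)
  have lu : ∀ j, L2Cont T fun t x => u t x j := fun j => (hE.regularity_velocity j).l2Cont_self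
  have lρ : L2Cont T ρ := hE.regularity_density.l2Cont_self
  have g1 := L2Cont.drift ε c su hum sd hdm sρ hρm
    (fun j => hφ.regularity.l2Cont_one (by norm_num) j) hc
  have g2 := L2Cont.drift ε c su hum sd hdm sρ hρm
    (fun j => L2Cont.const ((hH t ht).hasL2Partial j).mem') (L2Cont.const (hc.mem t ht))
  -- `w1`, `w2` and `w3` are the weights paired with the increments of `φ`, of the components of `u`
  -- and of `ρ`. They are sums of values at `s` and at `t`, which makes the increments exact and not
  -- merely first-order expansions.
  have w1 := g1.add g2
  have w2 : ∀ j, L2Cont T fun s x => cdot (Complex.I * (ε : ℂ) * weakPartial j (φ t) x) (φ t x)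
      + 1 / 2 * (massDensity (φ t) x * (u s x j + u t x j)) := fun j =>
    (L2Cont.const (memLp_cdot_modulation ε (hH t ht) j)).add
      ((L2Cont.bilin (SupCont.const (massDensity_bound hC)) (fun _ _ => hm.1)
        ((lu j).add (L2Cont.const ((lu j).mem t ht))) (ContinuousLinearMap.mul ℝ ℝ)).clm_comp
          (ContinuousLinearMap.mul ℝ ℝ (1 / 2)))
  have w3 : L2Cont T fun s x => -c * massDensity (φ t) x + c / 2 * (ρ s x + ρ t x) :=
    (L2Cont.const (hm.const_mul (-c))).add
      ((lρ.add (L2Cont.const (lρ.mem t ht))).clm_comp (ContinuousLinearMap.mul ℝ ℝ (c / 2)))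
  have dρ := hE.continuity t ht
  have d1 := (hφ.timeDeriv ht).tendsto_pairing_cont hc ht cdot w1
  have d2 := fun j => (hE.momentum t ht j).tendsto_pairing_cont (lu j) ht
    (ContinuousLinearMap.mul ℝ ℝ) (w2 j)
  have d3 := dρ.tendsto_pairing_cont lρ ht (ContinuousLinearMap.mul ℝ ℝ) w3
  -- The energy is one summand of the modulated energy, and its conservation means that it
  -- contributes nothing.
  have d0 := hasDerivWithinAt_iff_tendsto_slope.1 (hφ.hasDerivWithinAt_energy hK hε ht)
  have d := ((d0.add d1).add (tendsto_finsetSum Finset.univ fun j _ => d2 j)).add d3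
  have i1 := integrable_bilin cdot (w1.mem t ht) (hφ.timeDeriv ht).1
  have i2 := fun j => integrable_mul_of_memLp ((w2 j).mem t ht) (hE.momentum t ht j).1
  have i3 := integrable_mul_of_memLp (w3.mem t ht) dρ.1
  have iS := (i1.add (integrable_finsetSum Finset.univ fun j _ => i2 j)).add i3
  have hae : (fun x => cdot (drift ε c (fun j => u t x j) (∑ j, weakPartial j (fun y => u t y j) x)
          (ρ t x) (fun j => weakPartial j (φ t) x) (φ t x)
        + drift ε c (fun j => u t x j) (∑ j, weakPartial j (fun y => u t y j) x)
          (ρ t x) (fun j => weakPartial j (φ t) x) (φ t x))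
        (gpVelocity ε (∑ j, weakPartial j (weakPartial j (φ t)) x) (meanField K (φ t) x) (φ t x))
      + (∑ j, (cdot (Complex.I * (ε : ℂ) * weakPartial j (φ t) x) (φ t x)
        + 1 / 2 * (massDensity (φ t) x * (u t x j + u t x j)))
        * -(∑ k : Fin 3, u t x k * weakPartial k (fun y => u t y j) x + c * weakPartial j (ρ t) x))
      + (-c * massDensity (φ t) x + c / 2 * (ρ t x + ρ t x))
        * -∑ j : Fin 3, weakPartial j (fun y => ρ t y * u t y j) x) =ᵐ[volume]
      fun x => modulatedRate ε c (φ t x) (fun j => weakPartial j (φ t) x)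
        (∑ j, weakPartial j (weakPartial j (φ t)) x) (fun j => u t x j)
        (fun j k => weakPartial k (fun y => u t y j) x) (ρ t x) (fun j => weakPartial j (ρ t) x)
        (meanField K (φ t) x) := by
    filter_upwards [hE.continuity_ae ht] with x hx
    rw [hx]
    simp only [modulatedRate, massDensity, map_add, add_apply, Fin.sum_univ_three]
    ring
  have iS' := iS.congr (g := fun x => modulatedRate ε c (φ t x) (fun j => weakPartial j (φ t) x)
        (∑ j, weakPartial j (weakPartial j (φ t)) x) (fun j => u t x j)
        (fun j k => weakPartial k (fun y => u t y j) x) (ρ t x) (fun j => weakPartial j (ρ t) x)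
        (meanField K (φ t) x)) (by
    refine EventuallyEq.trans (Eventually.of_forall fun x => ?_) hae
    simp only [Pi.add_apply])
  refine ⟨?_, iS'⟩
  rw [hasDerivWithinAt_iff_tendsto_slope]
  have hlim := integral_congr_ae hae
  have i12 : Integrable (fun x => cdot (drift ε c (fun j => u t x j)
          (∑ j, weakPartial j (fun y => u t y j) x)
          (ρ t x) (fun j => weakPartial j (φ t) x) (φ t x)
        + drift ε c (fun j => u t x j) (∑ j, weakPartial j (fun y => u t y j) x)
          (ρ t x) (fun j => weakPartial j (φ t) x) (φ t x))
        (gpVelocity ε (∑ j, weakPartial j (weakPartial j (φ t)) x) (meanField K (φ t) x) (φ t x))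
      + (∑ j, (cdot (Complex.I * (ε : ℂ) * weakPartial j (φ t) x) (φ t x)
        + 1 / 2 * (massDensity (φ t) x * (u t x j + u t x j)))
        * -(∑ k : Fin 3, u t x k * weakPartial k (fun y => u t y j) x
          + c * weakPartial j (ρ t) x))) volume :=
    i1.add (integrable_finsetSum Finset.univ fun j _ => i2 j)
  rw [integral_add i12 i3, integral_add i1 (integrable_finsetSum Finset.univ fun j _ => i2 j),
    integral_finsetSum _ fun j _ => i2 j] at hlim
  rw [← hlim]
  rw [zero_add] at d
  refine d.congr' ?_
  filter_upwards [self_mem_nhdsWithin] with s hs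
  have e1 := modulatedEnergy_eq (ε := ε) (c := c) (K := K) (u := u s)
    (fun j => hE.memH_velocity hs.1 j) (hE.memH_density hs.1) (hH s hs.1)
  have e2 := modulatedEnergy_eq (ε := ε) (c := c) (K := K) (u := u t)
    (fun j => hE.memH_velocity ht j) (hE.memH_density ht) (hH t ht)
  have e3 := integral_driftField_sub (ε := ε) (c := c) (fun j => hE.memH_velocity hs.1 j)
    (fun j => hE.memH_velocity ht j) (hE.memH_density hs.1) (hE.memH_density ht) (hH s hs.1)
    (hH t ht)
  have md : MemLp (fun x => ρ s x - ρ t x) 2 volume := (lρ.mem s hs.1).sub (lρ.mem t ht)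
  have e4 : ∫ x, (-c * massDensity (φ t) x + c / 2 * (ρ s x + ρ t x)) * (ρ s x - ρ t x)
      = (∫ x, -c * massDensity (φ t) x * (ρ s x - ρ t x))
        + (c / 2 * (∫ x, ρ s x * ρ s x) - c / 2 * ∫ x, ρ t x * ρ t x) := by
    have j1 : Integrable (fun x => -c * massDensity (φ t) x * (ρ s x - ρ t x)) volume :=
      integrable_mul_of_memLp (hm.const_mul (-c)) md
    have j2 := (integrable_mul_of_memLp (lρ.mem s hs.1) (lρ.mem s hs.1)).const_mul (c / 2)
    have j3 := (integrable_mul_of_memLp (lρ.mem t ht) (lρ.mem t ht)).const_mul (c / 2)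
    have j4 := integral_add j1 (j2.sub j3)
    simp only [Pi.sub_apply] at j4
    rw [← integral_const_mul, ← integral_const_mul, ← integral_sub j2 j3, ← j4]
    refine integral_congr_ae (Eventually.of_forall fun x => ?_)
    ring
  simp only [slope_def_field, ContinuousLinearMap.mul_apply', ← Finset.mul_sum] at *
  rw [e1, e2, e4]
  simp only [driftField] at e3 ⊢
  linear_combination (-(s - t)⁻¹) * e3

end Derivative

/-! ### Growth of the modulated energy -/

/-- The function is integrable with integral `a`. -/
structure HasIntegralEq (f : E3 → ℝ) (a : ℝ) : Prop where
  integrable : Integrable f volume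
  eq : ∫ x, f x = a

namespace HasIntegralEq

variable {f g : E3 → ℝ} {a b : ℝ}

theorem of_integrable (h : Integrable f volume) : HasIntegralEq f (∫ x, f x) := ⟨h, rfl⟩

theorem add (hf : HasIntegralEq f a) (hg : HasIntegralEq g b) :
    HasIntegralEq (fun x => f x + g x) (a + b) :=
  ⟨hf.1.add hg.1, by rw [integral_add hf.1 hg.1, hf.2, hg.2]⟩

theorem const_mul (hf : HasIntegralEq f a) (s : ℝ) : HasIntegralEq (fun x => s * f x) (s * a) :=
  ⟨hf.1.const_mul s, by rw [integral_const_mul, hf.2]⟩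

theorem sum {ι : Type*} [Fintype ι] {f : ι → E3 → ℝ} {a : ι → ℝ}
    (hf : ∀ i, HasIntegralEq (f i) (a i)) : HasIntegralEq (fun x => ∑ i, f i x) (∑ i, a i) :=
  ⟨integrable_finsetSum _ fun i _ => (hf i).1, by
    rw [integral_finsetSum _ fun i _ => (hf i).1]
    exact Finset.sum_congr rfl fun i _ => (hf i).2⟩

theorem congr (hf : HasIntegralEq f a) (h : ∀ x, f x = g x) : HasIntegralEq g a := by
  have : f = g := funext h
  rwa [← this]

end HasIntegralEq

theorem integrable_bounded_mul {w f : E3 → ℝ} {C : ℝ} (hw : AEStronglyMeasurable w volume)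
    (hC : ∀ᵐ x, ‖w x‖ ≤ C) (hf : Integrable f volume) :
    Integrable (fun x => w x * f x) volume :=
  hf.bdd_mul (c := C) hw hC

theorem abs_integral_bounded_mul_le {w f : E3 → ℝ} {C : ℝ}
    (hC : ∀ᵐ x, ‖w x‖ ≤ C) (hf : Integrable f volume) :
    |∫ x, w x * f x| ≤ C * ∫ x, |f x| := by
  have := norm_integral_le_of_norm_le (hf.abs.const_mul C) (f := fun x => w x * f x) (by
    filter_upwards [hC] with x hx
    rw [norm_mul]
    exact mul_le_mul_of_nonneg_right hx (abs_nonneg _))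
  rwa [integral_const_mul] at this

/-- The modulated kinetic energy and the distance of the densities. -/
def defect (ε c : ℝ) (p : E3 → ℂ) (ρ : E3 → ℝ) (u : Fin 3 → E3 → ℝ) : ℝ :=
  1 / 2 * (∑ j, l2 (fun x => Complex.I * (ε : ℂ) * weakPartial j p x + (u j x : ℂ) * p x) ^ 2)
    + c / 2 * l2 (fun x => massDensity p x - ρ x) ^ 2

theorem defect_nonneg {ε c : ℝ} (hc : 0 ≤ c) (p : E3 → ℂ) (ρ : E3 → ℝ) (u : Fin 3 → E3 → ℝ) :
    0 ≤ defect ε c p ρ u :=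
  add_nonneg (mul_nonneg (by norm_num) (Finset.sum_nonneg fun _ _ => sq_nonneg _))
    (mul_nonneg (by linarith) (sq_nonneg _))

theorem sum_sum_mul_le (d : Fin 3 → ℝ) : ∑ j, ∑ k, d j * d k ≤ 3 * ∑ j, d j ^ 2 := by
  simp only [Fin.sum_univ_three]
  nlinarith [sq_nonneg (d 0 - d 1), sq_nonneg (d 0 - d 2), sq_nonneg (d 1 - d 2)]

/-- The growth of the modulated energy in terms of the defect. -/
theorem integral_modulatedFlux_le {ε c : ℝ} (hc : 0 ≤ c) {K : E3 → ℝ} {r : ℝ} (hK : IsKernel K r)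
    (hr : 0 ≤ r) {p : E3 → ℂ} (hp : MemH 4 p) {u : Fin 3 → E3 → ℝ} (hu : ∀ j, MemH 4 (u j))
    {ρ : E3 → ℝ} (hρ : MemH 2 ρ) {M B R S Q : ℝ} (hM : 0 ≤ M)
    (huM : ∀ j k, ∀ᵐ x, ‖weakPartial k (u j) x‖ ≤ M)
    (huB : ∑ j, ∑ k, l2 (weakPartial k (weakPartial k (weakPartial j (u j)))) ≤ B)
    (hR : l2 (massDensity p) ≤ R) (hS : ∑ k, l2 (weakPartial k p) ≤ S)
    (hQ : l2 (fun x => ‖p x‖ ^ 3) ≤ Q) :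
    (∫ x, modulatedFlux ε c (p x) (fun j => weakPartial j p x) (fun j => u j x)
          (fun j k => weakPartial k (u j) x)
          (fun j k => weakPartial k (weakPartial k (weakPartial j (u j))) x) (ρ x)
          (meanField K p x))
      ≤ 6 * M * defect ε c p ρ u + ε ^ 2 / 4 * (B * R)
        + 24 * M * ((∫ z, K z) * (r * (S * Q))) + 3 / 2 * M * (|(∫ z, K z) - c| * R ^ 2) := by
  obtain ⟨CS, -, hsob⟩ := exists_sobolev
  have hp1 : ∀ j, HasL2Partial j p (weakPartial j p) := fun j => hp.hasL2Partial j
  have h6 := (hsob p _ hp1).1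
  obtain ⟨Cp, hCp⟩ := hp.exists_bound hasSupBound_complex (by norm_num)
  have hCu := fun j => (hu j).exists_bound hasSupBound_real (by norm_num)
  choose Cu hCu using hCu
  obtain ⟨Cr, hCr⟩ := hρ.exists_bound hasSupBound_real le_rfl
  set g := massDensity p with hg
  have hm : MemLp g 2 volume := memLp_massDensity hp.memLp hCp
  set k := ∫ z, K z with hk
  have hk0 : 0 ≤ k := hK.integral_nonneg
  set D : Fin 3 → E3 → ℂ := fun j x => Complex.I * (ε : ℂ) * weakPartial j p x + (u j x : ℂ) * p x
    with hD
  have mD : ∀ j, MemLp (D j) 2 volume := fun j =>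
    memLp_modulated (hu j).memLp (hCu j) (hp.mono (by norm_num)) j
  have mu1 : ∀ j k, MemLp (weakPartial k (u j)) 2 volume := fun j k =>
    ((hu j).hasL2Partial k).mem'
  have mu3 : ∀ j k, MemLp (weakPartial k (weakPartial k (weakPartial j (u j)))) 2 volume :=
    fun j k => ((memH_weakPartial (memH_weakPartial (hu j) j) k).hasL2Partial k).mem'
  have igg := integrable_mul_of_memLp hm hm
  have irg := integrable_mul_of_memLp hρ.memLp hm
  have irr := integrable_mul_of_memLp hρ.memLp hρ.memLp
  have md : MemLp (fun x => g x - ρ x) 2 volume := hm.sub hρ.memLp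
  have hTr := fun j => abs_integral_transport_sub_le hK hr hp1 hCp h6 j
    (fun k => (hu j).hasL2Partial k) hM (hCu j) (huM j)
  have a1 := fun j k => HasIntegralEq.of_integrable
    (integrable_bounded_mul (mu1 j k).1 (huM j k) (integrable_bilin cdot (mD j) (mD k)))
  have a2 := fun j k => HasIntegralEq.of_integrable (integrable_mul_of_memLp (mu3 j k) hm)
  have a3 := fun j => HasIntegralEq.of_integrable (hTr j).1
  have a4 := fun j => HasIntegralEq.of_integrable (integrable_bounded_mul (mu1 j j).1 (huM j j) irg)
  have a5 := fun j => HasIntegralEq.of_integrable (integrable_bounded_mul (mu1 j j).1 (huM j j) irr)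
  have a6 := fun j => HasIntegralEq.of_integrable (integrable_bounded_mul (mu1 j j).1 (huM j j) igg)
  have a7 := fun j => HasIntegralEq.of_integrable (integrable_bounded_mul (mu1 j j).1 (huM j j)
    (integrable_mul_of_memLp md md))
  -- The expanded square shows which combination of the force and the Euler terms is needed below.
  have e7 : ∀ j, ∫ x, weakPartial j (u j) x * ((g x - ρ x) * (g x - ρ x))
      = (∫ x, weakPartial j (u j) x * (g x * g x)) + (-2 * (∫ x, weakPartial j (u j) x * (ρ x * g x))
        + ∫ x, weakPartial j (u j) x * (ρ x * ρ x)) := fun j => by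
    rw [← ((a6 j).add (((a4 j).const_mul (-2)).add (a5 j))).eq]
    refine integral_congr_ae (Eventually.of_forall fun x => ?_)
    ring
  have key := ((((HasIntegralEq.sum fun j => HasIntegralEq.sum fun k => a1 j k).const_mul (-1)).add
    ((HasIntegralEq.sum fun j => HasIntegralEq.sum fun k => a2 j k).const_mul (ε ^ 2 / 4))).add
    ((HasIntegralEq.sum a3).const_mul (-1))).add
    (((HasIntegralEq.sum a4).const_mul c).add ((HasIntegralEq.sum a5).const_mul (-(c / 2))))
  have key2 := (key.congr (g := fun x => modulatedFlux ε c (p x) (fun j => weakPartial j p x)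
          (fun j => u j x) (fun j k => weakPartial k (u j) x)
          (fun j k => weakPartial k (weakPartial k (weakPartial j (u j))) x) (ρ x)
          (meanField K p x)) (fun x => by
    simp only [modulatedFlux, hD, hg, massDensity, Fin.sum_univ_three]
    ring)).eq
  rw [key2]
  have b1 : -(∑ j, ∑ k, ∫ x, weakPartial k (u j) x * cdot (D j x) (D k x))
      ≤ M * (3 * ∑ j, l2 (D j) ^ 2) := by
    have h1 : ∀ j k, |∫ x, weakPartial k (u j) x * cdot (D j x) (D k x)|
        ≤ M * (l2 (D j) * l2 (D k)) := fun j k => by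
      refine (abs_integral_bounded_mul_le (huM j k)
        (integrable_bilin cdot (mD j) (mD k))).trans (mul_le_mul_of_nonneg_left ?_ hM)
      refine (norm_integral_bilin_le cdot (mD j) (mD k)).trans ?_
      have h0 := mul_nonneg (l2_nonneg (D j)) (l2_nonneg (D k))
      calc _ ≤ 1 * (l2 (D j) * l2 (D k)) := mul_le_mul_of_nonneg_right norm_cdot_le h0
        _ = _ := one_mul _
    calc _ = ∑ j, ∑ k, -∫ x, weakPartial k (u j) x * cdot (D j x) (D k x) := by
          simp only [Finset.sum_neg_distrib]
      _ ≤ ∑ j, ∑ k, M * (l2 (D j) * l2 (D k)) := Finset.sum_le_sum fun j _ =>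
          Finset.sum_le_sum fun k _ => (neg_le_abs _).trans (h1 j k)
      _ = M * ∑ j, ∑ k, l2 (D j) * l2 (D k) := by simp only [Finset.mul_sum]
      _ ≤ _ := mul_le_mul_of_nonneg_left (sum_sum_mul_le fun j => l2 (D j)) hM
  have b2 : ∑ j, ∑ k, ∫ x, weakPartial k (weakPartial k (weakPartial j (u j))) x * g x ≤ B * R := by
    calc _ ≤ ∑ j, ∑ k, l2 (weakPartial k (weakPartial k (weakPartial j (u j)))) * l2 g :=
          Finset.sum_le_sum fun j _ => Finset.sum_le_sum fun k _ =>
            (le_abs_self _).trans (abs_integral_mul_le (mu3 j k) hm)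
      _ = (∑ j, ∑ k, l2 (weakPartial k (weakPartial k (weakPartial j (u j))))) * l2 g := by
          simp only [Finset.sum_mul]
      _ ≤ B * R := mul_le_mul huB hR (l2_nonneg _) ((Finset.sum_nonneg fun j _ =>
          Finset.sum_nonneg fun k _ => l2_nonneg _).trans huB)
  have hl2 : ∀ f : E3 → ℝ, MemLp f 2 volume → ∫ x, |f x * f x| = l2 f ^ 2 := fun f hf => by
    rw [l2_sq hf]
    refine integral_congr_ae (Eventually.of_forall fun x => ?_)
    change |f x * f x| = ‖f x‖ ^ 2
    rw [abs_mul, sq, Real.norm_eq_abs]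
  have hS0 : 0 ≤ ∑ k, l2 (weakPartial k p) := Finset.sum_nonneg fun _ _ => l2_nonneg _
  have hSQ : (∑ k, l2 (weakPartial k p)) * l2 (fun x => ‖p x‖ ^ 3) ≤ S * Q :=
    mul_le_mul hS hQ (l2_nonneg _) (hS0.trans hS)
  have b3 : ∀ j, |2 * (∫ x, (u j x * (2 * cdot (p x) (weakPartial j p x))
        + weakPartial j (u j) x * g x) * meanField K p x)
      - k * ∫ x, weakPartial j (u j) x * (g x * g x)| ≤ 16 * M * (k * (r * (S * Q))) := fun j => by
    refine (hTr j).2.trans ?_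
    have h1 : k * (r * ((∑ k, l2 (weakPartial k p)) * l2 (fun x => ‖p x‖ ^ 3))) ≤ k * (r * (S * Q)) :=
      mul_le_mul_of_nonneg_left (mul_le_mul_of_nonneg_left hSQ hr) hk0
    have h2 := mul_le_mul_of_nonneg_left h1 (mul_nonneg (by norm_num : (0 : ℝ) ≤ 16) hM)
    refine le_trans (le_of_eq ?_) h2
    ring
  have b6 : ∀ j, |∫ x, weakPartial j (u j) x * (g x * g x)| ≤ M * R ^ 2 := fun j => by
    refine (abs_integral_bounded_mul_le (huM j j) igg).trans (mul_le_mul_of_nonneg_left ?_ hM)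
    rw [hl2 g hm]
    exact pow_le_pow_left₀ (l2_nonneg _) hR 2
  have b7 : ∀ j, |∫ x, weakPartial j (u j) x * ((g x - ρ x) * (g x - ρ x))|
      ≤ M * l2 (fun x => g x - ρ x) ^ 2 := fun j => by
    refine (abs_integral_bounded_mul_le (huM j j) (integrable_mul_of_memLp md md)).trans ?_
    rw [hl2 _ md]
  have b8 : ∀ j, (k - c) * (∫ x, weakPartial j (u j) x * (g x * g x)) ≥ -(|k - c| * (M * R ^ 2)) :=
    fun j => by
      have := mul_le_mul_of_nonneg_left (b6 j) (abs_nonneg (k - c))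
      rw [← abs_mul] at this
      linarith [neg_abs_le ((k - c) * ∫ x, weakPartial j (u j) x * (g x * g x))]
  have b9 : ∀ j, c * (∫ x, weakPartial j (u j) x * ((g x - ρ x) * (g x - ρ x)))
      ≥ -(c * (M * l2 (fun x => g x - ρ x) ^ 2)) := fun j => by
    have h1 := (abs_le.1 (b7 j)).1
    have := mul_le_mul_of_nonneg_left h1 hc
    linarith
  -- The symmetrized force contributes `-½ k ∫ ∂ⱼuⱼ (ρ^ε)²`. Replacing `k` by `c` costs `|k - c|`,
  -- after which the Euler terms complete the square in `ρ^ε - ρ`.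
  have b10 : ∀ j, -(∫ x, (u j x * (2 * cdot (p x) (weakPartial j p x))
        + weakPartial j (u j) x * g x) * meanField K p x)
      + c * (∫ x, weakPartial j (u j) x * (ρ x * g x))
      - c / 2 * (∫ x, weakPartial j (u j) x * (ρ x * ρ x))
      ≤ 8 * M * (k * (r * (S * Q))) + 1 / 2 * (|k - c| * (M * R ^ 2))
        + 1 / 2 * (c * (M * l2 (fun x => g x - ρ x) ^ 2)) := fun j => by
    have h1 := (abs_le.1 (b3 j)).1
    have h2 := b8 j
    have h3 := b9 j
    rw [e7 j] at h3
    linarith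
  have b11 := Finset.sum_le_sum (s := Finset.univ) fun (j : Fin 3) _ => b10 j
  rw [Finset.sum_add_distrib, Finset.sum_add_distrib] at b11
  simp only [Finset.sum_const, Finset.card_univ, Fintype.card_fin, nsmul_eq_mul,
    Finset.sum_sub_distrib, Finset.sum_add_distrib, Finset.sum_neg_distrib, ← Finset.mul_sum]
    at b11
  have hdef : defect ε c p ρ u = 1 / 2 * (∑ j, l2 (D j) ^ 2)
    + c / 2 * l2 (fun x => g x - ρ x) ^ 2 := rfl
  rw [hdef]
  have b12 := mul_le_mul_of_nonneg_left b2 (by positivity : 0 ≤ ε ^ 2 / 4)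
  push_cast at b11
  -- The density part of the defect grows at rate `3 * M` only; the surplus in `6 * M` is this
  -- nonnegative quantity.
  have hsq : 0 ≤ M * (c * l2 (fun x => g x - ρ x) ^ 2) :=
    mul_nonneg hM (mul_nonneg hc (sq_nonneg _))
  linarith

theorem l2_sq_eq_integral_mul {f : E3 → ℝ} (hf : MemLp f 2 volume) :
    l2 f ^ 2 = ∫ x, f x * f x := by
  rw [l2_sq hf]
  refine integral_congr_ae (Eventually.of_forall fun x => ?_)
  change ‖f x‖ ^ 2 = f x * f x
  rw [Real.norm_eq_abs, sq_abs, sq]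

/-- The modulated energy in terms of the defect. -/
theorem modulatedEnergy_eq_defect {ε c : ℝ} {K : E3 → ℝ} {p : E3 → ℂ} {ρ : E3 → ℝ} {u : E3 → E3}
    (hu : ∀ j, MemH 4 fun x => u x j) (hρ : MemH 2 ρ) (hp : MemH 2 p) :
    modulatedEnergy ε c K p ρ u = defect ε c p ρ (fun j x => u x j)
      + 1 / 2 * ((∫ x, meanField K p x * massDensity p x) - c * l2 (massDensity p) ^ 2) := by
  have hCu := fun j => (hu j).exists_bound hasSupBound_real (by norm_num)
  choose Cu hCu using hCu
  obtain ⟨C, hC⟩ := hp.exists_bound hasSupBound_complex le_rfl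
  have hm := memLp_massDensity hp.memLp hC
  have mD := fun j => memLp_modulated (ε := ε) (hu j).memLp (hCu j) (hp.mono (by norm_num)) j
  have md : MemLp (fun x => massDensity p x - ρ x) 2 volume := hm.sub hρ.memLp
  have e1 : ∫ x, ∑ j : Fin 3,
      ‖Complex.I * (ε : ℂ) * weakPartial j p x + ((u x j : ℝ) : ℂ) * p x‖ ^ 2
      = ∑ j, l2 (fun x => Complex.I * (ε : ℂ) * weakPartial j p x + (u x j : ℂ) * p x) ^ 2 := by
    rw [integral_finsetSum _ fun j _ => (mD j).integrable_norm_pow (by norm_num)]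
    exact Finset.sum_congr rfl fun j _ => (l2_sq (mD j)).symm
  have e2 : ∫ x, (ρ x ^ 2 - 2 * ρ x * massDensity p x)
      = l2 (fun x => massDensity p x - ρ x) ^ 2 - l2 (massDensity p) ^ 2 := by
    rw [l2_sq_eq_integral_mul md, l2_sq_eq_integral_mul hm,
      ← integral_sub (integrable_mul_of_memLp md md) (integrable_mul_of_memLp hm hm)]
    refine integral_congr_ae (Eventually.of_forall fun x => ?_)
    ring
  rw [modulatedEnergy, e1, e2, defect]
  ring

/-! ### From the defect to the densities -/

theorem normSqLe_one {F : Type} [NormedAddCommGroup F] [NormedSpace ℝ F] {f : E3 → F} {b B : ℝ}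
    {h : E3 → ℝ} (hf : AEStronglyMeasurable f volume) (hh : Integrable h volume)
    (hle : ∀ᵐ x, ‖f x‖ ≤ h x) (hb : ∫ x, h x ≤ b) (hB : b ^ 2 ≤ B) : NormSqLe 1 f B := by
  have hi : Integrable f volume := hh.mono' hf hle
  refine ⟨memLp_one_iff_integrable.2 hi, ?_⟩
  have e : (eLpNorm f 1 volume).toReal = ∫ x, ‖f x‖ := by
    rw [eLpNorm_one_eq_lintegral_enorm, integral_norm_eq_lintegral_enorm hf]
  rw [e]
  refine (pow_le_pow_left₀ (integral_nonneg fun x => norm_nonneg _) ?_ 2).trans hB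
  exact (integral_mono_ae hi.norm hh hle).trans hb

theorem norm_le_sum_abs (w : E3) : ‖w‖ ≤ ∑ j, |w j| := by
  rw [EuclideanSpace.norm_eq]
  refine Real.sqrt_le_iff.2 ⟨Finset.sum_nonneg fun _ _ => abs_nonneg _, ?_⟩
  simp only [Fin.sum_univ_three, Real.norm_eq_abs]
  nlinarith [mul_nonneg (abs_nonneg (w 0)) (abs_nonneg (w 1)),
    mul_nonneg (abs_nonneg (w 0)) (abs_nonneg (w 2)), mul_nonneg (abs_nonneg (w 1)) (abs_nonneg (w 2))]

theorem add_sq_le_two_mul (a b : ℝ) : (a + b) ^ 2 ≤ 2 * (a ^ 2 + b ^ 2) := by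
  nlinarith [sq_nonneg (a - b)]

/-- The density, the momentum density and the kinetic energy density are controlled by the
defect. -/
theorem density_estimates_of_defect {ε c G U W Z : ℝ} (hc : 0 < c) (hU : 0 ≤ U) {p : E3 → ℂ} (hp : MemH 2 p) {ρ : E3 → ℝ} (hρ : MemH 2 ρ) {u : E3 → E3}
    (hu : ∀ j, MemH 4 fun x => u x j) (hpG : l2 p ≤ G) (huU : ∀ j : Fin 3, ∀ᵐ x, ‖u x j‖ ≤ U)
    (huW : ∑ j : Fin 3, l2 (fun x => u x j) ≤ W) (hZ : defect ε c p ρ (fun j x => u x j) ≤ Z) {B : ℝ}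
    (hB : defect ε c p ρ (fun j x => u x j)
      * (2 / c + (12 * G ^ 2 + 4 * W ^ 2 / c) + (8 * Z + 96 * (U * G) ^ 2 + 8 * (U * W) ^ 2 / c))
        ≤ B) :
    NormSqLe 2 (fun x => massDensity p x - ρ x) B ∧
    NormSqLe 1 (fun x => momentumDensity ε p x - ρ x • u x) B ∧
    NormSqLe 1 (fun x => kineticDensity ε p x - ρ x * ‖u x‖ ^ 2) B := by
  obtain ⟨C, hC⟩ := hp.exists_bound hasSupBound_complex le_rfl
  have hm := memLp_massDensity hp.memLp hC
  set D : Fin 3 → E3 → ℂ := fun j x => Complex.I * (ε : ℂ) * weakPartial j p x + (u x j : ℂ) * p x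
    with hD
  have mD : ∀ j, MemLp (D j) 2 volume := fun j =>
    memLp_modulated (hu j).memLp (huU j) (hp.mono (by norm_num)) j
  have md : MemLp (fun x => massDensity p x - ρ x) 2 volume := hm.sub hρ.memLp
  set z := defect ε c p ρ (fun j x => u x j) with hz
  set e := l2 (fun x => massDensity p x - ρ x) with he
  have hzdef : z = 1 / 2 * (∑ j, l2 (D j) ^ 2) + c / 2 * e ^ 2 := rfl
  have hz0 : 0 ≤ z := defect_nonneg hc.le _ _ _
  have he0 : 0 ≤ e := l2_nonneg _
  have hD0 : ∀ j, 0 ≤ l2 (D j) := fun j => l2_nonneg _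
  have hsq : ∑ j, l2 (D j) ^ 2 ≤ 2 * z := by
    have : 0 ≤ c / 2 * e ^ 2 := by positivity
    linarith
  have hsq0 : 0 ≤ ∑ j, l2 (D j) ^ 2 := Finset.sum_nonneg fun _ _ => sq_nonneg _
  have hesq : e ^ 2 ≤ 2 / c * z := by
    rw [div_mul_eq_mul_div, le_div_iff₀ hc]
    linarith
  set s := ∑ j, l2 (D j) with hs
  have hs0 : 0 ≤ s := Finset.sum_nonneg fun j _ => hD0 j
  have hssq : s ^ 2 ≤ 6 * z := by
    have h1 := sum_sum_mul_le fun j => l2 (D j)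
    have h2 : s ^ 2 = ∑ j, ∑ k, l2 (D j) * l2 (D k) := by rw [sq, hs, Finset.sum_mul_sum]
    linarith
  have hW0 : 0 ≤ W := (Finset.sum_nonneg fun _ _ => l2_nonneg _).trans huW
  have hZ0 : 0 ≤ Z := hz0.trans hZ
  have t0 : 0 ≤ 2 / c := by positivity
  have t1 : 0 ≤ 12 * G ^ 2 + 4 * W ^ 2 / c := by positivity
  have t2 : 0 ≤ 8 * Z + 96 * (U * G) ^ 2 + 8 * (U * W) ^ 2 / c := by positivity
  have B0 : z * (2 / c) ≤ B := (mul_le_mul_of_nonneg_left (by linarith) hz0).trans hB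
  have B1 : z * (12 * G ^ 2 + 4 * W ^ 2 / c) ≤ B :=
    (mul_le_mul_of_nonneg_left (by linarith) hz0).trans hB
  have B2 : z * (8 * Z + 96 * (U * G) ^ 2 + 8 * (U * W) ^ 2 / c) ≤ B :=
    (mul_le_mul_of_nonneg_left (by linarith) hz0).trans hB
  have iDp : ∀ j, Integrable (fun x => |‖D j x‖ * ‖p x‖|) volume := fun j =>
    (integrable_mul_of_memLp (mD j).norm hp.memLp.norm).abs
  have ie : ∀ j, Integrable (fun x => |u x j * (massDensity p x - ρ x)|) volume := fun j =>
    (integrable_mul_of_memLp (hu j).memLp md).abs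
  have bDp : ∀ j, ∫ x, |‖D j x‖ * ‖p x‖| ≤ l2 (D j) * G := fun j => by
    have h1 := integral_abs_mul_le (mD j).norm hp.memLp.norm
    have h2 : l2 (fun x => ‖D j x‖) = l2 (D j) := by rw [l2, l2, eLpNorm_norm]
    have h3 : l2 (fun x => ‖p x‖) = l2 p := by rw [l2, l2, eLpNorm_norm]
    rw [h2, h3] at h1
    exact h1.trans (mul_le_mul_of_nonneg_left hpG (hD0 j))
  have be : ∀ j : Fin 3, ∫ x, |u x j * (massDensity p x - ρ x)| ≤ l2 (fun x => u x j) * e := fun j =>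
    integral_abs_mul_le (hu j).memLp md
  have mp1 : ∀ j, AEStronglyMeasurable (weakPartial j p) volume := fun j =>
    ((hp.hasL2Partial j).mem').1
  have muM : AEStronglyMeasurable u volume := by
    have : u = fun x => WithLp.toLp 2 (fun j => u x j) := rfl
    rw [this]
    exact (PiLp.continuous_toLp 2 _).comp_aestronglyMeasurable
      (aemeasurable_pi_iff.2 fun j => (hu j).memLp.1.aemeasurable).aestronglyMeasurable
  refine ⟨⟨md, ?_⟩, ?_, ?_⟩
  · have : (eLpNorm (fun x => massDensity p x - ρ x) 2 volume).toReal = e := rfl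
    rw [this]
    linarith
  · refine normSqLe_one (b := G * s + W * e)
      (h := fun x => ∑ j, (|‖D j x‖ * ‖p x‖| + |u x j * (massDensity p x - ρ x)|)) ?_
      (integrable_finsetSum _ fun j _ => (iDp j).add (ie j)) ?_ ?_ ?_
    · refine AEStronglyMeasurable.sub ?_ (hρ.memLp.1.smul muM)
      refine (PiLp.continuous_toLp 2 _).comp_aestronglyMeasurable
        (aemeasurable_pi_iff.2 fun j => AEStronglyMeasurable.aemeasurable ?_).aestronglyMeasurable
      exact Complex.continuous_im.comp_aestronglyMeasurable
        (((mp1 j).const_mul _).mul (Complex.continuous_conj.comp_aestronglyMeasurable hp.memLp.1))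
    · refine Eventually.of_forall fun x => (norm_le_sum_abs _).trans
        (Finset.sum_le_sum fun j _ => ?_)
      -- With `D = (iε∇ + u)φ` the difference is the current of `D` against `φ`, plus `u` times the
      -- error of the density: each summand contains one small factor.
      have h1 : (momentumDensity ε p x - ρ x • u x) j
          = -cdot (D j x) (p x) + u x j * (massDensity p x - ρ x) := by
        simp only [momentumDensity, PiLp.sub_apply, PiLp.smul_apply, smul_eq_mul, hD,
          massDensity, ← cdot_self, cdot_apply, Complex.add_re, Complex.add_im, Complex.mul_re,
          Complex.mul_im, Complex.I_re, Complex.I_im, Complex.ofReal_re, Complex.ofReal_im,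
          Complex.conj_re, Complex.conj_im]
        ring
      rw [h1]
      refine (abs_add_le _ _).trans (add_le_add ?_ le_rfl)
      rw [abs_neg]
      exact (abs_cdot_le _ _).trans (le_abs_self _)
    · have i3 : ∀ j, Integrable (fun x => |‖D j x‖ * ‖p x‖|
          + |u x j * (massDensity p x - ρ x)|) volume := fun j => (iDp j).add (ie j)
      rw [integral_finsetSum _ fun j _ => i3 j]
      have h1 : ∀ j : Fin 3, ∫ x, (|‖D j x‖ * ‖p x‖| + |u x j * (massDensity p x - ρ x)|)
          ≤ l2 (D j) * G + l2 (fun x => u x j) * e := fun j => by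
        rw [integral_add (iDp j) (ie j)]
        exact add_le_add (bDp j) (be j)
      refine (Finset.sum_le_sum fun j _ => h1 j).trans ?_
      rw [Finset.sum_add_distrib, ← Finset.sum_mul, ← Finset.sum_mul]
      have := mul_le_mul_of_nonneg_right huW he0
      linarith
    · refine (add_sq_le_two_mul _ _).trans (le_trans ?_ B1)
      have h1 : (G * s) ^ 2 ≤ G ^ 2 * (6 * z) := by
        rw [mul_pow]; exact mul_le_mul_of_nonneg_left hssq (sq_nonneg _)
      have h2 : (W * e) ^ 2 ≤ W ^ 2 * (2 / c * z) := by
        rw [mul_pow]; exact mul_le_mul_of_nonneg_left hesq (sq_nonneg _)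
      have h3 : z * (12 * G ^ 2 + 4 * W ^ 2 / c)
          = 2 * (G ^ 2 * (6 * z) + W ^ 2 * (2 / c * z)) := by ring
      linarith
  · have iDD : ∀ j, Integrable (fun x => ‖D j x‖ ^ 2) volume := fun j =>
      (mD j).integrable_norm_pow (by norm_num)
    refine normSqLe_one (b := 2 * z + (2 * (U * G) * s + U * W * e))
      (h := fun x => ∑ j, (‖D j x‖ ^ 2 + (2 * U * |‖D j x‖ * ‖p x‖|
        + U * |u x j * (massDensity p x - ρ x)|))) ?_
      (integrable_finsetSum _ fun j _ =>
        (iDD j).add (((iDp j).const_mul (2 * U)).add ((ie j).const_mul U))) ?_ ?_ ?_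
    · exact (integrable_kineticDensity (hp.mono (by norm_num))).1.sub
        (hρ.memLp.1.mul (muM.norm.pow 2))
    · filter_upwards [ae_all_iff.2 huU] with x hx
      -- Expanding `iε∇φ = D - uφ` gives `|D|²`, a cross term, and `|u|² |φ|²`, where the density
      -- error again appears.
      have h1 : kineticDensity ε p x - ρ x * ‖u x‖ ^ 2
          = ∑ j, (‖D j x‖ ^ 2 + (-(2 * (u x j * cdot (D j x) (p x)))
            + u x j * (u x j * (massDensity p x - ρ x)))) := by
        rw [EuclideanSpace.norm_sq_eq]
        simp only [kineticDensity, hD, massDensity, ← cdot_self, cdot_apply, Fin.sum_univ_three,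
          Complex.add_re, Complex.add_im, Complex.mul_re, Complex.mul_im, Complex.I_re,
          Complex.I_im, Complex.ofReal_re, Complex.ofReal_im, Real.norm_eq_abs, sq_abs]
        ring
      rw [h1]
      refine (norm_sum_le _ _).trans (Finset.sum_le_sum fun j _ => ?_)
      refine (norm_add_le _ _).trans (add_le_add (le_of_eq ?_) ?_)
      · rw [Real.norm_of_nonneg (sq_nonneg _)]
      refine (norm_add_le _ _).trans (add_le_add ?_ ?_)
      · rw [norm_neg, norm_mul, norm_mul, Real.norm_ofNat, mul_assoc]
        refine mul_le_mul_of_nonneg_left ?_ zero_le_two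
        exact mul_le_mul (hx j) ((abs_cdot_le _ _).trans (le_abs_self _)) (norm_nonneg _) hU
      · rw [norm_mul]
        exact mul_le_mul_of_nonneg_right (hx j) (abs_nonneg _)
    · have i3 : ∀ j, Integrable (fun x => ‖D j x‖ ^ 2 + (2 * U * |‖D j x‖ * ‖p x‖|
          + U * |u x j * (massDensity p x - ρ x)|)) volume := fun j =>
        (iDD j).add (((iDp j).const_mul (2 * U)).add ((ie j).const_mul U))
      rw [integral_finsetSum _ fun j _ => i3 j]
      have h1 : ∀ j : Fin 3, ∫ x, (‖D j x‖ ^ 2 + (2 * U * |‖D j x‖ * ‖p x‖|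
            + U * |u x j * (massDensity p x - ρ x)|))
          ≤ l2 (D j) ^ 2 + (2 * U * G * l2 (D j) + U * e * l2 (fun x => u x j)) := fun j => by
        have i3 : Integrable (fun x => 2 * U * |‖D j x‖ * ‖p x‖|
            + U * |u x j * (massDensity p x - ρ x)|) volume :=
          ((iDp j).const_mul (2 * U)).add ((ie j).const_mul U)
        rw [integral_add (iDD j) i3, integral_add ((iDp j).const_mul (2 * U)) ((ie j).const_mul U),
          integral_const_mul, integral_const_mul, l2_sq (mD j)]
        have k1 := mul_le_mul_of_nonneg_left (bDp j) (mul_nonneg zero_le_two hU)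
        have k2 := mul_le_mul_of_nonneg_left (be j) hU
        linarith
      refine (Finset.sum_le_sum fun j _ => h1 j).trans ?_
      rw [Finset.sum_add_distrib, Finset.sum_add_distrib, ← Finset.mul_sum, ← Finset.mul_sum]
      have := mul_le_mul_of_nonneg_left huW (mul_nonneg hU he0)
      linarith
    · refine (add_sq_le_two_mul _ _).trans ?_
      have h0 := add_sq_le_two_mul (2 * (U * G) * s) (U * W * e)
      have h1 : (2 * (U * G) * s) ^ 2 ≤ 4 * (U * G) ^ 2 * (6 * z) := by
        have : (2 * (U * G) * s) ^ 2 = 4 * (U * G) ^ 2 * s ^ 2 := by ring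
        rw [this]; exact mul_le_mul_of_nonneg_left hssq (by positivity)
      have h2 : (U * W * e) ^ 2 ≤ (U * W) ^ 2 * (2 / c * z) := by
        rw [mul_pow]; exact mul_le_mul_of_nonneg_left hesq (sq_nonneg _)
      -- The term quadratic in the defect is made linear by the a priori bound `Z`.
      have h3 : (2 * z) ^ 2 ≤ 4 * (z * Z) := by
        have := mul_le_mul_of_nonneg_left hZ hz0
        linarith [(by ring : (2 * z) ^ 2 = 4 * (z * z))]
      have h4 : z * (8 * Z + 96 * (U * G) ^ 2 + 8 * (U * W) ^ 2 / c)
          = 2 * (4 * (z * Z) + 2 * (4 * (U * G) ^ 2 * (6 * z) + (U * W) ^ 2 * (2 / c * z))) := by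
        ring
      linarith

/-! ### The effective potential as a kernel -/

theorem isKernel_effectivePotential {R₀ : ℝ} {v f : E3 → ℝ} (hv : IsPotential R₀ v)
    (hf : Continuous f) (hfr : IsRadial f) (hf0 : ∀ x, 0 < f x) {lam : ℝ} (hlam : 0 ≤ lam) {N : ℕ}
    (hN : 0 < N) {ε : ℝ} (hε : 0 < ε) :
    IsKernel (effectivePotential v f lam N ε) (R₀ * ε ^ 4 / boxLength N ε) := by
  have hs : 0 < (N : ℝ) * ε ^ 2 := by positivity
  set s := (N : ℝ) * ε ^ 2 with hsdef
  -- The rescaled radius is written through `L` because the factor `ε ^ 4` is exactly what the a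
  -- priori bounds consume.
  have hb : R₀ * ε ^ 4 / boxLength N ε = R₀ / s := by
    rw [boxLength, ← hsdef, mul_div_mul_right _ _ (by positivity)]
  have hsm : ∀ x : E3, ‖s • x‖ = s * ‖x‖ := fun x => by
    rw [norm_smul, Real.norm_of_nonneg hs.le]
  rw [hb]
  refine ⟨?_, fun z => ?_, fun z => ?_, ?_, fun z hz => ?_⟩
  · have hm : Measurable fun x : E3 => s • x := measurable_const_smul s
    exact ((hv.measurable.comp hm).const_mul _).mul (hf.measurable.comp hm)
  · exact mul_nonneg (mul_nonneg (mul_nonneg hlam (by positivity)) (hv.nonneg _)) (hf0 _).le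
  · have e : ‖s • (-z)‖ = ‖s • z‖ := by rw [hsm, hsm, norm_neg]
    rw [effectivePotential, effectivePotential, hv.radial _ _ e, hfr _ _ e]
  · obtain ⟨M, hM⟩ := hv.bounded
    -- Only values of `f` on the support of `v` matter, and there continuity and compactness bound
    -- it.
    obtain ⟨C, hC⟩ := (isCompact_closedBall (0 : E3) R₀).exists_bound_of_continuousOn hf.continuousOn
    have hM0 : 0 ≤ M := (hv.nonneg 0).trans (hM 0)
    have key : ∀ y, v y * f y ≤ M * |C| := fun y => by
      by_cases hy : ‖y‖ ≤ R₀
      · have h1 := hC y (by simpa using hy)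
        rw [Real.norm_of_nonneg (hf0 y).le] at h1
        exact mul_le_mul (hM y) (h1.trans (le_abs_self C)) (hf0 y).le hM0
      · rw [hv.support y (not_le.1 hy), zero_mul]
        positivity
    refine ⟨lam * s ^ 3 * (M * |C|), fun z => ?_⟩
    rw [effectivePotential, mul_assoc]
    exact mul_le_mul_of_nonneg_left (key _) (by positivity)
  · have : R₀ < ‖s • z‖ := by
      rw [hsm]
      rw [div_lt_iff₀ hs] at hz
      linarith
    rw [effectivePotential, hv.support _ this, mul_zero, zero_mul]

theorem integral_effectivePotential (v f : E3 → ℝ) (lam : ℝ) {N : ℕ} (hN : 0 < N) {ε : ℝ}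
    (hε : 0 < ε) : ∫ x, effectivePotential v f lam N ε x = lam * ∫ x, v x * f x := by
  have hs : 0 < (N : ℝ) * ε ^ 2 := by positivity
  set s := (N : ℝ) * ε ^ 2 with hsdef
  have h := Measure.integral_comp_smul (volume : Measure E3) (fun x => v x * f x) s
  have e : ∀ x, effectivePotential v f lam N ε x = lam * s ^ 3 * (v (s • x) * f (s • x)) :=
    fun x => by rw [effectivePotential, mul_assoc]
  simp only [e]
  rw [integral_const_mul, h, finrank_euclideanSpace, Fintype.card_fin,
    abs_of_nonneg (by positivity), smul_eq_mul]
  field_simp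

/-! ### A priori bounds from mass and energy -/

theorem le_one_add_of_sq_le {x a : ℝ} (h : x ^ 2 ≤ a) : x ≤ 1 + a := by
  nlinarith [sq_nonneg (x - 1)]

theorem interaction_nonneg {K : E3 → ℝ} {r : ℝ} (hK : IsKernel K r) (p : E3 → ℂ) :
    0 ≤ ∫ x, meanField K p x * massDensity p x :=
  integral_nonneg fun x => mul_nonneg
    (integral_nonneg fun z => mul_nonneg (hK.nonneg z) (massDensity_nonneg p _))
    (massDensity_nonneg p x)

theorem kinetic_le_of_energy_le {ε C : ℝ} {K : E3 → ℝ} {r : ℝ} (hK : IsKernel K r)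
    {p : E3 → ℂ} (hp : MemH 1 p) (h : energy ε K p ≤ C) (j : Fin 3) :
    ε * l2 (weakPartial j p) ≤ 1 + 2 * C := by
  rw [energy, integral_kineticDensity hp] at h
  have h1 := interaction_nonneg hK p
  have h2 : l2 (weakPartial j p) ^ 2 ≤ ∑ j, l2 (weakPartial j p) ^ 2 :=
    Finset.single_le_sum (f := fun j => l2 (weakPartial j p) ^ 2) (fun _ _ => sq_nonneg _)
      (Finset.mem_univ j)
  refine le_one_add_of_sq_le ?_
  have h3 := mul_le_mul_of_nonneg_left h2 (sq_nonneg ε)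
  rw [mul_pow]
  linarith

theorem interaction_le_of_energy_le {ε C : ℝ} {K : E3 → ℝ} {p : E3 → ℂ} (hp : MemH 1 p)
    (h : energy ε K p ≤ C) : ∫ x, meanField K p x * massDensity p x ≤ 2 * C := by
  rw [energy, integral_kineticDensity hp] at h
  have h2 : 0 ≤ ε ^ 2 * ∑ j, l2 (weakPartial j p) ^ 2 :=
    mul_nonneg (sq_nonneg _) (Finset.sum_nonneg fun _ _ => sq_nonneg _)
  linarith

/-- The a priori bound on the product of the gradient norm and the cubic norm. -/
theorem exists_cubic_bound {G : ℝ} (hG : 0 ≤ G) : ∃ H, 0 ≤ H ∧ ∀ (ε : ℝ) (p : E3 → ℂ), 0 < ε →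
    ε ≤ 1 → MemH 1 p → l2 p ≤ G → (∀ j, ε * l2 (weakPartial j p) ≤ G) → MemLp p 6 volume ∧
      ε ^ 4 * ((∑ j, l2 (weakPartial j p)) * l2 (fun x => ‖p x‖ ^ 3)) ≤ H := by
  obtain ⟨C, hC, hS⟩ := exists_sobolev
  refine ⟨3 * G * (C * (4 * G)) ^ 3, by positivity, fun ε p hε hε1 hp h0 h1 => ?_⟩
  obtain ⟨h6, hb⟩ := hS p _ fun j => hp.hasL2Partial j
  refine ⟨h6, ?_⟩
  obtain ⟨-, e⟩ := memLp_cube h6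
  rw [e]
  set S := ∑ j, l2 (weakPartial j p) with hSdef
  set q := (eLpNorm p 6 volume).toReal with hq
  have hq0 : 0 ≤ q := ENNReal.toReal_nonneg
  have hS0 : 0 ≤ S := Finset.sum_nonneg fun _ _ => l2_nonneg _
  have hS3 : ε * S ≤ 3 * G := by
    rw [hSdef, Fin.sum_univ_three]
    linarith [h1 0, h1 1, h1 2]
  have hq1 : ε * q ≤ C * (4 * G) := by
    have k1 := mul_le_mul_of_nonneg_left hb hε.le
    have k2 : ε * l2 p ≤ G := (mul_le_of_le_one_left (l2_nonneg p) hε1).trans h0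
    have k3 : C * (ε * l2 p + ε * S) ≤ C * (4 * G) := mul_le_mul_of_nonneg_left (by linarith) hC
    calc ε * q ≤ ε * (C * (l2 p + S)) := k1
      _ = C * (ε * l2 p + ε * S) := by ring
      _ ≤ _ := k3
  have k := mul_le_mul hS3 (pow_le_pow_left₀ (mul_nonneg hε.le hq0) hq1 3) (by positivity)
    (by positivity)
  -- One power of `ε` pays for the gradient and three for the cube of the `L⁶` norm.
  calc ε ^ 4 * (S * q ^ 3) = ε * S * (ε * q) ^ 3 := by ring
    _ ≤ _ := k

/-- The a priori bound at the initial time. -/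
theorem exists_initial_bound {G : ℝ} (hG : 0 ≤ G) : ∃ H, 0 ≤ H ∧ ∀ (ε : ℝ) (p : E3 → ℂ), 0 < ε →
    ε ≤ 1 → MemH 2 p → l2 p ≤ G → (∀ j, ε * l2 (weakPartial j p) ≤ G) →
    (∀ j, ε ^ 2 * l2 (weakPartial j (weakPartial j p)) ≤ G) → ∃ Cp, 0 ≤ Cp ∧
      (∀ᵐ x, ‖p x‖ ≤ Cp) ∧ ε ^ 3 * (Cp * ∑ j, l2 (weakPartial j p)) ≤ H := by
  obtain ⟨C, hC, hS⟩ := hasSupBound_complex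
  refine ⟨C * (7 * G) * (3 * G), by positivity, fun ε p hε hε1 hp h0 h1 h2 => ?_⟩
  have hb := hS p _ _ (fun j => hp.hasL2Partial j) fun j => (memH_weakPartial hp j).hasL2Partial j
  have n0 := l2_nonneg p
  have n1 := fun j => l2_nonneg (weakPartial j p)
  have n2 := fun j => l2_nonneg (weakPartial j (weakPartial j p))
  have hs0 : 0 ≤ ∑ j, (l2 (weakPartial j p) + l2 (weakPartial j (weakPartial j p))) :=
    Finset.sum_nonneg fun j _ => add_nonneg (n1 j) (n2 j)
  refine ⟨_, mul_nonneg hC (add_nonneg n0 hs0), hb, ?_⟩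
  have a0 : ε ^ 2 * l2 p ≤ G :=
    (mul_le_of_le_one_left n0 (pow_le_one₀ hε.le hε1)).trans h0
  have a1 : ∀ j, ε ^ 2 * l2 (weakPartial j p) ≤ G := fun j => by
    have := mul_le_of_le_one_left (mul_nonneg hε.le (n1 j)) hε1
    calc ε ^ 2 * l2 (weakPartial j p) = ε * (ε * l2 (weakPartial j p)) := by ring
      _ ≤ _ := this
      _ ≤ G := h1 j
  have a2 : ε ^ 2 * (l2 p + ∑ j, (l2 (weakPartial j p) + l2 (weakPartial j (weakPartial j p))))
      ≤ 7 * G := by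
    rw [Fin.sum_univ_three]
    linarith [a1 0, a1 1, a1 2, h2 0, h2 1, h2 2]
  have a3 : ε * ∑ j, l2 (weakPartial j p) ≤ 3 * G := by
    rw [Fin.sum_univ_three]
    linarith [h1 0, h1 1, h1 2]
  have a4 : 0 ≤ ∑ j, l2 (weakPartial j p) := Finset.sum_nonneg fun j _ => n1 j
  -- Two powers of `ε` pay for the two derivatives in the sup bound and one for the gradient.
  calc _ = C * (ε ^ 2 * (l2 p + ∑ j, (l2 (weakPartial j p)
        + l2 (weakPartial j (weakPartial j p))))) * (ε * ∑ j, l2 (weakPartial j p)) := by ring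
    _ ≤ _ := mul_le_mul (mul_le_mul_of_nonneg_left a2 hC) a3 (mul_nonneg hε.le a4) (by positivity)

/-- Lowers the coefficient, here from the integral of the kernel to its lower bound, without knowing
the sign of `y`; for negative `y` the bound `0 ≤ x` suffices. -/
theorem mul_le_of_le_mul {k k' x y : ℝ} (hk : 0 ≤ k') (hkk : k' ≤ k) (hx : 0 ≤ x)
    (h : k * y ≤ x) : k' * y ≤ x := by
  rcases le_total 0 y with hy | hy
  · exact (mul_le_mul_of_nonneg_right hkk hy).trans h
  · exact (mul_nonpos_of_nonneg_of_nonpos hk hy).trans hx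

/-! ### Grönwall's inequality and the uniform estimate -/

/-- Grönwall's inequality on an interval. -/
theorem le_exp_mul_of_deriv_le {T κ : ℝ} {y y' : ℝ → ℝ}
    (hy : ∀ t ∈ Icc 0 T, HasDerivWithinAt y (y' t) (Icc 0 T) t)
    (hle : ∀ t ∈ Icc 0 T, y' t ≤ κ * y t) {t : ℝ} (ht : t ∈ Icc 0 T) :
    y t ≤ Real.exp (κ * t) * y 0 := by
  have hd : ∀ s ∈ Icc 0 T, HasDerivWithinAt (fun s => Real.exp (-(κ * s)) * y s)
      (Real.exp (-(κ * s)) * (y' s - κ * y s)) (Icc 0 T) s := fun s hs => by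
    have h1 : HasDerivAt (fun s => Real.exp (-(κ * s))) (Real.exp (-(κ * s)) * -(κ * 1)) s :=
      ((hasDerivAt_id s).const_mul κ).neg.exp
    exact (h1.hasDerivWithinAt.mul (hy s hs)).congr_deriv (by ring)
  have hanti : AntitoneOn (fun s => Real.exp (-(κ * s)) * y s) (Icc 0 T) := by
    refine antitoneOn_of_deriv_nonpos (convex_Icc 0 T)
      (fun s hs => (hd s hs).continuousWithinAt) (fun s hs => ?_) fun s hs => ?_
    · exact ((hd s (interior_subset hs)).mono interior_subset).differentiableWithinAt
    · rw [interior_Icc] at hs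
      have h1 := (hd s (Ioo_subset_Icc_self hs)).hasDerivAt (Icc_mem_nhds hs.1 hs.2)
      rw [h1.deriv]
      exact mul_nonpos_of_nonneg_of_nonpos (Real.exp_pos _).le
        (sub_nonpos.2 (hle s (Ioo_subset_Icc_self hs)))
  have h := hanti (left_mem_Icc.2 (ht.1.trans ht.2)) ht ht.1
  simp only [mul_zero, neg_zero, Real.exp_zero, one_mul] at h
  have h2 := mul_le_mul_of_nonneg_left h (Real.exp_pos (κ * t)).le
  rwa [← mul_assoc, ← Real.exp_add, add_neg_cancel, Real.exp_zero, one_mul] at h2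

/-- Uniform bounds for the solution of the Euler equation. -/
structure EulerBounds (T : ℝ) (ρ : ℝ → E3 → ℝ) (u : ℝ → E3 → E3) (M U W B P : ℝ) : Prop where
  M_nonneg : 0 ≤ M
  U_nonneg : 0 ≤ U
  B_nonneg : 0 ≤ B
  gradient : ∀ t ∈ Icc 0 T, ∀ j k : Fin 3, ∀ᵐ x, ‖weakPartial k (fun y => u t y j) x‖ ≤ M
  velocity : ∀ t ∈ Icc 0 T, ∀ j : Fin 3, ∀ᵐ x, ‖u t x j‖ ≤ U
  velocity_l2 : ∀ t ∈ Icc 0 T, ∑ j : Fin 3, l2 (fun x => u t x j) ≤ W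
  third : ∀ t ∈ Icc 0 T, ∑ j : Fin 3, ∑ k : Fin 3,
    l2 (weakPartial k (weakPartial k (weakPartial j (fun y => u t y j)))) ≤ B
  density : ∀ t ∈ Icc 0 T, l2 (ρ t) ≤ P

theorem IsEulerSolution.exists_bounds {c T : ℝ} {ρ : ℝ → E3 → ℝ} {u : ℝ → E3 → E3}
    (hE : IsEulerSolution c T ρ u) : ∃ M U W B P, EulerBounds T ρ u M U W B P := by
  have h1 := fun j k => ((hE.regularity_velocity j).supCont hasSupBound_real [k] (by simp)).bounded
  have h2 := fun j => ((hE.regularity_velocity j).supCont hasSupBound_real [] (by simp)).bounded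
  have h3 := fun j => (hE.regularity_velocity j).l2Cont_self.bounded
  have h4 := fun j k => ((hE.regularity_velocity j).l2Cont [k, k, j] (by simp)).bounded
  obtain ⟨P, -, hP⟩ := hE.regularity_density.l2Cont_self.bounded
  choose M hM0 hM using h1
  choose U hU0 hU using h2
  choose W hW0 hW using h3
  choose B hB0 hB using h4
  refine ⟨∑ j, ∑ k, M j k, ∑ j, U j, ∑ j, W j, ∑ j, ∑ k, B j k, P,
    Finset.sum_nonneg fun j _ => Finset.sum_nonneg fun k _ => hM0 j k,
    Finset.sum_nonneg fun j _ => hU0 j,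
    Finset.sum_nonneg fun j _ => Finset.sum_nonneg fun k _ => hB0 j k, fun t ht j k => ?_,
    fun t ht j => ?_, fun t ht => Finset.sum_le_sum fun j _ => hW j t ht,
    fun t ht => Finset.sum_le_sum fun j _ => Finset.sum_le_sum fun k _ => hB j k t ht, hP⟩
  · have k1 : M j k ≤ ∑ k, M j k :=
      Finset.single_le_sum (f := fun k => M j k) (fun k _ => hM0 j k) (Finset.mem_univ k)
    have k2 : ∑ k, M j k ≤ ∑ j, ∑ k, M j k :=
      Finset.single_le_sum (f := fun j => ∑ k, M j k)
        (fun j _ => Finset.sum_nonneg fun k _ => hM0 j k) (Finset.mem_univ j)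
    exact (hM j k t ht).mono fun x hx => hx.trans (k1.trans k2)
  · have k1 : U j ≤ ∑ j, U j :=
      Finset.single_le_sum (f := U) (fun j _ => hU0 j) (Finset.mem_univ j)
    exact (hU j t ht).mono fun x hx => hx.trans k1

/-- The energy bound at a fixed time: the interaction energy is bounded below and the density is
bounded in `L²`. -/
theorem interaction_bounds {R₀ c C₀ G H : ℝ} (hR₀ : 0 < R₀) (hc : 0 < c) (hC₀ : 0 ≤ C₀)
    (hG : G = 1 + 2 * C₀) (hH : 0 ≤ H)
    (hcub : ∀ (ε : ℝ) (p : E3 → ℂ), 0 < ε →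
      ε ≤ 1 → MemH 1 p → l2 p ≤ G → (∀ j, ε * l2 (weakPartial j p) ≤ G) → MemLp p 6 volume ∧
      ε ^ 4 * ((∑ j, l2 (weakPartial j p)) * l2 (fun x => ‖p x‖ ^ 3)) ≤ H)
    {ε L k' : ℝ} (hε : 0 < ε) (hε1 : ε ≤ 1) (hL : R₀ < L) {K : E3 → ℝ}
    (hK : IsKernel K (R₀ * ε ^ 4 / L)) (hk1 : c / 2 ≤ k') (hk : k' ≤ ∫ z, K z) {p : E3 → ℂ}
    (hp : MemH 2 p) (hpG : l2 p ≤ G) (hen : energy ε K p ≤ C₀) :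
    R₀ * ε ^ 4 / L * ((∑ j, l2 (weakPartial j p)) * l2 (fun x => ‖p x‖ ^ 3)) ≤ R₀ * H * (1 / L) ∧
    k' * (l2 (massDensity p) ^ 2 - 4 * (R₀ * H * (1 / L)))
      ≤ ∫ x, meanField K p x * massDensity p x ∧
    l2 (massDensity p) ≤ 1 + (4 * C₀ / c + 4 * H) := by
  have hp1 : MemH 1 p := hp.mono (by norm_num)
  have hL0 : 0 < L := hR₀.trans hL
  have hkin := fun j => kinetic_le_of_energy_le hK hp1 hen j
  rw [← hG] at hkin
  obtain ⟨h6, hc4⟩ := hcub ε p hε hε1 hp1 hpG hkin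
  set S := ∑ j, l2 (weakPartial j p) with hS
  set Q := l2 (fun x => ‖p x‖ ^ 3) with hQ
  obtain ⟨Cp, hCp⟩ := hp.exists_bound hasSupBound_complex le_rfl
  have e1 : R₀ * ε ^ 4 / L * (S * Q) ≤ R₀ * H * (1 / L) := by
    have h1 : R₀ * ε ^ 4 / L * (S * Q) = R₀ / L * (ε ^ 4 * (S * Q)) := by ring
    have h2 : R₀ * H * (1 / L) = R₀ / L * H := by ring
    rw [h1, h2]
    exact mul_le_mul_of_nonneg_left hc4 (by positivity)
  have hlow := le_interaction hK (fun j => hp.hasL2Partial j) hCp h6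
  set X := ∫ x, meanField K p x * massDensity p x with hX
  have hX0 : 0 ≤ X := interaction_nonneg hK p
  have hXC : X ≤ 2 * C₀ := interaction_le_of_energy_le hp1 hen
  have hk0 : 0 ≤ k' := by linarith
  have e2 : k' * (l2 (massDensity p) ^ 2 - 4 * (R₀ * H * (1 / L))) ≤ X := by
    refine mul_le_of_le_mul hk0 hk hX0 (le_trans ?_ hlow)
    refine mul_le_mul_of_nonneg_left ?_ hK.integral_nonneg
    have : 4 * (R₀ * ε ^ 4 / L * S) * Q = 4 * (R₀ * ε ^ 4 / L * (S * Q)) := by ring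
    linarith
  refine ⟨e1, e2, le_one_add_of_sq_le ?_⟩
  have h1 : R₀ * H * (1 / L) ≤ H := by
    have : R₀ * (1 / L) ≤ 1 := by rw [mul_one_div, div_le_one hL0]; exact hL.le
    calc R₀ * H * (1 / L) = R₀ * (1 / L) * H := by ring
      _ ≤ 1 * H := mul_le_mul_of_nonneg_right this hH
      _ = H := one_mul H
  -- Either the density norm is already below the locality error, or the bracket is nonnegative and
  -- `c / 2 ≤ k'` turns the energy bound into a bound on it.
  rcases le_total (l2 (massDensity p) ^ 2) (4 * (R₀ * H * (1 / L))) with h | h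
  · have : 0 ≤ 4 * C₀ / c := by positivity
    linarith
  · have h2 : c / 2 * (l2 (massDensity p) ^ 2 - 4 * (R₀ * H * (1 / L))) ≤ 2 * C₀ :=
      (mul_le_mul_of_nonneg_right hk1 (sub_nonneg.2 h)).trans (e2.trans hXC)
    have h3 : l2 (massDensity p) ^ 2 - 4 * (R₀ * H * (1 / L)) ≤ 4 * C₀ / c := by
      rw [le_div_iff₀ hc]
      linarith
    linarith

/-- The defect is bounded by the modulated energy. -/
theorem defect_le_modulatedEnergy {ε c k' R E : ℝ} {K : E3 → ℝ} {p : E3 → ℂ} {ρ : E3 → ℝ}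
    {u : E3 → E3} (hu : ∀ j, MemH 4 fun x => u x j) (hρ : MemH 2 ρ) (hp : MemH 2 p)
    (hk : k' ≤ c) (hR : l2 (massDensity p) ≤ R) (hE : 0 ≤ E)
    (hX : k' * (l2 (massDensity p) ^ 2 - E) ≤ ∫ x, meanField K p x * massDensity p x) :
    defect ε c p ρ (fun j x => u x j)
      ≤ modulatedEnergy ε c K p ρ u + 1 / 2 * (R ^ 2 * (c - k')) + c / 2 * E := by
  rw [modulatedEnergy_eq_defect hu hρ hp]
  have h1 : l2 (massDensity p) ^ 2 ≤ R ^ 2 := pow_le_pow_left₀ (l2_nonneg _) hR 2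
  have h2 := mul_le_mul_of_nonneg_right h1 (sub_nonneg.2 hk)
  have h3 := mul_le_mul_of_nonneg_right hk hE
  linarith

/-- The crude bound has two uses: it is the whole estimate when `λ/L` is not small, and it
linearizes the square of the defect in the kinetic estimate. -/
theorem defect_le_const {ε c G U R P : ℝ} (hc : 0 ≤ c) (hU : 0 ≤ U) (hε : 0 ≤ ε) {p : E3 → ℂ}
    (hp : MemH 2 p) {ρ : E3 → ℝ} (hρ : MemH 2 ρ) {u : Fin 3 → E3 → ℝ} (hu : ∀ j, MemH 4 (u j))
    (huU : ∀ j, ∀ᵐ x, ‖u j x‖ ≤ U) (hpG : l2 p ≤ G) (hkin : ∀ j, ε * l2 (weakPartial j p) ≤ G)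
    (hR : l2 (massDensity p) ≤ R) (hP : l2 ρ ≤ P) :
    defect ε c p ρ u ≤ 3 / 2 * (G + U * G) ^ 2 + c / 2 * (R + P) ^ 2 := by
  obtain ⟨C, hC⟩ := hp.exists_bound hasSupBound_complex le_rfl
  have hm := memLp_massDensity hp.memLp hC
  have h1 : ∀ j, l2 (fun x => Complex.I * (ε : ℂ) * weakPartial j p x + (u j x : ℂ) * p x)
      ≤ G + U * G := fun j => by
    have m1 : MemLp (fun x => Complex.I * (ε : ℂ) * weakPartial j p x) 2 volume :=
      (hp.hasL2Partial j).mem'.const_mul _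
    have m2 : MemLp (fun x => (u j x : ℂ) * p x) 2 volume := by
      refine memLp_two_of_le (C := U) ((Complex.continuous_ofReal.comp_aestronglyMeasurable
        (hu j).memLp.1).mul hp.memLp.1) hp.memLp ?_
      filter_upwards [huU j] with x hx
      rw [norm_mul, Complex.norm_real]
      exact mul_le_mul_of_nonneg_right hx (norm_nonneg _)
    refine (l2_add_le m1 m2).trans (add_le_add ?_ ?_)
    · refine (l2_le_mul hε (hp.hasL2Partial j).mem' (Eventually.of_forall fun x => ?_)).trans
        (hkin j)
      simp [abs_of_nonneg hε]
    · refine (l2_le_mul hU hp.memLp ?_).trans (mul_le_mul_of_nonneg_left hpG hU)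
      filter_upwards [huU j] with x hx
      rw [norm_mul, Complex.norm_real]
      exact mul_le_mul_of_nonneg_right hx (norm_nonneg _)
  have h2 := fun j => pow_le_pow_left₀ (l2_nonneg _) (h1 j) 2
  have h3 : l2 (fun x => massDensity p x - ρ x) ≤ R + P :=
    (l2_sub_le hm hρ.memLp).trans (add_le_add hR hP)
  have h4 := pow_le_pow_left₀ (l2_nonneg _) h3 2
  rw [defect, Fin.sum_univ_three]
  have h5 := mul_le_mul_of_nonneg_left h4 (by linarith : 0 ≤ c / 2)
  linarith [h2 0, h2 1, h2 2]

/-- The lower bound of the modulated energy at the initial time. -/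
theorem neg_le_modulatedEnergy_initial {R₀ c C₀ G H₀ : ℝ} (hR₀ : 0 < R₀) (hc : 0 < c)
    (hC₀ : 0 ≤ C₀) (hG : G = 1 + 2 * C₀)
    (hini : ∀ (ε : ℝ) (p : E3 → ℂ), 0 < ε →
      ε ≤ 1 → MemH 2 p → l2 p ≤ G → (∀ j, ε * l2 (weakPartial j p) ≤ G) →
      (∀ j, ε ^ 2 * l2 (weakPartial j (weakPartial j p)) ≤ G) → ∃ Cp, 0 ≤ Cp ∧
        (∀ᵐ x, ‖p x‖ ≤ Cp) ∧ ε ^ 3 * (Cp * ∑ j, l2 (weakPartial j p)) ≤ H₀)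
    {ε L k' R : ℝ} (hε : 0 < ε) (hε1 : ε ≤ 1) (hεδ : 2 * (c * R₀ * H₀ ^ 2) * ε ≤ 1) (hL : R₀ < L)
    {K : E3 → ℝ} (hK : IsKernel K (R₀ * ε ^ 4 / L)) (hk0 : 0 ≤ k') (hkc : k' ≤ c)
    (hk : k' ≤ ∫ z, K z) {p : E3 → ℂ} (hp : MemH 4 p) (hw : weightedNormSq ε 4 p ≤ C₀)
    (hR : l2 (massDensity p) ≤ R) {ρ : E3 → ℝ} (hρ : MemH 2 ρ) {u : E3 → E3}
    (hu : ∀ j, MemH 4 fun x => u x j) :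
    -(1 / 2 * (R ^ 2 * (c - k')) + 1 / 2 * (1 / L)) ≤ modulatedEnergy ε c K p ρ u := by
  have hL0 : 0 < L := hR₀.trans hL
  have hp2 : MemH 2 p := hp.mono (by norm_num)
  -- The weighted norm is bounded only at the initial time; it provides the second derivatives
  -- behind the sup bound on the data.
  have hw' : ∀ l : List (Fin 3), l.length ≤ 4 → ε ^ l.length * l2 (weakDeriv l p) ≤ G := by
    intro l hl
    have h1 := (weightedNormSq_ge hε.le hp l hl).trans hw
    have h2 : (ε ^ l.length * l2 (weakDeriv l p)) ^ 2 ≤ C₀ := by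
      rw [mul_pow, ← pow_mul, mul_comm l.length 2]
      exact h1
    have h3 := le_one_add_of_sq_le h2
    linarith
  have a0 : l2 p ≤ G := by
    have := hw' [] (by simp)
    simpa [weakDeriv] using this
  have a1 : ∀ j, ε * l2 (weakPartial j p) ≤ G := fun j => by
    have := hw' [j] (by simp)
    simpa [weakDeriv] using this
  have a2 : ∀ j, ε ^ 2 * l2 (weakPartial j (weakPartial j p)) ≤ G := fun j => by
    have := hw' [j, j] (by simp)
    simpa [weakDeriv] using this
  obtain ⟨Cp, hCp0, hCp, hb⟩ := hini ε p hε hε1 hp2 a0 a1 a2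
  have hlow := le_interaction_sq hK (fun j => hp.hasL2Partial j) hCp hCp0
  set S := ∑ j, l2 (weakPartial j p) with hS
  have hS0 : 0 ≤ S := Finset.sum_nonneg fun _ _ => l2_nonneg _
  set E := 2 * (R₀ * ε ^ 4 / L * (Cp * S)) ^ 2 with hE
  have hX := mul_le_of_le_mul hk0 hk (interaction_nonneg hK p) hlow
  have hd := defect_le_modulatedEnergy (ε := ε) hu hρ hp2 hkc hR (by positivity : 0 ≤ E) hX
  have hd0 : 0 ≤ defect ε c p ρ (fun j x => u x j) := defect_nonneg hc.le _ _ _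
  have e1 : R₀ * ε ^ 4 / L * (Cp * S) ≤ R₀ / L * (ε * H₀) := by
    have h1 : R₀ * ε ^ 4 / L * (Cp * S) = R₀ / L * (ε * (ε ^ 3 * (Cp * S))) := by ring
    rw [h1]
    exact mul_le_mul_of_nonneg_left (mul_le_mul_of_nonneg_left hb hε.le) (by positivity)
  have e2 := pow_le_pow_left₀ (by positivity : 0 ≤ R₀ * ε ^ 4 / L * (Cp * S)) e1 2
  have hRL : R₀ / L ≤ 1 := by rw [div_le_one hL0]; exact hL.le
  -- The error is quadratic in `R₀ / L`, so one such factor and the smallness of `ε` produce the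
  -- coefficient `1/2`. A coefficient below 1 is essential: it leaves part of `1/L` to keep the
  -- final right-hand side positive.
  have e3 : c * (R₀ / L * (ε * H₀)) ^ 2 ≤ 1 / 2 * (1 / L) := by
    have h1 : c * (R₀ / L * (ε * H₀)) ^ 2 = (c * R₀ * H₀ ^ 2 * ε) * ε * (R₀ / L) * (1 / L) := by
      ring
    rw [h1]
    have n1 : 0 ≤ c * R₀ * H₀ ^ 2 * ε := by positivity
    have h2 : (c * R₀ * H₀ ^ 2 * ε) * ε ≤ 1 / 2 * 1 :=
      mul_le_mul (by linarith) hε1 hε.le (by norm_num)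
    have h3 : (c * R₀ * H₀ ^ 2 * ε) * ε * (R₀ / L) ≤ 1 / 2 * 1 * 1 :=
      mul_le_mul h2 hRL (by positivity) (by norm_num)
    have h4 := mul_le_mul_of_nonneg_right h3 (by positivity : 0 ≤ 1 / L)
    linarith
  have e4 : c / 2 * E ≤ 1 / 2 * (1 / L) := by
    have : c / 2 * E = c * (R₀ * ε ^ 4 / L * (Cp * S)) ^ 2 := by rw [hE]; ring
    rw [this]
    exact (mul_le_mul_of_nonneg_left e2 hc.le).trans e3
  linarith

/-- The quantitative convergence result with constants that do not depend on the kernel. -/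
theorem exists_uniform_estimate {R₀ c T C₀ θ B : ℝ} (hR₀ : 0 < R₀) (hc : 0 < c) (hT : 0 < T)
    (hC₀ : 0 ≤ C₀) (hθ : 0 < θ) (hB : 0 ≤ B) {ρ : ℝ → E3 → ℝ} {u : ℝ → E3 → E3}
    (hE : IsEulerSolution c T ρ u) :
    ∃ C > 0, ∃ A > 0, ∃ δ > 0, ∀ (ε L lam k' : ℝ) (K : E3 → ℝ) (φ : ℝ → E3 → ℂ),
      0 < ε → ε < δ → R₀ < L → 1 ≤ lam → IsKernel K (R₀ * ε ^ 4 / L) → c / 2 ≤ k' → k' ≤ c →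
      k' ≤ ∫ z, K z → (lam / L ≤ θ → ∫ z, K z ≤ k' + B * (lam / L)) →
      IsModifiedGPSolution ε K T φ → weightedNormSq ε 4 (φ 0) ≤ C₀ → energy ε K (φ 0) ≤ C₀ →
      DensityEstimates ε T φ ρ u (C * (modulatedEnergy ε c K (φ 0) (ρ 0) (u 0)
        + ε ^ 2 + lam / L + A * (c - k'))) := by
  obtain ⟨M, U, W, B₃, P, hb⟩ := hE.exists_bounds
  obtain ⟨G, hG⟩ : ∃ G, G = 1 + 2 * C₀ := ⟨_, rfl⟩
  have hG0 : 0 ≤ G := by rw [hG]; positivity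
  obtain ⟨H, hH0, hcub⟩ := exists_cubic_bound hG0
  obtain ⟨H₀, hH₀0, hini⟩ := exists_initial_bound hG0
  obtain ⟨R, hR⟩ : ∃ R, R = 1 + (4 * C₀ / c + 4 * H) := ⟨_, rfl⟩
  have hR1 : 1 ≤ R := by
    have : 0 ≤ 4 * C₀ / c := by positivity
    rw [hR]; linarith
  have hM := hb.M_nonneg
  have hU := hb.U_nonneg
  have hB₃ := hb.B_nonneg
  obtain ⟨C₃, hC₃⟩ : ∃ x, x = 1 / 2 + 2 * (c * (R₀ * H)) := ⟨_, rfl⟩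
  have hC₃0 : 0 ≤ C₃ := by rw [hC₃]; positivity
  obtain ⟨C₂, hC₂⟩ : ∃ x, x = B₃ * R / 4 + 24 * M * ((c + B * θ) * (R₀ * H))
    + 3 / 2 * M * (1 + B * R ^ 2) := ⟨_, rfl⟩
  have hC₂0 : 0 ≤ C₂ := by rw [hC₂]; positivity
  obtain ⟨Zm, hZm⟩ : ∃ x, x = 3 / 2 * (G + U * G) ^ 2 + c / 2 * (R + P) ^ 2 := ⟨_, rfl⟩
  have hZm0 : 0 ≤ Zm := by rw [hZm]; positivity
  obtain ⟨C₅, hC₅⟩ : ∃ x, x = Real.exp ((6 * M + 1) * T) * (1 + 2 * (C₃ + C₂)) + 2 * Zm / θ :=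
    ⟨_, rfl⟩
  have hx0 : 0 ≤ Real.exp ((6 * M + 1) * T) * (1 + 2 * (C₃ + C₂)) := by positivity
  have hx1 : 0 ≤ 2 * Zm / θ := by positivity
  have hC₅0 : 0 ≤ C₅ := by rw [hC₅]; positivity
  obtain ⟨C₆, hC₆⟩ : ∃ x, x = 2 / c + (12 * G ^ 2 + 4 * W ^ 2 / c)
    + (8 * Zm + 96 * (U * G) ^ 2 + 8 * (U * W) ^ 2 / c) := ⟨_, rfl⟩
  have hC₆0 : 0 ≤ C₆ := by rw [hC₆]; positivity
  have hδ0 : 0 < 1 + 2 * (c * R₀ * H₀ ^ 2) := by positivity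
  -- `C₅` bounds the defect and `C₆` passes to the densities; the added 1 only makes the product
  -- positive. `A = R²` is the factor with which `c - k'` enters the errors, and the last constant
  -- gives both `ε ≤ 1` and the smallness needed at time zero.
  refine ⟨C₅ * C₆ + 1, by positivity, R ^ 2, by positivity, 1 / (1 + 2 * (c * R₀ * H₀ ^ 2)),
    by positivity, ?_⟩
  intro ε L lam k' K φ hε hεδ hL hlam hK hk1 hkc hk hkB hφ hw hen
  rw [lt_div_iff₀ hδ0] at hεδ
  have hε1 : ε ≤ 1 := by
    have : 0 ≤ ε * (2 * (c * R₀ * H₀ ^ 2)) := by positivity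
    linarith
  have hεδ' : 2 * (c * R₀ * H₀ ^ 2) * ε ≤ 1 := by linarith
  have hL0 : 0 < L := hR₀.trans hL
  have h1L : 1 / L ≤ lam / L := by gcongr
  have hiL : 0 < 1 / L := by positivity
  have hk0 : 0 ≤ k' := by linarith
  have h0T : (0 : ℝ) ∈ Icc 0 T := ⟨le_rfl, hT.le⟩
  have hH4 : ∀ t ∈ Icc 0 T, MemH 4 (φ t) := hφ.regularity.1
  have hH2 : ∀ t ∈ Icc 0 T, MemH 2 (φ t) := fun t ht => (hH4 t ht).mono (by norm_num)
  have hrho : ∀ t ∈ Icc 0 T, MemH 2 (ρ t) := fun t ht => hE.memH_density ht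
  have hvel : ∀ t ∈ Icc 0 T, ∀ j, MemH 4 fun x => u t x j := fun t ht => hE.memH_velocity ht
  have hl2 : ∀ t ∈ Icc 0 T, l2 (φ t) ≤ G := fun t ht => by
    rw [hφ.l2_eq hε.ne' hT ht]
    have h1 := (weightedNormSq_ge hε.le (hH4 0 h0T) [] (by simp)).trans hw
    have h2 : l2 (φ 0) ^ 2 ≤ C₀ := by simpa [weakDeriv] using h1
    have := le_one_add_of_sq_le h2
    linarith
  have hent : ∀ t ∈ Icc 0 T, energy ε K (φ t) ≤ C₀ := fun t ht => by
    rw [hφ.energy_eq hK hε.ne' hT ht]; exact hen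
  have hbd := fun t (ht : t ∈ Icc 0 T) => interaction_bounds hR₀ hc hC₀ hG hH0 hcub hε hε1 hL hK
    hk1 hk (hH2 t ht) (hl2 t ht) (hent t ht)
  rw [← hR] at hbd
  obtain ⟨Z, hZ⟩ : ∃ Z : ℝ → ℝ, Z = fun t => defect ε c (φ t) (ρ t) (fun j x => u t x j) := ⟨_, rfl⟩
  obtain ⟨Y, hY⟩ : ∃ Y : ℝ → ℝ, Y = fun t => modulatedEnergy ε c K (φ t) (ρ t) (u t) := ⟨_, rfl⟩
  obtain ⟨q, hq⟩ : ∃ q, q = ε ^ 2 + lam / L + R ^ 2 * (c - k') := ⟨_, rfl⟩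
  have hA0 : 0 ≤ R ^ 2 * (c - k') := mul_nonneg (sq_nonneg _) (sub_nonneg.2 hkc)
  have hε2 : 0 ≤ ε ^ 2 := sq_nonneg _
  have hl0 : 0 ≤ lam / L := hiL.le.trans h1L
  have hY0 : -(1 / 2 * (R ^ 2 * (c - k')) + 1 / 2 * (1 / L)) ≤ Y 0 := by
    rw [hY]
    exact neg_le_modulatedEnergy_initial hR₀ hc hC₀ hG hini hε hε1 hεδ' hL hK hk0 hkc hk
      (hH4 0 h0T) hw (hbd 0 h0T).2.2 (hrho 0 h0T) (hvel 0 h0T)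
  -- The initial lower bound loses at most half of `q`. Hence the right-hand side dominates all
  -- error terms even when the initial modulated energy is negative.
  have hQ : q ≤ 2 * (Y 0 + q) := by rw [hq]; linarith
  have hq0 : 0 ≤ q := by rw [hq]; linarith
  have hQ0 : 0 ≤ Y 0 + q := by linarith
  have hZY : ∀ t ∈ Icc 0 T, Z t ≤ Y t + C₃ * q := fun t ht => by
    have h1 := defect_le_modulatedEnergy (ε := ε) (hvel t ht) (hrho t ht) (hH2 t ht) hkc
      (hbd t ht).2.2 (by positivity : 0 ≤ 4 * (R₀ * H * (1 / L))) (hbd t ht).2.1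
    have h2 : c / 2 * (4 * (R₀ * H * (1 / L))) ≤ 2 * (c * (R₀ * H)) * q := by
      have : 1 / L ≤ q := by rw [hq]; linarith
      calc c / 2 * (4 * (R₀ * H * (1 / L))) = 2 * (c * (R₀ * H)) * (1 / L) := by ring
        _ ≤ _ := mul_le_mul_of_nonneg_left this (by positivity)
    have h3 : 1 / 2 * (R ^ 2 * (c - k')) ≤ 1 / 2 * q := by rw [hq]; linarith
    rw [hZ, hY, hC₃]
    linarith
  have hZ0 : ∀ t, 0 ≤ Z t := fun t => by rw [hZ]; exact defect_nonneg hc.le _ _ _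
  have hZc : ∀ t ∈ Icc 0 T, Z t ≤ Zm := fun t ht => by
    have hkin := fun j => kinetic_le_of_energy_le hK ((hH2 t ht).mono (by norm_num)) (hent t ht) j
    rw [← hG] at hkin
    rw [hZ, hZm]
    exact defect_le_const hc.le hU hε.le (hH2 t ht) (hrho t ht) (hvel t ht) (hb.velocity t ht)
      (hl2 t ht) hkin (hbd t ht).2.2 (hb.density t ht)
  have hmain : ∀ t ∈ Icc 0 T, Z t ≤ C₅ * (Y 0 + q) := by
    intro t ht
    -- Below `θ` the upper bound on the integral of the kernel is available and Grönwall applies.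
    -- Above it, `Y 0 + q ≥ θ/2`, and the crude bound `Zm` suffices; the two summands of `C₅`
    -- correspond to the two cases.
    rcases le_total (lam / L) θ with hcase | hcase
    · have hkB' := hkB hcase
      have hkm : ∫ z, K z ≤ c + B * θ := by
        have := mul_le_mul_of_nonneg_left hcase hB
        linarith
      have hkd : |(∫ z, K z) - c| * R ^ 2 ≤ (1 + B * R ^ 2) * q := by
        have h1 : |(∫ z, K z) - c| ≤ (c - k') + B * (lam / L) := by
          have : 0 ≤ B * (lam / L) := mul_nonneg hB hl0
          rw [abs_le]
          constructor <;> linarith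
        have h2 := mul_le_mul_of_nonneg_right h1 (sq_nonneg R)
        have h3 : R ^ 2 * (c - k') ≤ q := by rw [hq]; linarith
        have h4 : B * R ^ 2 * (lam / L) ≤ B * R ^ 2 * q :=
          mul_le_mul_of_nonneg_left (by rw [hq]; linarith) (by positivity)
        linarith
      have hder : ∀ s ∈ Icc 0 T, ∃ d, HasDerivWithinAt Y d (Icc 0 T) s ∧
          d ≤ 6 * M * Z s + C₂ * q := by
        intro s hs
        obtain ⟨hd, hi⟩ := hasDerivWithinAt_modulatedEnergy hφ hE hK hε.ne' hs
        refine ⟨_, by rw [hY]; exact hd, ?_⟩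
        -- Rate and flux differ by an integrable function with zero integral, so the derivative may
        -- be estimated through the flux.
        have hnull := nullIntegral_modulatedRate_sub_flux hε.ne' c (hH4 s hs) (hvel s hs)
          (hrho s hs) (meanField K (φ s))
        have hfi := hi.sub hnull.integrable
        have e1 := hnull.zero
        have hfi' : Integrable (fun x => modulatedFlux ε c (φ s x)
            (fun j => weakPartial j (φ s) x) (fun j => u s x j)
            (fun j k => weakPartial k (fun y => u s y j) x)
            (fun j k => weakPartial k (weakPartial k (weakPartial j (fun y => u s y j))) x)
            (ρ s x) (meanField K (φ s) x)) volume := by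
          refine hfi.congr (Eventually.of_forall fun x => ?_)
          simp only [Pi.sub_apply, sub_sub_cancel]
        rw [integral_sub hi hfi', sub_eq_zero] at e1
        rw [e1]
        refine (integral_modulatedFlux_le hc.le hK (by positivity) (hH4 s hs) (hvel s hs)
          (hrho s hs) hM (hb.gradient s hs) (hb.third s hs) (hbd s hs).2.2 le_rfl le_rfl).trans ?_
        have t1 : ε ^ 2 / 4 * (B₃ * R) ≤ B₃ * R / 4 * q := by
          have : ε ^ 2 ≤ q := by rw [hq]; linarith
          calc ε ^ 2 / 4 * (B₃ * R) = B₃ * R / 4 * ε ^ 2 := by ring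
            _ ≤ _ := mul_le_mul_of_nonneg_left this (by positivity)
        have t2 : (∫ z, K z) * (R₀ * ε ^ 4 / L * ((∑ k, l2 (weakPartial k (φ s)))
            * l2 (fun x => ‖φ s x‖ ^ 3))) ≤ (c + B * θ) * (R₀ * H) * q := by
          have h1 : R₀ * H * (1 / L) ≤ R₀ * H * q :=
            mul_le_mul_of_nonneg_left (by rw [hq]; linarith) (by positivity)
          have h2 : 0 ≤ R₀ * H * q := by positivity
          calc _ ≤ (∫ z, K z) * (R₀ * H * q) :=
                mul_le_mul_of_nonneg_left ((hbd s hs).1.trans h1) hK.integral_nonneg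
            _ ≤ (c + B * θ) * (R₀ * H * q) := mul_le_mul_of_nonneg_right hkm h2
            _ = _ := by ring
        have t3 := mul_le_mul_of_nonneg_left t2 (by positivity : 0 ≤ 24 * M)
        have t4 := mul_le_mul_of_nonneg_left hkd (by positivity : 0 ≤ 3 / 2 * M)
        have e2 : C₂ * q = B₃ * R / 4 * q + 24 * M * ((c + B * θ) * (R₀ * H) * q)
            + 3 / 2 * M * ((1 + B * R ^ 2) * q) := by rw [hC₂]; ring
        rw [e2, hZ]
        linarith
      choose! d hd hdle using hder
      -- The shift by `(C₃ + C₂) * q` makes the inequality homogeneous. `Y + C₃ q` dominates the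
      -- defect, hence is nonnegative, and the extra 1 in the rate absorbs `C₂ q`.
      have hgr := le_exp_mul_of_deriv_le (κ := 6 * M + 1) (y := fun s => Y s + (C₃ + C₂) * q)
        (fun s hs => (hd s hs).add_const _) (fun s hs => by
          have h1 := hdle s hs
          have h2 := hZY s hs
          have h3 := hZ0 s
          have h4 := mul_le_mul_of_nonneg_left h2 (by positivity : 0 ≤ 6 * M)
          have h5 : 0 ≤ 6 * M * (C₂ * q) := by positivity
          linarith) ht
      have hexp : Real.exp ((6 * M + 1) * t) ≤ Real.exp ((6 * M + 1) * T) :=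
        Real.exp_le_exp.2 (mul_le_mul_of_nonneg_left ht.2 (by positivity))
      have hY1 : Y 0 + (C₃ + C₂) * q ≤ (1 + 2 * (C₃ + C₂)) * (Y 0 + q) := by
        have h1 := mul_le_mul_of_nonneg_left hQ (add_nonneg hC₃0 hC₂0)
        linarith
      have hY2 : 0 ≤ (1 + 2 * (C₃ + C₂)) * (Y 0 + q) := by positivity
      have h1 := hZY t ht
      have h2 : 0 ≤ C₂ * q := by positivity
      have h3 : Real.exp ((6 * M + 1) * t) * (Y 0 + (C₃ + C₂) * q)
          ≤ Real.exp ((6 * M + 1) * T) * ((1 + 2 * (C₃ + C₂)) * (Y 0 + q)) :=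
        (mul_le_mul_of_nonneg_left hY1 (Real.exp_pos _).le).trans
          (mul_le_mul_of_nonneg_right hexp hY2)
      have h4 : 0 ≤ 2 * Zm / θ * (Y 0 + q) := mul_nonneg hx1 hQ0
      have e1 : C₅ * (Y 0 + q) = Real.exp ((6 * M + 1) * T) * ((1 + 2 * (C₃ + C₂)) * (Y 0 + q))
          + 2 * Zm / θ * (Y 0 + q) := by rw [hC₅]; ring
      rw [e1]
      linarith
    · have h1 : θ ≤ 2 * (Y 0 + q) := by
        have : lam / L ≤ q := by rw [hq]; linarith
        linarith
      have h2 : Zm ≤ 2 * Zm / θ * (Y 0 + q) := by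
        rw [div_mul_eq_mul_div, le_div_iff₀ hθ]
        have := mul_le_mul_of_nonneg_left h1 hZm0
        linarith
      have h3 := mul_nonneg hx0 hQ0
      have e1 : C₅ * (Y 0 + q) = Real.exp ((6 * M + 1) * T) * (1 + 2 * (C₃ + C₂)) * (Y 0 + q)
          + 2 * Zm / θ * (Y 0 + q) := by rw [hC₅]; ring
      rw [e1]
      linarith [hZc t ht]
  intro t ht
  have hfin : Z t * C₆ ≤ (C₅ * C₆ + 1) * (Y 0 + q) := by
    have := mul_le_mul_of_nonneg_right (hmain t ht) hC₆0
    linarith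
  have e1 : Y 0 + q = modulatedEnergy ε c K (φ 0) (ρ 0) (u 0) + ε ^ 2 + lam / L
      + R ^ 2 * (c - k') := by rw [hY, hq]; ring
  rw [e1] at hfin
  have hZt : Z t = defect ε c (φ t) (ρ t) (fun j x => u t x j) := by rw [hZ]
  have hZct := hZc t ht
  rw [hZt, hC₆] at hfin
  rw [hZt] at hZct
  rw [hC₆]
  exact density_estimates_of_defect hc hU (hH2 t ht) (hrho t ht) (hvel t ht) (hl2 t ht)
    (hb.velocity t ht) (hb.velocity_l2 t ht) hZct (by rw [← hC₆] at hfin ⊢; exact hfin)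

/-! ### The Gross–Pitaevskii and hard-core regimes -/

/-- With `μ = 1/λ` the prefactor `λ` of the kernel cancels the `μ` in the Neumann bounds. Their
smallness condition `M R₀³ ≤ 3 μ L` becomes a threshold on `λ/L`. -/
theorem integral_effectivePotential_bounds {R₀ : ℝ} {v : E3 → ℝ} (hv : IsPotential R₀ v)
    (hR : 0 < R₀) {M : ℝ} (hM1 : 1 ≤ M) (hM : ∀ x, |v x| ≤ M) {lam : ℝ} (hlam : 0 < lam) {N : ℕ}
    (hN : 0 < N) {ε : ℝ} (hε : 0 < ε) (hL : R₀ < boxLength N ε) {f₀ f : E3 → ℝ}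
    (hf₀ : IsZeroEnergySolution v (1 / lam) f₀)
    (hf : IsNeumannGroundState v (1 / lam) (boxLength N ε) f) :
    4 * Real.pi * scatteringLength v (1 / lam) f₀ ≤ ∫ x, effectivePotential v f lam N ε x ∧
    (lam / boxLength N ε ≤ 3 / (M * R₀ ^ 3) →
      ∫ x, effectivePotential v f lam N ε x ≤ 4 * Real.pi * scatteringLength v (1 / lam) f₀
        + 4 * Real.pi * (M * R₀ ^ 4) * (lam / boxLength N ε)) := by
  have hL0 : 0 < boxLength N ε := hR.trans hL
  obtain ⟨h1, h2⟩ := neumann_bounds hv hR hM (one_div_pos.2 hlam) hL hf₀ hf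
  rw [integral_effectivePotential v f lam hN hε]
  generalize boxLength N ε = L at *
  generalize scatteringLength v (1 / lam) f₀ = a at *
  have e : lam * (4 * Real.pi * (1 / lam * a)) = 4 * Real.pi * a := by field_simp
  refine ⟨e ▸ mul_le_mul_of_nonneg_left h1 hlam.le, fun hθ => ?_⟩
  have h3 : M * R₀ ^ 3 ≤ 3 * (1 / lam * L) := by
    rw [div_le_div_iff₀ hL0 (by positivity)] at hθ
    have : 3 * (1 / lam * L) = 3 * L / lam := by field_simp
    rw [this, le_div_iff₀ hlam]
    linarith
  calc lam * ∫ x, v x * f x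
      ≤ lam * (4 * Real.pi * (1 / lam * a) + 4 * Real.pi * (M * R₀ ^ 4) / L) :=
        mul_le_mul_of_nonneg_left (h2 h3) hlam.le
    _ = 4 * Real.pi * a + 4 * Real.pi * (M * R₀ ^ 4) * (lam / L) := by
        rw [mul_add, e]; ring

/-- The lower bound of the kernel integral is `k' = 4π𝔞`, so the term `c - k'` measures how far the
effective coupling is from the one in the Euler equation. The absolute value of `C₀` is used because
no sign is assumed. -/
theorem exists_scattering_estimate {R₀ : ℝ} {v : E3 → ℝ} (hv : IsPotential R₀ v) (hR : 0 < R₀)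
    {c T : ℝ} (hc : 0 < c) (hT : 0 < T) (C₀ : ℝ) {ρ : ℝ → E3 → ℝ} {u : ℝ → E3 → E3}
    (hE : IsEulerSolution c T ρ u) :
    ∃ C > 0, ∃ A > 0, ∃ δ > 0,
      ∀ (N : ℕ) (ε lam : ℝ) (f₀ fL : E3 → ℝ) (φ : ℝ → E3 → ℂ),
        0 < N → 0 < ε → ε < δ → R₀ < boxLength N ε → 1 ≤ lam →
        IsZeroEnergySolution v (1 / lam) f₀ →
        c / 2 ≤ 4 * Real.pi * scatteringLength v (1 / lam) f₀ →
        4 * Real.pi * scatteringLength v (1 / lam) f₀ ≤ c →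
        IsNeumannGroundState v (1 / lam) (boxLength N ε) fL →
        IsModifiedGPSolution ε (effectivePotential v fL lam N ε) T φ →
        weightedNormSq ε 4 (φ 0) ≤ C₀ →
        energy ε (effectivePotential v fL lam N ε) (φ 0) ≤ C₀ →
        DensityEstimates ε T φ ρ u
          (C * (modulatedEnergy ε c (effectivePotential v fL lam N ε) (φ 0) (ρ 0) (u 0)
            + ε ^ 2 + lam / boxLength N ε
            + A * (c - 4 * Real.pi * scatteringLength v (1 / lam) f₀))) := by
  obtain ⟨M, hM1, hM⟩ := hv.exists_bound
  obtain ⟨C, hC, A, hA, δ, hδ, h⟩ := exists_uniform_estimate (C₀ := |C₀|) (θ := 3 / (M * R₀ ^ 3))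
    (B := 4 * Real.pi * (M * R₀ ^ 4)) hR hc hT (abs_nonneg _) (by positivity) (by positivity) hE
  refine ⟨C, hC, A, hA, δ, hδ, ?_⟩
  intro N ε lam f₀ fL φ hN hε hεδ hL hlam hf₀ hlo hhi hfL hφ hw hen
  have hb := integral_effectivePotential_bounds hv hR hM1 hM (by linarith) hN hε hL hf₀ hfL
  exact h ε _ lam _ _ φ hε hεδ hL hlam
    (isKernel_effectivePotential hv hfL.contDiff.continuous hfL.radial hfL.pos (by linarith) hN hε)
    hlo hhi hb.1 hb.2 hφ (hw.trans (le_abs_self _)) (hen.trans (le_abs_self _))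

/-- Since `(ln N)^α → ∞`, its inverse approaches 0 from the right, and smallness of `1/N` forces any
property that holds near `0⁺`. -/
theorem eventually_log_rpow {α : ℝ} (hα : 0 < α) {P : ℝ → Prop} (hP : ∀ᶠ μ in 𝓝[>] (0 : ℝ), P μ) :
    ∃ δ > 0, ∀ N : ℕ, 0 < N → 1 / (N : ℝ) < δ →
      1 ≤ Real.log N ^ α ∧ P (1 / Real.log N ^ α) := by
  have hlim : Tendsto (fun N : ℕ => Real.log N ^ α) atTop atTop :=
    (tendsto_rpow_atTop hα).comp (Real.tendsto_log_atTop.comp tendsto_natCast_atTop_atTop)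
  have hinv : Tendsto (fun N : ℕ => 1 / Real.log N ^ α) atTop (𝓝[>] 0) := by
    simpa only [one_div, Function.comp_def] using tendsto_inv_atTop_nhdsGT_zero.comp hlim
  obtain ⟨n, hn⟩ := eventually_atTop.1 ((hlim.eventually_ge_atTop 1).and (hinv.eventually hP))
  refine ⟨1 / (n + 1), by positivity, fun N hN h => hn N ?_⟩
  have := (one_div_lt_one_div (by exact_mod_cast hN) (by positivity)).1 h
  exact_mod_cast (by linarith : (n : ℝ) ≤ N)

end

end SemiclassicalGP

/-! ### The two regimes -/

theorem mainTheorem7 (R₀ : ℝ) (hR₀ : 0 < R₀) (v : E3 → ℝ) (hv : IsPotential R₀ v)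
    (f₀ : ℝ → E3 → ℝ) (hf₀ : ∀ μ : ℝ, 0 < μ → IsZeroEnergySolution v μ (f₀ μ)) :
    -- GP regime: `λ = 1`, `μ = 1`, `c = 4π𝔞₀`
    (∀ (T₀ : ℝ) (ρ : ℝ → E3 → ℝ) (u : ℝ → E3 → E3), 0 < T₀ →
      IsEulerSolution (4 * Real.pi * scatteringLength v 1 (f₀ 1)) T₀ ρ u →
      ∀ C₀ : ℝ, ∃ C > 0, ∃ δ > 0,
        ∀ (N : ℕ) (ε : ℝ) (fL : E3 → ℝ) (φ : ℝ → E3 → ℂ),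
          0 < N → 0 < ε → 1 / (N : ℝ) + ε < δ → R₀ < boxLength N ε →
          IsNeumannGroundState v 1 (boxLength N ε) fL →
          IsModifiedGPSolution ε (effectivePotential v fL 1 N ε) T₀ φ →
          weightedNormSq ε 4 (φ 0) ≤ C₀ →
          energy ε (effectivePotential v fL 1 N ε) (φ 0) ≤ C₀ →
          DensityEstimates ε T₀ φ ρ u
            (C * (modulatedEnergy ε (4 * Real.pi * scatteringLength v 1 (f₀ 1))
                (effectivePotential v fL 1 N ε) (φ 0) (ρ 0) (u 0)
              + ε ^ 2 + 1 / boxLength N ε))) ∧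
    -- HC regime: `λ = (ln N)^α`, `μ = 1/λ`, `c = 4π𝔠₀` with `𝔠₀ = R₀`
    (∀ (α T₀ : ℝ) (ρ : ℝ → E3 → ℝ) (u : ℝ → E3 → E3), 0 < α → α < 1 → 0 < T₀ →
      IsEulerSolution (4 * Real.pi * R₀) T₀ ρ u →
      ∀ C₀ : ℝ, ∃ C > 0, ∃ A > 0, ∃ δ > 0,
        ∀ (N : ℕ) (ε lam : ℝ) (fL : E3 → ℝ) (φ : ℝ → E3 → ℂ),
          0 < N → 0 < ε → 1 / (N : ℝ) + ε < δ → R₀ < boxLength N ε →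
          lam = Real.log N ^ α →
          IsNeumannGroundState v (1 / lam) (boxLength N ε) fL →
          IsModifiedGPSolution ε (effectivePotential v fL lam N ε) T₀ φ →
          weightedNormSq ε 4 (φ 0) ≤ C₀ →
          energy ε (effectivePotential v fL lam N ε) (φ 0) ≤ C₀ →
          DensityEstimates ε T₀ φ ρ u
            (C * (modulatedEnergy ε (4 * Real.pi * R₀)
                (effectivePotential v fL lam N ε) (φ 0) (ρ 0) (u 0)
              + ε ^ 2 + lam / boxLength N ε
              + A * (R₀ - scatteringLength v (1 / lam) (f₀ (1 / lam)))))) ∧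
    -- the rate `η(μ) = 𝔠₀ - 𝔞₀^μ` tends to zero
    Tendsto (fun μ : ℝ => R₀ - scatteringLength v μ (f₀ μ)) (𝓝[>] 0) (𝓝 0) := by
  refine ⟨?_, ?_, tendsto_scatteringLength hv hR₀ hf₀⟩
  · intro T₀ ρ u hT hE C₀
    have ha := (hf₀ 1 one_pos).scatteringLength_pos hv hR₀ one_pos
    have hpi := Real.pi_pos
    obtain ⟨C, hC, A, -, δ, hδ, h⟩ := exists_scattering_estimate hv hR₀ (by positivity) hT C₀ hE
    refine ⟨C, hC, δ, hδ, ?_⟩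
    intro N ε fL φ hN hε hNε hL hfL hφ hw hen
    have hN' : 0 < 1 / (N : ℝ) := by positivity
    have := h N ε 1 (f₀ 1) fL φ hN hε (by linarith) hL le_rfl
    -- For `λ = 1` the coupling equals `c` exactly, so the term with `A` disappears.
    simp only [div_self (one_ne_zero' ℝ), sub_self, mul_zero, add_zero] at this
    exact this (hf₀ 1 one_pos) (half_le_self (by positivity)) le_rfl hfL hφ hw hen
  · intro α T₀ ρ u hα _ hT hE C₀
    have hpi := Real.pi_pos
    obtain ⟨C, hC, A, hA, δ, hδ, h⟩ := exists_scattering_estimate hv hR₀ (by positivity) hT C₀ hE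
    -- `η ≤ R₀/2` is what gives `c/2 ≤ 4π𝔞`, the lower bound required by the uniform estimate.
    obtain ⟨δ', hδ', hlog⟩ := eventually_log_rpow hα
      ((tendsto_scatteringLength hv hR₀ hf₀).eventually_le_const (half_pos hR₀))
    -- The factor `4π` comes from `c - 4π𝔞 = 4π η`.
    refine ⟨C, hC, A * (4 * Real.pi), by positivity, min δ δ', lt_min hδ hδ', ?_⟩
    intro N ε lam fL φ hN hε hNε hL hlam hfL hφ hw hen
    have hN' : 0 < 1 / (N : ℝ) := by positivity
    obtain ⟨hlam1, hη⟩ := hlog N hN (by linarith [min_le_right δ δ'])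
    rw [← hlam] at hlam1 hη
    have hμ : 0 < 1 / lam := by positivity
    have hlt := (hf₀ _ hμ).scatteringLength_lt hv hR₀ hμ
    have := h N ε lam (f₀ (1 / lam)) fL φ hN hε (by linarith [min_le_left δ δ']) hL hlam1
      (hf₀ _ hμ) (by nlinarith) (by nlinarith) hfL hφ hw hen
    rwa [← mul_sub, ← mul_assoc A] at this
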